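/- Let $M$ be a compact smooth $6$-manifold, oriented by a nowhere vanishing $6$-form. Fix a parity, and let $H=H^{ev}(M,\mathbf R)$ or $H=H^{od}(M,\mathbf R)$ be the corresponding de Rham cohomology (closed modulo exact forms of mixed degree), a finite-dimensional real vector space. On forms of this parity put $\langle\alpha,\beta\rangle=(\sigma\alpha\wedge\beta)_6$, where $\sigma$ is multiplication by $(-1)^m$ in degrees $2m$ and $2m+1$. A generalized Calabi–Yau structure is a closed complex form $\varphi$ of this parity such that at each point $\langle\varphi,\bar\varphi\rangle\neq 0$ and $\varphi$ is a pure spinor, i.e. the space of $v+\xi\in(T\oplus T^*)\otimes\mathbf C$ with $\iota(v)\varphi+\xi\wedge\varphi=0$ has complex dimension $6$. For such $\varphi$ define real closed forms $\rho,\hat\rho$ by $\rho=\varphi+\bar\varphi$ and $\rho+i\hat\rho=2\varphi$. Two structures are equivalent if they are related by $\varphi'=\exp(d\xi)\wedge f^*\varphi$, where $f$ is a diffeomorphism smoothly isotopic to the identity and $\xi$ is a real $1$-form. Let $\mathcal U\subset H$ be an open set which is a moduli space for a set $\mathcal S$ of generalized Calabi–Yau structures of the given parity, with modulus $\varphi\mapsto[\rho]$,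 in the following sense: $[\rho]\in\mathcal U$ for all $\varphi\in\mathcal S$; any two structures in $\mathcal S$ with the same class $[\rho]$ are equivalent; and each point of $\mathcal U$ has an open neighbourhood $\mathcal V\subset\mathcal U$ with a smooth family of structures $\varphi_u\in\mathcal S$, $u\in\mathcal V$, such that $[\rho_u]=u$. Then $H$ is finite-dimensional, and $\mathcal U$ carries a special pseudo-Kähler structure, given by the following well-defined data: * the flat connection $\nabla=D$ (the directional derivative in the vector space $H$); * the constant symplectic form $\omega([\alpha],[\beta])=\int_M\sigma(\alpha)\wedge\beta=(\sigma[\alpha]\cup[\beta])[M]$ on $H$; * the smooth vector field $X:\mathcal U\to H$, $X([\rho])=[\hat\rho]$; * the complex structure $J=DX$, the derivative of $[\rho]\mapsto[\hat\rho]$. That is: $\nabla$ is flat and torsion-free, $\omega$ is non-degenerate, skew, closed and $\nabla\omega=0$; $J^2=-1$, $J$ is integrable (near each point there are complex coordinates $z$ with $dz\circ J=i\,dz$), $\omega(Ja,Jb)=\omega(a,b)$; and $\nabla X=J$. -/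

import Mathlib

open scoped Manifold ContDiff Topology
open Set

namespace GenCY

/-! ## A norm on an arbitrary real vector space

Only used on finite-dimensional spaces, where all norms are equivalent, so that open sets, smoothness
and derivatives do not depend on the choice of basis. -/

section BasisNorm

variable (W : Type*) [AddCommGroup W] [Module ℝ W]

/-- The `ℓ¹` norm of the coordinates in a chosen basis. -/
@[reducible]
noncomputable def basisNorm : Norm W :=
  ⟨fun v => ∑ i ∈ ((Module.Basis.ofVectorSpace ℝ W).repr v).support,
    |(Module.Basis.ofVectorSpace ℝ W).repr v i|⟩

theorem basisNorm_core : @NormedSpace.Core ℝ W _ _ _ (basisNorm W) := by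
  let := basisNorm W
  have key : ∀ (v : W) (s : Finset _), ((Module.Basis.ofVectorSpace ℝ W).repr v).support ⊆ s →
      ‖v‖ = ∑ i ∈ s, |(Module.Basis.ofVectorSpace ℝ W).repr v i| := by
    intro v s hs
    refine Finset.sum_subset hs ?_
    intro i _ hi
    simpa using hi
  refine { norm_nonneg := ?_, norm_smul := ?_, norm_triangle := ?_, norm_eq_zero_iff := ?_ }
  · intro v
    exact Finset.sum_nonneg fun i _ => abs_nonneg _
  · intro c v
    rw [key (c • v) ((Module.Basis.ofVectorSpace ℝ W).repr v).support
      (by rw [map_smul]; exact Finsupp.support_smul), key v _ (Finset.Subset.refl _),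
      Finset.mul_sum]
    refine Finset.sum_congr rfl fun i _ => ?_
    simp [abs_mul]
  · intro v w
    classical
    set s := ((Module.Basis.ofVectorSpace ℝ W).repr v).support ∪
      ((Module.Basis.ofVectorSpace ℝ W).repr w).support with hs
    rw [key v s Finset.subset_union_left, key w s Finset.subset_union_right,
      key (v + w) s (by rw [map_add]; exact Finsupp.support_add), ← Finset.sum_add_distrib]
    refine Finset.sum_le_sum fun i _ => ?_
    rw [map_add]
    exact abs_add_le _ _
  · intro v
    constructor
    · intro h
      have h0 := (Finset.sum_eq_zero_iff_of_nonneg (fun i _ => abs_nonneg _)).1 h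
      apply (Module.Basis.ofVectorSpace ℝ W).repr.injective
      rw [map_zero]
      ext i
      by_cases hi : i ∈ ((Module.Basis.ofVectorSpace ℝ W).repr v).support
      · simpa using h0 i hi
      · simpa using hi
    · rintro rfl
      rw [key 0 ∅ (by simp)]
      simp

end BasisNorm

/-! ## Linear algebra: forms on `V = ℝ⁶` as spinors for `V ⊕ V*` -/

/-- The model vector space `V = ℝ⁶`. -/
abbrev E : Type := EuclideanSpace ℝ (Fin 6)

/-- The exterior algebra `Λ^* V^*`: forms of mixed degree at a point. -/
abbrev Lam : Type := ExteriorAlgebra ℝ (Module.Dual ℝ E)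

noncomputable instance instNormedAddCommGroupLam : NormedAddCommGroup Lam :=
  letI := basisNorm Lam
  NormedAddCommGroup.ofCore (basisNorm_core Lam)

noncomputable instance instNormedSpaceLam : NormedSpace ℝ Lam :=
  letI := basisNorm Lam
  NormedSpace.ofCore (basisNorm_core Lam)

/-- The basis `e¹, …, e⁶` of `V^*`. -/
noncomputable def dualBasis : Module.Basis (Fin 6) ℝ (Module.Dual ℝ E) :=
  (EuclideanSpace.basisFun (Fin 6) ℝ).toBasis.dualBasis

/-- The coefficient of `e¹ ∧ ⋯ ∧ e⁶` in a form of mixed degree. -/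
noncomputable def topCoeff : Lam →ₗ[ℝ] ℝ :=
  ExteriorAlgebra.liftAlternating
    (Pi.single (M := fun i : ℕ => Module.Dual ℝ E [⋀^Fin i]→ₗ[ℝ] ℝ) 6 dualBasis.det)

/-- The bilinear form `⟨φ, ψ⟩ = (σ φ ∧ ψ)₆`. The antiautomorphism `reverse` multiplies degree `k` by
`(-1)^(k(k-1)/2)`, so it is `σ`: the sign is `(-1)^m` in degrees `2m` and `2m+1`. The number is the
coefficient of `e¹ ∧ ⋯ ∧ e⁶`. -/
noncomputable def pairing (φ ψ : Lam) : ℝ := topCoeff (CliffordAlgebra.reverse φ * ψ)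

/-- The Clifford action `(v + ξ) · φ = ι(v) φ + ξ ∧ φ` of `V ⊕ V^*`. -/
noncomputable def cl (w : E × Module.Dual ℝ E) : Lam →ₗ[ℝ] Lam :=
  CliffordAlgebra.contractLeft (Module.Dual.eval ℝ E w.1) +
    LinearMap.mulLeft ℝ (ExteriorAlgebra.ι ℝ w.2)

theorem cl_add (w w' : E × Module.Dual ℝ E) (φ : Lam) : cl (w + w') φ = cl w φ + cl w' φ := by
  simp only [cl, Prod.fst_add, Prod.snd_add, map_add, LinearMap.add_apply,
    LinearMap.mulLeft_apply, add_mul]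
  abel

theorem cl_smul (c : ℝ) (w : E × Module.Dual ℝ E) (φ : Lam) : cl (c • w) φ = c • cl w φ := by
  simp only [cl, Prod.smul_fst, Prod.smul_snd, map_smul, LinearMap.add_apply, LinearMap.smul_apply,
    LinearMap.mulLeft_apply, smul_mul_assoc, smul_add]

/-- A complex form `φ = α + iβ` of mixed degree at a point, as the pair `(α, β)` of its real and
imaginary parts. -/
abbrev CLam : Type := Lam × Lam

/-- The annihilator `E_φ ⊂ (V ⊕ V^*) ⊗ ℂ` of `φ = α + iβ` under the complexified Clifford action;
the pair `(a, b)` stands for the complex vector `a + ib`. -/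
noncomputable def annihilator (φ : CLam) :
    Submodule ℝ ((E × Module.Dual ℝ E) × (E × Module.Dual ℝ E)) where
  carrier := {w | cl w.1 φ.1 - cl w.2 φ.2 = 0 ∧ cl w.1 φ.2 + cl w.2 φ.1 = 0}
  add_mem' := by
    rintro w w' ⟨h1, h2⟩ ⟨h3, h4⟩
    refine ⟨?_, ?_⟩
    · rw [Prod.fst_add, Prod.snd_add, cl_add, cl_add, add_sub_add_comm, h1, h3, add_zero]
    · rw [Prod.fst_add, Prod.snd_add, cl_add, cl_add, add_add_add_comm, h2, h4, add_zero]
  zero_mem' := by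
    have h : ∀ φ : Lam, cl 0 φ = 0 := fun φ => by
      simpa using cl_smul 0 0 φ
    simp [h]
  smul_mem' := by
    rintro c w ⟨h1, h2⟩
    refine ⟨?_, ?_⟩
    · rw [Prod.smul_fst, Prod.smul_snd, cl_smul, cl_smul, ← smul_sub, h1, smul_zero]
    · rw [Prod.smul_fst, Prod.smul_snd, cl_smul, cl_smul, ← smul_add, h2, smul_zero]

/-- `φ` is a complex pure spinor: `E_φ` has complex dimension `6 = dim V`, that is, real
dimension `12`. -/
def IsPure (φ : CLam) : Prop := Module.finrank ℝ (annihilator φ) = 12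

/-- The complex bilinear extension of `⟨·, ·⟩`. -/
noncomputable def cpairing (φ ψ : CLam) : ℂ :=
  ⟨pairing φ.1 ψ.1 - pairing φ.2 ψ.2, pairing φ.1 ψ.2 + pairing φ.2 ψ.1⟩

/-- The complex conjugate form. -/
noncomputable def cconj (φ : CLam) : CLam := (φ.1, -φ.2)

/-! ## Differential forms on a 6-manifold -/

section Forms

variable {M : Type*} [TopologicalSpace M] [ChartedSpace E M]

/-- The pull-back `Λ^* (T_{f(x)} N')^* → Λ^* (T_x N)^*` by the derivative of `f` at `x`. (In Mathlib
all tangent spaces are the model space `E`.) -/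
noncomputable def pullAt {N N' : Type*} [TopologicalSpace N] [ChartedSpace E N]
    [TopologicalSpace N'] [ChartedSpace E N'] (f : N → N') (x : N) : Lam →ₐ[ℝ] Lam :=
  ExteriorAlgebra.map (R := ℝ) (M := Module.Dual ℝ E) (N := Module.Dual ℝ E)
    (LinearMap.dualMap (M₁ := E) (M₂ := E) (mfderiv (𝓡 6) (𝓡 6) f x).toLinearMap)

/-- A (not necessarily smooth) differential form of mixed degree on `M`: its value at `x` lies in
`Λ^* (T_x M)^*`. -/
abbrev MForm (M : Type*) : Type _ := M → Lam

/-- The pull-back `f^* θ`. -/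
noncomputable def pullback {N N' : Type*} [TopologicalSpace N] [ChartedSpace E N]
    [TopologicalSpace N'] [ChartedSpace E N'] (f : N → N') (θ : MForm N') : MForm N :=
  fun x => pullAt f x (θ (f x))

/-- The expression of a form in the chart at `x₀`: its pull-back by the inverse of the chart. -/
noncomputable def chartRep (x₀ : M) (θ : MForm M) : MForm E :=
  pullback (extChartAt (𝓡 6) x₀).symm θ

/-- Smoothness of a form. -/
def IsSmooth (θ : MForm M) : Prop :=
  ∀ x₀ : M, ContDiffOn ℝ ∞ (chartRep x₀ θ) (extChartAt (𝓡 6) x₀).target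

/-- The exterior derivative `∑ᵢ eⁱ ∧ ∂ᵢ η` of a form on (an open subset of) `V`. -/
noncomputable def dE (η : E → Lam) (y : E) : Lam :=
  ∑ i : Fin 6, ExteriorAlgebra.ι ℝ (dualBasis i) *
    fderiv ℝ η y (EuclideanSpace.single i (1 : ℝ))

/-- The exterior derivative of a form on `M`, computed at `x` in the chart at `x`. -/
noncomputable def extD (θ : MForm M) : MForm M := fun x =>
  pullAt (extChartAt (𝓡 6) x) x (dE (chartRep x θ) (extChartAt (𝓡 6) x x))

/-- All components of `θ` have even degree (`p = 0`), respectively odd degree (`p = 1`). -/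
def HasParity (p : ZMod 2) (θ : MForm M) : Prop :=
  ∀ x, θ x ∈ CliffordAlgebra.evenOdd (0 : QuadraticForm ℝ (Module.Dual ℝ E)) p

theorem chartRep_add (x₀ : M) (θ η : MForm M) :
    chartRep x₀ (θ + η) = chartRep x₀ θ + chartRep x₀ η := by
  funext y; simp [chartRep, pullback]

theorem chartRep_smul (x₀ : M) (c : ℝ) (θ : MForm M) :
    chartRep x₀ (c • θ) = c • chartRep x₀ θ := by
  funext y; simp [chartRep, pullback]

theorem chartRep_zero (x₀ : M) : chartRep x₀ (0 : MForm M) = 0 := by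
  funext y; simp [chartRep, pullback]

theorem IsSmooth.add {θ η : MForm M} (hθ : IsSmooth θ) (hη : IsSmooth η) : IsSmooth (θ + η) := by
  intro x₀
  rw [chartRep_add]
  exact (hθ x₀).add (hη x₀)

theorem IsSmooth.smul (c : ℝ) {θ : MForm M} (hθ : IsSmooth θ) : IsSmooth (c • θ) := by
  intro x₀
  rw [chartRep_smul]
  exact contDiffOn_const.smul (hθ x₀)

theorem isSmooth_zero : IsSmooth (0 : MForm M) := by
  intro x₀
  rw [chartRep_zero]
  exact contDiffOn_const

theorem IsSmooth.differentiableAt {θ : MForm M} (hθ : IsSmooth θ) (x : M) :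
    DifferentiableAt ℝ (chartRep x θ) (extChartAt (𝓡 6) x x) :=
  ((hθ x).contDiffAt ((isOpen_extChartAt_target x).mem_nhds
    (mem_extChartAt_target x))).differentiableAt (by simp)

theorem extD_add {θ η : MForm M} (hθ : IsSmooth θ) (hη : IsSmooth η) :
    extD (θ + η) = extD θ + extD η := by
  funext x
  simp only [extD, Pi.add_apply, ← map_add]
  congr 1
  simp only [dE, chartRep_add, fderiv_add (hθ.differentiableAt x) (hη.differentiableAt x),
    _root_.add_apply, mul_add, Finset.sum_add_distrib]

theorem extD_smul (c : ℝ) {θ : MForm M} (hθ : IsSmooth θ) :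
    extD (c • θ) = c • extD θ := by
  funext x
  simp only [extD, Pi.smul_apply, ← map_smul]
  congr 1
  simp only [dE, chartRep_smul, fderiv_const_smul (hθ.differentiableAt x),
    _root_.smul_apply, mul_smul_comm, Finset.smul_sum]

theorem extD_zero : extD (0 : MForm M) = 0 := by
  simpa using extD_smul (0 : ℝ) (isSmooth_zero (M := M))

/-! ## De Rham cohomology -/

/-- Closed smooth forms of parity `p`. -/
def closedForms (M : Type*) [TopologicalSpace M] [ChartedSpace E M] (p : ZMod 2) :
    Submodule ℝ (MForm M) where
  carrier := {θ | IsSmooth θ ∧ HasParity p θ ∧ extD θ = 0}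
  add_mem' := by
    rintro θ η ⟨h1, h2, h3⟩ ⟨h4, h5, h6⟩
    exact ⟨h1.add h4, fun x => Submodule.add_mem _ (h2 x) (h5 x), by
      rw [extD_add h1 h4, h3, h6, add_zero]⟩
  zero_mem' := ⟨isSmooth_zero, fun _ => Submodule.zero_mem _, extD_zero⟩
  smul_mem' := by
    rintro c θ ⟨h1, h2, h3⟩
    exact ⟨h1.smul c, fun x => Submodule.smul_mem _ c (h2 x), by
      rw [extD_smul c h1, h3, smul_zero]⟩

/-- Exact forms of parity `p`: derivatives of smooth forms of parity `p + 1`. -/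
def exactForms (M : Type*) [TopologicalSpace M] [ChartedSpace E M] (p : ZMod 2) :
    Submodule ℝ (MForm M) where
  carrier := {θ | ∃ τ : MForm M, IsSmooth τ ∧ HasParity (p + 1) τ ∧ extD τ = θ}
  add_mem' := by
    rintro _ _ ⟨τ, h1, h2, rfl⟩ ⟨τ', h4, h5, rfl⟩
    exact ⟨τ + τ', h1.add h4, fun x => Submodule.add_mem _ (h2 x) (h5 x), extD_add h1 h4⟩
  zero_mem' := ⟨0, isSmooth_zero, fun _ => Submodule.zero_mem _, extD_zero⟩
  smul_mem' := by
    rintro c _ ⟨τ, h1, h2, rfl⟩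
    exact ⟨c • τ, h1.smul c, fun x => Submodule.smul_mem _ c (h2 x), extD_smul c h1⟩

/-- The de Rham cohomology `H^{ev}(M, ℝ)` (`p = 0`) or `H^{od}(M, ℝ)` (`p = 1`): closed modulo
exact forms. -/
def Coh (M : Type*) [TopologicalSpace M] [ChartedSpace E M] (p : ZMod 2) : Type _ :=
  closedForms M p ⧸ (exactForms M p).submoduleOf (closedForms M p)

noncomputable instance (p : ZMod 2) : AddCommGroup (Coh M p) :=
  inferInstanceAs (AddCommGroup (closedForms M p ⧸ (exactForms M p).submoduleOf (closedForms M p)))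

noncomputable instance (p : ZMod 2) : Module ℝ (Coh M p) :=
  inferInstanceAs (Module ℝ (closedForms M p ⧸ (exactForms M p).submoduleOf (closedForms M p)))

noncomputable instance (p : ZMod 2) : NormedAddCommGroup (Coh M p) :=
  letI := basisNorm (Coh M p)
  NormedAddCommGroup.ofCore (basisNorm_core (Coh M p))

noncomputable instance (p : ZMod 2) : NormedSpace ℝ (Coh M p) :=
  letI := basisNorm (Coh M p)
  NormedSpace.ofCore (basisNorm_core (Coh M p))

/-- The cohomology class `[θ]` of a closed form. -/
noncomputable def Coh.mk {p : ZMod 2} (θ : closedForms M p) : Coh M p :=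
  Submodule.Quotient.mk θ

/-- `θ` is closed and `[θ] = u`. -/
def Represents {p : ZMod 2} (θ : MForm M) (u : Coh M p) : Prop :=
  ∃ h : θ ∈ closedForms M p, Coh.mk ⟨θ, h⟩ = u

/-! ## Orientation and integration -/

/-- `ν` is a smooth nowhere vanishing 6-form; it fixes an orientation of `M`. -/
def IsVolumeForm (ν : MForm M) : Prop :=
  IsSmooth ν ∧ ∀ x, ν x ∈ ⋀[ℝ]^6 (Module.Dual ℝ E) ∧ ν x ≠ 0

/-- A smooth partition of unity subordinate to the chart domains. -/
noncomputable def chartPartition (M : Type*) [TopologicalSpace M] [ChartedSpace E M]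
    [IsManifold (𝓡 6) ∞ M] [CompactSpace M] [T2Space M] :
    SmoothPartitionOfUnity M (𝓡 6) M univ :=
  (SmoothPartitionOfUnity.exists_isSubordinate_chartAt_source (𝓡 6) M).choose

/-- The integral over `M`, oriented by `ν`, of the degree 6 part of the smooth form `θ`. In each
chart the sign of the coefficient of `ν` tells whether the chart preserves the orientation. -/
noncomputable def integral [IsManifold (𝓡 6) ∞ M] [CompactSpace M] [T2Space M]
    (ν θ : MForm M) : ℝ :=
  ∑ᶠ x₀ : M, ∫ y in (extChartAt (𝓡 6) x₀).target,
    (SignType.sign (topCoeff (chartRep x₀ ν y)) : ℝ) *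
      chartPartition M x₀ ((extChartAt (𝓡 6) x₀).symm y) * topCoeff (chartRep x₀ θ y)

/-- The form `σ(α) ∧ β`. -/
noncomputable def sigmaWedge (α β : MForm M) : MForm M := fun x =>
  CliffordAlgebra.reverse (α x) * β x

/-! ## Generalized Calabi–Yau structures and their moduli -/

/-- A complex form `φ` on `M`, as the pair of its real and imaginary parts. -/
abbrev CForm (M : Type*) : Type _ := MForm M × MForm M

/-- The value of a complex form at a point. -/
def CForm.at (φ : CForm M) (x : M) : CLam := (φ.1 x, φ.2 x)

/-- `φ` is a generalized Calabi–Yau structure of parity `p` on `M`: a closed complex form of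
parity `p` which is a pure spinor with `⟨φ, φ̄⟩ ≠ 0` at each point. -/
structure IsGCY (p : ZMod 2) (φ : CForm M) : Prop where
  closed_re : φ.1 ∈ closedForms M p
  closed_im : φ.2 ∈ closedForms M p
  pure : ∀ x, IsPure (φ.at x)
  nondeg : ∀ x, cpairing (φ.at x) (cconj (φ.at x)) ≠ 0

/-- The real form `ρ = φ + φ̄` of a structure `φ`. -/
noncomputable def rho (φ : CForm M) : MForm M := (2 : ℝ) • φ.1

/-- The real form `ρ̂ = -i (φ - φ̄)`, so that `ρ + i ρ̂ = 2 φ`. -/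
noncomputable def rhoHat (φ : CForm M) : MForm M := (2 : ℝ) • φ.2

/-- The form `exp(B) = 1 + B + B²/2 + B³/6` of a 2-form `B` (`B⁴ = 0` in dimension 6). -/
noncomputable def expForm (B : MForm M) : MForm M := fun x =>
  ∑ k ∈ Finset.range 4, ((k.factorial : ℝ)⁻¹) • (B x) ^ k

/-- `φ'` is obtained from `φ` by a diffeomorphism smoothly isotopic to the identity, followed by an
exact `B`-field `dξ`: `φ' = exp(dξ) ∧ f^* φ`. -/
def GaugeEquiv (φ φ' : CForm M) : Prop :=
  ∃ (F : ℝ → (M ≃ₘ^∞⟮𝓡 6, 𝓡 6⟯ M)) (ξ : MForm M),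
    ContMDiff (𝓘(ℝ, ℝ).prod (𝓡 6)) (𝓡 6) ∞ (fun q : ℝ × M => F q.1 q.2) ∧
    (∀ x, F 0 x = x) ∧
    IsSmooth ξ ∧ (∀ x, ξ x ∈ ⋀[ℝ]^1 (Module.Dual ℝ E)) ∧
    φ'.1 = expForm (extD ξ) * pullback (F 1) φ.1 ∧
    φ'.2 = expForm (extD ξ) * pullback (F 1) φ.2

/-- The family of forms `u ↦ θ u`, `u ∈ V`, is smooth (jointly in `u` and the point of `M`). -/
def IsSmoothFamily {W : Type*} [NormedAddCommGroup W] [NormedSpace ℝ W] (V : Set W)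
    (θ : W → MForm M) : Prop :=
  ∀ x₀ : M, ContDiffOn ℝ ∞ (fun q : W × E => chartRep x₀ (θ q.1) q.2)
    (V ×ˢ (extChartAt (𝓡 6) x₀).target)

/-- The open set `U` of cohomology classes is a moduli space for the set `S` of generalized
Calabi–Yau structures of parity `p`, the modulus of `φ` being the class of `ρ = φ + φ̄`:
the moduli of the structures in `S` lie in `U`, two structures in `S` with the same modulus are
equivalent, and near each point of `U` there is a smooth family of structures in `S`, parametrized by
their moduli (in particular each point of `U` is the modulus of a structure in `S`). -/
structure IsModuliSpace (p : ZMod 2) (U : Set (Coh M p)) (S : Set (CForm M)) : Prop where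
  isOpen : IsOpen U
  isGCY : ∀ φ ∈ S, IsGCY p φ
  modulus : ∀ φ ∈ S, ∃ u ∈ U, Represents (rho φ) u
  equiv : ∀ φ ∈ S, ∀ φ' ∈ S, ∀ u : Coh M p,
    Represents (rho φ) u → Represents (rho φ') u → GaugeEquiv φ φ'
  family : ∀ u₀ ∈ U, ∃ V ⊆ U, IsOpen V ∧ u₀ ∈ V ∧ ∃ φ : Coh M p → CForm M,
    IsSmoothFamily V (fun u => (φ u).1) ∧ IsSmoothFamily V (fun u => (φ u).2) ∧
    ∀ u ∈ V, φ u ∈ S ∧ Represents (rho (φ u)) u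

end Forms

/-! ## Special pseudo-Kähler structures -/

section SpecialKahler

variable {W : Type*} [NormedAddCommGroup W] [NormedSpace ℝ W]

/-- The almost complex structure `J` on the open set `U ⊆ W` is a complex structure: near each
point there are complex coordinates `z : V → ℂᵐ` whose derivative intertwines `J` and `i`. -/
def IsIntegrable (U : Set W) (J : W → W →L[ℝ] W) : Prop :=
  ∀ u₀ ∈ U, ∃ V ⊆ U, IsOpen V ∧ u₀ ∈ V ∧ ∃ (m : ℕ) (z : W → Fin m → ℂ),
    ContDiffOn ℝ ∞ z V ∧ InjOn z V ∧
    ∀ u ∈ V, Function.Bijective (fderiv ℝ z u) ∧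
      ∀ a, fderiv ℝ z u (J u a) = Complex.I • fderiv ℝ z u a

/-- A special pseudo-Kähler structure on the open subset `U` of the vector space `W`: a flat
torsion-free symplectic connection `(∇, Ω)`, where `∇_a Y = D_a Y + Γ(a, Y)`, and a complex
structure `J` compatible with `Ω`, such that locally `J = ∇X` for a vector field `X`.
(The pseudo-Kähler metric is `Ω(J ·, ·)` up to sign.) -/
structure IsSpecialPseudoKahler (U : Set W) (Γ : W → W →L[ℝ] W →L[ℝ] W)
    (Ω : W → W →L[ℝ] W →L[ℝ] ℝ) (J : W → W →L[ℝ] W) : Prop where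
  isOpen : IsOpen U
  smooth_conn : ContDiffOn ℝ ∞ Γ U
  smooth_form : ContDiffOn ℝ ∞ Ω U
  smooth_J : ContDiffOn ℝ ∞ J U
  torsionFree : ∀ u ∈ U, ∀ a b, Γ u a b = Γ u b a
  flat : ∀ u ∈ U, ∀ a b c,
    fderiv ℝ Γ u a b c - fderiv ℝ Γ u b a c + Γ u a (Γ u b c) - Γ u b (Γ u a c) = 0
  alternating : ∀ u ∈ U, ∀ a, Ω u a a = 0
  nondegenerate : ∀ u ∈ U, ∀ a, (∀ b, Ω u a b = 0) → a = 0
  closed : ∀ u ∈ U, ∀ a b c,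
    fderiv ℝ Ω u a b c + fderiv ℝ Ω u b c a + fderiv ℝ Ω u c a b = 0
  parallel : ∀ u ∈ U, ∀ a b c,
    fderiv ℝ Ω u a b c - Ω u (Γ u a b) c - Ω u b (Γ u a c) = 0
  J_sq : ∀ u ∈ U, ∀ a, J u (J u a) = -a
  integrable : IsIntegrable U J
  compatible : ∀ u ∈ U, ∀ a b, Ω u (J u a) (J u b) = Ω u a b
  potential : ∀ u₀ ∈ U, ∃ V ⊆ U, IsOpen V ∧ u₀ ∈ V ∧ ∃ X : W → W, ContDiffOn ℝ ∞ X V ∧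
    ∀ u ∈ V, ∀ a, fderiv ℝ X u a + Γ u a (X u) = J u a

end SpecialKahler

end GenCY

namespace GenCY

/-! ## Linear algebra of mixed forms at a point -/

/-! The geometric core is algebraic. Along a curve of pure spinors `φ t` the maps `w ↦ w · φ t` have
constant rank. Hence for `e` in the annihilator of `φ 0` the derivative `ψ` satisfies `e · ψ = w · φ
0` for some `w`, and the Clifford relation shows that products of three annihilating vectors kill
`ψ` (`kills_deriv`). Clifford multiplication is self-adjoint for the pairing, so factors can be
moved from one argument to the other. This makes any two such tangent vectors orthogonal for the
complex bilinear pairing (`cpairing_eq_zero_of_kills`); the count `3 + 3 = 6` is exactly what a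
6-dimensional complex annihilator allows.

Apply this pointwise to the derivatives of the local family of structures and integrate over `M`.
With `J = DX`, the real and imaginary parts say `ω(Ja, Jb) = ω(a, b)` and `ω(Ja, b) = -ω(a, Jb)`
(`IsModuliSpace.field_properties`). As `ω` is non-degenerate, `J² = -1`. The map `u ↦ (u - J₀ X(u))
/ 2`, with `J₀` the value of `J` at a point, is holomorphic from `J` to `J₀` and has derivative `1`
there, so it gives complex coordinates (`isIntegrable_fderiv`). Everything else is constant
(`isSpecialPseudoKahler_of_field`). The field `X` is well defined because equivalent structures have
the same classes: by the homotopy formula `f^* θ - θ` is exact, and `exp(dξ) ∧ θ - θ` is exact for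
closed `θ` (`gauge_sub_mem_exactForms`).

The analytic input is that the cohomology is finite-dimensional and that `ω` is non-degenerate.
Following de Rham, averages of pull-backs by local translations are composed into an operator `R`
with smooth kernel that commutes with `d` and is chain homotopic to the identity
(`exists_adm_smoothing`). It extends to a compact operator on the closure of the closed forms inside
a Banach space of continuous forms, and applying it does not change the cohomology class. So the
class map factors through the cokernel of `1 - R`, which is finite-dimensional by Riesz
(`finiteDimensional_coh`), and every linear functional on cohomology is continuous on that closure.
Hahn–Banach extends the functional to all continuous forms; composing with `R` turns it into the
pairing with a smooth form, which is closed because the functional kills exact forms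
(`exists_dual_form`). The same duality reduces smoothness and derivatives of cohomology classes to
integrals depending on parameters (`contDiffOn_class`, `represents_dFam`). -/

instance instFiniteDimensionalLam : FiniteDimensional ℝ Lam :=
  Module.Finite.of_basis dualBasis.ExteriorAlgebra

/-- The pull-back of mixed forms by a linear map of the model space. -/
noncomputable def pb (A : E →L[ℝ] E) : Lam →ₐ[ℝ] Lam :=
  ExteriorAlgebra.map (R := ℝ) (M := Module.Dual ℝ E) (N := Module.Dual ℝ E)
    (LinearMap.dualMap (M₁ := E) (M₂ := E) A.toLinearMap)

@[simp] theorem pb_ι (A : E →L[ℝ] E) (ξ : Module.Dual ℝ E) :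
    pb A (ExteriorAlgebra.ι ℝ ξ) = ExteriorAlgebra.ι ℝ (ξ ∘ₗ A.toLinearMap) :=
  ExteriorAlgebra.map_apply_ι _ _

theorem pb_id : pb (ContinuousLinearMap.id ℝ E) = AlgHom.id ℝ Lam := by
  have : LinearMap.dualMap (M₁ := E) (M₂ := E) (ContinuousLinearMap.id ℝ E).toLinearMap
    = LinearMap.id := by ext; rfl
  rw [pb, this]
  exact ExteriorAlgebra.map_id

theorem pb_pb (A B : E →L[ℝ] E) (a : Lam) : pb A (pb B a) = pb (B ∘L A) a := by
  have := ExteriorAlgebra.map_comp_map (R := ℝ)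
    (LinearMap.dualMap (M₁ := E) (M₂ := E) B.toLinearMap)
    (LinearMap.dualMap (M₁ := E) (M₂ := E) A.toLinearMap)
  exact DFunLike.congr_fun this a

/-- Multiplication of mixed forms as a continuous bilinear map. -/
noncomputable def lmul : Lam →L[ℝ] Lam →L[ℝ] Lam :=
  LinearMap.toContinuousLinearMap
    ((LinearMap.toContinuousLinearMap : (Lam →ₗ[ℝ] Lam) ≃ₗ[ℝ] (Lam →L[ℝ] Lam)).toLinearMap ∘ₗ
      LinearMap.mul ℝ Lam)

@[simp] theorem lmul_apply (a b : Lam) : lmul a b = a * b := rfl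

/-- `reverse` as a continuous linear map. -/
noncomputable def revL : Lam →L[ℝ] Lam :=
  LinearMap.toContinuousLinearMap (CliffordAlgebra.reverse (Q := (0 : QuadraticForm ℝ (Module.Dual ℝ E))))

@[simp] theorem revL_apply (a : Lam) : revL a = CliffordAlgebra.reverse a := rfl

/-- The top coefficient as a continuous linear map. -/
noncomputable def topL : Lam →L[ℝ] ℝ := LinearMap.toContinuousLinearMap topCoeff

@[simp] theorem topL_apply (a : Lam) : topL a = topCoeff a := rfl

/-- The grading automorphism. -/
noncomputable def inv : Lam →ₐ[ℝ] Lam :=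
  CliffordAlgebra.involute (Q := (0 : QuadraticForm ℝ (Module.Dual ℝ E)))

@[simp] theorem inv_ι (ξ : Module.Dual ℝ E) :
    inv (ExteriorAlgebra.ι ℝ ξ) = -ExteriorAlgebra.ι ℝ ξ :=
  CliffordAlgebra.involute_ι _

@[simp] theorem inv_inv (a : Lam) : inv (inv a) = a := CliffordAlgebra.involute_involute a

theorem ι_mul_comm (ξ : Module.Dual ℝ E) (a : Lam) :
    ExteriorAlgebra.ι ℝ ξ * a = inv a * ExteriorAlgebra.ι ℝ ξ := by
  induction a using ExteriorAlgebra.induction with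
  | algebraMap r => simp [Algebra.commutes]
  | ι x =>
    rw [inv_ι]
    have := ExteriorAlgebra.ι_add_mul_swap (R := ℝ) ξ x
    rw [neg_mul]; exact eq_neg_of_add_eq_zero_left this
  | mul a b ha hb => rw [← mul_assoc, ha, mul_assoc, hb, map_mul, mul_assoc]
  | add a b ha hb => rw [mul_add, ha, hb, map_add, add_mul]

theorem inv_pb (A : E →L[ℝ] E) (a : Lam) : inv (pb A a) = pb A (inv a) := by
  induction a using ExteriorAlgebra.induction with
  | algebraMap r => simp
  | ι x => simp
  | mul a b ha hb => simp [ha, hb]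
  | add a b ha hb => simp [ha, hb]

theorem reverse_pb (A : E →L[ℝ] E) (a : Lam) :
    CliffordAlgebra.reverse (pb A a) = pb A (CliffordAlgebra.reverse a) := by
  induction a using ExteriorAlgebra.induction with
  | algebraMap r => simp
  | ι x => simp only [pb_ι, CliffordAlgebra.reverse_ι]
  | mul a b ha hb => simp [ha, hb, CliffordAlgebra.reverse.map_mul]
  | add a b ha hb => simp [ha, hb]

theorem topCoeff_ιMulti {n : ℕ} (hn : n ≠ 6) (v : Fin n → Module.Dual ℝ E) :
    topCoeff (ExteriorAlgebra.ιMulti ℝ n v) = 0 := by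
  rw [topCoeff, ExteriorAlgebra.liftAlternating_apply_ιMulti]
  simp [Pi.single_eq_of_ne hn]

theorem topCoeff_ιMulti_six (v : Fin 6 → Module.Dual ℝ E) :
    topCoeff (ExteriorAlgebra.ιMulti ℝ 6 v) = dualBasis.det v := by
  rw [topCoeff, ExteriorAlgebra.liftAlternating_apply_ιMulti]
  simp

theorem topCoeff_ext {f g : Lam →ₗ[ℝ] ℝ}
    (h : ∀ n (v : Fin n → Module.Dual ℝ E), f (ExteriorAlgebra.ιMulti ℝ n v) =
      g (ExteriorAlgebra.ιMulti ℝ n v)) : f = g := by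
  apply ExteriorAlgebra.lhom_ext
  intro n
  ext v
  exact h n v

theorem pb_ιMulti (A : E →L[ℝ] E) {n : ℕ} (v : Fin n → Module.Dual ℝ E) :
    pb A (ExteriorAlgebra.ιMulti ℝ n v) =
      ExteriorAlgebra.ιMulti ℝ n (fun i => (v i) ∘ₗ A.toLinearMap) :=
  ExteriorAlgebra.map_apply_ιMulti _ _

/-- Only degree 6 contributes. There the transpose of `A` acts on the determinant form by its
determinant, which is that of `A`. -/
theorem topCoeff_pb (A : E →L[ℝ] E) (a : Lam) : topCoeff (pb A a) = A.det * topCoeff a := by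
  have : topCoeff ∘ₗ (pb A).toLinearMap = A.det • topCoeff := by
    apply topCoeff_ext
    intro n v
    simp only [LinearMap.comp_apply, AlgHom.toLinearMap_apply, pb_ιMulti, LinearMap.smul_apply]
    by_cases hn : n = 6
    · subst hn
      rw [topCoeff_ιMulti_six, topCoeff_ιMulti_six]
      have := Module.Basis.det_comp dualBasis (LinearMap.dualMap (M₁ := E) (M₂ := E) A.toLinearMap) v
      rw [LinearMap.det_dualMap] at this
      exact this
    · rw [topCoeff_ιMulti hn, topCoeff_ιMulti hn, smul_zero]
  exact DFunLike.congr_fun this a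

theorem reverse_ιMulti {n : ℕ} (v : Fin n → Module.Dual ℝ E) :
    CliffordAlgebra.reverse (ExteriorAlgebra.ιMulti ℝ n v) =
      ExteriorAlgebra.ιMulti ℝ n (fun i => v (Fin.rev i)) := by
  have h := CliffordAlgebra.reverse_prod_map_ι (Q := (0 : QuadraticForm ℝ (Module.Dual ℝ E)))
    (List.ofFn v)
  rw [List.map_ofFn] at h
  rw [ExteriorAlgebra.ιMulti_apply, ExteriorAlgebra.ιMulti_apply]
  refine h.trans ?_
  congr 1
  apply List.ext_get (by simp)
  intro i h1 h2
  simp only [List.get_eq_getElem, List.getElem_reverse, List.getElem_ofFn, List.length_ofFn,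
    Function.comp_apply]
  congr 2
  ext
  simp [Fin.val_rev]
  omega

/-- Reversing six factors is a product of three transpositions, an odd permutation. This sign is
what makes the pairing skew in dimension 6. -/
theorem topCoeff_reverse (a : Lam) : topCoeff (CliffordAlgebra.reverse a) = -topCoeff a := by
  have : topCoeff ∘ₗ CliffordAlgebra.reverse (Q := (0 : QuadraticForm ℝ (Module.Dual ℝ E)))
      = -topCoeff := by
    apply topCoeff_ext
    intro n v
    simp only [LinearMap.comp_apply, LinearMap.neg_apply]
    erw [reverse_ιMulti]
    by_cases hn : n = 6
    · subst hn
      have h := AlternatingMap.map_perm (ExteriorAlgebra.ιMulti ℝ 6) v (Fin.revPerm)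
      have hs : Equiv.Perm.sign (Fin.revPerm : Equiv.Perm (Fin 6)) = -1 := by decide
      rw [hs] at h
      have h' : ExteriorAlgebra.ιMulti ℝ 6 (fun i => v (Fin.rev i))
        = - ExteriorAlgebra.ιMulti ℝ 6 v := by
        rw [Units.neg_smul, one_smul] at h
        exact h
      rw [h', map_neg]
    · rw [topCoeff_ιMulti hn, topCoeff_ιMulti hn, neg_zero]
  exact DFunLike.congr_fun this a

/-- The grading automorphism is pull-back by `-1`, whose determinant on a 6-dimensional space is
`1`. -/
theorem topCoeff_inv (a : Lam) : topCoeff (inv a) = topCoeff a := by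
  have h : ∀ a, inv a = pb (-ContinuousLinearMap.id ℝ E) a := by
    intro a
    induction a using ExteriorAlgebra.induction with
    | algebraMap r => simp
    | ι x => 
      simp only [inv_ι, pb_ι, ← map_neg]
      congr 1
      ext; simp
    | mul a b ha hb => simp [ha, hb]
    | add a b ha hb => simp [ha, hb]
  rw [h, topCoeff_pb]
  have : (-ContinuousLinearMap.id ℝ E).det = 1 := by
    have h1 : ((-ContinuousLinearMap.id ℝ E : E →L[ℝ] E) : E →ₗ[ℝ] E) = (-1 : ℝ) • LinearMap.id := by
      ext; simp
    rw [ContinuousLinearMap.det, h1, LinearMap.det_smul, LinearMap.det_id]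
    simp [finrank_euclideanSpace]
    norm_num
  rw [this, one_mul]

theorem pairing_skew (a b : Lam) : pairing a b = -pairing b a := by
  unfold pairing
  rw [← topCoeff_reverse, CliffordAlgebra.reverse.map_mul, CliffordAlgebra.reverse_reverse]

/-- The product of two basis monomials has a top coefficient exactly when their index sets are
complementary. So multiplying by the monomial of the complement of `s` isolates the `s`-coefficient
up to a nonzero factor. -/
theorem pairing_nondeg (a : Lam) (h : ∀ b, pairing a b = 0) : a = 0 := by
  classical
  set B := dualBasis.ExteriorAlgebra with hB
  suffices h' : ∀ c : Lam, (∀ b, topCoeff (c * b) = 0) → c = 0 by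
    have := h' (CliffordAlgebra.reverse a) h
    rw [← CliffordAlgebra.reverse_reverse (Q := (0 : QuadraticForm ℝ (Module.Dual ℝ E))) a]
    rw [this, map_zero]
  intro c hc
  have hmul0 : ∀ s t : Finset (Fin 6), ¬ (t = sᶜ) → topCoeff (B s * B t) = 0 := by
    intro s t hst
    by_cases hd : Disjoint s t
    · have := ExteriorAlgebra.basis_mul_of_disjoint dualBasis
        (⟨s, rfl⟩ : powersetCard (Fin 6) s.card) (⟨t, rfl⟩ : powersetCard (Fin 6) t.card) hd
      rw [hB]
      simp only at this
      rw [this, ExteriorAlgebra.basis_apply]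
      rw [Units.smul_def, map_zsmul]
      erw [topCoeff_ιMulti]
      · rw [smul_zero]
      intro hcard
      apply hst
      have h1 : (Set.powersetCard.disjUnion (s := (⟨s, rfl⟩ : powersetCard (Fin 6) s.card))
        (t := (⟨t, rfl⟩ : powersetCard (Fin 6) t.card)) hd : Finset (Fin 6)) = s ∪ t := by
        simp
      rw [h1] at hcard
      have h2 : s ∪ t = Finset.univ := by
        apply Finset.eq_univ_of_card; simpa using hcard
      ext i
      have h3 := Finset.ext_iff.1 h2 i
      simp only [Finset.mem_union, Finset.mem_univ, iff_true] at h3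
      rw [Finset.mem_compl]
      constructor
      · intro hi hi'; exact Finset.disjoint_left.1 hd hi' hi
      · intro hi; tauto
    · have := ExteriorAlgebra.basis_mul_of_not_disjoint dualBasis
        (⟨s, rfl⟩ : powersetCard (Fin 6) s.card) (⟨t, rfl⟩ : powersetCard (Fin 6) t.card) hd
      rw [hB]
      simp only at this
      rw [this, map_zero]
  have hmul1 : ∀ s : Finset (Fin 6), topCoeff (B s * B sᶜ) ≠ 0 := by
    intro s
    have hd : Disjoint s sᶜ := disjoint_compl_right
    have := ExteriorAlgebra.basis_mul_of_disjoint dualBasis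
      (⟨s, rfl⟩ : powersetCard (Fin 6) s.card) (⟨sᶜ, rfl⟩ : powersetCard (Fin 6) sᶜ.card) hd
    rw [hB]
    simp only at this
    rw [this, Units.smul_def, map_zsmul]
    have h1 : (Set.powersetCard.disjUnion (s := (⟨s, rfl⟩ : powersetCard (Fin 6) s.card))
        (t := (⟨sᶜ, rfl⟩ : powersetCard (Fin 6) sᶜ.card)) hd : Finset (Fin 6)) = Finset.univ := by
      simp
    rw [h1]
    have h6 : (Finset.univ : Finset (Fin 6)).card = 6 := by simp
    rw [ExteriorAlgebra.basis_apply_ofCard dualBasis h6]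
    erw [topCoeff_ιMulti_six]
    have h2 : dualBasis.det (dualBasis ∘ (Set.powersetCard.ofFinEmbEquiv.symm
      (Set.powersetCard.ofCard h6))) ≠ 0 := by
      set f : Fin 6 → Fin 6 := ⇑(Set.powersetCard.ofFinEmbEquiv.symm
        (Set.powersetCard.ofCard h6)) with hf
      have hinj : Function.Injective f := by
        rw [hf]; exact (Set.powersetCard.ofFinEmbEquiv.symm
        (Set.powersetCard.ofCard h6)).injective
      have hbij : Function.Bijective f := Finite.injective_iff_bijective.1 hinj
      have h3 := AlternatingMap.map_perm dualBasis.det dualBasis (Equiv.ofBijective f hbij)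
      have h4 : (dualBasis ∘ (Equiv.ofBijective f hbij)) = dualBasis ∘ f := rfl
      rw [h4, Module.Basis.det_self] at h3
      intro h0
      rw [h0] at h3
      rcases Int.units_eq_one_or (Equiv.Perm.sign (Equiv.ofBijective f hbij)) with h5 | h5 <;>
        rw [h5] at h3 <;> simp at h3
    intro h0
    rw [smul_eq_zero] at h0
    rcases h0 with h0 | h0
    · exact (Units.ne_zero _) h0
    · exact h2 h0
  apply B.repr.injective
  rw [map_zero]
  ext s
  have h1 := hc (B sᶜ)
  rw [← B.sum_repr c, Finset.sum_mul, map_sum, Finset.sum_eq_single s] at h1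
  · rw [smul_mul_assoc, map_smul, smul_eq_mul, mul_eq_zero] at h1
    exact h1.resolve_right (hmul1 s)
  · intro t _ hts
    rw [smul_mul_assoc, map_smul, hmul0, smul_zero]
    intro h; exact hts (by simpa using h.symm)
  · simp

end GenCY

namespace GenCY

/-! ## Exterior calculus on the model space -/

theorem dualBasis_apply (i : Fin 6) (v : E) : dualBasis i v = v i := by
  simp [dualBasis]

/-- The antisymmetrization `∑ᵢ eⁱ ∧ L(eᵢ)`. -/
noncomputable def wedge : (E →L[ℝ] Lam) →ₗ[ℝ] Lam where
  toFun L := ∑ i : Fin 6, ExteriorAlgebra.ι ℝ (dualBasis i) * L (EuclideanSpace.single i (1 : ℝ))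
  map_add' L L' := by simp [mul_add, Finset.sum_add_distrib]
  map_smul' c L := by simp [Finset.smul_sum]

theorem wedge_apply (L : E →L[ℝ] Lam) : wedge L =
    ∑ i : Fin 6, ExteriorAlgebra.ι ℝ (dualBasis i) * L (EuclideanSpace.single i (1 : ℝ)) := rfl

theorem dE_eq_wedge (η : E → Lam) (y : E) : dE η y = wedge (fderiv ℝ η y) := rfl

theorem sum_single (v : E) : ∑ i : Fin 6, v i • EuclideanSpace.single i (1 : ℝ) = v := by
  ext j
  simp [Finset.sum_apply, Pi.single_apply]

theorem dual_eq_sum (l : Module.Dual ℝ E) :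
    ∑ i : Fin 6, l (EuclideanSpace.single i (1 : ℝ)) • dualBasis i = l := by
  ext v
  conv_rhs => rw [← sum_single v]
  simp [dualBasis_apply, mul_comm]

theorem wedge_smulRight (l : E →L[ℝ] ℝ) (a : Lam) :
    wedge (l.smulRight a) = ExteriorAlgebra.ι ℝ (l : Module.Dual ℝ E) * a := by
  conv_rhs => rw [← dual_eq_sum (l : Module.Dual ℝ E)]
  simp [wedge_apply, Finset.sum_mul]

theorem wedge_mul_right (L : E →L[ℝ] Lam) (a : Lam) :
    wedge ((lmul.flip a) ∘L L) = wedge L * a := by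
  simp [wedge_apply, Finset.sum_mul, mul_assoc]

theorem wedge_mul_left (L : E →L[ℝ] Lam) (a : Lam) :
    wedge ((lmul a) ∘L L) = inv a * wedge L := by
  simp only [wedge_apply, Finset.mul_sum, ContinuousLinearMap.comp_apply, lmul_apply]
  exact Finset.sum_congr rfl fun i _ => by rw [← mul_assoc, ι_mul_comm, mul_assoc]

/-- `pb A` as a continuous linear map. -/
noncomputable def pbL (A : E →L[ℝ] E) : Lam →L[ℝ] Lam := LinearMap.toContinuousLinearMap
  (pb A).toLinearMap

@[simp] theorem pbL_apply (A : E →L[ℝ] E) (a : Lam) : pbL A a = pb A a := rfl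

/-- Antisymmetrization does not depend on the basis: expanding `A eᵢ` in the basis, or `eʲ ∘ A` in
the dual basis, gives the same double sum. -/
theorem wedge_pb (A : E →L[ℝ] E) (L : E →L[ℝ] Lam) :
    wedge (pbL A ∘L L ∘L A) = pb A (wedge L) := by
  simp only [wedge_apply, map_sum, map_mul, pb_ι, ContinuousLinearMap.comp_apply, pbL_apply]
  have h : ∀ i : Fin 6, A (EuclideanSpace.single i (1 : ℝ)) =
      ∑ j : Fin 6, (A (EuclideanSpace.single i (1 : ℝ))) j • EuclideanSpace.single j (1 : ℝ) :=
    fun i => (sum_single _).symm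
  have h' : ∀ j : Fin 6, (dualBasis j ∘ₗ A.toLinearMap : Module.Dual ℝ E) =
      ∑ i : Fin 6, (A (EuclideanSpace.single i (1 : ℝ))) j • dualBasis i := by
    intro j
    conv_lhs => rw [← dual_eq_sum (dualBasis j ∘ₗ A.toLinearMap)]
    simp [dualBasis_apply]
  simp_rw [h', map_sum, Finset.sum_mul, map_smul]
  rw [Finset.sum_comm]
  refine Finset.sum_congr rfl fun i _ => ?_
  conv_lhs => rw [h i]
  simp [Finset.mul_sum]

/-- The map `ξ ↦ ι ξ` on continuous functionals precomposed with a linear map. -/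
noncomputable def ιL (ξ : Module.Dual ℝ E) : (E →L[ℝ] E) →L[ℝ] Lam :=
  LinearMap.toContinuousLinearMap
    { toFun := fun A => ExteriorAlgebra.ι ℝ (ξ ∘ₗ A.toLinearMap)
      map_add' := fun A B => by
        rw [← map_add]; congr 1; ext; simp
      map_smul' := fun c A => by
        rw [RingHom.id_apply, ← map_smul]; congr 1; ext; simp }

@[simp] theorem ιL_apply (ξ : Module.Dual ℝ E) (A : E →L[ℝ] E) :
    ιL ξ A = ExteriorAlgebra.ι ℝ (ξ ∘ₗ A.toLinearMap) := rfl

theorem contDiff_lmul {V : Type*} [NormedAddCommGroup V] [NormedSpace ℝ V] {n : ℕ∞ω}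
    {f g : V → Lam} (hf : ContDiff ℝ n f) (hg : ContDiff ℝ n g) :
    ContDiff ℝ n (fun x => f x * g x) :=
  (lmul.contDiff.comp hf).clm_apply hg

/-- For a fixed form the pull-back is polynomial in `A`: linear on generators and multiplicative. -/
theorem contDiff_pbL {n : ℕ∞ω} : ContDiff ℝ n pbL := by
  rw [contDiff_clm_apply_iff]
  intro a
  simp only [pbL_apply]
  induction a using ExteriorAlgebra.induction with
  | algebraMap r => simpa using contDiff_const
  | ι ξ =>
    simp only [pb_ι]
    exact (ιL ξ).contDiff
  | mul a b ha hb => simpa using contDiff_lmul ha hb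
  | add a b ha hb => simpa using ha.add hb

/-- Contraction with a vector. -/
noncomputable def contr : E →L[ℝ] Lam →L[ℝ] Lam :=
  LinearMap.toContinuousLinearMap
    ((LinearMap.toContinuousLinearMap : (Lam →ₗ[ℝ] Lam) ≃ₗ[ℝ] (Lam →L[ℝ] Lam)).toLinearMap ∘ₗ
      (CliffordAlgebra.contractLeft (Q := (0 : QuadraticForm ℝ (Module.Dual ℝ E)))) ∘ₗ
        (Module.Dual.eval ℝ E))

theorem contr_ι_mul (v : E) (ξ : Module.Dual ℝ E) (a : Lam) :
    contr v (ExteriorAlgebra.ι ℝ ξ * a) = ξ v • a - ExteriorAlgebra.ι ℝ ξ * contr v a :=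
  CliffordAlgebra.contractLeft_ι_mul _ _ _

theorem contr_algebraMap (v : E) (r : ℝ) : contr v (algebraMap ℝ Lam r) = 0 :=
  CliffordAlgebra.contractLeft_algebraMap _ _ _

/-- Sum the rule `ι(v)(eⁱ ∧ a) = vⁱ a - eⁱ ∧ ι(v) a` over `i`. For `L` the derivative of a form this
is the algebraic core of Cartan's formula. -/
theorem contr_wedge (v : E) (L : E →L[ℝ] Lam) :
    contr v (wedge L) = L v - wedge (contr v ∘L L) := by
  simp only [wedge_apply, map_sum, contr_ι_mul, Finset.sum_sub_distrib, dualBasis_apply,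
    ContinuousLinearMap.comp_apply]
  congr 1
  conv_rhs => rw [← sum_single v]
  simp

theorem fderiv_mul_form {V : Type*} [NormedAddCommGroup V] [NormedSpace ℝ V] {f g : V → Lam}
    {x : V} (hf : DifferentiableAt ℝ f x) (hg : DifferentiableAt ℝ g x) :
    fderiv ℝ (fun y => f y * g y) x =
      (lmul.flip (g x)) ∘L fderiv ℝ f x + (lmul (f x)) ∘L fderiv ℝ g x := by
  have := (lmul.hasFDerivAt_of_bilinear hf.hasFDerivAt hg.hasFDerivAt).fderiv
  simp only [lmul_apply] at this
  rw [this, add_comm]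
  rfl

theorem dE_mul {α β : E → Lam} {x : E} (hα : DifferentiableAt ℝ α x)
    (hβ : DifferentiableAt ℝ β x) :
    dE (fun y => α y * β y) x = dE α x * β x + inv (α x) * dE β x := by
  simp only [dE_eq_wedge, fderiv_mul_form hα hβ, map_add, wedge_mul_left, wedge_mul_right]

theorem dE_smul {f : E → ℝ} {β : E → Lam} {x : E} (hf : DifferentiableAt ℝ f x)
    (hβ : DifferentiableAt ℝ β x) :
    dE (fun y => f y • β y) x =
      ExteriorAlgebra.ι ℝ (fderiv ℝ f x : Module.Dual ℝ E) * β x + f x • dE β x := by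
  rw [dE_eq_wedge, dE_eq_wedge, fderiv_fun_smul hf hβ, map_add, map_smul, wedge_smulRight, add_comm]

/-- Symmetric coefficients meet anticommuting products: exchanging the two indices shows that the
sum is its own negative. -/
theorem wedge_ι_symm {S : E →L[ℝ] E →L[ℝ] ℝ} (h : ∀ u v, S u v = S v u) (T : E →L[ℝ] Lam)
    (hT : ∀ u, T u = ExteriorAlgebra.ι ℝ (S u : Module.Dual ℝ E)) : wedge T = 0 := by
  have h1 : ∀ i : Fin 6, T (EuclideanSpace.single i (1 : ℝ)) = ∑ j : Fin 6,
      S (EuclideanSpace.single i (1 : ℝ)) (EuclideanSpace.single j (1 : ℝ)) •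
        ExteriorAlgebra.ι ℝ (dualBasis j) := by
    intro i
    rw [hT, ← dual_eq_sum (S (EuclideanSpace.single i (1 : ℝ)) : Module.Dual ℝ E)]
    simp
  have h2 : wedge T = -wedge T := by
    conv_lhs => rw [wedge_apply]
    conv_rhs => rw [wedge_apply]
    simp_rw [h1, Finset.mul_sum, mul_smul_comm]
    rw [← Finset.sum_neg_distrib]
    simp_rw [← Finset.sum_neg_distrib]
    rw [Finset.sum_comm]
    refine Finset.sum_congr rfl fun i _ => Finset.sum_congr rfl fun j _ => ?_
    rw [h, ← smul_neg]
    congr 1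
    exact eq_neg_of_add_eq_zero_left (ExteriorAlgebra.ι_add_mul_swap _ _)
  have h3 : (2 : ℝ) • wedge T = 0 := by
    rw [two_smul]; nth_rewrite 1 [h2]; exact neg_add_cancel _
  exact (smul_eq_zero.1 h3).resolve_left two_ne_zero

/-- Second partial derivatives commute while one-forms anticommute, so the double sum is its own
negative. -/
theorem dE_dE {η : E → Lam} {x : E} (hη : ContDiffAt ℝ ∞ η x) : dE (dE η) x = 0 := by
  have hd : DifferentiableAt ℝ (fderiv ℝ η) x :=
    (hη.fderiv_right (m := 1) (by norm_cast)).differentiableAt (by simp)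
  have hsymm : IsSymmSndFDerivAt ℝ η x := hη.isSymmSndFDerivAt (by simp; norm_cast)
  let wL : (E →L[ℝ] Lam) →L[ℝ] Lam := LinearMap.toContinuousLinearMap wedge
  have h1 : fderiv ℝ (dE η) x = wL ∘L fderiv ℝ (fderiv ℝ η) x := by
    have : dE η = fun y => wL (fderiv ℝ η y) := rfl
    rw [this]
    exact (wL.hasFDerivAt.comp x hd.hasFDerivAt).fderiv
  rw [dE_eq_wedge, h1]
  set S := fderiv ℝ (fderiv ℝ η) x with hS
  have h2 : wedge (wL ∘L S) = -wedge (wL ∘L S) := by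
    have h3 : wedge (wL ∘L S) = ∑ i : Fin 6, ∑ j : Fin 6, ExteriorAlgebra.ι ℝ (dualBasis i) *
        (ExteriorAlgebra.ι ℝ (dualBasis j) *
          S (EuclideanSpace.single i (1 : ℝ)) (EuclideanSpace.single j (1 : ℝ))) := by
      simp only [wedge_apply, ContinuousLinearMap.comp_apply, wL, LinearMap.coe_toContinuousLinearMap',
        Finset.mul_sum]
    conv_lhs => rw [h3]
    rw [h3, ← Finset.sum_neg_distrib]
    simp_rw [← Finset.sum_neg_distrib]
    rw [Finset.sum_comm]
    refine Finset.sum_congr rfl fun i _ => Finset.sum_congr rfl fun j _ => ?_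
    rw [hsymm.eq, ← mul_assoc, ← mul_assoc, ← neg_mul]
    congr 1
    exact eq_neg_of_add_eq_zero_left (ExteriorAlgebra.ι_add_mul_swap _ _)
  have h3 : (2 : ℝ) • wedge (wL ∘L S) = 0 := by
    rw [two_smul]; nth_rewrite 1 [h2]; exact neg_add_cancel _
  exact (smul_eq_zero.1 h3).resolve_left two_ne_zero

section Naturality

variable {f : E → E} {x : E}

theorem contDiffAt_pb_fderiv (hf : ContDiffAt ℝ ∞ f x) :
    ContDiffAt ℝ ∞ (fun y => pbL (fderiv ℝ f y)) x :=
  contDiff_pbL.contDiffAt.comp x (hf.fderiv_right (m := ∞) (by simp))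

/-- The one-form is the differential of `ξ ∘ f`, hence closed by the symmetry of the second
derivative of `f`. -/
theorem dE_ι_fderiv (hf : ContDiffAt ℝ ∞ f x) (ξ : Module.Dual ℝ E) :
    dE (fun y => ExteriorAlgebra.ι ℝ (ξ ∘ₗ (fderiv ℝ f y).toLinearMap)) x = 0 := by
  have hd : DifferentiableAt ℝ (fderiv ℝ f) x :=
    (hf.fderiv_right (m := 1) (by norm_cast)).differentiableAt (by simp)
  have hsymm : IsSymmSndFDerivAt ℝ f x := hf.isSymmSndFDerivAt (by simp; norm_cast)
  have h1 : fderiv ℝ (fun y => ExteriorAlgebra.ι ℝ (ξ ∘ₗ (fderiv ℝ f y).toLinearMap)) x =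
      (ιL ξ) ∘L fderiv ℝ (fderiv ℝ f) x :=
    ((ιL ξ).hasFDerivAt.comp x hd.hasFDerivAt).fderiv
  rw [dE_eq_wedge, h1]
  let ξ' : E →L[ℝ] ℝ := LinearMap.toContinuousLinearMap ξ
  refine wedge_ι_symm (S := (ContinuousLinearMap.compL ℝ E E ℝ ξ') ∘L fderiv ℝ (fderiv ℝ f) x)
    ?_ _ ?_
  · intro u v
    simp [hsymm.eq u v]
  · intro u
    simp only [ContinuousLinearMap.comp_apply, ιL_apply]
    congr 1

/-- Leibniz rule: the pull-back of a constant form is built by products and sums from pulled-back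
generators, which are closed. -/
theorem dE_pb_const (hf : ContDiffAt ℝ ∞ f x) (a : Lam) :
    dE (fun y => pb (fderiv ℝ f y) a) x = 0 := by
  have hsm : ∀ a, DifferentiableAt ℝ (fun y => pb (fderiv ℝ f y) a) x := fun a =>
    ((contDiffAt_pb_fderiv hf).clm_apply contDiffAt_const).differentiableAt (by simp)
  induction a using CliffordAlgebra.left_induction with
  | algebraMap r => simp [dE_eq_wedge]
  | add a b ha hb =>
    have : (fun y => pb (fderiv ℝ f y) (a + b)) =
      fun y => pb (fderiv ℝ f y) a + pb (fderiv ℝ f y) b := by simp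
    rw [this, dE_eq_wedge, fderiv_fun_add (hsm a) (hsm b), map_add, ← dE_eq_wedge, ← dE_eq_wedge,
      ha, hb, add_zero]
  | ι_mul a ξ ha =>
    have h0 := hsm (ExteriorAlgebra.ι ℝ ξ)
    simp only [pb_ι] at h0
    have : (fun y => pb (fderiv ℝ f y) (CliffordAlgebra.ι 0 ξ * a)) =
      fun y => ExteriorAlgebra.ι ℝ (ξ ∘ₗ (fderiv ℝ f y).toLinearMap) * pb (fderiv ℝ f y) a := by
      funext y
      rw [map_mul]
      congr 1
      exact pb_ι _ _
    rw [this, dE_mul h0 (hsm a), ha, dE_ι_fderiv hf]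
    simp

/-- The exterior derivative commutes with pull-backs. -/
theorem dE_pullback {η : E → Lam} (hf : ContDiffAt ℝ ∞ f x) (hη : DifferentiableAt ℝ η (f x)) :
    dE (fun y => pb (fderiv ℝ f y) (η (f y))) x = pb (fderiv ℝ f x) (dE η (f x)) := by
  have hC := ((contDiffAt_pb_fderiv hf).differentiableAt (by simp)).hasFDerivAt
  have hfd := (hf.differentiableAt (by simp)).hasFDerivAt
  have h1 := (hC.clm_apply (hη.hasFDerivAt.comp x hfd)).fderiv
  have h0 := (hC.clm_apply (hasFDerivAt_const (η (f x)) x)).fderiv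
  have h2 := dE_pb_const hf (η (f x))
  rw [dE_eq_wedge] at h2 ⊢
  simp only [Function.comp_apply, pbL_apply, ContinuousLinearMap.comp_zero, zero_add] at h1 h0
  rw [h0] at h2
  -- The product rule has two terms. The one that differentiates the Jacobian vanishes by
  -- `dE_pb_const`; the one that differentiates `η` is `wedge_pb`.
  rw [h1, map_add, h2, add_zero, dE_eq_wedge, ← wedge_pb]

end Naturality

/-! ### Cartan's formula for families of maps of the model space. -/

section Cartan

variable {W : Type*} [NormedAddCommGroup W] [NormedSpace ℝ W] {F : W × E → E} {w : W} {x : E}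

/-- The partial derivative in the second variable. -/
noncomputable def dsnd (F : W × E → E) (q : W × E) : E →L[ℝ] E :=
  fderiv ℝ F q ∘L ContinuousLinearMap.inr ℝ W E

/-- The derivative of `F` in the direction `e` of the parameter space. -/
noncomputable def dpar (F : W × E → E) (e : W) (q : W × E) : E := fderiv ℝ F q (e, 0)

theorem contDiffAt_dsnd (hF : ContDiffAt ℝ ∞ F (w, x)) : ContDiffAt ℝ ∞ (dsnd F) (w, x) :=
  (hF.fderiv_right (m := ∞) (by simp)).clm_comp contDiffAt_const

theorem contDiffAt_dpar (hF : ContDiffAt ℝ ∞ F (w, x)) (e : W) :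
    ContDiffAt ℝ ∞ (dpar F e) (w, x) :=
  (hF.fderiv_right (m := ∞) (by simp)).clm_apply contDiffAt_const

theorem contDiffAt_slice_left {G : Type*} [NormedAddCommGroup G] [NormedSpace ℝ G] {n : ℕ∞ω}
    {f : W × E → G} (hf : ContDiffAt ℝ n f (w, x)) : ContDiffAt ℝ n (fun w' => f (w', x)) w :=
  hf.comp w (contDiffAt_id.prodMk contDiffAt_const)

theorem contDiffAt_slice_right {G : Type*} [NormedAddCommGroup G] [NormedSpace ℝ G] {n : ℕ∞ω}
    {f : W × E → G} (hf : ContDiffAt ℝ n f (w, x)) : ContDiffAt ℝ n (fun x' => f (w, x')) x :=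
  hf.comp x (contDiffAt_const.prodMk contDiffAt_id)

theorem fderiv_slice_right {G : Type*} [NormedAddCommGroup G] [NormedSpace ℝ G]
    {f : W × E → G} (hf : DifferentiableAt ℝ f (w, x)) :
    fderiv ℝ (fun x' => f (w, x')) x = fderiv ℝ f (w, x) ∘L ContinuousLinearMap.inr ℝ W E :=
  (hf.hasFDerivAt.comp x (hasFDerivAt_prodMk_right w x)).fderiv

theorem fderiv_slice_left {G : Type*} [NormedAddCommGroup G] [NormedSpace ℝ G]
    {f : W × E → G} (hf : DifferentiableAt ℝ f (w, x)) :
    fderiv ℝ (fun w' => f (w', x)) w = fderiv ℝ f (w, x) ∘L ContinuousLinearMap.inl ℝ W E :=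
  (hf.hasFDerivAt.comp w (hasFDerivAt_prodMk_left w x)).fderiv

theorem eventually_dsnd (hF : ContDiffAt ℝ ∞ F (w, x)) :
    ∀ᶠ x' in 𝓝 x, dsnd F (w, x') = fderiv ℝ (fun x'' => F (w, x'')) x' := by
  have h1 : ∀ᶠ q in 𝓝 (w, x), DifferentiableAt ℝ F q := by
    filter_upwards [(hF.of_le (m := 1) (by simp)).eventually (by simp)] with q hq
    exact hq.differentiableAt (by simp)
  have h2 : Filter.Tendsto (fun x' : E => (w, x')) (𝓝 x) (𝓝 (w, x)) :=
    (Continuous.prodMk_right w).tendsto x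
  filter_upwards [h2.eventually h1] with x' hx'
  rw [fderiv_slice_right hx', dsnd]

theorem dE_congr {η η' : E → Lam} (h : η =ᶠ[𝓝 x] η') : dE η x = dE η' x := by
  rw [dE_eq_wedge, dE_eq_wedge, h.fderiv_eq]

theorem dE_pb_dsnd_const (hF : ContDiffAt ℝ ∞ F (w, x)) (a : Lam) :
    dE (fun x' => pb (dsnd F (w, x')) a) x = 0 := by
  rw [dE_congr (η' := fun x' => pb (fderiv ℝ (fun x'' => F (w, x'')) x') a)]
  · exact dE_pb_const (contDiffAt_slice_right hF) a
  · filter_upwards [eventually_dsnd hF] with x' hx'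
    rw [hx']

/-- Symmetry of the mixed second derivatives of `F`. It proves Cartan's formula on one-form
generators. -/
theorem fderiv_dpar (hF : ContDiffAt ℝ ∞ F (w, x)) (e : W) :
    fderiv ℝ (fun x' => dpar F e (w, x')) x = fderiv ℝ (fun w' => dsnd F (w', x)) w e := by
  have hd : DifferentiableAt ℝ (fderiv ℝ F) (w, x) :=
    (hF.fderiv_right (m := 1) (by norm_cast)).differentiableAt (by simp)
  have hsymm : IsSymmSndFDerivAt ℝ F (w, x) := hF.isSymmSndFDerivAt (by simp; norm_cast)
  rw [fderiv_slice_right ((contDiffAt_dpar hF e).differentiableAt (by simp)),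
    fderiv_slice_left ((contDiffAt_dsnd hF).differentiableAt (by simp))]
  have h1 : fderiv ℝ (dpar F e) (w, x) = (ContinuousLinearMap.apply ℝ E ((e, 0) : W × E)) ∘L
      fderiv ℝ (fderiv ℝ F) (w, x) :=
    ((ContinuousLinearMap.apply ℝ E ((e, 0) : W × E)).hasFDerivAt.comp _ hd.hasFDerivAt).fderiv
  let cR : ((W × E) →L[ℝ] E) →L[ℝ] (E →L[ℝ] E) :=
    (ContinuousLinearMap.compL ℝ E (W × E) E).flip (ContinuousLinearMap.inr ℝ W E)
  have h2 : fderiv ℝ (dsnd F) (w, x) = cR ∘L fderiv ℝ (fderiv ℝ F) (w, x) :=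
    (cR.hasFDerivAt.comp _ hd.hasFDerivAt).fderiv
  rw [h1, h2]
  ext1 v
  simp [cR, hsymm.eq]

/-- Induction on the form. For `ξ ∧ a` the contraction produces the function `ξ(velocity)`, whose
differential is the parameter derivative of `ξ ∘ DF`. The term containing the contraction of `a` is
the inductive hypothesis, with two signs that cancel, and the remaining terms contain derivatives of
pulled-back constant forms, which vanish. -/
theorem cartan_const (hF : ContDiffAt ℝ ∞ F (w, x)) (e : W) (a : Lam) :
    fderiv ℝ (fun w' => pb (dsnd F (w', x)) a) w e =
      dE (fun x' => pb (dsnd F (w, x')) (contr (dpar F e (w, x')) a)) x := by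
  have hpb : ContDiffAt ℝ ∞ (fun q => pbL (dsnd F q)) (w, x) :=
    contDiff_pbL.contDiffAt.comp _ (contDiffAt_dsnd hF)
  have hL : ∀ a, DifferentiableAt ℝ (fun w' => pb (dsnd F (w', x)) a) w := fun a =>
    ((contDiffAt_slice_left hpb).clm_apply contDiffAt_const).differentiableAt (by simp)
  have hR : ∀ a, DifferentiableAt ℝ (fun x' => pb (dsnd F (w, x')) a) x := fun a =>
    ((contDiffAt_slice_right hpb).clm_apply contDiffAt_const).differentiableAt (by simp)
  have hcon : ∀ a, DifferentiableAt ℝ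
      (fun x' => pb (dsnd F (w, x')) (contr (dpar F e (w, x')) a)) x := fun a =>
    ((contDiffAt_slice_right hpb).clm_apply
      ((contr.contDiff.contDiffAt.comp x (contDiffAt_slice_right (contDiffAt_dpar hF e))).clm_apply
        contDiffAt_const)).differentiableAt (by simp)
  induction a using CliffordAlgebra.left_induction with
  | algebraMap r =>
    have : ∀ x', contr (dpar F e (w, x')) (algebraMap ℝ Lam r) = 0 := fun x' => contr_algebraMap _ _
    simp only [AlgHom.commutes, this, map_zero]
    simp [dE_eq_wedge]
  | add a b ha hb =>
    simp only [map_add]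
    rw [fderiv_fun_add (hL a) (hL b), dE_eq_wedge, fderiv_fun_add (hcon a) (hcon b), map_add,
      ← dE_eq_wedge, ← dE_eq_wedge, ← ha, ← hb]
    rfl
  | ι_mul a ξ ha =>
    have hLξ := hL (ExteriorAlgebra.ι ℝ ξ)
    have hRξ := hR (ExteriorAlgebra.ι ℝ ξ)
    simp only [pb_ι] at hLξ hRξ
    have e1 : (fun w' => pb (dsnd F (w', x)) (CliffordAlgebra.ι 0 ξ * a)) =
        fun w' => ExteriorAlgebra.ι ℝ (ξ ∘ₗ (dsnd F (w', x)).toLinearMap) *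
          pb (dsnd F (w', x)) a := by
      funext y
      rw [map_mul]
      congr 1
      exact pb_ι _ _
    have e2 : (fun x' => pb (dsnd F (w, x')) (contr (dpar F e (w, x')) (CliffordAlgebra.ι 0 ξ * a)))
        = fun x' => ξ (dpar F e (w, x')) • pb (dsnd F (w, x')) a -
          ExteriorAlgebra.ι ℝ (ξ ∘ₗ (dsnd F (w, x')).toLinearMap) *
            pb (dsnd F (w, x')) (contr (dpar F e (w, x')) a) := by
      funext y
      have := contr_ι_mul (dpar F e (w, y)) ξ a
      erw [this]
      rw [map_sub, map_smul, map_mul, pb_ι]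
    let ξ' : E →L[ℝ] ℝ := LinearMap.toContinuousLinearMap ξ
    have hdp : DifferentiableAt ℝ (fun x' => dpar F e (w, x')) x :=
      (contDiffAt_slice_right (contDiffAt_dpar hF e)).differentiableAt (by simp)
    have hξ : HasFDerivAt (fun x' => ξ (dpar F e (w, x')))
        (ξ' ∘L fderiv ℝ (fun x' => dpar F e (w, x')) x) x :=
      ξ'.hasFDerivAt.comp x hdp.hasFDerivAt
    have hds : DifferentiableAt ℝ (fun w' => dsnd F (w', x)) w :=
      (contDiffAt_slice_left (contDiffAt_dsnd hF)).differentiableAt (by simp)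
    have hιL : fderiv ℝ (fun w' => ExteriorAlgebra.ι ℝ (ξ ∘ₗ (dsnd F (w', x)).toLinearMap)) w =
        ιL ξ ∘L fderiv ℝ (fun w' => dsnd F (w', x)) w :=
      ((ιL ξ).hasFDerivAt.comp w hds.hasFDerivAt).fderiv
    have hz : dE (fun x' => ExteriorAlgebra.ι ℝ (ξ ∘ₗ (dsnd F (w, x')).toLinearMap)) x = 0 := by
      have := dE_pb_dsnd_const hF (ExteriorAlgebra.ι ℝ ξ)
      simpa only [pb_ι] using this
    rw [e1, e2, fderiv_mul_form hLξ (hL a), dE_eq_wedge, fderiv_fun_sub, map_sub, ← dE_eq_wedge,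
      ← dE_eq_wedge, dE_smul hξ.differentiableAt (hR a), dE_mul hRξ (hcon a), ← ha, hz,
      dE_pb_dsnd_const hF, hξ.fderiv, hιL, fderiv_dpar hF]
    · simp only [zero_mul, smul_zero, add_zero, zero_add, inv_ι, neg_mul, sub_neg_eq_add]
      simp only [_root_.add_apply, ContinuousLinearMap.comp_apply, lmul_apply,
        ContinuousLinearMap.flip_apply, ιL_apply]
      congr 1
    · exact hξ.differentiableAt.smul (hR a)
    · exact (lmul.hasFDerivAt_of_bilinear hRξ.hasFDerivAt (hcon a).hasFDerivAt).differentiableAt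

/-- Cartan's formula for a smooth family of maps. -/
theorem cartan (hF : ContDiffAt ℝ ∞ F (w, x)) (e : W) {η : E → Lam}
    (hη : DifferentiableAt ℝ η (F (w, x))) :
    fderiv ℝ (fun w' => pb (dsnd F (w', x)) (η (F (w', x)))) w e =
      dE (fun x' => pb (dsnd F (w, x')) (contr (dpar F e (w, x')) (η (F (w, x'))))) x +
        pb (dsnd F (w, x)) (contr (dpar F e (w, x)) (dE η (F (w, x)))) := by
  have hpb : ContDiffAt ℝ ∞ (fun q => pbL (dsnd F q)) (w, x) :=
    contDiff_pbL.contDiffAt.comp _ (contDiffAt_dsnd hF)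
  have hFd := hF.differentiableAt (by simp)
  -- the left-hand side
  have hCl := ((contDiffAt_slice_left hpb).differentiableAt (by simp)).hasFDerivAt
  have hηl : HasFDerivAt (fun w' => η (F (w', x))) (fderiv ℝ η (F (w, x)) ∘L
      (fderiv ℝ F (w, x) ∘L ContinuousLinearMap.inl ℝ W E)) w :=
    HasFDerivAt.comp w hη.hasFDerivAt (hFd.hasFDerivAt.comp w (hasFDerivAt_prodMk_left w x))
  have l1 := (hCl.clm_apply hηl).fderiv
  have l0 := (hCl.clm_apply (hasFDerivAt_const (η (F (w, x))) w)).fderiv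
  -- the right-hand side
  let D : W × E → Lam →L[ℝ] Lam := fun q => pbL (dsnd F q) ∘L contr (dpar F e q)
  have hD : ContDiffAt ℝ ∞ D (w, x) :=
    hpb.clm_comp (contr.contDiff.contDiffAt.comp _ (contDiffAt_dpar hF e))
  have hDr := ((contDiffAt_slice_right hD).differentiableAt (by simp)).hasFDerivAt
  have hηr : HasFDerivAt (fun x' => η (F (w, x'))) (fderiv ℝ η (F (w, x)) ∘L dsnd F (w, x)) x :=
    HasFDerivAt.comp x hη.hasFDerivAt (hFd.hasFDerivAt.comp x (hasFDerivAt_prodMk_right w x))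
  have r1 := (hDr.clm_apply hηr).fderiv
  have r0 := (hDr.clm_apply (hasFDerivAt_const (η (F (w, x))) x)).fderiv
  have hc := cartan_const hF e (η (F (w, x)))
  rw [dE_eq_wedge] at hc ⊢
  simp only [D, ContinuousLinearMap.comp_apply, pbL_apply, ContinuousLinearMap.comp_zero,
    zero_add] at l1 l0 r1 r0
  -- With `η` frozen at its value at the image point, both sides agree by `cartan_const`. What
  -- remains are the terms that differentiate `η`, and these match by `contr_wedge`.
  rw [l0, r0] at hc
  rw [l1, r1, map_add, _root_.add_apply, hc, dE_eq_wedge, contr_wedge, map_sub]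
  rw [← wedge_pb]
  simp only [ContinuousLinearMap.comp_apply, pbL_apply, dpar, ContinuousLinearMap.inl_apply,
    ContinuousLinearMap.comp_assoc]
  abel

end Cartan

end GenCY

namespace GenCY

set_option linter.unusedSectionVars false

/-! ## Forms on manifolds in charts -/

section Charts

variable {M : Type*} [TopologicalSpace M] [ChartedSpace E M] [IsManifold (𝓡 6) ∞ M]

/-- The chart at `x₀`. -/
local notation "ch" => extChartAt (𝓡 6) (M := M) (H := E)

theorem mdifferentiableAt_chart {x₀ x : M} (hx : x ∈ (ch x₀).source) :
    MDifferentiableAt (𝓡 6) (𝓡 6) (ch x₀) x := by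
  rw [extChartAt_source] at hx
  exact (contMDiffAt_extChartAt' (n := ∞) hx).mdifferentiableAt (by simp)

theorem contMDiffAt_chart_symm {x₀ : M} {y : E} (hy : y ∈ (ch x₀).target) :
    ContMDiffAt (𝓡 6) (𝓡 6) ∞ (ch x₀).symm y :=
  (contMDiffOn_extChartAt_symm x₀).contMDiffAt ((isOpen_extChartAt_target x₀).mem_nhds hy)

theorem mdifferentiableAt_chart_symm {x₀ : M} {y : E} (hy : y ∈ (ch x₀).target) :
    MDifferentiableAt (𝓡 6) (𝓡 6) (ch x₀).symm y :=
  (contMDiffAt_chart_symm hy).mdifferentiableAt (by simp)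

theorem pullAt_eq_pb {N N' : Type*} [TopologicalSpace N] [ChartedSpace E N]
    [TopologicalSpace N'] [ChartedSpace E N'] (f : N → N') (x : N) :
    pullAt f x = pb (mfderiv (𝓡 6) (𝓡 6) f x) := rfl

theorem pullAt_comp {N N' N'' : Type*} [TopologicalSpace N] [ChartedSpace E N]
    [TopologicalSpace N'] [ChartedSpace E N'] [TopologicalSpace N''] [ChartedSpace E N'']
    {g : N' → N''} {f : N → N'} {x : N} {y : N'} (hy : f x = y)
    (hg : MDifferentiableAt (𝓡 6) (𝓡 6) g y) (hf : MDifferentiableAt (𝓡 6) (𝓡 6) f x) (a : Lam) :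
    pullAt f x (pullAt g y a) = pullAt (g ∘ f) x a := by
  subst hy
  rw [pullAt_eq_pb, pullAt_eq_pb, pullAt_eq_pb, mfderiv_comp x hg hf]
  exact pb_pb _ _ _

theorem pullAt_congr {N N' : Type*} [TopologicalSpace N] [ChartedSpace E N]
    [TopologicalSpace N'] [ChartedSpace E N'] {f g : N → N'} {x : N} (h : f =ᶠ[𝓝 x] g) :
    pullAt f x = pullAt g x := by
  rw [pullAt_eq_pb, pullAt_eq_pb, h.mfderiv_eq]

theorem pullAt_id {N : Type*} [TopologicalSpace N] [ChartedSpace E N] (x : N) (a : Lam) :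
    pullAt (id : N → N) x a = a := by
  rw [pullAt_eq_pb, mfderiv_id]
  exact DFunLike.congr_fun pb_id a

theorem pullAt_model (f : E → E) (x : E) : pullAt f x = pb (fderiv ℝ f x) := by
  rw [pullAt_eq_pb, mfderiv_eq_fderiv]

theorem pullback_id (θ : MForm M) : pullback (id : M → M) θ = θ :=
  funext fun x => pullAt_id x _

theorem form_eq_pullAt_chartRep {x₀ x : M} (hx : x ∈ (ch x₀).source) (θ : MForm M) :
    θ x = pullAt (ch x₀) x (chartRep x₀ θ (ch x₀ x)) := by
  have hx' := (ch x₀).map_source hx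
  rw [chartRep, pullback, pullAt_comp rfl (mdifferentiableAt_chart_symm hx')
    (mdifferentiableAt_chart hx), (ch x₀).left_inv hx, pullAt_congr (g := id), pullAt_id]
  filter_upwards [(isOpen_extChartAt_source x₀).mem_nhds hx] with x' hx'
  exact (ch x₀).left_inv hx'

theorem chartRep_pullAt {x₀ : M} {y : E} (hy : y ∈ (ch x₀).target) (a : Lam) :
    pullAt (ch x₀).symm y (pullAt (ch x₀) ((ch x₀).symm y) a) = a := by
  rw [pullAt_comp rfl (mdifferentiableAt_chart ((ch x₀).map_target hy))
    (mdifferentiableAt_chart_symm hy), pullAt_congr (g := id), pullAt_id]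
  filter_upwards [(isOpen_extChartAt_target x₀).mem_nhds hy] with y' hy'
  exact (ch x₀).right_inv hy'

/-- A map in the charts at `x₁` (source) and `x₀` (target). -/
noncomputable def inCharts (x₀ x₁ : M) (f : M → M) : E → E := fun y => ch x₀ (f ((ch x₁).symm y))

theorem chartRep_pullback {x₀ x₁ : M} {f : M → M} {y : E} (hy : y ∈ (ch x₁).target)
    (hf : ContMDiffAt (𝓡 6) (𝓡 6) ∞ f ((ch x₁).symm y)) (hfy : f ((ch x₁).symm y) ∈ (ch x₀).source)
    (θ : MForm M) :
    chartRep x₁ (pullback f θ) y =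
      pb (fderiv ℝ (inCharts x₀ x₁ f) y) (chartRep x₀ θ (inCharts x₀ x₁ f y)) := by
  have hfd := hf.mdifferentiableAt (by simp)
  have hsd := mdifferentiableAt_chart_symm hy
  rw [chartRep, pullback, pullback, form_eq_pullAt_chartRep hfy θ, pullAt_comp rfl
    (mdifferentiableAt_chart hfy) hfd, pullAt_comp rfl
    ((mdifferentiableAt_chart hfy).comp _ hfd) hsd, pullAt_model]
  rfl

theorem chartRep_change {x₀ x₁ : M} {y : E} (hy : y ∈ (ch x₁).target)
    (hy' : (ch x₁).symm y ∈ (ch x₀).source) (θ : MForm M) :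
    chartRep x₁ θ y =
      pb (fderiv ℝ (inCharts x₀ x₁ id) y) (chartRep x₀ θ (inCharts x₀ x₁ id y)) := by
  rw [← chartRep_pullback hy contMDiffAt_id hy', pullback_id]

variable {W : Type*} [NormedAddCommGroup W] [NormedSpace ℝ W]

/-- A family of maps in charts. -/
noncomputable def inChartsFam (x₀ x₁ : M) (F : W → M → M) : W × E → E :=
  fun q => ch x₀ (F q.1 ((ch x₁).symm q.2))

theorem contDiffAt_inChartsFam {x₀ x₁ : M} {F : W → M → M} {w : W} {y : E}
    (hy : y ∈ (ch x₁).target)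
    (hF : ContMDiffAt (𝓘(ℝ, W).prod (𝓡 6)) (𝓡 6) ∞ (fun q : W × M => F q.1 q.2)
      (w, (ch x₁).symm y)) (hFy : F w ((ch x₁).symm y) ∈ (ch x₀).source) :
    ContDiffAt ℝ ∞ (inChartsFam x₀ x₁ F) (w, y) := by
  rw [← contMDiffAt_iff_contDiffAt]
  have h1 : ContMDiffAt 𝓘(ℝ, W × E) (𝓘(ℝ, W).prod (𝓡 6)) ∞
      (fun q : W × E => (q.1, (ch x₁).symm q.2)) (w, y) := by
    apply ContMDiffAt.prodMk
    · exact contDiffAt_fst.contMDiffAt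
    · exact ContMDiffAt.comp (w, y) (contMDiffAt_chart_symm hy) contDiffAt_snd.contMDiffAt
  have h2 := ContMDiffAt.comp (w, y) hF h1
  rw [extChartAt_source] at hFy
  exact ContMDiffAt.comp (w, y) (contMDiffAt_extChartAt' (n := ∞) hFy) h2

theorem contDiffAt_inCharts {x₀ x₁ : M} {f : M → M} {y : E} (hy : y ∈ (ch x₁).target)
    (hf : ContMDiffAt (𝓡 6) (𝓡 6) ∞ f ((ch x₁).symm y))
    (hfy : f ((ch x₁).symm y) ∈ (ch x₀).source) :
    ContDiffAt ℝ ∞ (inCharts x₀ x₁ f) y := by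
  rw [← contMDiffAt_iff_contDiffAt]
  have h2 := ContMDiffAt.comp y hf (contMDiffAt_chart_symm hy)
  rw [extChartAt_source] at hfy
  exact ContMDiffAt.comp y (contMDiffAt_extChartAt' (n := ∞) hfy) h2

theorem eventually_mem_target {x₀ : M} {y : E} (hy : y ∈ (ch x₀).target) :
    ∀ᶠ y' in 𝓝 y, y' ∈ (ch x₀).target := (isOpen_extChartAt_target x₀).mem_nhds hy

theorem continuousAt_chart_symm {x₀ : M} {y : E} (hy : y ∈ (ch x₀).target) :
    ContinuousAt (ch x₀).symm y := (contMDiffAt_chart_symm hy).continuousAt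

/-- Joint smoothness of a family of forms near a parameter and a point. -/
def SmAt (θ : W → MForm M) (w : W) (x : M) : Prop :=
  ∀ x₀, x ∈ (ch x₀).source →
    ContDiffAt ℝ ∞ (fun q : W × E => chartRep x₀ (θ q.1) q.2) (w, ch x₀ x)

theorem contDiffAt_pb_apply {V : Type*} [NormedAddCommGroup V] [NormedSpace ℝ V] {n : ℕ∞ω}
    {A : V → E →L[ℝ] E} {g : V → Lam} {v : V} (hA : ContDiffAt ℝ n A v) (hg : ContDiffAt ℝ n g v) :
    ContDiffAt ℝ n (fun v => pb (A v) (g v)) v :=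
  (contDiff_pbL.contDiffAt.comp v hA).clm_apply hg

theorem contDiffAt_snd_fderiv {f : E → E} {w : W} {y : E} (hf : ContDiffAt ℝ ∞ f y) :
    ContDiffAt ℝ ∞ (fun q : W × E => fderiv ℝ f q.2) (w, y) :=
  (hf.fderiv_right (m := ∞) (by simp)).comp (w, y) contDiffAt_snd

theorem contDiffAt_comp_snd {G : Type*} [NormedAddCommGroup G] [NormedSpace ℝ G] {g : W × E → G}
    {f : E → E} {w : W} {y : E} (hg : ContDiffAt ℝ ∞ g (w, f y)) (hf : ContDiffAt ℝ ∞ f y) :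
    ContDiffAt ℝ ∞ (fun q : W × E => g (q.1, f q.2)) (w, y) :=
  ContDiffAt.comp (f := fun q : W × E => (q.1, f q.2)) (w, y) hg
    (contDiffAt_fst.prodMk (hf.comp (w, y) contDiffAt_snd))

/-- Transition maps are smooth and do not involve the parameter, so one chart around the point
suffices. -/
theorem SmAt.of_chart {θ : W → MForm M} {w : W} {x : M} (x₀ : M) (hx : x ∈ (ch x₀).source)
    (h : ContDiffAt ℝ ∞ (fun q : W × E => chartRep x₀ (θ q.1) q.2) (w, ch x₀ x)) :
    SmAt θ w x := by
  intro x₁ hx₁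
  have hy := (ch x₁).map_source hx₁
  have hl : (ch x₁).symm (ch x₁ x) = x := (ch x₁).left_inv hx₁
  have hsm : ContDiffAt ℝ ∞ (inCharts x₀ x₁ id) (ch x₁ x) :=
    contDiffAt_inCharts hy contMDiffAt_id (by rw [hl]; exact hx)
  have hg : ContDiffAt ℝ ∞ (fun q : W × E => pb (fderiv ℝ (inCharts x₀ x₁ id) q.2)
      (chartRep x₀ (θ q.1) (inCharts x₀ x₁ id q.2))) (w, ch x₁ x) := by
    refine contDiffAt_pb_apply (contDiffAt_snd_fderiv hsm) ?_
    have h2 : inCharts x₀ x₁ id (ch x₁ x) = ch x₀ x := by rw [inCharts, hl, id]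
    rw [← h2] at h
    exact contDiffAt_comp_snd h hsm
  refine hg.congr_of_eventuallyEq ?_
  have e1 : ∀ᶠ y in 𝓝 (ch x₁ x), y ∈ (ch x₁).target ∧ (ch x₁).symm y ∈ (ch x₀).source :=
    (eventually_mem_target hy).and ((continuousAt_chart_symm hy).eventually
      ((isOpen_extChartAt_source x₀).mem_nhds (by rw [hl]; exact hx)))
  have e2 : ∀ᶠ q : W × E in 𝓝 (w, ch x₁ x), q.2 ∈ (ch x₁).target ∧
      (ch x₁).symm q.2 ∈ (ch x₀).source :=
    (continuousAt_snd (p := (w, ch x₁ x))).eventually e1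
  filter_upwards [e2] with q hq
  exact chartRep_change hq.1 hq.2 _

theorem isSmoothFamily_iff {V : Set W} (hV : IsOpen V) {θ : W → MForm M} :
    IsSmoothFamily V θ ↔ ∀ w ∈ V, ∀ x, SmAt θ w x := by
  constructor
  · intro h w hw x x₀ hx
    exact (h x₀).contDiffAt ((hV.prod (isOpen_extChartAt_target x₀)).mem_nhds
      ⟨hw, (ch x₀).map_source hx⟩)
  · intro h x₀ q hq
    have := h q.1 hq.1 ((ch x₀).symm q.2) x₀ ((ch x₀).map_target hq.2)
    rw [(ch x₀).right_inv hq.2] at this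
    exact this.contDiffWithinAt

theorem SmAt.isSmooth {θ : W → MForm M} {w : W} (h : ∀ x, SmAt θ w x) : IsSmooth (θ w) := by
  intro x₀ y hy
  have := h ((ch x₀).symm y) x₀ ((ch x₀).map_target hy)
  rw [(ch x₀).right_inv hy] at this
  exact (contDiffAt_slice_right this).contDiffWithinAt

theorem IsSmooth.contDiffAt {θ : MForm M} (h : IsSmooth θ) {x₀ : M} {y : E}
    (hy : y ∈ (ch x₀).target) : ContDiffAt ℝ ∞ (chartRep x₀ θ) y :=
  (h x₀).contDiffAt ((isOpen_extChartAt_target x₀).mem_nhds hy)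

theorem IsSmooth.smAt {θ : MForm M} (h : IsSmooth θ) (w : W) (x : M) : SmAt (fun _ => θ) w x := by
  intro x₀ hx
  exact (h.contDiffAt ((ch x₀).map_source hx)).comp (w, ch x₀ x) contDiffAt_snd

theorem tendsto_param_chart {w : W} {x₀ x : M} (hx : x ∈ (ch x₀).source) :
    Filter.Tendsto (fun q : W × E => (q.1, (ch x₀).symm q.2)) (𝓝 (w, ch x₀ x)) (𝓝 (w, x)) := by
  have h1 : ContinuousAt (fun q : W × E => (q.1, (ch x₀).symm q.2)) (w, ch x₀ x) :=
    continuousAt_fst.prodMk (ContinuousAt.comp (x := (w, ch x₀ x))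
      (continuousAt_chart_symm ((ch x₀).map_source hx)) continuousAt_snd)
  have h2 := h1.tendsto
  rwa [(ch x₀).left_inv hx] at h2

/-- Eventual equality of families of forms. -/
theorem SmAt.congr {θ θ' : W → MForm M} {w : W} {x : M} (h : SmAt θ w x)
    (he : ∀ᶠ q : W × M in 𝓝 (w, x), θ' q.1 q.2 = θ q.1 q.2) : SmAt θ' w x := by
  intro x₀ hx
  refine (h x₀ hx).congr_of_eventuallyEq ?_
  have hy := (ch x₀).map_source hx
  have hc := tendsto_param_chart (W := W) (w := w) hx
  filter_upwards [hc.eventually he] with q hq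
  simp only [chartRep, pullback] at hq ⊢
  rw [hq]

theorem SmAt.param {W' : Type*} [NormedAddCommGroup W'] [NormedSpace ℝ W'] {θ : W → MForm M}
    {w : W'} {x : M} {g : W' → W} (h : SmAt θ (g w) x) (hg : ContDiffAt ℝ ∞ g w) :
    SmAt (fun w' => θ (g w')) w x := by
  intro x₀ hx
  exact ContDiffAt.comp (w, ch x₀ x) (g := fun q : W × E => chartRep x₀ (θ q.1) q.2)
    (f := fun q : W' × E => (g q.1, q.2)) (h x₀ hx)
    ((hg.comp (w, ch x₀ x) contDiffAt_fst).prodMk contDiffAt_snd)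

theorem SmAt.const_smul {θ : W → MForm M} {w : W} {x : M} (c : ℝ) (hθ : SmAt θ w x) :
    SmAt (fun w => c • θ w) w x := by
  intro x₀ hx
  simp only [chartRep_smul, Pi.smul_apply]
  exact (contDiffAt_const (c := c)).smul (hθ x₀ hx)

theorem chartRep_mul (x₀ : M) (θ η : MForm M) :
    chartRep x₀ (θ * η) = chartRep x₀ θ * chartRep x₀ η := by
  funext y; simp [chartRep, pullback]

theorem SmAt.mul {θ η : W → MForm M} {w : W} {x : M} (hθ : SmAt θ w x) (hη : SmAt η w x) :
    SmAt (fun w => θ w * η w) w x := by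
  intro x₀ hx
  simp only [chartRep_mul, Pi.mul_apply]
  exact (lmul.contDiff.contDiffAt.comp _ (hθ x₀ hx)).clm_apply (hη x₀ hx)

theorem chartRep_comp {T : Lam →L[ℝ] Lam} (hT : ∀ A a, T (pb A a) = pb A (T a)) (x₀ : M)
    (θ : MForm M) : chartRep x₀ (fun x => T (θ x)) = fun y => T (chartRep x₀ θ y) := by
  funext y
  simp only [chartRep, pullback, pullAt_eq_pb]
  exact (hT _ _).symm

theorem SmAt.map {θ : W → MForm M} {w : W} {x : M} {T : Lam →L[ℝ] Lam}
    (hT : ∀ A a, T (pb A a) = pb A (T a)) (hθ : SmAt θ w x) :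
    SmAt (fun w x => T (θ w x)) w x := by
  intro x₀ hx
  simp only [chartRep_comp hT]
  exact T.contDiff.contDiffAt.comp _ (hθ x₀ hx)

theorem chartRep_fun_smul (x₀ : M) (f : M → ℝ) (θ : MForm M) (y : E) :
    chartRep x₀ (fun x => f x • θ x) y = f ((ch x₀).symm y) • chartRep x₀ θ y := by
  simp [chartRep, pullback]

theorem SmAt.fun_smul {θ : W → MForm M} {w : W} {x : M} {f : W → M → ℝ}
    (hf : ContMDiffAt (𝓘(ℝ, W).prod (𝓡 6)) 𝓘(ℝ, ℝ) ∞ (fun q : W × M => f q.1 q.2) (w, x))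
    (hθ : SmAt θ w x) : SmAt (fun w x => f w x • θ w x) w x := by
  intro x₀ hx
  simp only [chartRep_fun_smul]
  refine ContDiffAt.smul (f := fun q : W × E => f q.1 ((ch x₀).symm q.2)) ?_ (hθ x₀ hx)
  have hy := (ch x₀).map_source hx
  rw [← contMDiffAt_iff_contDiffAt]
  have h1 : ContMDiffAt 𝓘(ℝ, W × E) (𝓘(ℝ, W).prod (𝓡 6)) ∞
      (fun q : W × E => (q.1, (ch x₀).symm q.2)) (w, ch x₀ x) := by
    apply ContMDiffAt.prodMk
    · exact contDiffAt_fst.contMDiffAt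
    · exact ContMDiffAt.comp (w, ch x₀ x) (contMDiffAt_chart_symm hy) contDiffAt_snd.contMDiffAt
  refine ContMDiffAt.comp (w, ch x₀ x) (g := fun q : W × M => f q.1 q.2) ?_ h1
  rwa [(ch x₀).left_inv hx]

theorem SmAt.smooth_smul {θ : W → MForm M} {w : W} {x : M} {f : M → ℝ}
    (hf : ContMDiff (𝓡 6) 𝓘(ℝ, ℝ) ∞ f) (hθ : SmAt θ w x) : SmAt (fun w x => f x • θ w x) w x :=
  SmAt.fun_smul (f := fun _ => f) ((hf.contMDiffAt (x := x)).comp (w, x) contMDiffAt_snd) hθ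

theorem IsSmooth.smooth_smul {θ : MForm M} {f : M → ℝ}
    (hf : ContMDiff (𝓡 6) 𝓘(ℝ, ℝ) ∞ f) (hθ : IsSmooth θ) : IsSmooth (fun x => f x • θ x) :=
  SmAt.isSmooth (W := ℝ) (w := 0) (θ := fun _ x => f x • θ x)
    fun x => (hθ.smAt 0 x).smooth_smul hf

theorem IsSmooth.mul {θ η : MForm M} (hθ : IsSmooth θ) (hη : IsSmooth η) : IsSmooth (θ * η) :=
  SmAt.isSmooth (W := ℝ) (w := 0) (θ := fun _ => θ * η) fun x => (hθ.smAt 0 x).mul (hη.smAt 0 x)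

theorem IsSmooth.map {θ : MForm M} {T : Lam →L[ℝ] Lam}
    (hT : ∀ A a, T (pb A a) = pb A (T a)) (hθ : IsSmooth θ) : IsSmooth (fun x => T (θ x)) :=
  SmAt.isSmooth (W := ℝ) (w := 0) (θ := fun _ x => T (θ x)) fun x => (hθ.smAt 0 x).map hT

/-! ### The exterior derivative -/

/-- `extD` uses at each point the chart centred there; naturality of `dE` under the transition map
gives the same result in any other chart. The constant one-parameter family in the hypothesis
expresses smoothness near a single point. -/
theorem chartRep_extD {θ : MForm M} {x₀ : M} {y : E} (hy : y ∈ (ch x₀).target)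
    (hθ : SmAt (fun _ : ℝ => θ) 0 ((ch x₀).symm y)) :
    chartRep x₀ (extD θ) y = dE (chartRep x₀ θ) y := by
  set x := (ch x₀).symm y with hx
  have hxs : x ∈ (ch x).source := mem_extChartAt_source x
  have hsm : ContDiffAt ℝ ∞ (inCharts x x₀ id) y :=
    contDiffAt_inCharts hy contMDiffAt_id hxs
  have hθx := contDiffAt_slice_right (hθ x hxs)
  have h1 : dE (chartRep x₀ θ) y = dE (fun y' => pb (fderiv ℝ (inCharts x x₀ id) y')
      (chartRep x θ (inCharts x x₀ id y'))) y := by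
    apply dE_congr
    filter_upwards [eventually_mem_target hy, (continuousAt_chart_symm hy).eventually
      ((isOpen_extChartAt_source x).mem_nhds hxs)] with y' h1 h2
    exact chartRep_change h1 h2 θ
  rw [h1, dE_pullback hsm (hθx.differentiableAt (by simp))]
  rw [chartRep, pullback, ← hx, extD, pullAt_comp hx.symm (mdifferentiableAt_chart hxs)
    (mdifferentiableAt_chart_symm hy), pullAt_model]
  rfl

theorem extD_congr {θ θ' : MForm M} {x : M} (h : θ =ᶠ[𝓝 x] θ') : extD θ x = extD θ' x := by
  have hy := mem_extChartAt_target (I := 𝓡 6) x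
  have : chartRep x θ =ᶠ[𝓝 (ch x x)] chartRep x θ' := by
    have hc := (continuousAt_chart_symm hy)
    rw [ContinuousAt, (ch x).left_inv (mem_extChartAt_source x)] at hc
    filter_upwards [hc.eventually h] with y hy
    simp only [chartRep, pullback, hy]
  rw [extD, extD, dE_congr this]

theorem SmAt.slice {θ : W → MForm M} {w : W} {x : M} (h : SmAt θ w x) (w' : ℝ) :
    SmAt (fun _ : ℝ => θ w) w' x := by
  intro x₀ hx
  exact (contDiffAt_slice_right (h x₀ hx)).comp (w', ch x₀ x) contDiffAt_snd

theorem SmAt.extD {θ : W → MForm M} {w : W} {x : M}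
    (h : ∀ᶠ q : W × M in 𝓝 (w, x), SmAt θ q.1 q.2) : SmAt (fun w => extD (θ w)) w x := by
  intro x₀ hx
  have hy := (ch x₀).map_source hx
  have hl := (ch x₀).left_inv hx
  have hs : SmAt θ w x := h.self_of_nhds
  let wL : (E →L[ℝ] Lam) →L[ℝ] Lam := LinearMap.toContinuousLinearMap wedge
  let G : W × E → Lam := fun q => chartRep x₀ (θ q.1) q.2
  have h1 : ContDiffAt ℝ ∞ (fun q : W × E => wL (fderiv ℝ G q ∘L ContinuousLinearMap.inr ℝ W E))
      (w, ch x₀ x) :=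
    wL.contDiff.contDiffAt.comp _
      (((hs x₀ hx).fderiv_right (m := ∞) (by simp)).clm_comp contDiffAt_const)
  refine h1.congr_of_eventuallyEq ?_
  have hc := tendsto_param_chart (W := W) (w := w) hx
  have e2 : ∀ᶠ q : W × E in 𝓝 (w, ch x₀ x), q.2 ∈ (ch x₀).target :=
    (continuousAt_snd (p := (w, ch x₀ x))).eventually (eventually_mem_target hy)
  filter_upwards [hc.eventually h, e2] with q hq hq2
  have hq' : SmAt θ q.1 ((ch x₀).symm q.2) := hq
  have h3 := hq' x₀ ((ch x₀).map_target hq2)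
  rw [(ch x₀).right_inv hq2] at h3
  rw [chartRep_extD hq2 (hq'.slice 0), dE_eq_wedge]
  have := fderiv_slice_right (f := G) (w := q.1) (x := q.2) (h3.differentiableAt (by simp))
  exact congrArg wedge this

end Charts

end GenCY

namespace GenCY

set_option linter.unusedSectionVars false

/-! ### Parity as an eigenvalue of the grading automorphism. -/

section Parity

theorem inv_wedge (L : E →L[ℝ] Lam) :
    inv (wedge L) = -wedge ((LinearMap.toContinuousLinearMap inv.toLinearMap) ∘L L) := by
  simp [wedge_apply, map_sum]

/-- The grading automorphism as a continuous linear map. -/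
noncomputable def invL : Lam →L[ℝ] Lam := LinearMap.toContinuousLinearMap inv.toLinearMap

@[simp] theorem invL_apply (a : Lam) : invL a = inv a := rfl

theorem invL_pb (A : E →L[ℝ] E) (a : Lam) : invL (pb A a) = pb A (invL a) := inv_pb A a

theorem revL_pb (A : E →L[ℝ] E) (a : Lam) : revL (pb A a) = pb A (revL a) := reverse_pb A a

theorem rev_wedge (L : E →L[ℝ] Lam) :
    CliffordAlgebra.reverse (wedge L) = wedge (invL ∘L revL ∘L L) := by
  simp only [wedge_apply, map_sum, CliffordAlgebra.reverse.map_mul]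
  refine Finset.sum_congr rfl fun i _ => ?_
  rw [ι_mul_comm]
  simp only [ContinuousLinearMap.comp_apply, invL_apply, inv_inv, revL_apply]
  congr 1
  exact CliffordAlgebra.reverse_ι _

/-- The sign of a parity. -/
noncomputable def sgn (p : ZMod 2) : ℝ := if p = 0 then 1 else -1

/-- The even and odd parts are complementary and are the eigenspaces for `1` and `-1`. As a linear
equation the condition passes easily through pull-backs, derivatives and integrals. -/
theorem mem_evenOdd_iff (p : ZMod 2) (a : Lam) :
    a ∈ CliffordAlgebra.evenOdd (0 : QuadraticForm ℝ (Module.Dual ℝ E)) p ↔ inv a = sgn p • a := by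
  have key : ∀ q : ZMod 2, ∀ b ∈ CliffordAlgebra.evenOdd
      (0 : QuadraticForm ℝ (Module.Dual ℝ E)) q, inv b = sgn q • b := by
    intro q b hb
    fin_cases q
    · have := CliffordAlgebra.involute_eq_of_mem_even hb
      change inv b = sgn 0 • b
      rw [show sgn 0 = 1 by simp [sgn], one_smul]
      exact this
    · have := CliffordAlgebra.involute_eq_of_mem_odd hb
      have h1 : sgn 1 = -1 := by simp [sgn]
      simpa [h1] using! this
  refine ⟨key p a, fun h => ?_⟩
  have hc := CliffordAlgebra.evenOdd_isCompl (Q := (0 : QuadraticForm ℝ (Module.Dual ℝ E)))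
  have hmem : a ∈ CliffordAlgebra.evenOdd (0 : QuadraticForm ℝ (Module.Dual ℝ E)) 0 ⊔
      CliffordAlgebra.evenOdd (0 : QuadraticForm ℝ (Module.Dual ℝ E)) 1 := by
    rw [hc.sup_eq_top]; trivial
  obtain ⟨b, hb, c, hc', rfl⟩ := Submodule.mem_sup.1 hmem
  have hib := key 0 b hb
  have hic := key 1 c hc'
  have hs0 : sgn 0 = 1 := by simp [sgn]
  have hs1 : sgn 1 = -1 := by simp [sgn]
  rw [map_add, hib, hic, hs0, hs1] at h
  fin_cases p
  · have h0 : sgn ((fun i => i) ⟨0, by norm_num⟩ : Fin 2) = 1 := hs0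
    rw [h0] at h
    have : (2 : ℝ) • c = 0 := by
      have : c = -c := by simpa using h.symm
      rw [two_smul]; nth_rewrite 1 [this]; exact neg_add_cancel _
    have hc0 : c = 0 := (smul_eq_zero.1 this).resolve_left two_ne_zero
    rw [hc0, add_zero]; exact hb
  · have h0 : sgn ((fun i => i) ⟨1, by norm_num⟩ : Fin 2) = -1 := hs1
    rw [h0] at h
    have : (2 : ℝ) • b = 0 := by
      have : b = -b := by
        simpa [add_comm, neg_add] using h
      rw [two_smul]; nth_rewrite 1 [this]; exact neg_add_cancel _
    have hc0 : b = 0 := (smul_eq_zero.1 this).resolve_left two_ne_zero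
    rw [hc0, zero_add]; exact hc'

theorem sgn_add_one (p : ZMod 2) : sgn (p + 1) = -sgn p := by
  fin_cases p
  · change sgn (0 + 1) = -sgn 0
    simp [sgn]
  · change sgn (1 + 1) = -sgn 1
    simp [sgn, show (1 + 1 : ZMod 2) = 0 from rfl]

theorem sgn_mul_self (p : ZMod 2) : sgn p * sgn p = 1 := by
  unfold sgn; split <;> norm_num

variable {M : Type*}

theorem hasParity_iff {p : ZMod 2} {θ : MForm M} :
    HasParity p θ ↔ ∀ x, inv (θ x) = sgn p • θ x :=
  forall_congr' fun x => mem_evenOdd_iff p (θ x)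

end Parity

/-! ### Pull-back, Leibniz rule and extension by zero on the manifold. -/

section Forms

variable {M : Type*} [TopologicalSpace M] [ChartedSpace E M] [IsManifold (𝓡 6) ∞ M]

/-- The chart at `x₀`. -/
local notation "ch" => extChartAt (𝓡 6) (M := M) (H := E)

variable {W : Type*} [NormedAddCommGroup W] [NormedSpace ℝ W]

theorem ContMDiff.slice {F : W → M → M}
    (hF : ContMDiff (𝓘(ℝ, W).prod (𝓡 6)) (𝓡 6) ∞ (fun q : W × M => F q.1 q.2)) (w : W) :
    ContMDiff (𝓡 6) (𝓡 6) ∞ (F w) :=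
  hF.comp (contMDiff_const.prodMk contMDiff_id)

theorem chartRep_pullback_family {x₀ x₁ : M} {F : W → M → M} {w : W} {y : E}
    (hy : y ∈ (ch x₁).target)
    (hF : ContMDiff (𝓘(ℝ, W).prod (𝓡 6)) (𝓡 6) ∞ (fun q : W × M => F q.1 q.2))
    (hFy : F w ((ch x₁).symm y) ∈ (ch x₀).source) (θ : MForm M) :
    chartRep x₁ (pullback (F w) θ) y =
      pb (dsnd (inChartsFam x₀ x₁ F) (w, y)) (chartRep x₀ θ (inChartsFam x₀ x₁ F (w, y))) := by
  rw [chartRep_pullback hy (GenCY.ContMDiff.slice hF w).contMDiffAt hFy, dsnd, ← fderiv_slice_right]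
  · rfl
  · exact (contDiffAt_inChartsFam hy hF.contMDiffAt hFy).differentiableAt (by simp)

theorem eventually_inChartsFam {x₀ x₁ x : M} {F : W → M → M} {w : W} (hx : x ∈ (ch x₁).source)
    (hF : ContMDiff (𝓘(ℝ, W).prod (𝓡 6)) (𝓡 6) ∞ (fun q : W × M => F q.1 q.2))
    (hFy : F w x ∈ (ch x₀).source) :
    ∀ᶠ q : W × E in 𝓝 (w, ch x₁ x), q.2 ∈ (ch x₁).target ∧
      F q.1 ((ch x₁).symm q.2) ∈ (ch x₀).source := by
  have hc := tendsto_param_chart (W := W) (w := w) hx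
  have h1 : ∀ᶠ q : W × M in 𝓝 (w, x), F q.1 q.2 ∈ (ch x₀).source :=
    hF.continuous.continuousAt.eventually ((isOpen_extChartAt_source x₀).mem_nhds hFy)
  have h2 : ∀ᶠ q : W × E in 𝓝 (w, ch x₁ x), q.2 ∈ (ch x₁).target :=
    (continuousAt_snd (p := (w, ch x₁ x))).eventually
      (eventually_mem_target ((ch x₁).map_source hx))
  exact h2.and (hc.eventually h1)

theorem SmAt.pullback {F : W → M → M} {θ : W → MForm M} {w : W} {x : M}
    (hF : ContMDiff (𝓘(ℝ, W).prod (𝓡 6)) (𝓡 6) ∞ (fun q : W × M => F q.1 q.2))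
    (hθ : SmAt θ w (F w x)) : SmAt (fun w => pullback (F w) (θ w)) w x := by
  intro x₁ hx
  have hy := (ch x₁).map_source hx
  have hl := (ch x₁).left_inv hx
  set x₀ := F w x
  have hx₀ : F w x ∈ (ch x₀).source := mem_extChartAt_source _
  have hFc : ContDiffAt ℝ ∞ (inChartsFam x₀ x₁ F) (w, ch x₁ x) :=
    contDiffAt_inChartsFam hy hF.contMDiffAt (by rw [hl]; exact hx₀)
  have hval : inChartsFam x₀ x₁ F (w, ch x₁ x) = ch x₀ x₀ := by
    simp only [inChartsFam, hl]; rfl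
  have h1 : ContDiffAt ℝ ∞ (fun q : W × E => pb (dsnd (inChartsFam x₀ x₁ F) q)
      (chartRep x₀ (θ q.1) (inChartsFam x₀ x₁ F q))) (w, ch x₁ x) := by
    refine contDiffAt_pb_apply (contDiffAt_dsnd hFc) ?_
    have h2 := hθ x₀ hx₀
    rw [← hval] at h2
    exact ContDiffAt.comp (f := fun q : W × E => (q.1, inChartsFam x₀ x₁ F q)) (w, ch x₁ x) h2
      (contDiffAt_fst.prodMk hFc)
  refine h1.congr_of_eventuallyEq ?_
  filter_upwards [eventually_inChartsFam hx hF hx₀] with q hq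
  exact chartRep_pullback_family (F := F) (w := q.1) hq.1 hF hq.2 _

theorem IsSmooth.pullback {f : M → M} {θ : MForm M} (hf : ContMDiff (𝓡 6) (𝓡 6) ∞ f)
    (hθ : IsSmooth θ) : IsSmooth (pullback f θ) :=
  SmAt.isSmooth (W := ℝ) (w := 0) (θ := fun _ => GenCY.pullback f θ) fun x =>
    SmAt.pullback (F := fun _ : ℝ => f) (hf.comp contMDiff_snd) (hθ.smAt 0 (f x))

theorem extD_pullback {f : M → M} {θ : MForm M} (hf : ContMDiff (𝓡 6) (𝓡 6) ∞ f)
    (hθ : IsSmooth θ) : extD (pullback f θ) = pullback f (extD θ) := by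
  funext x
  have hx := mem_extChartAt_source (I := 𝓡 6) x
  have hy := mem_extChartAt_target (I := 𝓡 6) x
  have hl := (ch x).left_inv hx
  have hfx : f x ∈ (ch (f x)).source := mem_extChartAt_source _
  have hfx' : f ((ch x).symm (ch x x)) ∈ (ch (f x)).source := by rw [hl]; exact hfx
  have ht : inCharts (f x) x f (ch x x) ∈ (ch (f x)).target := (ch (f x)).map_source hfx'
  rw [form_eq_pullAt_chartRep hx (extD _), form_eq_pullAt_chartRep hx (pullback f (extD θ)),
    chartRep_extD hy ((hθ.pullback hf).smAt 0 _), chartRep_pullback hy hf.contMDiffAt hfx',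
    chartRep_extD ht (hθ.smAt 0 _), ← dE_pullback]
  · congr 1
    apply dE_congr
    have := eventually_inChartsFam (F := fun _ : ℝ => f) (w := (0 : ℝ)) hx
      (hf.comp contMDiff_snd) hfx
    have h2 : Filter.Tendsto (fun y : E => ((0 : ℝ), y)) (𝓝 (ch x x)) (𝓝 ((0 : ℝ), ch x x)) :=
      (Continuous.prodMk_right _).tendsto _
    filter_upwards [h2.eventually this] with y hy'
    exact chartRep_pullback hy'.1 hf.contMDiffAt hy'.2 θ
  · exact contDiffAt_inCharts hy hf.contMDiffAt hfx'
  · exact (hθ.contDiffAt ht).differentiableAt (by simp)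

/-- To prove an identity of forms at a point it is enough to prove it in a chart. -/
theorem form_ext_chart {θ η : MForm M} (h : ∀ x₀ : M, ∀ y ∈ (ch x₀).target,
    chartRep x₀ θ y = chartRep x₀ η y) : θ = η := by
  funext x
  have hx := mem_extChartAt_source (I := 𝓡 6) x
  rw [form_eq_pullAt_chartRep hx θ, form_eq_pullAt_chartRep hx η, h x _ ((ch x).map_source hx)]

theorem IsSmooth.chartRep_extD {θ : MForm M} (hθ : IsSmooth θ) {x₀ : M} {y : E}
    (hy : y ∈ (ch x₀).target) : chartRep x₀ (extD θ) y = dE (chartRep x₀ θ) y :=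
  GenCY.chartRep_extD hy (hθ.smAt 0 _)

theorem SmAt.extD_of_open {V : Set W} (hV : IsOpen V) {θ : W → MForm M}
    (h : ∀ w ∈ V, ∀ x, SmAt θ w x) {w : W} (hw : w ∈ V) (x : M) :
    SmAt (fun w => GenCY.extD (θ w)) w x := by
  apply SmAt.extD
  filter_upwards [(continuousAt_fst (p := (w, x))).eventually (hV.mem_nhds hw)] with q hq
  exact h _ hq _

theorem IsSmooth.extD {θ : MForm M} (hθ : IsSmooth θ) : IsSmooth (extD θ) :=
  SmAt.isSmooth (W := ℝ) (w := 0) (θ := fun _ => GenCY.extD θ) fun x =>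
    SmAt.extD_of_open isOpen_univ (θ := fun _ : ℝ => θ) (fun w _ x => hθ.smAt w x) (mem_univ _) x

theorem extD_extD {θ : MForm M} (hθ : IsSmooth θ) : extD (extD θ) = 0 := by
  apply form_ext_chart
  intro x₀ y hy
  rw [hθ.extD.chartRep_extD hy, dE_congr (η' := dE (chartRep x₀ θ)), dE_dE (hθ.contDiffAt hy),
    chartRep_zero]
  · rfl
  · filter_upwards [eventually_mem_target hy] with y' hy'
    exact hθ.chartRep_extD hy'

theorem extD_mul {θ η : MForm M} (hθ : IsSmooth θ) (hη : IsSmooth η) :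
    extD (θ * η) = extD θ * η + (fun x => inv (θ x)) * extD η := by
  apply form_ext_chart
  intro x₀ y hy
  have hi : chartRep x₀ (fun x => inv (θ x)) = fun y => inv (chartRep x₀ θ y) :=
    chartRep_comp (T := invL) invL_pb x₀ θ
  rw [(hθ.mul hη).chartRep_extD hy, chartRep_add, chartRep_mul, chartRep_mul, chartRep_mul, hi]
  simp only [Pi.add_apply, Pi.mul_apply, hθ.chartRep_extD hy, hη.chartRep_extD hy]
  exact dE_mul ((hθ.contDiffAt hy).differentiableAt (by simp))
    ((hη.contDiffAt hy).differentiableAt (by simp))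

theorem extD_inv {θ : MForm M} (hθ : IsSmooth θ) :
    extD (fun x => inv (θ x)) = fun x => -inv (extD θ x) := by
  apply form_ext_chart
  intro x₀ y hy
  have hi : ∀ θ : MForm M, chartRep x₀ (fun x => inv (θ x)) = fun y => inv (chartRep x₀ θ y) :=
    fun θ => chartRep_comp (T := invL) invL_pb x₀ θ
  have hn : chartRep x₀ (fun x => -inv (extD θ x)) = fun y => -inv (chartRep x₀ (extD θ) y) :=
    chartRep_comp (T := -invL) (by intro A a; simp [inv_pb]) x₀ _
  have hs : IsSmooth (fun x => inv (θ x)) := hθ.map (T := invL) invL_pb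
  rw [hs.chartRep_extD hy, hi, hn]
  simp only [hθ.chartRep_extD hy]
  have h1 : fderiv ℝ (fun y => inv (chartRep x₀ θ y)) y = invL ∘L fderiv ℝ (chartRep x₀ θ) y :=
    (invL.hasFDerivAt.comp y ((hθ.contDiffAt hy).differentiableAt (by simp)).hasFDerivAt).fderiv
  rw [dE_eq_wedge, dE_eq_wedge, h1, inv_wedge, neg_neg]
  rfl

/-- Reversal moves the factor `eⁱ` of `eⁱ ∧ ∂ᵢθ` to the right; bringing it back to the left costs
the grading automorphism. This is the sign bookkeeping behind the skew-adjointness of `d`. -/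
theorem reverse_extD {θ : MForm M} (hθ : IsSmooth θ) :
    (fun x => CliffordAlgebra.reverse (extD θ x) : MForm M) =
      extD (fun x => inv (CliffordAlgebra.reverse (θ x))) := by
  apply form_ext_chart
  intro x₀ y hy
  have hr : ∀ θ : MForm M, chartRep x₀ (fun x => CliffordAlgebra.reverse (θ x)) =
      fun y => CliffordAlgebra.reverse (chartRep x₀ θ y) :=
    fun θ => chartRep_comp (T := revL) revL_pb x₀ θ
  have hpb : ∀ A a, (invL ∘L revL) (pb A a) = pb A ((invL ∘L revL) a) := by
    intro A a; simp [reverse_pb, inv_pb]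
  have hn : chartRep x₀ (fun x => inv (CliffordAlgebra.reverse (θ x))) =
      fun y => inv (CliffordAlgebra.reverse (chartRep x₀ θ y)) :=
    chartRep_comp (T := invL ∘L revL) hpb x₀ _
  have hs : IsSmooth (fun x => inv (CliffordAlgebra.reverse (θ x))) :=
    hθ.map (T := invL ∘L revL) hpb
  rw [hs.chartRep_extD hy, hr, hn]
  simp only [hθ.chartRep_extD hy]
  have h1 : fderiv ℝ (fun y => inv (CliffordAlgebra.reverse (chartRep x₀ θ y))) y =
      (invL ∘L revL) ∘L fderiv ℝ (chartRep x₀ θ) y :=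
    ((invL ∘L revL).hasFDerivAt.comp y
      ((hθ.contDiffAt hy).differentiableAt (by simp)).hasFDerivAt).fderiv
  rw [dE_eq_wedge, dE_eq_wedge, h1, rev_wedge]
  rfl

theorem HasParity.extD {p : ZMod 2} {θ : MForm M} (hθ : IsSmooth θ) (h : HasParity p θ) :
    HasParity (p + 1) (extD θ) := by
  rw [hasParity_iff] at h ⊢
  intro x
  have h1 := congrFun (extD_inv hθ) x
  have h2 : (fun x => inv (θ x)) = sgn p • θ := funext h
  rw [h2, extD_smul _ hθ, Pi.smul_apply] at h1
  rw [sgn_add_one, neg_smul, h1, neg_neg]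

theorem exactForms_le_closedForms (p : ZMod 2) : exactForms M p ≤ closedForms M p := by
  rintro _ ⟨τ, h1, h2, rfl⟩
  refine ⟨h1.extD, ?_, extD_extD h1⟩
  have := HasParity.extD h1 h2
  rwa [add_assoc, show (1 + 1 : ZMod 2) = 0 from rfl, add_zero] at this

theorem HasParity.mul {p q : ZMod 2} {θ η : MForm M} (h : HasParity p θ) (h' : HasParity q η) :
    HasParity (p + q) (θ * η) := fun x => SetLike.mul_mem_graded (h x) (h' x)

/-! ### Extension by zero from a chart -/

open Classical in
/-- The form on `M` which is given by `η` in the chart at `x₀` and is zero outside it. -/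
noncomputable def push (x₀ : M) (η : E → Lam) : MForm M := fun x =>
  if x ∈ (ch x₀).source then pullAt (ch x₀) x (η (ch x₀ x)) else 0

theorem push_of_mem {x₀ x : M} (hx : x ∈ (ch x₀).source) (η : E → Lam) :
    push x₀ η x = pullAt (ch x₀) x (η (ch x₀ x)) := if_pos hx

theorem push_of_notMem {x₀ x : M} (hx : x ∉ (ch x₀).source) (η : E → Lam) :
    push x₀ η x = 0 := if_neg hx

theorem chartRep_push {x₀ : M} (η : E → Lam) {y : E} (hy : y ∈ (ch x₀).target) :
    chartRep x₀ (push x₀ η) y = η y := by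
  rw [chartRep, pullback, push_of_mem ((ch x₀).map_target hy), chartRep_pullAt hy,
    (ch x₀).right_inv hy]

variable [T2Space M]

/-- The image of `C` in `M` is compact, hence closed, and misses `x`. The neighbourhood does not
depend on `η`, so the statement can be used for families. -/
theorem push_eventually_zero {x₀ x : M} {C : Set E} (hC : IsCompact C) (hCt : C ⊆ (ch x₀).target)
    (hx : x ∉ (ch x₀).source) :
    ∀ᶠ x' in 𝓝 x, ∀ η : E → Lam, (∀ y ∉ C, η y = 0) → push x₀ η x' = 0 := by
  have hK : IsCompact ((ch x₀).symm '' C) :=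
    hC.image_of_continuousOn ((continuousOn_extChartAt_symm x₀).mono hCt)
  have hxK : x ∉ (ch x₀).symm '' C := by
    rintro ⟨y, hy, rfl⟩
    exact hx ((ch x₀).map_target (hCt hy))
  filter_upwards [hK.isClosed.isOpen_compl.mem_nhds hxK] with x' hx' η hη
  by_cases hs : x' ∈ (ch x₀).source
  · rw [push_of_mem hs, hη, map_zero]
    intro h
    exact hx' ⟨_, h, (ch x₀).left_inv hs⟩
  · exact push_of_notMem hs η

theorem SmAt.push {x₀ : M} {C : Set E} (hC : IsCompact C) (hCt : C ⊆ (ch x₀).target)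
    {η : W → E → Lam} {w : W} (hη : ∀ᶠ w' in 𝓝 w, ∀ y ∉ C, η w' y = 0)
    (hs : ∀ y ∈ (ch x₀).target, ContDiffAt ℝ ∞ (fun q : W × E => η q.1 q.2) (w, y)) (x : M) :
    SmAt (fun w => push x₀ (η w)) w x := by
  by_cases hx : x ∈ (ch x₀).source
  · refine SmAt.of_chart x₀ hx ((hs _ ((ch x₀).map_source hx)).congr_of_eventuallyEq ?_)
    filter_upwards [(continuousAt_snd (p := (w, ch x₀ x))).eventually
      (eventually_mem_target ((ch x₀).map_source hx))] with q hq
    exact chartRep_push _ hq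
  · have h0 : SmAt (fun _ : W => (0 : MForm M)) w x := isSmooth_zero.smAt w x
    refine h0.congr ?_
    filter_upwards [(continuousAt_snd (p := (w, x))).eventually (push_eventually_zero hC hCt hx),
      (continuousAt_fst (p := (w, x))).eventually hη] with q hq hq'
    exact hq _ hq'

theorem isSmooth_push {x₀ : M} {C : Set E} (hC : IsCompact C) (hCt : C ⊆ (ch x₀).target)
    {η : E → Lam} (hη : ∀ y ∉ C, η y = 0)
    (hs : ∀ y ∈ (ch x₀).target, ContDiffAt ℝ ∞ η y) : IsSmooth (push x₀ η) :=
  SmAt.isSmooth (W := ℝ) (w := 0) (θ := fun _ => GenCY.push x₀ η) fun x =>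
    SmAt.push hC hCt (η := fun _ => η) (.of_forall fun _ => hη)
      (fun y hy => (hs y hy).comp _ contDiffAt_snd) x

theorem dE_of_notMem {C : Set E} (hC : IsClosed C) {η : E → Lam} (hη : ∀ y ∉ C, η y = 0) {y : E}
    (hy : y ∉ C) : dE η y = 0 := by
  rw [dE_congr (η' := fun _ => 0), dE_eq_wedge]
  · simp
  · filter_upwards [hC.isOpen_compl.mem_nhds hy] with y' hy'
    exact hη y' hy'

end Forms

end GenCY

namespace GenCY
set_option linter.unusedSectionVars false

/-! ## Integrals depending on parameters -/

section ParamIntegral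

open MeasureTheory

variable {P : Type*} [NormedAddCommGroup P] [NormedSpace ℝ P]
  {G : Type*} [NormedAddCommGroup G] [NormedSpace ℝ G] [MeasurableSpace G] [BorelSpace G]
  {μ : Measure G} {F : Type*} [NormedAddCommGroup F] [NormedSpace ℝ F]
  {V : Set P} {k : Set G} {c : G → ℝ} {g : P → G → F}

theorem hasCompactSupport_of_zero {X F : Type*} [TopologicalSpace X] [T2Space X] [Zero F] {k : Set X}
    {g : X → F} (hk : IsCompact k) (h : ∀ t ∉ k, g t = 0) : HasCompactSupport g :=
  HasCompactSupport.intro hk (fun x hx => h x hx)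

theorem integrable_smul_of_zero (hc : LocallyIntegrable c μ) (hk : IsCompact k) {g : G → F}
    (hg : Continuous g) (h : ∀ t ∉ k, g t = 0) : Integrable (fun t => c t • g t) μ :=
  hc.integrable_smul_right_of_hasCompactSupport hg (hasCompactSupport_of_zero hk h)

theorem param_aux (hg : ContDiffOn ℝ ∞ (fun q : P × G => g q.1 q.2) (V ×ˢ univ)) :
    ContDiffOn ℝ ∞ (Function.uncurry fun (p : P) (t : G) => g p (-t)) (V ×ˢ univ) := by
  have h1 : ContDiff ℝ ∞ (fun q : P × G => (q.1, -q.2)) := contDiff_fst.prodMk contDiff_snd.neg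
  exact hg.comp h1.contDiffOn (fun q hq => ⟨hq.1, mem_univ _⟩)

/-- The integral is the convolution of `c` with the reflection of `g p`, evaluated at `0`. So it
inherits the smoothness of convolutions depending on a parameter. -/
theorem contDiffOn_param_integral (hV : IsOpen V) (hk : IsCompact k) (hc : LocallyIntegrable c μ)
    (hgs : ∀ p ∈ V, ∀ t ∉ k, g p t = 0)
    (hg : ContDiffOn ℝ ∞ (fun q : P × G => g q.1 q.2) (V ×ˢ univ)) :
    ContDiffOn ℝ ∞ (fun p => ∫ t, c t • g p t ∂μ) V := by
  have hk' : IsCompact (-k) := hk.neg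
  have h := contDiffOn_convolution_right_with_param_comp (μ := μ) (n := ⊤)
    (ContinuousLinearMap.lsmul ℝ ℝ : ℝ →L[ℝ] F →L[ℝ] F) (v := fun _ => (0 : G))
    contDiffOn_const (f := c) (g := fun p t => g p (-t)) hV hk'
    (fun p t hp ht => hgs p hp _ (by simpa using ht)) hc (param_aux hg)
  simpa only [convolution_def, ContinuousLinearMap.lsmul_apply, zero_sub, neg_neg] using h

theorem hasFDerivAt_param_integral [CompleteSpace F] (hV : IsOpen V) (hk : IsCompact k)
    (hc : LocallyIntegrable c μ) (hgs : ∀ p ∈ V, ∀ t ∉ k, g p t = 0)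
    (hg : ContDiffOn ℝ ∞ (fun q : P × G => g q.1 q.2) (V ×ˢ univ)) {p : P} (hp : p ∈ V) :
    HasFDerivAt (fun p => ∫ t, c t • g p t ∂μ) (∫ t, c t • fderiv ℝ (fun p => g p t) p ∂μ) p := by
  have hk' : IsCompact (-k) := hk.neg
  set g' : P → G → F := fun p t => g p (-t) with hg'
  have h := hasFDerivAt_convolution_right_with_param (μ := μ) (𝕜 := ℝ)
    (ContinuousLinearMap.lsmul ℝ ℝ : ℝ →L[ℝ] F →L[ℝ] F) (f := c) (g := g') hV hk'
    (fun p t hp ht => hgs p hp _ (by simpa using ht)) hc ((param_aux hg).of_le (by simp)) (p, 0) hp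
  have h2 := HasFDerivAt.comp (f := fun p : P => (p, (0 : G))) p h
    ((hasFDerivAt_id p).prodMk (hasFDerivAt_const (0 : G) p))
  have hat : ∀ t, ContDiffAt ℝ ∞ (fun q : P × G => g q.1 q.2) (p, t) := fun t =>
    hg.contDiffAt ((hV.prod isOpen_univ).mem_nhds ⟨hp, mem_univ _⟩)
  have hat' : ∀ t, ContDiffAt ℝ ∞ (Function.uncurry g') (p, t) := fun t =>
    (param_aux hg).contDiffAt ((hV.prod isOpen_univ).mem_nhds ⟨hp, mem_univ _⟩)
  have hD : ∀ t, (fderiv ℝ (Function.uncurry g') (p, -t)) ∘L (ContinuousLinearMap.inl ℝ P G) =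
      fderiv ℝ (fun p => g p t) p := by
    intro t
    have h1 : HasFDerivAt (fun p : P => (p, -t)) (ContinuousLinearMap.inl ℝ P G) p :=
      hasFDerivAt_prodMk_left p (-t)
    have h2 := (((hat' (-t)).differentiableAt (by simp)).hasFDerivAt.comp p h1).fderiv
    rw [← h2]
    congr 1
    funext p
    simp [hg', Function.comp, Function.uncurry]
  convert h2 using 1
  · funext p
    simp only [Function.comp, convolution_def, ContinuousLinearMap.lsmul_apply, zero_sub, hg', neg_neg]
  · have e1 : (ContinuousLinearMap.id ℝ P).prod (0 : P →L[ℝ] G) = ContinuousLinearMap.inl ℝ P G := rfl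
    rw [e1, convolution_def]
    simp only [zero_sub]
    have hcont : Continuous fun t => fderiv ℝ (Function.uncurry g') (p, -t) := by
      rw [continuous_iff_continuousAt]
      intro t
      exact ContinuousAt.comp (f := fun t : G => (p, -t))
        ((hat' (-t)).fderiv_right (m := ∞) (by simp)).continuousAt (by fun_prop)
    have hz : ∀ t ∉ k, fderiv ℝ (Function.uncurry g') (p, -t) = 0 := by
      intro t ht
      refine (hasFDerivAt_zero_of_eventually_const 0 ?_).fderiv
      have m1 : ∀ᶠ q : P × G in 𝓝 (p, -t), q.1 ∈ V ∧ -q.2 ∉ k := by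
        refine ((continuousAt_fst (p := (p, -t))).eventually (hV.mem_nhds hp)).and
          ((continuous_snd.neg.continuousAt (x := (p, -t))).eventually
            (hk.isClosed.isOpen_compl.mem_nhds ?_))
        simpa using ht
      filter_upwards [m1] with q hq
      exact hgs _ hq.1 _ hq.2
    have hint := integrable_smul_of_zero hc hk hcont hz
    have hcomm := ((ContinuousLinearMap.compL ℝ P (P × G) F).flip
      (ContinuousLinearMap.inl ℝ P G)).integral_comp_comm hint
    simp only [ContinuousLinearMap.flip_apply, ContinuousLinearMap.compL_apply,
      ContinuousLinearMap.smul_comp, hD] at hcomm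
    rw [hcomm]
    rfl

end ParamIntegral

section IntegralForms

open MeasureTheory

variable {M : Type*} [TopologicalSpace M] [ChartedSpace E M] [IsManifold (𝓡 6) ∞ M]

/-- The chart at `x₀`. -/
local notation "ch" => extChartAt (𝓡 6) (M := M) (H := E)

variable {W : Type*} [NormedAddCommGroup W] [NormedSpace ℝ W]
  {G : Type*} [NormedAddCommGroup G] [NormedSpace ℝ G] [MeasurableSpace G] [BorelSpace G]
  {μ : Measure G} {V : Set W} {k : Set G} {c : G → ℝ}

/-- The integral of a family of forms, as a form. -/
noncomputable def formInt (μ : Measure G) (c : G → ℝ) (θ : G → MForm M) : MForm M :=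
  fun x => ∫ s, c s • θ s x ∂μ

/-- Smooth dependence of a form on a parameter. -/
def Fam (V : Set W) (θ : W → MForm M) : Prop := ∀ w ∈ V, ∀ x, SmAt θ w x

theorem Fam.contDiffOn {θ : W → MForm M} (h : Fam V θ) (x₀ : M) :
    ContDiffOn ℝ ∞ (fun q : W × E => chartRep x₀ (θ q.1) q.2) (V ×ˢ (ch x₀).target) := by
  intro q hq
  have := h q.1 hq.1 ((ch x₀).symm q.2) x₀ ((ch x₀).map_target hq.2)
  rw [(ch x₀).right_inv hq.2] at this
  exact this.contDiffWithinAt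

theorem Fam.isSmooth {θ : W → MForm M} (h : Fam V θ) {w : W} (hw : w ∈ V) : IsSmooth (θ w) :=
  SmAt.isSmooth (h w hw)

theorem Fam.chartRep_slice {θ : W → MForm M} (h : Fam V θ) {w : W} (hw : w ∈ V) {x₀ : M} {y : E}
    (hy : y ∈ (ch x₀).target) : ContDiffAt ℝ ∞ (fun w => chartRep x₀ (θ w) y) w := by
  have := h w hw ((ch x₀).symm y) x₀ ((ch x₀).map_target hy)
  rw [(ch x₀).right_inv hy] at this
  exact contDiffAt_slice_left this

theorem Fam.contDiffAt_apply {θ : W → MForm M} (h : Fam V θ) {w : W} (hw : w ∈ V) (x : M) :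
    ContDiffAt ℝ ∞ (fun w => θ w x) w := by
  have hx := mem_extChartAt_source (I := 𝓡 6) x
  have h1 := (pbL (mfderiv (𝓡 6) (𝓡 6) (ch x) x)).contDiff.contDiffAt.comp w
    (h.chartRep_slice hw ((ch x).map_source hx))
  convert h1 using 1
  funext w'
  exact form_eq_pullAt_chartRep hx (θ w')

theorem Fam.continuous_apply {θ : W → MForm M} (h : Fam univ θ) (x : M) :
    Continuous fun w => θ w x :=
  continuous_iff_continuousAt.2 fun _ => (h.contDiffAt_apply (mem_univ _) x).continuousAt

/-- The two-parameter version used for integrals. -/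
theorem chartRep_formInt (hc : LocallyIntegrable c μ) (hk : IsCompact k) {θ : G → MForm M}
    (h : Fam univ θ) (hz : ∀ s ∉ k, θ s = 0) (x₀ : M) (y : E) :
    chartRep x₀ (formInt μ c θ) y = ∫ s, c s • chartRep x₀ (θ s) y ∂μ := by
  have hint := integrable_smul_of_zero hc hk (h.continuous_apply ((ch x₀).symm y))
    (fun s hs => by rw [hz s hs]; rfl)
  have := (pbL (mfderiv (𝓡 6) (𝓡 6) (ch x₀).symm y)).integral_comp_comm hint
  rw [chartRep, pullback, pullAt_eq_pb]
  refine this.symm.trans ?_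
  simp only [map_smul]
  rfl

theorem Fam.swap {θ : W → G → MForm M} (h : Fam (V ×ˢ univ) (fun q : W × G => θ q.1 q.2)) (x₀ : M) :
    ContDiffOn ℝ ∞ (fun q : (W × E) × G => chartRep x₀ (θ q.1.1 q.2) q.1.2)
      ((V ×ˢ (ch x₀).target) ×ˢ univ) := by
  have h1 : ContDiff ℝ ∞ (fun q : (W × E) × G => (((q.1.1, q.2), q.1.2) : (W × G) × E)) :=
    ((contDiff_fst.comp contDiff_fst).prodMk contDiff_snd).prodMk (contDiff_snd.comp contDiff_fst)
  exact ContDiffOn.comp (g := fun q : (W × G) × E => chartRep x₀ (θ q.1.1 q.1.2) q.2)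
    (f := fun q : (W × E) × G => (((q.1.1, q.2), q.1.2) : (W × G) × E))
    (t := (V ×ˢ univ) ×ˢ (ch x₀).target) (h.contDiffOn x₀) h1.contDiffOn
    (fun q hq => ⟨⟨hq.1.1, mem_univ _⟩, hq.1.2⟩)

theorem Fam.left {θ : W → G → MForm M} (h : Fam (V ×ˢ univ) (fun q : W × G => θ q.1 q.2)) {w : W}
    (hw : w ∈ V) : Fam univ (θ w) := fun s _ x =>
  SmAt.param (θ := fun q : W × G => θ q.1 q.2) (g := fun s : G => (w, s))
    (h (w, s) ⟨hw, mem_univ _⟩ x) (contDiffAt_const.prodMk contDiffAt_id)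

theorem Fam.formInt (hV : IsOpen V) (hc : LocallyIntegrable c μ) (hk : IsCompact k)
    {θ : W → G → MForm M} (h : Fam (V ×ˢ univ) (fun q : W × G => θ q.1 q.2))
    (hz : ∀ w ∈ V, ∀ s ∉ k, θ w s = 0) : Fam V (fun w => GenCY.formInt μ c (θ w)) := by
  intro w hw x x₀ hx
  have ho : IsOpen (V ×ˢ (ch x₀).target) := hV.prod (isOpen_extChartAt_target x₀)
  have h1 := contDiffOn_param_integral (g := fun (p : W × E) s => chartRep x₀ (θ p.1 s) p.2)
    ho hk hc (fun p hp s hs => by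
      simp only [hz p.1 hp.1 s hs, chartRep_zero]; rfl) (h.swap x₀)
  refine ((h1.contDiffAt (ho.mem_nhds ⟨hw, (ch x₀).map_source hx⟩))).congr_of_eventuallyEq ?_
  filter_upwards [ho.mem_nhds (show (w, ch x₀ x) ∈ _ from ⟨hw, (ch x₀).map_source hx⟩)] with q hq
  exact chartRep_formInt hc hk (h.left hq.1) (hz _ hq.1) x₀ q.2

theorem isSmooth_formInt (hc : LocallyIntegrable c μ) (hk : IsCompact k) {θ : G → MForm M}
    (h : Fam univ θ) (hz : ∀ s ∉ k, θ s = 0) : IsSmooth (formInt μ c θ) :=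
  Fam.isSmooth (V := (univ : Set ℝ)) (w := 0) (θ := fun _ => GenCY.formInt μ c θ)
    (Fam.formInt isOpen_univ hc hk (θ := fun _ => θ)
      (fun q _ x => SmAt.param (g := fun q : ℝ × G => q.2) (h q.2 (mem_univ _) x) contDiffAt_snd)
      fun _ _ => hz) (mem_univ _)

/-- Differentiate under the integral sign in a chart; the antisymmetrization is a continuous linear
map and commutes with the integral. -/
theorem extD_formInt (hc : LocallyIntegrable c μ) (hk : IsCompact k) {θ : G → MForm M}
    (h : Fam univ θ) (hz : ∀ s ∉ k, θ s = 0) :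
    extD (formInt μ c θ) = formInt μ c (fun s => extD (θ s)) := by
  have h' : Fam univ (fun s => extD (θ s)) := fun s hs x =>
    SmAt.extD_of_open isOpen_univ h hs x
  have hz' : ∀ s ∉ k, extD (θ s) = 0 := fun s hs => by rw [hz s hs, extD_zero]
  apply form_ext_chart
  intro x₀ y hy
  rw [(isSmooth_formInt hc hk h hz).chartRep_extD hy, chartRep_formInt hc hk h' hz']
  have e1 : chartRep x₀ (formInt μ c θ) = fun y => ∫ s, c s • chartRep x₀ (θ s) y ∂μ :=
    funext fun y => chartRep_formInt hc hk h hz x₀ y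
  have hsm : ContDiffOn ℝ ∞ (fun q : E × G => chartRep x₀ (θ q.2) q.1)
      ((ch x₀).target ×ˢ univ) := by
    have h1 : ContDiff ℝ ∞ (fun q : E × G => (q.2, q.1)) := contDiff_snd.prodMk contDiff_fst
    exact ContDiffOn.comp (g := fun q : G × E => chartRep x₀ (θ q.1) q.2)
      (f := fun q : E × G => (q.2, q.1)) (t := univ ×ˢ (ch x₀).target)
      (h.contDiffOn x₀) h1.contDiffOn (fun q hq => ⟨mem_univ _, hq.1⟩)
  have hgs : ∀ y ∈ (ch x₀).target, ∀ s ∉ k, chartRep x₀ (θ s) y = 0 := fun y _ s hs => by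
    rw [hz s hs, chartRep_zero]; rfl
  have h2 := hasFDerivAt_param_integral (g := fun (y : E) s => chartRep x₀ (θ s) y)
    (isOpen_extChartAt_target x₀) hk hc hgs hsm hy
  rw [e1, dE_eq_wedge, h2.fderiv]
  let wL : (E →L[ℝ] Lam) →L[ℝ] Lam := LinearMap.toContinuousLinearMap wedge
  have hcont : Continuous fun s => fderiv ℝ (fun y => chartRep x₀ (θ s) y) y := by
    rw [continuous_iff_continuousAt]
    intro s
    have h3 : ∀ s, ContDiffAt ℝ ∞ (fun q : G × E => chartRep x₀ (θ q.1) q.2) (s, y) := fun s =>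
      (h.contDiffOn x₀).contDiffAt ((isOpen_univ.prod (isOpen_extChartAt_target x₀)).mem_nhds
        ⟨mem_univ _, hy⟩)
    have h4 : ContinuousAt (fun s => fderiv ℝ (fun q : G × E => chartRep x₀ (θ q.1) q.2) (s, y) ∘L
        ContinuousLinearMap.inr ℝ G E) s :=
      (ContinuousAt.comp (f := fun s : G => (s, y)) ((h3 s).fderiv_right (m := ∞)
        (by simp)).continuousAt (by fun_prop)).clm_comp continuousAt_const
    refine h4.congr (.of_forall fun s => ?_)
    exact (fderiv_slice_right ((h3 s).differentiableAt (by simp))).symm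
  have hint := integrable_smul_of_zero hc hk hcont (fun s hs => by
    have : (fun y => chartRep x₀ (θ s) y) = fun _ => 0 := by
      funext y; rw [hz s hs, chartRep_zero]; rfl
    rw [this]; simp)
  have hcomm := wL.integral_comp_comm hint
  refine hcomm.symm.trans ?_
  congr 1
  funext s
  rw [map_smul, (h.isSmooth (mem_univ s)).chartRep_extD hy]
  rfl

end IntegralForms

end GenCY

namespace GenCY
set_option linter.unusedSectionVars false

/-! ## Integration over an oriented manifold -/

/-- An alternating map of degree 6 on a 6-dimensional space is determined by its value on a basis.
-/
theorem exteriorPower_six_eq {a : Lam} (ha : a ∈ ⋀[ℝ]^6 (Module.Dual ℝ E)) :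
    a = topCoeff a • ExteriorAlgebra.ιMulti ℝ 6 dualBasis := by
  rw [← ExteriorAlgebra.ιMulti_span_fixedDegree] at ha
  have key : ExteriorAlgebra.ιMulti ℝ (M := Module.Dual ℝ E) 6 =
      ((LinearMap.id : ℝ →ₗ[ℝ] ℝ).smulRight (ExteriorAlgebra.ιMulti ℝ 6 dualBasis)).compAlternatingMap
        dualBasis.det := by
    refine Module.Basis.ext_alternating dualBasis fun v hv => ?_
    let σ := Equiv.ofBijective v (Finite.injective_iff_bijective.1 hv)
    have e1 : (fun i => dualBasis (v i)) = fun i => dualBasis (σ i) := rfl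
    have e2 : dualBasis.det (fun i => dualBasis (σ i)) = Equiv.Perm.sign σ • (1 : ℝ) := by
      rw [← Module.Basis.det_self dualBasis]; exact AlternatingMap.map_perm _ _ _
    rw [e1, LinearMap.compAlternatingMap_apply, e2, LinearMap.smulRight_apply, LinearMap.id_apply,
      smul_assoc, one_smul]
    exact AlternatingMap.map_perm _ _ _
  induction ha using Submodule.span_induction with
  | mem x hx =>
    obtain ⟨v, rfl⟩ := hx
    rw [topCoeff_ιMulti_six]
    exact congrArg (fun f => f v) key
  | zero => simp
  | add x y _ _ hx hy => rw [map_add, add_smul, ← hx, ← hy]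
  | smul c x _ hx => rw [map_smul, smul_eq_mul, mul_smul, ← hx]

theorem topCoeff_ne_zero {a : Lam} (ha : a ∈ ⋀[ℝ]^6 (Module.Dual ℝ E)) (h0 : a ≠ 0) :
    topCoeff a ≠ 0 := fun h => h0 (by rw [exteriorPower_six_eq ha, h, zero_smul])

theorem exists_topCoeff_eq_one : ∃ a : Lam, topCoeff a = 1 :=
  ⟨ExteriorAlgebra.ιMulti ℝ 6 dualBasis, by rw [topCoeff_ιMulti_six, Module.Basis.det_self]⟩

section Integral

open MeasureTheory

variable {M : Type*} [TopologicalSpace M] [ChartedSpace E M] [IsManifold (𝓡 6) ∞ M]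

/-- The chart at `x₀`. -/
local notation "ch" => extChartAt (𝓡 6) (M := M) (H := E)

variable {W : Type*} [NormedAddCommGroup W] [NormedSpace ℝ W] {V : Set W} {ν : MForm M}

/-- The orientation sign of the chart at `x₀`. -/
noncomputable def eps (ν : MForm M) (x₀ : M) (y : E) : ℝ :=
  (SignType.sign (topCoeff (chartRep x₀ ν y)) : ℝ)

theorem topCoeff_chartRep (x₀ : M) (θ : MForm M) (y : E) : topCoeff (chartRep x₀ θ y) =
    (mfderiv (𝓡 6) (𝓡 6) (ch x₀).symm y : E →L[ℝ] E).det * topCoeff (θ ((ch x₀).symm y)) :=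
  topCoeff_pb _ _

theorem topCoeff_volume_ne_zero (hν : IsVolumeForm ν) {x₀ : M} {y : E} (hy : y ∈ (ch x₀).target) :
    topCoeff (chartRep x₀ ν y) ≠ 0 := by
  rw [topCoeff_chartRep]
  refine mul_ne_zero ?_ (topCoeff_ne_zero (hν.2 _).1 (hν.2 _).2)
  obtain ⟨a, ha⟩ := exists_topCoeff_eq_one
  have h := congrArg topCoeff (chartRep_pullAt hy a)
  rw [ha] at h
  exact left_ne_zero_of_mul_eq_one ((topCoeff_pb _ _).symm.trans h)

/-- The coefficient of `ν` in a chart is continuous and never zero, so its sign is locally constant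
and behaves as a constant under differentiation. -/
theorem eps_eventually (hν : IsVolumeForm ν) {x₀ : M} {y : E} (hy : y ∈ (ch x₀).target) :
    ∀ᶠ y' in 𝓝 y, eps ν x₀ y' = eps ν x₀ y := by
  have hc : ContinuousAt (fun y => topCoeff (chartRep x₀ ν y)) y :=
    topL.continuous.continuousAt.comp (hν.1.contDiffAt hy).continuousAt
  rcases lt_or_gt_of_ne (topCoeff_volume_ne_zero hν hy) with h | h
  · filter_upwards [hc.eventually (gt_mem_nhds h)] with y' hy'
    rw [eps, eps, sign_neg h, sign_neg hy']
  · filter_upwards [hc.eventually (lt_mem_nhds h)] with y' hy'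
    rw [eps, eps, sign_pos h, sign_pos hy']

theorem eps_sq (hν : IsVolumeForm ν) {x₀ : M} {y : E} (hy : y ∈ (ch x₀).target) :
    eps ν x₀ y * eps ν x₀ y = 1 := by
  rcases lt_or_gt_of_ne (topCoeff_volume_ne_zero hν hy) with h | h
  · rw [eps, sign_neg h]; simp
  · rw [eps, sign_pos h]; simp

/-- The oriented expression of a form in a chart, extended by zero. -/
noncomputable def loc (ν : MForm M) (x₀ : M) (θ : MForm M) : E → Lam :=
  (ch x₀).target.indicator fun y => eps ν x₀ y • chartRep x₀ θ y

theorem loc_of_mem {x₀ : M} {y : E} (hy : y ∈ (ch x₀).target) (θ : MForm M) :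
    loc ν x₀ θ y = eps ν x₀ y • chartRep x₀ θ y := indicator_of_mem hy _

theorem loc_of_notMem {x₀ : M} {y : E} (hy : y ∉ (ch x₀).target) (θ : MForm M) :
    loc ν x₀ θ y = 0 := indicator_of_notMem hy _

theorem loc_add (x₀ : M) (θ η : MForm M) : loc ν x₀ (θ + η) = loc ν x₀ θ + loc ν x₀ η := by
  rw [loc, chartRep_add, loc, loc, ← indicator_add']
  congr 1
  funext y
  exact smul_add _ _ _

theorem loc_smul (x₀ : M) (c : ℝ) (θ : MForm M) : loc ν x₀ (c • θ) = c • loc ν x₀ θ := by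
  funext y
  by_cases hy : y ∈ (ch x₀).target
  · rw [loc_of_mem hy, chartRep_smul, Pi.smul_apply, Pi.smul_apply, loc_of_mem hy, smul_comm]
  · rw [loc_of_notMem hy, Pi.smul_apply, loc_of_notMem hy, smul_zero]

/-- The integral in a chart. -/
noncomputable def intChart (ν : MForm M) (x₀ : M) (θ : MForm M) : ℝ := ∫ y, topCoeff (loc ν x₀ θ y)

theorem loc_eq_zero {x₀ : M} {K : Set M} {θ : MForm M} (hθ : ∀ x ∉ K, θ x = 0) {y : E}
    (hy : y ∉ ch x₀ '' (K ∩ (ch x₀).source)) : loc ν x₀ θ y = 0 := by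
  by_cases h : y ∈ (ch x₀).target
  · rw [loc_of_mem h, chartRep, pullback, hθ, map_zero, smul_zero]
    intro hk
    exact hy ⟨_, ⟨hk, (ch x₀).map_target h⟩, (ch x₀).right_inv h⟩
  · exact loc_of_notMem h θ

theorem isCompact_chart_image {x₀ : M} {K : Set M} (hK : IsCompact K) (hKs : K ⊆ (ch x₀).source) :
    IsCompact (ch x₀ '' (K ∩ (ch x₀).source)) := by
  rw [inter_eq_left.2 hKs]
  exact hK.image_of_continuousOn ((continuousOn_extChartAt x₀).mono hKs)

/-- Compactness of `K` inside the chart domain keeps the support away from the boundary of the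
chart, so the extension by zero stays smooth. -/
theorem contDiffOn_loc (hν : IsVolumeForm ν) {x₀ : M} {K : Set M} (hK : IsCompact K)
    (hKs : K ⊆ (ch x₀).source) (hV : IsOpen V) {θ : W → MForm M} (hθ : Fam V θ)
    (hz : ∀ w ∈ V, ∀ x ∉ K, θ w x = 0) :
    ContDiffOn ℝ ∞ (fun q : W × E => loc ν x₀ (θ q.1) q.2) (V ×ˢ univ) := by
  intro q hq
  apply ContDiffAt.contDiffWithinAt
  by_cases hy : q.2 ∈ (ch x₀).target
  · have h1 := (hθ.contDiffOn x₀).contDiffAt ((hV.prod (isOpen_extChartAt_target x₀)).mem_nhds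
      ⟨hq.1, hy⟩)
    have h2 : ContDiffAt ℝ ∞ (fun q' : W × E => eps ν x₀ q.2 • chartRep x₀ (θ q'.1) q'.2) q :=
      ContDiffAt.smul (f := fun _ => eps ν x₀ q.2) contDiffAt_const h1
    refine h2.congr_of_eventuallyEq ?_
    filter_upwards [(continuousAt_snd (p := q)).eventually
      ((eventually_mem_target hy).and (eps_eventually hν hy))] with q' hq'
    rw [loc_of_mem hq'.1, hq'.2]
  · have hC := isCompact_chart_image hK hKs
    have h0 : ContDiffAt ℝ ∞ (fun _ : W × E => (0 : Lam)) q := contDiffAt_const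
    refine h0.congr_of_eventuallyEq ?_
    have hq2 : q.2 ∉ ch x₀ '' (K ∩ (ch x₀).source) := by
      rintro ⟨x, hx, hxy⟩
      exact hy (hxy ▸ (ch x₀).map_source hx.2)
    filter_upwards [(continuousAt_fst (p := q)).eventually (hV.mem_nhds hq.1),
      (continuousAt_snd (p := q)).eventually (hC.isClosed.isOpen_compl.mem_nhds hq2)] with q' h1 h2
    exact loc_eq_zero (hz _ h1) h2

theorem IsSmooth.fam {θ : MForm M} (h : IsSmooth θ) (V : Set W) : Fam V (fun _ => θ) :=
  fun w _ x => h.smAt w x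

theorem contDiff_loc (hν : IsVolumeForm ν) {x₀ : M} {K : Set M} (hK : IsCompact K)
    (hKs : K ⊆ (ch x₀).source) {θ : MForm M} (hθ : IsSmooth θ)
    (hz : ∀ x ∉ K, θ x = 0) : ContDiff ℝ ∞ (loc ν x₀ θ) := by
  have := contDiffOn_loc hν hK hKs isOpen_univ (hθ.fam (univ : Set ℝ)) (fun _ _ => hz)
  rw [univ_prod_univ, contDiffOn_univ] at this
  exact this.comp (contDiff_const (c := (0 : ℝ)) |>.prodMk contDiff_id)

theorem integrable_loc (hν : IsVolumeForm ν) {x₀ : M} {K : Set M} (hK : IsCompact K)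
    (hKs : K ⊆ (ch x₀).source) {θ : MForm M} (hθ : IsSmooth θ)
    (hz : ∀ x ∉ K, θ x = 0) : Integrable (fun y => topCoeff (loc ν x₀ θ y)) :=
  Continuous.integrable_of_hasCompactSupport
    (topL.continuous.comp (contDiff_loc hν hK hKs hθ hz).continuous)
    (hasCompactSupport_of_zero (isCompact_chart_image hK hKs)
      (fun y hy => by rw [loc_eq_zero hz hy, map_zero]))

theorem intChart_smul (x₀ : M) (c : ℝ) (θ : MForm M) :
    intChart ν x₀ (c • θ) = c * intChart ν x₀ θ := by
  simp only [intChart, loc_smul, Pi.smul_apply, map_smul, smul_eq_mul, integral_const_mul]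

theorem intChart_add (hν : IsVolumeForm ν) {x₀ : M} {K : Set M} (hK : IsCompact K)
    (hKs : K ⊆ (ch x₀).source) {θ η : MForm M} (hθ : IsSmooth θ) (hη : IsSmooth η)
    (hz : ∀ x ∉ K, θ x = 0) (hz' : ∀ x ∉ K, η x = 0) :
    intChart ν x₀ (θ + η) = intChart ν x₀ θ + intChart ν x₀ η := by
  simp only [intChart, loc_add, Pi.add_apply, map_add]
  exact integral_add (integrable_loc hν hK hKs hθ hz) (integrable_loc hν hK hKs hη hz')

theorem intChart_congr {x₀ : M} {θ η : MForm M} (h : ∀ x, topCoeff (θ x) = topCoeff (η x)) :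
    intChart ν x₀ θ = intChart ν x₀ η := by
  rw [intChart, intChart]
  congr 1
  funext y
  by_cases hy : y ∈ (ch x₀).target
  · rw [loc_of_mem hy, loc_of_mem hy, map_smul, map_smul, topCoeff_chartRep, topCoeff_chartRep, h]
  · rw [loc_of_notMem hy, loc_of_notMem hy]

/-- A change of chart multiplies the coefficients of `ν` and of the integrand by the same Jacobian
determinant `a`. The sign of the first and the value of the second combine to `|a|`, the factor in
the change-of-variables formula. -/
theorem sign_mul_abs_mul (a b c : ℝ) : (SignType.sign (a * b) : ℝ) * (a * c) =
    |a| * ((SignType.sign b : ℝ) * c) := by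
  rw [sign_mul, SignType.coe_mul, ← sign_mul_self a]
  ring

/-- The integrand vanishes off the overlap of the two charts in either picture. On the overlap this
is the change-of-variables formula for the transition map, with the orientation sign supplying the
absolute value of the Jacobian. -/
theorem intChart_change {x₀ x₁ : M} {θ : MForm M} (h0 : ∀ x ∉ (ch x₀).source, θ x = 0)
    (h1 : ∀ x ∉ (ch x₁).source, θ x = 0) : intChart ν x₀ θ = intChart ν x₁ θ := by
  let A : M → M → Set E := fun i j => (ch i).target ∩ (ch i).symm ⁻¹' (ch j).source
  have hA : ∀ i j, IsOpen (A i j) := fun i j =>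
    (continuousOn_extChartAt_symm i).isOpen_inter_preimage (isOpen_extChartAt_target i)
      (isOpen_extChartAt_source j)
  have hset : ∀ i j, (∀ x ∉ (ch j).source, θ x = 0) →
      intChart ν i θ = ∫ y in A i j, topCoeff (loc ν i θ y) := by
    intro i j hj
    rw [intChart, ← integral_indicator (hA i j).measurableSet]
    congr 1
    funext y
    by_cases hy : y ∈ A i j
    · rw [indicator_of_mem hy]
    · rw [indicator_of_notMem hy]
      by_cases hy' : y ∈ (ch i).target
      · rw [loc_of_mem hy', chartRep, pullback, hj, map_zero, smul_zero, map_zero]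
        exact fun h => hy ⟨hy', h⟩
      · rw [loc_of_notMem hy', map_zero]
  rw [hset x₀ x₁ h1, hset x₁ x₀ h0]
  set f := inCharts x₀ x₁ id
  have hl : ∀ y ∈ A x₁ x₀, (ch x₀).symm (f y) = (ch x₁).symm y := fun y hy =>
    (ch x₀).left_inv hy.2
  have him : f '' A x₁ x₀ = A x₀ x₁ := by
    apply Subset.antisymm
    · rintro _ ⟨y, hy, rfl⟩
      refine ⟨(ch x₀).map_source hy.2, ?_⟩
      rw [mem_preimage, hl y hy]
      exact (ch x₁).map_target hy.1
    · intro y hy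
      refine ⟨inCharts x₁ x₀ id y, ⟨(ch x₁).map_source hy.2, ?_⟩, ?_⟩
      · rw [mem_preimage]
        change (ch x₁).symm (ch x₁ ((ch x₀).symm y)) ∈ _
        rw [(ch x₁).left_inv hy.2]
        exact (ch x₀).map_target hy.1
      · change ch x₀ ((ch x₁).symm (ch x₁ ((ch x₀).symm y))) = y
        rw [(ch x₁).left_inv hy.2, (ch x₀).right_inv hy.1]
  have hinj : InjOn f (A x₁ x₀) := by
    intro y hy y' hy' h
    have := congrArg (ch x₀).symm h
    rw [hl y hy, hl y' hy'] at this
    rw [← (ch x₁).right_inv hy.1, ← (ch x₁).right_inv hy'.1, this]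
  have hd : ∀ y ∈ A x₁ x₀, HasFDerivWithinAt f (fderiv ℝ f y) (A x₁ x₀) y := fun y hy =>
    ((contDiffAt_inCharts hy.1 contMDiffAt_id hy.2).differentiableAt
      (by simp)).hasFDerivAt.hasFDerivWithinAt
  rw [← him, integral_image_eq_integral_abs_det_fderiv_smul volume (hA x₁ x₀).measurableSet hd hinj]
  refine setIntegral_congr_fun (hA x₁ x₀).measurableSet fun y hy => ?_
  have hfy : f y ∈ (ch x₀).target := (ch x₀).map_source hy.2
  simp only [loc_of_mem hfy, loc_of_mem hy.1, eps, chartRep_change hy.1 hy.2, map_smul, topCoeff_pb,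
    smul_eq_mul]
  exact (sign_mul_abs_mul _ _ _).symm

end Integral

end GenCY

namespace GenCY
set_option linter.unusedSectionVars false

/-! ### The integral over the manifold, Stokes' theorem, derivatives of integrals. -/

section GlobalIntegral

open MeasureTheory

variable {M : Type*} [TopologicalSpace M] [ChartedSpace E M] [IsManifold (𝓡 6) ∞ M]
  [CompactSpace M] [T2Space M]

/-- The chart at `x₀`. -/
local notation "ch" => extChartAt (𝓡 6) (M := M) (H := E)

variable {W : Type*} [NormedAddCommGroup W] [NormedSpace ℝ W] {V : Set W} {ν : MForm M}

theorem tsupport_chartPartition (i : M) : tsupport (chartPartition M i) ⊆ (ch i).source := by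
  rw [extChartAt_source]
  exact (SmoothPartitionOfUnity.exists_isSubordinate_chartAt_source (𝓡 6) M).choose_spec i

theorem isCompact_tsupport_chartPartition (i : M) : IsCompact (tsupport (chartPartition M i)) :=
  (isClosed_tsupport _).isCompact

/-- The form `ψᵢ θ`, where `ψᵢ` belongs to the partition of unity. -/
noncomputable def cut (i : M) (θ : MForm M) : MForm M := fun x => chartPartition M i x • θ x

theorem cut_eq_zero (i : M) (θ : MForm M) : ∀ x ∉ tsupport (chartPartition M i), cut i θ x = 0 := by
  intro x hx
  rw [cut, image_eq_zero_of_notMem_tsupport hx, zero_smul]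

theorem cut_eq_zero_of (i : M) {θ : MForm M} {x : M} (hx : θ x = 0) : cut i θ x = 0 := by
  rw [cut, hx, smul_zero]

theorem contMDiff_chartPartition (i : M) : ContMDiff (𝓡 6) 𝓘(ℝ, ℝ) ∞ (chartPartition M i) :=
  (chartPartition M i).contMDiff

theorem IsSmooth.cut {θ : MForm M} (h : IsSmooth θ) (i : M) : IsSmooth (cut i θ) :=
  h.smooth_smul (contMDiff_chartPartition i)

theorem Fam.cut {θ : W → MForm M} (h : Fam V θ) (i : M) : Fam V (fun w => GenCY.cut i (θ w)) :=
  fun w hw x => (h w hw x).smooth_smul (contMDiff_chartPartition i)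

theorem cut_add (i : M) (θ η : MForm M) : cut i (θ + η) = cut i θ + cut i η := by
  funext x; simp [cut]

theorem cut_smul (i : M) (c : ℝ) (θ : MForm M) : cut i (c • θ) = c • cut i θ := by
  funext x; simp [cut, smul_comm c]

theorem finite_chartPartition :
    {i : M | (Function.support (chartPartition M i)).Nonempty}.Finite :=
  LocallyFinite.finite_nonempty_of_compact (chartPartition M).locallyFinite

/-- The finite set of indices for which the partition function is not zero. -/
noncomputable def cidx (M : Type*) [TopologicalSpace M] [ChartedSpace E M]
    [IsManifold (𝓡 6) ∞ M] [CompactSpace M] [T2Space M] : Finset M :=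
  (finite_chartPartition (M := M)).toFinset

theorem cut_of_notMem {i : M} (hi : i ∉ cidx M) (θ : MForm M) : cut i θ = 0 := by
  funext x
  have : chartPartition M i x = 0 := by
    by_contra h
    exact hi ((finite_chartPartition (M := M)).mem_toFinset.2 ⟨x, h⟩)
  rw [cut, this, zero_smul]; rfl

theorem sum_cut (θ : MForm M) : ∑ i ∈ cidx M, cut i θ = θ := by
  funext x
  have h := (chartPartition M).sum_eq_one (mem_univ x)
  rw [finsum_eq_sum_of_support_subset (s := cidx M)] at h
  · rw [Finset.sum_apply]
    simp only [cut, ← Finset.sum_smul, h, one_smul]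
  · intro i hi
    exact (finite_chartPartition (M := M)).mem_toFinset.2 ⟨x, hi⟩

theorem intChart_zero (x₀ : M) : intChart ν x₀ 0 = 0 := by
  simpa using intChart_smul (ν := ν) x₀ 0 0

theorem integral_eq_sum (θ : MForm M) :
    integral ν θ = ∑ i ∈ cidx M, intChart ν i (cut i θ) := by
  have h : ∀ i : M, (∫ y in (ch i).target, (SignType.sign (topCoeff (chartRep i ν y)) : ℝ) *
      chartPartition M i ((ch i).symm y) * topCoeff (chartRep i θ y)) = intChart ν i (cut i θ) := by
    intro i
    rw [intChart, ← integral_indicator (isOpen_extChartAt_target i).measurableSet]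
    congr 1
    funext y
    by_cases hy : y ∈ (ch i).target
    · rw [indicator_of_mem hy, loc_of_mem hy, map_smul, eps, smul_eq_mul, mul_assoc]
      have : chartRep i (cut i θ) y = chartPartition M i ((ch i).symm y) • chartRep i θ y :=
        chartRep_fun_smul i _ θ y
      rw [this, map_smul, smul_eq_mul]
    · rw [indicator_of_notMem hy, loc_of_notMem hy, map_zero]
  rw [integral]
  simp only [h]
  refine finsum_eq_sum_of_support_subset _ fun i hi => ?_
  by_contra hc
  exact hi (by simp only [cut_of_notMem (show i ∉ cidx M from hc), intChart_zero])

theorem integral_smul (c : ℝ) (θ : MForm M) : integral ν (c • θ) = c * integral ν θ := by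
  simp only [integral_eq_sum, cut_smul, intChart_smul, Finset.mul_sum]

theorem integral_zero : integral ν 0 = 0 := by
  simpa using integral_smul (ν := ν) 0 0

theorem integral_neg (θ : MForm M) : integral ν (-θ) = -integral ν θ := by
  simpa using integral_smul (ν := ν) (-1) θ

theorem integral_congr_top {θ η : MForm M} (h : ∀ x, topCoeff (θ x) = topCoeff (η x)) :
    integral ν θ = integral ν η := by
  rw [integral_eq_sum, integral_eq_sum]
  refine Finset.sum_congr rfl fun i _ => intChart_congr fun x => ?_
  rw [cut, cut, map_smul, map_smul, h]

theorem integral_add (hν : IsVolumeForm ν) {θ η : MForm M} (hθ : IsSmooth θ) (hη : IsSmooth η) :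
    integral ν (θ + η) = integral ν θ + integral ν η := by
  simp only [integral_eq_sum, cut_add, ← Finset.sum_add_distrib]
  exact Finset.sum_congr rfl fun i _ => intChart_add hν (isCompact_tsupport_chartPartition i)
    (tsupport_chartPartition i) (hθ.cut i) (hη.cut i) (cut_eq_zero i θ) (cut_eq_zero i η)

theorem integral_sub (hν : IsVolumeForm ν) {θ η : MForm M} (hθ : IsSmooth θ) (hη : IsSmooth η) :
    integral ν (θ - η) = integral ν θ - integral ν η := by
  have := integral_add hν hθ (hη.smul (-1))
  rw [integral_smul] at this
  rw [sub_eq_add_neg, sub_eq_add_neg, ← neg_one_smul ℝ η, this, neg_one_mul]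

theorem IsSmooth.sum {ι : Type*} (s : Finset ι) {θ : ι → MForm M} (h : ∀ i ∈ s, IsSmooth (θ i)) :
    IsSmooth (∑ i ∈ s, θ i) := by
  classical
  induction s using Finset.induction_on with
  | empty => simpa using isSmooth_zero
  | insert a s ha ih =>
    rw [Finset.sum_insert ha]
    exact (h a (by simp)).add (ih fun i hi => h i (by simp [hi]))

theorem integral_sum (hν : IsVolumeForm ν) {ι : Type*} (s : Finset ι) {θ : ι → MForm M}
    (h : ∀ i ∈ s, IsSmooth (θ i)) : integral ν (∑ i ∈ s, θ i) = ∑ i ∈ s, integral ν (θ i) := by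
  classical
  induction s using Finset.induction_on with
  | empty => simpa using integral_zero
  | insert a s ha ih =>
    rw [Finset.sum_insert ha, Finset.sum_insert ha, integral_add hν (h a (by simp))
      (IsSmooth.sum s fun i hi => h i (by simp [hi])), ih fun i hi => h i (by simp [hi])]

theorem extD_sum {ι : Type*} (s : Finset ι) {θ : ι → MForm M} (h : ∀ i ∈ s, IsSmooth (θ i)) :
    extD (∑ i ∈ s, θ i) = ∑ i ∈ s, extD (θ i) := by
  classical
  induction s using Finset.induction_on with
  | empty => simpa using extD_zero
  | insert a s ha ih =>
    rw [Finset.sum_insert ha, Finset.sum_insert ha, extD_add (h a (by simp))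
      (IsSmooth.sum s fun i hi => h i (by simp [hi])), ih fun i hi => h i (by simp [hi])]

theorem intChart_sum (hν : IsVolumeForm ν) {x₀ : M} {K : Set M} (hK : IsCompact K)
    (hKs : K ⊆ (ch x₀).source) {ι : Type*} (s : Finset ι) {θ : ι → MForm M}
    (h : ∀ i ∈ s, IsSmooth (θ i)) (hz : ∀ i ∈ s, ∀ x ∉ K, θ i x = 0) :
    intChart ν x₀ (∑ i ∈ s, θ i) = ∑ i ∈ s, intChart ν x₀ (θ i) := by
  classical
  induction s using Finset.induction_on with
  | empty => simpa using intChart_zero x₀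
  | insert a s ha ih =>
    rw [Finset.sum_insert ha, Finset.sum_insert ha, intChart_add hν hK hKs (h a (by simp))
      (IsSmooth.sum s fun i hi => h i (by simp [hi])) (hz a (by simp)),
      ih (fun i hi => h i (by simp [hi])) fun i hi => hz i (by simp [hi])]
    intro x hx
    rw [Finset.sum_apply]
    exact Finset.sum_eq_zero fun i hi => hz i (by simp [hi]) x hx

/-- Cut the form by the partition of unity; each piece is supported both in its own chart and in the
chart at `x₀`, so `intChart_change` moves it to the latter. -/
theorem integral_eq_intChart (hν : IsVolumeForm ν) {x₀ : M} {K : Set M} (hK : IsCompact K)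
    (hKs : K ⊆ (ch x₀).source) {θ : MForm M} (hθ : IsSmooth θ) (hz : ∀ x ∉ K, θ x = 0) :
    integral ν θ = intChart ν x₀ θ := by
  have h1 : ∀ i ∈ cidx M, ∀ x ∉ K, cut i θ x = 0 := fun i _ x hx => cut_eq_zero_of i (hz x hx)
  conv_rhs => rw [← sum_cut θ]
  rw [integral_eq_sum, intChart_sum hν hK hKs _ (fun i _ => hθ.cut i) h1]
  refine Finset.sum_congr rfl fun i hi => intChart_change (fun x hx => ?_) fun x hx => ?_
  · exact cut_eq_zero i θ x fun h => hx (tsupport_chartPartition i h)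
  · exact h1 i hi x fun h => hx (hKs h)

/-! ### Stokes' theorem -/

/-- Integration by parts against the constant function `1`. -/
theorem integral_fderiv_eq_zero {f : E → ℝ} (hf : ContDiff ℝ ∞ f) (hc : HasCompactSupport f) (v : E) :
    ∫ y, fderiv ℝ f y v = 0 := by
  have hi : Integrable (fun y => fderiv ℝ f y v) := by
    refine Continuous.integrable_of_hasCompactSupport ?_ ?_
    · exact (hf.continuous_fderiv (by simp)).clm_apply continuous_const
    · exact hc.fderiv_apply (𝕜 := ℝ) v
  have h := integral_mul_fderiv_eq_neg_fderiv_mul_of_integrable (𝕜 := ℝ) (μ := (volume : Measure E))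
    (f := fun _ => (1 : ℝ)) (g := f) (v := v) (by simp) (by simpa using hi)
    (by simpa using hf.continuous.integrable_of_hasCompactSupport hc)
    (fun x _ => differentiableAt_const _) (fun x _ => hf.differentiable (by simp) x)
  simpa using h

theorem integral_dE_eq_zero {η : E → Lam} (hη : ContDiff ℝ ∞ η) (hc : HasCompactSupport η) :
    ∫ y, topCoeff (dE η y) = 0 := by
  have h1 : ∀ y, topCoeff (dE η y) = ∑ i : Fin 6,
      fderiv ℝ (fun y => (topL ∘L lmul (ExteriorAlgebra.ι ℝ (dualBasis i))) (η y)) y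
        (EuclideanSpace.single i (1 : ℝ)) := by
    intro y
    rw [dE, map_sum]
    refine Finset.sum_congr rfl fun i _ => ?_
    have := ((topL ∘L lmul (ExteriorAlgebra.ι ℝ (dualBasis i))).hasFDerivAt.comp y
      (hη.differentiable (by simp) y).hasFDerivAt).fderiv
    erw [this]
    rfl
  have hs : ∀ i : Fin 6, ContDiff ℝ ∞
      (fun y => (topL ∘L lmul (ExteriorAlgebra.ι ℝ (dualBasis i))) (η y)) :=
    fun i => (ContinuousLinearMap.contDiff _).comp hη
  have hcs : ∀ i : Fin 6, HasCompactSupport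
      (fun y => (topL ∘L lmul (ExteriorAlgebra.ι ℝ (dualBasis i))) (η y)) :=
    fun i => hc.comp_left (map_zero _)
  simp only [h1]
  rw [integral_finsetSum]
  · exact Finset.sum_eq_zero fun i _ => integral_fderiv_eq_zero (hs i) (hcs i) _
  · intro i _
    refine Continuous.integrable_of_hasCompactSupport ?_ ((hcs i).fderiv_apply (𝕜 := ℝ) _)
    exact ((hs i).continuous_fderiv (by simp)).clm_apply continuous_const

/-- The partition of unity is applied before differentiating: each `d(ψᵢ τ)` is supported in one
chart, where its integral is that of the exterior derivative of a compactly supported form on the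
model space. -/
theorem integral_extD (hν : IsVolumeForm ν) {τ : MForm M} (hτ : IsSmooth τ) :
    integral ν (extD τ) = 0 := by
  rw [← sum_cut τ, extD_sum _ fun i _ => hτ.cut i, integral_sum hν _ fun i _ => (hτ.cut i).extD]
  refine Finset.sum_eq_zero fun i _ => ?_
  have hK := isCompact_tsupport_chartPartition i
  have hKs := tsupport_chartPartition i
  have hz := cut_eq_zero i τ
  have hz' : ∀ x ∉ tsupport (chartPartition M i), extD (cut i τ) x = 0 := by
    intro x hx
    have : cut i τ =ᶠ[𝓝 x] 0 := by
      filter_upwards [hK.isClosed.isOpen_compl.mem_nhds hx] with x' hx' using hz x' hx'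
    rw [extD_congr this, extD_zero]; rfl
  have hs := contDiff_loc hν hK hKs (hτ.cut i) hz
  have hC := isCompact_chart_image hK hKs
  rw [integral_eq_intChart hν hK hKs (hτ.cut i).extD hz', intChart, ← integral_dE_eq_zero hs
    (hasCompactSupport_of_zero hC fun y hy => loc_eq_zero hz hy)]
  congr 1
  funext y
  congr 1
  by_cases hy : y ∈ (ch i).target
  · rw [loc_of_mem hy, (hτ.cut i).chartRep_extD hy]
    have h1 : loc ν i (cut i τ) =ᶠ[𝓝 y] fun y' => eps ν i y • chartRep i (cut i τ) y' := by
      filter_upwards [eventually_mem_target hy, eps_eventually hν hy] with y' h1 h2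
      rw [loc_of_mem h1, h2]
    rw [dE_congr h1, dE_eq_wedge, dE_eq_wedge, fderiv_fun_const_smul
      (((hτ.cut i).contDiffAt hy).differentiableAt (by simp)), map_smul]
  · rw [loc_of_notMem hy, dE_of_notMem hC.isClosed (fun y hy => loc_eq_zero hz hy)]
    rintro ⟨x, hx, hxy⟩
    exact hy (hxy ▸ (ch i).map_source hx.2)

/-! ### Smooth families -/

theorem contDiffOn_intChart (hν : IsVolumeForm ν) {x₀ : M} {K : Set M} (hK : IsCompact K)
    (hKs : K ⊆ (ch x₀).source) (hV : IsOpen V) {θ : W → MForm M} (hθ : Fam V θ)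
    (hz : ∀ w ∈ V, ∀ x ∉ K, θ w x = 0) :
    ContDiffOn ℝ ∞ (fun w => intChart ν x₀ (θ w)) V := by
  have h := contDiffOn_param_integral (μ := (volume : Measure E)) (c := fun _ => 1)
    (g := fun w y => topL (loc ν x₀ (θ w) y)) hV
    (isCompact_chart_image hK hKs) (locallyIntegrable_const 1)
    (fun w hw y hy => by rw [loc_eq_zero (hz w hw) hy, map_zero])
    (topL.contDiff.comp_contDiffOn (contDiffOn_loc hν hK hKs hV hθ hz))
  simp only [one_smul] at h
  exact h

theorem fderiv_intChart (hν : IsVolumeForm ν) {x₀ : M} {K : Set M} (hK : IsCompact K)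
    (hKs : K ⊆ (ch x₀).source) (hV : IsOpen V) {θ : W → MForm M} (hθ : Fam V θ)
    (hz : ∀ w ∈ V, ∀ x ∉ K, θ w x = 0) {w : W} (hw : w ∈ V) (a : W) :
    fderiv ℝ (fun w => intChart ν x₀ (θ w)) w a =
      intChart ν x₀ (fun x => fderiv ℝ (fun w => θ w x) w a) := by
  have hsm := topL.contDiff.comp_contDiffOn (contDiffOn_loc hν hK hKs hV hθ hz)
  have hzero : ∀ w ∈ V, ∀ y ∉ ch x₀ '' (K ∩ (ch x₀).source), topL (loc ν x₀ (θ w) y) = 0 :=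
    fun w hw y hy => by rw [loc_eq_zero (hz w hw) hy, map_zero]
  have h := hasFDerivAt_param_integral (μ := (volume : Measure E)) (c := fun _ => 1)
    (g := fun w y => topL (loc ν x₀ (θ w) y)) hV
    (isCompact_chart_image hK hKs) (locallyIntegrable_const 1) hzero hsm hw
  simp only [one_smul] at h
  have hat : ∀ y, ContDiffAt ℝ ∞ (fun q : W × E => topL (loc ν x₀ (θ q.1) q.2)) (w, y) := fun y =>
    hsm.contDiffAt ((hV.prod isOpen_univ).mem_nhds ⟨hw, mem_univ _⟩)
  have hcont : Continuous fun y => fderiv ℝ (fun w => topL (loc ν x₀ (θ w) y)) w := by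
    rw [continuous_iff_continuousAt]
    intro y
    have h4 : ContinuousAt (fun y => fderiv ℝ (fun q : W × E => topL (loc ν x₀ (θ q.1) q.2)) (w, y) ∘L
        ContinuousLinearMap.inl ℝ W E) y :=
      (ContinuousAt.comp (f := fun y : E => (w, y)) ((hat y).fderiv_right (m := ∞)
        (by simp)).continuousAt (by fun_prop)).clm_comp continuousAt_const
    refine h4.congr (.of_forall fun y => ?_)
    exact (fderiv_slice_left ((hat y).differentiableAt (by simp))).symm
  have hint : Integrable (fun y => fderiv ℝ (fun w => topL (loc ν x₀ (θ w) y)) w) := by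
    refine hcont.integrable_of_hasCompactSupport
      (hasCompactSupport_of_zero (isCompact_chart_image hK hKs) fun y hy => ?_)
    refine (hasFDerivAt_zero_of_eventually_const 0 ?_).fderiv
    filter_upwards [hV.mem_nhds hw] with w' hw' using hzero w' hw' y hy
  have h5 := h.fderiv
  change fderiv ℝ (fun w => ∫ y, topL (loc ν x₀ (θ w) y)) w a = _
  rw [h5, ContinuousLinearMap.integral_apply hint, intChart]
  congr 1
  funext y
  by_cases hy : y ∈ (ch x₀).target
  · simp only [loc_of_mem hy]
    have e1 : (fun w => topL (eps ν x₀ y • chartRep x₀ (θ w) y)) = fun w =>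
        (topL ∘L (eps ν x₀ y • pbL (mfderiv (𝓡 6) (𝓡 6) (ch x₀).symm y)))
          (θ w ((ch x₀).symm y)) := rfl
    have h6 := ((topL ∘L (eps ν x₀ y • pbL (mfderiv (𝓡 6) (𝓡 6) (ch x₀).symm y))).hasFDerivAt.comp w
      ((hθ.contDiffAt_apply hw ((ch x₀).symm y)).differentiableAt (by simp)).hasFDerivAt).fderiv
    rw [e1]
    erw [h6]
    rfl
  · simp only [loc_of_notMem hy, map_zero]
    simp

theorem contDiffOn_integral (hν : IsVolumeForm ν) (hV : IsOpen V) {θ : W → MForm M}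
    (hθ : Fam V θ) : ContDiffOn ℝ ∞ (fun w => integral ν (θ w)) V := by
  simp only [integral_eq_sum]
  exact ContDiffOn.sum fun i _ => contDiffOn_intChart hν (isCompact_tsupport_chartPartition i)
    (tsupport_chartPartition i) hV (hθ.cut i) fun w _ => cut_eq_zero i (θ w)

theorem fderiv_integral (hν : IsVolumeForm ν) (hV : IsOpen V) {θ : W → MForm M}
    (hθ : Fam V θ) {w : W} (hw : w ∈ V) (a : W) :
    fderiv ℝ (fun w => integral ν (θ w)) w a =
      integral ν (fun x => fderiv ℝ (fun w => θ w x) w a) := by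
  simp only [integral_eq_sum]
  have hK := fun i : M => isCompact_tsupport_chartPartition i
  have hs := fun i : M => tsupport_chartPartition i
  rw [fderiv_fun_sum, _root_.sum_apply]
  · refine Finset.sum_congr rfl fun i _ => ?_
    rw [fderiv_intChart hν (hK i) (hs i) hV (hθ.cut i) (fun w _ => cut_eq_zero i (θ w)) hw]
    congr 1
    funext x
    simp only [cut]
    rw [fderiv_fun_const_smul ((hθ.contDiffAt_apply hw x).differentiableAt (by simp))]
    rfl
  · intro i _
    exact ((contDiffOn_intChart hν (hK i) (hs i) hV (hθ.cut i)
      fun w _ => cut_eq_zero i (θ w)).contDiffAt (hV.mem_nhds hw)).differentiableAt (by simp)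

end GlobalIntegral

end GenCY

namespace GenCY
set_option linter.unusedSectionVars false

/-! ## The pairing of forms -/

/-! ### Derivatives of families of forms with respect to the parameter. -/

section FamilyCalculus

variable {M : Type*} [TopologicalSpace M] [ChartedSpace E M] [IsManifold (𝓡 6) ∞ M]

/-- The chart at `x₀`. -/
local notation "ch" => extChartAt (𝓡 6) (M := M) (H := E)

variable {W : Type*} [NormedAddCommGroup W] [NormedSpace ℝ W] {V : Set W}

/-- The derivative of a family of forms in a direction of the parameter space. -/
noncomputable def dFam (θ : W → MForm M) (a : W) (w : W) : MForm M :=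
  fun x => fderiv ℝ (fun w => θ w x) w a

theorem chartRep_dFam (hV : IsOpen V) {θ : W → MForm M} (hθ : Fam V θ) (a : W) {w : W} (hw : w ∈ V)
    {x₀ : M} {y : E} (hy : y ∈ (ch x₀).target) :
    chartRep x₀ (dFam θ a w) y =
      fderiv ℝ (fun q : W × E => chartRep x₀ (θ q.1) q.2) (w, y) (a, 0) := by
  have h1 := (hθ.contDiffOn x₀).contDiffAt ((hV.prod (isOpen_extChartAt_target x₀)).mem_nhds
    (show (w, y) ∈ _ from ⟨hw, hy⟩))
  have h2 := fderiv_slice_left (h1.differentiableAt (by simp))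
  have h3 := congrArg (fun L => L a) h2
  refine Eq.trans ?_ h3
  have h4 := ((pbL (mfderiv (𝓡 6) (𝓡 6) (ch x₀).symm y)).hasFDerivAt.comp w
    ((hθ.contDiffAt_apply hw ((ch x₀).symm y)).differentiableAt (by simp)).hasFDerivAt).fderiv
  exact (congrArg (fun L => L a) h4).symm

theorem Fam.dFam (hV : IsOpen V) {θ : W → MForm M} (hθ : Fam V θ) (a : W) :
    Fam V (GenCY.dFam θ a) := by
  intro w hw x x₀ hx
  have hy := (ch x₀).map_source hx
  have hm := (hV.prod (isOpen_extChartAt_target x₀)).mem_nhds (show (w, ch x₀ x) ∈ _ from ⟨hw, hy⟩)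
  have h1 := ((hθ.contDiffOn x₀).contDiffAt hm).fderiv_right (m := ∞) (by simp)
  refine (h1.clm_apply (contDiffAt_const (c := (a, (0 : E))))).congr_of_eventuallyEq ?_
  filter_upwards [hm] with q hq
  exact chartRep_dFam hV hθ a hq.1 hq.2

/-- Symmetry of the mixed second derivatives in the parameter and in the point. -/
theorem extD_dFam (hV : IsOpen V) {θ : W → MForm M} (hθ : Fam V θ) (a : W) {w : W} (hw : w ∈ V) :
    extD (dFam θ a w) = dFam (fun w => extD (θ w)) a w := by
  have hθ' : Fam V (fun w => extD (θ w)) := fun w hw x => SmAt.extD_of_open hV hθ hw x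
  apply form_ext_chart
  intro x₀ y hy
  set g : W × E → Lam := fun q => chartRep x₀ (θ q.1) q.2 with hg
  have hm : ∀ {y}, y ∈ (ch x₀).target → V ×ˢ (ch x₀).target ∈ 𝓝 (w, y) := fun hy =>
    (hV.prod (isOpen_extChartAt_target x₀)).mem_nhds ⟨hw, hy⟩
  have hga : ContDiffAt ℝ ∞ g (w, y) := (hθ.contDiffOn x₀).contDiffAt (hm hy)
  have hdg : DifferentiableAt ℝ (fderiv ℝ g) (w, y) :=
    (hga.fderiv_right (m := ∞) (by simp)).differentiableAt (by simp)
  rw [((hθ.dFam hV a).isSmooth hw).chartRep_extD hy, chartRep_dFam hV hθ' a hw hy]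
  have e1 : chartRep x₀ (dFam θ a w) =ᶠ[𝓝 y] fun y => fderiv ℝ g (w, y) (a, 0) := by
    filter_upwards [eventually_mem_target hy] with y' hy' using chartRep_dFam hV hθ a hw hy'
  let wL : (E →L[ℝ] Lam) →L[ℝ] Lam := LinearMap.toContinuousLinearMap wedge
  have e2 : (fun q : W × E => chartRep x₀ (extD (θ q.1)) q.2) =ᶠ[𝓝 (w, y)]
      fun q => wL (fderiv ℝ g q ∘L ContinuousLinearMap.inr ℝ W E) := by
    filter_upwards [hm hy] with q hq
    rw [(hθ.isSmooth hq.1).chartRep_extD hq.2, dE_eq_wedge]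
    have hgq : DifferentiableAt ℝ g q := ((hθ.contDiffOn x₀).contDiffAt
      ((hV.prod (isOpen_extChartAt_target x₀)).mem_nhds hq)).differentiableAt (by simp)
    exact congrArg wedge (fderiv_slice_right hgq)
  rw [dE_congr e1, e2.fderiv_eq, dE_eq_wedge]
  have h1 : fderiv ℝ (fun y => fderiv ℝ g (w, y) (a, 0)) y =
      (fderiv ℝ (fderiv ℝ g) (w, y)).flip (a, 0) ∘L ContinuousLinearMap.inr ℝ W E := by
    have h := (hdg.hasFDerivAt.comp y (hasFDerivAt_prodMk_right w y)).clm_apply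
      (hasFDerivAt_const (a, (0 : E)) y)
    have h' := h.fderiv
    simp only [Function.comp_def] at h'
    rw [h']
    ext v : 1
    simp
  have h2 : fderiv ℝ (fun q => wL (fderiv ℝ g q ∘L ContinuousLinearMap.inr ℝ W E)) (w, y) (a, 0) =
      wL (fderiv ℝ (fderiv ℝ g) (w, y) (a, 0) ∘L ContinuousLinearMap.inr ℝ W E) := by
    have h := wL.hasFDerivAt.comp (w, y) (hdg.hasFDerivAt.clm_comp
      (hasFDerivAt_const (ContinuousLinearMap.inr ℝ W E) (w, y)))
    have h' := h.fderiv
    simp only [Function.comp_def] at h'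
    rw [h']
    simp
  rw [h1, h2]
  change wedge _ = wedge _
  congr 1
  ext v : 1
  have hsymm : IsSymmSndFDerivAt ℝ g (w, y) := hga.isSymmSndFDerivAt (by simp; norm_cast)
  exact hsymm _ _

theorem Fam.mul {θ η : W → MForm M} (hθ : Fam V θ) (hη : Fam V η) : Fam V (fun w => θ w * η w) :=
  fun w hw x => (hθ w hw x).mul (hη w hw x)

theorem IsSmooth.sigmaWedge {θ η : MForm M} (hθ : IsSmooth θ) (hη : IsSmooth η) :
    IsSmooth (sigmaWedge θ η) :=
  IsSmooth.mul (hθ.map (T := revL) revL_pb) hη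

theorem Fam.sigmaWedge {θ η : W → MForm M} (hθ : Fam V θ) (hη : Fam V η) :
    Fam V (fun w => GenCY.sigmaWedge (θ w) (η w)) :=
  Fam.mul (θ := fun w x => revL (θ w x)) (fun w hw x => (hθ w hw x).map revL_pb) hη

theorem Fam.const_smul {θ : W → MForm M} (hθ : Fam V θ) (c : ℝ) : Fam V (fun w => c • θ w) :=
  fun w hw x => (hθ w hw x).const_smul c

theorem Fam.param_smul {θ : W → MForm M} (hθ : Fam V θ) {f : W → ℝ} (hV : IsOpen V)
    (hf : ContDiffOn ℝ ∞ f V) : Fam V (fun w => f w • θ w) := fun w hw x =>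
  SmAt.fun_smul (f := fun w _ => f w)
    (((hf.contDiffAt (hV.mem_nhds hw)).contMDiffAt).comp (w, x) contMDiffAt_fst) (hθ w hw x)

end FamilyCalculus

/-! ### The global pairing, its adjointness rules and its non-degeneracy. -/

section Pairing

open MeasureTheory

variable {M : Type*} [TopologicalSpace M] [ChartedSpace E M] [IsManifold (𝓡 6) ∞ M]
  [CompactSpace M] [T2Space M]

/-- The chart at `x₀`. -/
local notation "ch" => extChartAt (𝓡 6) (M := M) (H := E)

variable {W : Type*} [NormedAddCommGroup W] [NormedSpace ℝ W] {V : Set W} {ν : MForm M}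

/-- The global pairing of forms. -/
noncomputable def ip (ν β η : MForm M) : ℝ := integral ν (sigmaWedge β η)

theorem sigmaWedge_apply (β η : MForm M) (x : M) :
    topCoeff (sigmaWedge β η x) = pairing (β x) (η x) := rfl

theorem sigmaWedge_add_right (β η η' : MForm M) :
    sigmaWedge β (η + η') = sigmaWedge β η + sigmaWedge β η' := by
  funext x; simp [sigmaWedge, mul_add]

theorem sigmaWedge_add_left (β β' η : MForm M) :
    sigmaWedge (β + β') η = sigmaWedge β η + sigmaWedge β' η := by
  funext x; simp [sigmaWedge, add_mul]

theorem ip_add_right (hν : IsVolumeForm ν) {β η η' : MForm M} (hβ : IsSmooth β) (hη : IsSmooth η)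
    (hη' : IsSmooth η') : ip ν β (η + η') = ip ν β η + ip ν β η' := by
  rw [ip, sigmaWedge_add_right, integral_add hν (hβ.sigmaWedge hη) (hβ.sigmaWedge hη')]
  rfl

theorem ip_add_left (hν : IsVolumeForm ν) {β β' η : MForm M} (hβ : IsSmooth β) (hβ' : IsSmooth β')
    (hη : IsSmooth η) : ip ν (β + β') η = ip ν β η + ip ν β' η := by
  rw [ip, sigmaWedge_add_left, integral_add hν (hβ.sigmaWedge hη) (hβ'.sigmaWedge hη)]
  rfl

theorem ip_smul_right (c : ℝ) (β η : MForm M) : ip ν β (c • η) = c * ip ν β η := by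
  rw [ip, ip, ← integral_smul]
  congr 1
  funext x; simp [sigmaWedge]

theorem ip_smul_left (c : ℝ) (β η : MForm M) : ip ν (c • β) η = c * ip ν β η := by
  rw [ip, ip, ← integral_smul]
  congr 1
  funext x; simp [sigmaWedge]

theorem ip_skew (β η : MForm M) : ip ν β η = -ip ν η β := by
  rw [ip, ip, ← integral_neg]
  refine integral_congr_top fun x => ?_
  rw [Pi.neg_apply, map_neg, sigmaWedge_apply, sigmaWedge_apply, pairing_skew]

theorem ip_sub_right (hν : IsVolumeForm ν) {β η η' : MForm M} (hβ : IsSmooth β) (hη : IsSmooth η)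
    (hη' : IsSmooth η') : ip ν β (η - η') = ip ν β η - ip ν β η' := by
  have := ip_add_right hν hβ hη (hη'.smul (-1))
  rw [ip_smul_right] at this
  rw [sub_eq_add_neg, sub_eq_add_neg, ← neg_one_smul ℝ η', this, neg_one_mul]

theorem ip_fun_smul (f : M → ℝ) (β η : MForm M) :
    ip ν β (fun x => f x • η x) = ip ν (fun x => f x • β x) η := by
  rw [ip, ip]
  congr 1
  funext x; simp [sigmaWedge]

/-- The exterior derivative is skew-adjoint for the pairing. -/
theorem ip_extD_left (hν : IsVolumeForm ν) {τ β : MForm M} (hτ : IsSmooth τ) (hβ : IsSmooth β) :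
    ip ν (extD τ) β = -ip ν τ (extD β) := by
  have hs : IsSmooth (fun x => revL (τ x)) := hτ.map revL_pb
  have hs' : IsSmooth (fun x => invL (revL (τ x))) := hs.map (T := invL) invL_pb
  -- Leibniz rule for the product of `inv (σ τ)` with `β`. The grading automorphism in the Leibniz
  -- rule cancels the one in this factor, and the one in `reverse_extD` accounts for the first term.
  -- The exact part then disappears by Stokes.
  have h1 : sigmaWedge (extD τ) β =
      extD ((fun x => invL (revL (τ x))) * β) - sigmaWedge τ (extD β) := by
    rw [extD_mul hs' hβ, eq_sub_iff_add_eq]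
    have e1 := reverse_extD hτ
    funext x
    have e2 := congrFun e1 x
    simp only [Pi.add_apply, Pi.mul_apply, sigmaWedge, e2]
    congr 1
    change _ = inv (inv _) * _
    rw [inv_inv]
    rfl
  rw [ip, h1, integral_sub hν (hs'.mul hβ).extD (hτ.sigmaWedge hβ.extD),
    integral_extD hν (hs'.mul hβ), zero_sub]
  rfl

theorem ip_extD_right (hν : IsVolumeForm ν) {τ β : MForm M} (hτ : IsSmooth τ) (hβ : IsSmooth β) :
    ip ν β (extD τ) = -ip ν (extD β) τ := by
  rw [ip_extD_left hν hβ hτ, neg_neg]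

/-- The grading automorphism fixes top coefficients and commutes with reversal. Its use is that the
projections to the forms of a given parity are self-adjoint. -/
theorem ip_inv (β η : MForm M) :
    ip ν (fun x => inv (β x)) η = ip ν β (fun x => inv (η x)) := by
  refine integral_congr_top fun x => ?_
  simp only [sigmaWedge]
  rw [← topCoeff_inv, map_mul]
  congr 2
  have : ∀ a : Lam, inv (CliffordAlgebra.reverse (inv a)) = CliffordAlgebra.reverse a := by
    intro a
    induction a using CliffordAlgebra.induction with
    | algebraMap r => simp
    | ι x =>
      have h := inv_ι x
      rw [ExteriorAlgebra.ι] at h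
      simp [h, CliffordAlgebra.reverse_ι]
    | mul a b ha hb => simp [ha, hb, CliffordAlgebra.reverse.map_mul]
    | add a b ha hb => simp [ha, hb]
  exact this _

theorem contDiffOn_ip (hν : IsVolumeForm ν) (hV : IsOpen V) {β η : W → MForm M} (hβ : Fam V β)
    (hη : Fam V η) : ContDiffOn ℝ ∞ (fun w => ip ν (β w) (η w)) V :=
  contDiffOn_integral hν hV (hβ.sigmaWedge hη)

theorem fderiv_ip (hν : IsVolumeForm ν) (hV : IsOpen V) {β η : W → MForm M} (hβ : Fam V β)
    (hη : Fam V η) {w : W} (hw : w ∈ V) (a : W) :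
    fderiv ℝ (fun w => ip ν (β w) (η w)) w a = ip ν (dFam β a w) (η w) + ip ν (β w) (dFam η a w) := by
  simp only [ip]
  rw [fderiv_integral hν hV (hβ.sigmaWedge hη) hw, ← integral_add hν
    (((hβ.dFam hV a).isSmooth hw).sigmaWedge (hη.isSmooth hw))
    ((hβ.isSmooth hw).sigmaWedge ((hη.dFam hV a).isSmooth hw))]
  congr 1
  funext x
  have h1 : DifferentiableAt ℝ (fun w => β w x) w :=
    (hβ.contDiffAt_apply hw x).differentiableAt (by simp)
  have h2 : DifferentiableAt ℝ (fun w => η w x) w :=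
    (hη.contDiffAt_apply hw x).differentiableAt (by simp)
  have h3 := (revL.hasFDerivAt.comp w h1.hasFDerivAt)
  have h4 := congrArg (fun L => L a) (fderiv_mul_form h3.differentiableAt h2)
  rw [h3.fderiv] at h4
  exact h4

theorem smul_chartRep_smooth (hν : IsVolumeForm ν) {x₀ : M} {g : E → Lam} {y : E}
    (hg : ContDiffAt ℝ ∞ g y) (hy : y ∈ (ch x₀).target) :
    ContDiffAt ℝ ∞ (fun y => eps ν x₀ y • g y) y := by
  have : ContDiffAt ℝ ∞ (fun y' => eps ν x₀ y • g y') y :=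
    ContDiffAt.smul (f := fun _ => eps ν x₀ y) contDiffAt_const hg
  refine this.congr_of_eventuallyEq ?_
  filter_upwards [eps_eventually hν hy] with y' hy'
  rw [hy']

/-- The pairing with a form supported in a chart. -/
theorem ip_push (hν : IsVolumeForm ν) {x₀ : M} {C : Set E} (hC : IsCompact C)
    (hCt : C ⊆ (ch x₀).target) {g : E → Lam} (hg : ∀ y ∉ C, g y = 0)
    (hs : ∀ y ∈ (ch x₀).target, ContDiffAt ℝ ∞ g y) {η : MForm M} (hη : IsSmooth η) :
    ip ν (push x₀ (fun y => eps ν x₀ y • g y)) η = ∫ y, pairing (g y) (chartRep x₀ η y) := by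
  have hz : ∀ y ∉ C, eps ν x₀ y • g y = 0 := fun y hy => by rw [hg y hy, smul_zero]
  have hsm := isSmooth_push hC hCt hz fun y hy => smul_chartRep_smooth hν (hs y hy) hy
  have hK : IsCompact ((ch x₀).symm '' C) :=
    hC.image_of_continuousOn ((continuousOn_extChartAt_symm x₀).mono hCt)
  have hKs : (ch x₀).symm '' C ⊆ (ch x₀).source := by
    rintro _ ⟨y, hy, rfl⟩
    exact (ch x₀).map_target (hCt hy)
  rw [ip, integral_eq_intChart hν hK hKs (hsm.sigmaWedge hη), intChart]
  · congr 1
    funext y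
    by_cases hy : y ∈ (ch x₀).target
    · have e : chartRep x₀ (sigmaWedge (push x₀ fun y => eps ν x₀ y • g y) η) y =
          CliffordAlgebra.reverse (eps ν x₀ y • g y) * chartRep x₀ η y := by
        have h1 := congrFun (chartRep_mul x₀ (fun x => revL
          (push x₀ (fun y => eps ν x₀ y • g y) x)) η) y
        have h2 := chartRep_comp (T := revL) revL_pb x₀ (push x₀ fun y => eps ν x₀ y • g y)
        rw [h2] at h1
        refine h1.trans ?_
        rw [Pi.mul_apply, chartRep_push _ hy]
        rfl
      -- The orientation sign occurs once in the pushed form and once in the oriented integral; its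
      -- square is `1`.
      rw [loc_of_mem hy, e, map_smul, map_smul, smul_mul_assoc, map_smul, smul_smul, eps_sq hν hy, one_smul, pairing]
    · rw [loc_of_notMem hy, hg y fun h => hy (hCt h), pairing]
      simp
  · intro x hx
    have : push x₀ (fun y => eps ν x₀ y • g y) x = 0 := by
      by_cases hxs : x ∈ (ch x₀).source
      · rw [push_of_mem hxs, hz, map_zero]
        exact fun h => hx ⟨_, h, (ch x₀).left_inv hxs⟩
      · exact push_of_notMem hxs _
    rw [sigmaWedge, this]
    simp

/-- A smooth form orthogonal to all smooth forms is zero. -/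
theorem ip_nondegenerate (hν : IsVolumeForm ν) {η : MForm M} (hη : IsSmooth η)
    (h : ∀ β : MForm M, IsSmooth β → ip ν β η = 0) : η = 0 := by
  apply form_ext_chart
  intro x₀ y₀ hy₀
  rw [chartRep_zero, Pi.zero_apply]
  apply pairing_nondeg
  intro b
  by_contra hb
  have hb' : pairing b (chartRep x₀ η y₀) ≠ 0 := by
    rw [pairing_skew]; exact neg_ne_zero.2 hb
  set P : Lam →L[ℝ] ℝ := topL ∘L lmul (CliffordAlgebra.reverse b) with hP
  have hPa : ∀ a, P a = pairing b a := fun a => rfl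
  have hcont : ContinuousAt (fun y => P (chartRep x₀ η y) * P (chartRep x₀ η y₀)) y₀ :=
    (P.continuous.continuousAt.comp (hη.contDiffAt hy₀).continuousAt).mul continuousAt_const
  have hpos : 0 < P (chartRep x₀ η y₀) * P (chartRep x₀ η y₀) := mul_self_pos.2 hb'
  obtain ⟨r, hr, hrs⟩ := Metric.eventually_nhds_iff_ball.1
    ((hcont.eventually (lt_mem_nhds hpos)).and (eventually_mem_target hy₀))
  -- The test form is a bump function times `⟨b, η(y₀)⟩ b`. The integrand becomes `f(y) ⟨b, η(y)⟩
  -- ⟨b, η(y₀)⟩`, which is nonnegative because `r` keeps the product of pairings positive on the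
  -- support of `f`, and is positive at `y₀`.
  let f : ContDiffBump y₀ := ⟨r / 4, r / 2, by positivity, by linarith⟩
  have hfr : Metric.closedBall y₀ f.rOut ⊆ Metric.ball y₀ r :=
    Metric.closedBall_subset_ball (by change r / 2 < r; linarith)
  have hf0 : ∀ y ∉ Metric.closedBall y₀ f.rOut, f y = 0 := by
    intro y hy
    have : y ∉ tsupport f := by rwa [f.tsupport_eq]
    exact image_eq_zero_of_notMem_tsupport this
  have hC : IsCompact (Metric.closedBall y₀ f.rOut) := isCompact_closedBall _ _
  have hCt : Metric.closedBall y₀ f.rOut ⊆ (ch x₀).target := fun y hy => (hrs y (hfr hy)).2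
  have hgz : ∀ y ∉ Metric.closedBall y₀ f.rOut, f y • (P (chartRep x₀ η y₀) • b) = 0 := fun y hy => by
    rw [hf0 y hy, zero_smul]
  have hgs : ∀ y ∈ (ch x₀).target, ContDiffAt ℝ ∞ (fun y => f y • (P (chartRep x₀ η y₀) • b)) y :=
    fun y _ => f.contDiffAt.smul contDiffAt_const
  have hsm := isSmooth_push (η := fun y => eps ν x₀ y • f y • (P (chartRep x₀ η y₀) • b)) hC hCt
    (fun y hy => by rw [hgz y hy, smul_zero])
    fun y hy => smul_chartRep_smooth hν (hgs y hy) hy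
  have h1 := ip_push hν hC hCt hgz hgs hη
  rw [h _ hsm] at h1
  have h2 : ∀ y, pairing (f y • (P (chartRep x₀ η y₀) • b)) (chartRep x₀ η y) =
      f y * (P (chartRep x₀ η y) * P (chartRep x₀ η y₀)) := by
    intro y
    simp only [pairing, map_smul, smul_mul_assoc, hPa, smul_eq_mul]
    ring
  simp only [h2] at h1
  have hnn : ∀ y, 0 ≤ f y * (P (chartRep x₀ η y) * P (chartRep x₀ η y₀)) := by
    intro y
    by_cases hy : y ∈ Metric.closedBall y₀ f.rOut
    · exact mul_nonneg f.nonneg (hrs y (hfr hy)).1.le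
    · rw [hf0 y hy, zero_mul]
  have hcts : Continuous fun y => f y * (P (chartRep x₀ η y) * P (chartRep x₀ η y₀)) := by
    rw [continuous_iff_continuousAt]
    intro y
    by_cases hy : y ∈ (ch x₀).target
    · exact f.continuous.continuousAt.mul
        ((P.continuous.continuousAt.comp (hη.contDiffAt hy).continuousAt).mul continuousAt_const)
    · have : (fun y => f y * (P (chartRep x₀ η y) * P (chartRep x₀ η y₀))) =ᶠ[𝓝 y] fun _ => 0 := by
        filter_upwards [hC.isClosed.isOpen_compl.mem_nhds fun h => hy (hCt h)] with y' hy'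
        rw [hf0 y' hy', zero_mul]
      exact continuousAt_const.congr this.symm
  have hlt := hcts.integral_pos_of_hasCompactSupport_nonneg_nonzero (μ := (volume : Measure E))
    (hasCompactSupport_of_zero hC fun y hy => by rw [hf0 y hy, zero_mul]) hnn (x := y₀) (by
      rw [f.one_of_mem_closedBall (Metric.mem_closedBall_self f.rIn_pos.le), one_mul]
      exact hpos.ne')
  exact hlt.ne h1

/-! ### Interchange of the pairing with integrals of families. -/

section Fubini

variable {G : Type*} [NormedAddCommGroup G] [NormedSpace ℝ G] [MeasurableSpace G] [BorelSpace G]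
  {μ : Measure G} [IsLocallyFiniteMeasure μ] {c : G → ℝ} {k : Set G}
  {θ : G → MForm M}

theorem continuous_loc (hν : IsVolumeForm ν) {x₀ : M} {K : Set M} (hK : IsCompact K)
    (hKs : K ⊆ (ch x₀).source) (h : Fam univ θ) (hz : ∀ s, ∀ x ∉ K, θ s x = 0) :
    Continuous fun q : G × E => loc ν x₀ (θ q.1) q.2 := by
  have := contDiffOn_loc hν hK hKs isOpen_univ h (fun s _ => hz s)
  rw [univ_prod_univ, contDiffOn_univ] at this
  exact this.continuous

theorem intChart_formInt (hν : IsVolumeForm ν) {x₀ : M} {K : Set M} (hK : IsCompact K)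
    (hKs : K ⊆ (ch x₀).source) (hc : Continuous c) (hk : IsCompact k)
    (h : Fam univ θ) (hzk : ∀ s ∉ k, θ s = 0) (hz : ∀ s, ∀ x ∉ K, θ s x = 0) :
    intChart ν x₀ (formInt μ c θ) = ∫ s, c s * intChart ν x₀ (θ s) ∂μ := by
  have hcl : LocallyIntegrable c μ := hc.locallyIntegrable
  have hcont := continuous_loc hν hK hKs h hz
  have h1 : ∀ y, topCoeff (loc ν x₀ (formInt μ c θ) y) =
      ∫ s, c s * topCoeff (loc ν x₀ (θ s) y) ∂μ := by
    intro y
    have hzy : ∀ s ∉ k, loc ν x₀ (θ s) y = 0 := fun s hs => by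
      rw [hzk s hs]; simpa using congrFun (loc_smul (ν := ν) x₀ 0 (0 : MForm M)) y
    have hint := integrable_smul_of_zero hcl hk
      (hcont.comp (Continuous.prodMk_left y)) hzy
    have e1 : loc ν x₀ (formInt μ c θ) y = ∫ s, c s • loc ν x₀ (θ s) y ∂μ := by
      by_cases hy : y ∈ (ch x₀).target
      · simp only [loc_of_mem hy]
        rw [chartRep_formInt hcl hk h hzk, ← MeasureTheory.integral_smul]
        simp only [smul_comm (eps ν x₀ y)]
      · simp only [loc_of_notMem hy, smul_zero, MeasureTheory.integral_zero]
    have h2 := topL.integral_comp_comm hint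
    rw [e1]
    refine h2.symm.trans ?_
    simp only [map_smul, smul_eq_mul, topL_apply]
    rfl
  rw [intChart]
  simp only [h1, intChart, ← integral_const_mul]
  refine (integral_integral_swap_of_hasCompactSupport
    (f := fun s y => c s * topCoeff (loc ν x₀ (θ s) y)) ?_ ?_).symm
  · exact (hc.comp continuous_fst).mul (topL.continuous.comp hcont)
  · refine hasCompactSupport_of_zero (hk.prod (isCompact_chart_image hK hKs)) ?_
    rintro ⟨s, y⟩ hsy
    by_cases hs : s ∈ k
    · have hy : y ∉ ch x₀ '' (K ∩ (ch x₀).source) := fun hy => hsy ⟨hs, hy⟩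
      simp only [Function.uncurry, loc_eq_zero (hz s) hy, map_zero, mul_zero]
    · have e2 : loc ν x₀ (0 : MForm M) y = 0 := by
        simpa using congrFun (loc_smul (ν := ν) x₀ 0 (0 : MForm M)) y
      simp only [Function.uncurry, hzk s hs, e2, map_zero, mul_zero]

theorem integral_formInt (hν : IsVolumeForm ν) (hc : Continuous c) (hk : IsCompact k)
    (h : Fam univ θ) (hz : ∀ s ∉ k, θ s = 0) :
    integral ν (formInt μ c θ) = ∫ s, c s * integral ν (θ s) ∂μ := by
  have hcl : LocallyIntegrable c μ := hc.locallyIntegrable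
  simp only [integral_eq_sum, Finset.mul_sum]
  have hzc : ∀ i, ∀ s ∉ k, cut i (θ s) = 0 := fun i s hs => by
    rw [hz s hs]; funext x; exact cut_eq_zero_of i rfl
  have hI : ∀ i, Continuous fun s => intChart ν i (cut i (θ s)) := fun i => by
    have := contDiffOn_intChart hν (isCompact_tsupport_chartPartition i)
      (tsupport_chartPartition i) isOpen_univ (h.cut i) fun w _ => cut_eq_zero i (θ w)
    exact (contDiffOn_univ.1 this).continuous
  rw [integral_finsetSum]
  · refine Finset.sum_congr rfl fun i _ => ?_
    rw [← intChart_formInt hν (isCompact_tsupport_chartPartition i)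
      (tsupport_chartPartition i) hc hk (h.cut i) (hzc i) fun s => cut_eq_zero i (θ s)]
    congr 1
    funext x
    simp only [cut, formInt, ← MeasureTheory.integral_smul]
    simp only [smul_comm (chartPartition M i x)]
  · intro i _
    exact integrable_smul_of_zero hcl hk (hI i) fun s hs => by rw [hzc i s hs, intChart_zero]

/-- The pairing commutes with integrals of families. -/
theorem ip_formInt (hν : IsVolumeForm ν) {β : MForm M} (hβ : IsSmooth β) (hc : Continuous c)
    (hk : IsCompact k) (h : Fam univ θ) (hz : ∀ s ∉ k, θ s = 0) :
    ip ν β (formInt μ c θ) = ∫ s, c s * ip ν β (θ s) ∂μ := by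
  have h1 : sigmaWedge β (formInt μ c θ) = formInt μ c fun s => sigmaWedge β (θ s) := by
    funext x
    have hint := integrable_smul_of_zero (hc.locallyIntegrable (μ := μ)) hk (h.continuous_apply x)
      (fun s hs => by rw [hz s hs]; rfl)
    have := (lmul (CliffordAlgebra.reverse (β x))).integral_comp_comm hint
    refine this.symm.trans ?_
    simp only [map_smul]
    rfl
  rw [ip, h1, integral_formInt hν hc hk ((hβ.fam univ).sigmaWedge h)]
  · rfl
  · intro s hs
    rw [hz s hs]
    funext x; simp [sigmaWedge]

theorem ip_formInt_left (hν : IsVolumeForm ν) {β : MForm M} (hβ : IsSmooth β) (hc : Continuous c)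
    (hk : IsCompact k) (h : Fam univ θ) (hz : ∀ s ∉ k, θ s = 0) :
    ip ν (formInt μ c θ) β = ∫ s, c s * ip ν (θ s) β ∂μ := by
  rw [ip_skew, ip_formInt hν hβ hc hk h hz, ← MeasureTheory.integral_neg]
  congr 1
  funext s
  rw [ip_skew (θ s), mul_neg]

end Fubini

end Pairing

end GenCY

namespace GenCY
set_option linter.unusedSectionVars false

/-! ## Homotopy formula -/

theorem contr_pb (A : E →L[ℝ] E) (v : E) (a : Lam) : contr v (pb A a) = pb A (contr (A v) a) := by
  induction a using CliffordAlgebra.left_induction with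
  | algebraMap r =>
    have h : ∀ v, contr v (algebraMap ℝ Lam r) = 0 := fun v => contr_algebraMap v r
    rw [AlgHom.commutes]
    exact (h v).trans (by erw [h, map_zero])
  | add a b ha hb => simp only [map_add, ha, hb]
  | ι_mul a ξ ha =>
    change contr v (pb A (ExteriorAlgebra.ι ℝ ξ * a)) =
      pb A (contr (A v) (ExteriorAlgebra.ι ℝ ξ * a))
    rw [map_mul, pb_ι, contr_ι_mul, contr_ι_mul, ha, map_sub, map_mul, pb_ι, map_smul]
    rfl

section Homotopy

variable {M : Type*} [TopologicalSpace M] [ChartedSpace E M] [IsManifold (𝓡 6) ∞ M]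

/-- The chart at `x₀`. -/
local notation "ch" => extChartAt (𝓡 6) (M := M) (H := E)

variable {W : Type*} [NormedAddCommGroup W] [NormedSpace ℝ W] {F : W → M → M}

/-- The velocity of a family of maps in a direction of the parameter space. -/
noncomputable def vel (F : W → M → M) (w e : W) (x : M) : E :=
  (mfderiv 𝓘(ℝ, W) (𝓡 6) (fun w' => F w' x) w : W →L[ℝ] E) e

/-- The pull-back of the contraction of a form with the velocity of a family of maps. -/
noncomputable def kap (F : W → M → M) (α : MForm M) (e w : W) : MForm M :=
  fun x => pullAt (F w) x (contr (vel F w e x) (α (F w x)))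

theorem chartRep_kap (hF : ContMDiff (𝓘(ℝ, W).prod (𝓡 6)) (𝓡 6) ∞ (fun q : W × M => F q.1 q.2))
    {x₀ x₁ : M} {w : W} {y : E} (hy : y ∈ (ch x₁).target)
    (hFy : F w ((ch x₁).symm y) ∈ (ch x₀).source) (α : MForm M) (e : W) :
    chartRep x₁ (kap F α e w) y = pb (dsnd (inChartsFam x₀ x₁ F) (w, y))
      (contr (dpar (inChartsFam x₀ x₁ F) e (w, y))
        (chartRep x₀ α (inChartsFam x₀ x₁ F (w, y)))) := by
  set x := (ch x₁).symm y with hx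
  have hfd : MDifferentiableAt (𝓡 6) (𝓡 6) (F w) x :=
    ((GenCY.ContMDiff.slice hF w).contMDiffAt (x := x)).mdifferentiableAt (by simp)
  have hsd := mdifferentiableAt_chart_symm hy
  have hcd := mdifferentiableAt_chart hFy
  have hF' := contDiffAt_inChartsFam hy hF.contMDiffAt hFy
  have hwd : MDifferentiableAt 𝓘(ℝ, W) (𝓡 6) (fun w' => F w' x) w := by
    have : ContMDiff 𝓘(ℝ, W) (𝓡 6) ∞ (fun w' => F w' x) :=
      hF.comp (contMDiff_id.prodMk contMDiff_const)
    exact (this.contMDiffAt (x := w)).mdifferentiableAt (by simp)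
  have e1 : dpar (inChartsFam x₀ x₁ F) e (w, y) =
      (mfderiv (𝓡 6) (𝓡 6) (ch x₀) (F w x) : E →L[ℝ] E) (vel F w e x) := by
    have h1 := congrArg (fun L => L e) (fderiv_slice_left (f := inChartsFam x₀ x₁ F) (w := w) (x := y)
      (hF'.differentiableAt (by simp)))
    have h2 := mfderiv_comp w hcd hwd
    have h3 : mfderiv 𝓘(ℝ, W) (𝓡 6) (ch x₀ ∘ fun w' => F w' x) w =
        fderiv ℝ (fun w' => inChartsFam x₀ x₁ F (w', y)) w := mfderiv_eq_fderiv
    rw [h2] at h3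
    refine h1.symm.trans ?_
    exact (congrArg (fun L : W →L[ℝ] E => L e) h3).symm
  have e2 : dsnd (inChartsFam x₀ x₁ F) (w, y) = fderiv ℝ (inCharts x₀ x₁ (F w)) y :=
    (fderiv_slice_right (hF'.differentiableAt (by simp))).symm
  have e3 : ∀ a, contr (vel F w e x) (pullAt (ch x₀) (F w x) a) = pullAt (ch x₀) (F w x)
      (contr (dpar (inChartsFam x₀ x₁ F) e (w, y)) a) := by
    intro a; rw [e1]; exact contr_pb _ _ _
  have e4 : ∀ a, pullAt (ch x₁).symm y (pullAt (F w) x (pullAt (ch x₀) (F w x) a)) =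
      pb (dsnd (inChartsFam x₀ x₁ F) (w, y)) a := by
    intro a
    rw [pullAt_comp rfl hcd hfd, pullAt_comp hx.symm (hcd.comp _ hfd) hsd, pullAt_model, e2]
    rfl
  rw [chartRep, pullback, kap, ← hx, form_eq_pullAt_chartRep hFy α, e3, e4]
  rfl

theorem Fam.kap (hF : ContMDiff (𝓘(ℝ, W).prod (𝓡 6)) (𝓡 6) ∞ (fun q : W × M => F q.1 q.2))
    {α : MForm M} (hα : IsSmooth α) (e : W) : Fam univ (GenCY.kap F α e) := by
  intro w _ x x₁ hx
  have hy := (ch x₁).map_source hx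
  have hl := (ch x₁).left_inv hx
  set x₀ := F w x
  have hx₀ : F w x ∈ (ch x₀).source := mem_extChartAt_source _
  have hFc : ContDiffAt ℝ ∞ (inChartsFam x₀ x₁ F) (w, ch x₁ x) :=
    contDiffAt_inChartsFam hy hF.contMDiffAt (by rw [hl]; exact hx₀)
  have ht : inChartsFam x₀ x₁ F (w, ch x₁ x) ∈ (ch x₀).target := by
    simp only [inChartsFam, hl]; exact (ch x₀).map_source hx₀
  have h1 : ContDiffAt ℝ ∞ (fun q : W × E => pb (dsnd (inChartsFam x₀ x₁ F) q)
      (contr (dpar (inChartsFam x₀ x₁ F) e q)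
        (chartRep x₀ α (inChartsFam x₀ x₁ F q)))) (w, ch x₁ x) := by
    refine contDiffAt_pb_apply (contDiffAt_dsnd hFc) ?_
    exact (contr.contDiff.contDiffAt.comp _ (contDiffAt_dpar hFc e)).clm_apply
      ((hα.contDiffAt ht).comp _ hFc)
  refine h1.congr_of_eventuallyEq ?_
  filter_upwards [eventually_inChartsFam hx hF hx₀] with q hq
  exact chartRep_kap (F := F) (w := q.1) hF hq.1 hq.2 α e

theorem HasParity.kap {p : ZMod 2} {α : MForm M} (h : HasParity p α) (e w : W) :
    HasParity (p + 1) (GenCY.kap F α e w) := by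
  rw [hasParity_iff] at h ⊢
  intro x
  have hc : ∀ (v : E) (a : Lam), inv (contr v a) = -contr v (inv a) := by
    intro v a
    induction a using CliffordAlgebra.left_induction with
    | algebraMap r =>
      have h : contr v (algebraMap ℝ Lam r) = 0 := contr_algebraMap v r
      have h' : inv (algebraMap ℝ Lam r) = algebraMap ℝ Lam r := AlgHom.commutes _ r
      erw [h, h', h]; simp
    | add a b ha hb => simp only [map_add, ha, hb, neg_add]
    | ι_mul a ξ ha =>
      change inv (contr v (ExteriorAlgebra.ι ℝ ξ * a)) = -contr v (inv (ExteriorAlgebra.ι ℝ ξ * a))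
      rw [contr_ι_mul, map_sub, map_mul, inv_ι, ha, map_smul, map_mul, inv_ι]
      simp only [neg_mul, mul_neg, neg_neg, map_neg, contr_ι_mul]
  have hp : ∀ a, inv (pullAt (F w) x a) = pullAt (F w) x (inv a) := inv_pb _
  rw [GenCY.kap, hp, hc, h, sgn_add_one, map_smul, map_neg, map_smul, neg_smul]

/-- Cartan's formula read in charts; the term containing `dα` drops out because `α` is closed. -/
theorem fderiv_pullback (hF : ContMDiff (𝓘(ℝ, W).prod (𝓡 6)) (𝓡 6) ∞ (fun q : W × M => F q.1 q.2))
    {α : MForm M} (hα : IsSmooth α) (hd : extD α = 0) (w e : W) (x : M) :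
    fderiv ℝ (fun w => pullback (F w) α x) w e = extD (kap F α e w) x := by
  have hx := mem_extChartAt_source (I := 𝓡 6) x
  have hy := mem_extChartAt_target (I := 𝓡 6) x
  have hl := (ch x).left_inv hx
  set x₀ := F w x
  have hx₀ : F w x ∈ (ch x₀).source := mem_extChartAt_source _
  have hx₀' : F w ((ch x).symm (ch x x)) ∈ (ch x₀).source := by rw [hl]; exact hx₀
  have hFc : ContDiffAt ℝ ∞ (inChartsFam x₀ x F) (w, ch x x) :=
    contDiffAt_inChartsFam hy hF.contMDiffAt hx₀'
  have ht : inChartsFam x₀ x F (w, ch x x) ∈ (ch x₀).target := by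
    simp only [inChartsFam, hl]; exact (ch x₀).map_source hx₀
  have hev := eventually_inChartsFam hx hF hx₀
  have hηd : DifferentiableAt ℝ (chartRep x₀ α) (inChartsFam x₀ x F (w, ch x x)) :=
    (hα.contDiffAt ht).differentiableAt (by simp)
  have hcart := cartan hFc e hηd
  rw [← hα.chartRep_extD ht, hd, chartRep_zero, Pi.zero_apply, map_zero, map_zero, add_zero] at hcart
  have h1 : (fun w => pullback (F w) α x) =ᶠ[𝓝 w] fun w' => pbL (mfderiv (𝓡 6) (𝓡 6) (ch x) x)
      (pb (dsnd (inChartsFam x₀ x F) (w', ch x x))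
        (chartRep x₀ α (inChartsFam x₀ x F (w', ch x x)))) := by
    have h2 : Filter.Tendsto (fun w' : W => (w', ch x x)) (𝓝 w) (𝓝 (w, ch x x)) :=
      (Continuous.prodMk_left _).tendsto _
    filter_upwards [h2.eventually hev] with w' hw'
    rw [form_eq_pullAt_chartRep hx (pullback (F w') α)]
    exact congrArg _ (chartRep_pullback_family hw'.1 hF hw'.2 α)
  have hdiff : DifferentiableAt ℝ (fun w' => pb (dsnd (inChartsFam x₀ x F) (w', ch x x))
        (chartRep x₀ α (inChartsFam x₀ x F (w', ch x x)))) w := by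
    have : ContDiffAt ℝ ∞ (fun q : W × E => pb (dsnd (inChartsFam x₀ x F) q)
        (chartRep x₀ α (inChartsFam x₀ x F q))) (w, ch x x) :=
      contDiffAt_pb_apply (contDiffAt_dsnd hFc) ((hα.contDiffAt ht).comp _ hFc)
    exact (contDiffAt_slice_left this).differentiableAt (by simp)
  have h3 := ((pbL (mfderiv (𝓡 6) (𝓡 6) (ch x) x)).hasFDerivAt.comp w hdiff.hasFDerivAt).fderiv
  rw [h1.fderiv_eq]
  refine (congrArg (fun L : W →L[ℝ] Lam => L e) h3).trans ?_
  refine (congrArg (pbL (mfderiv (𝓡 6) (𝓡 6) (ch x) x)) hcart).trans ?_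
  rw [extD]
  refine congrArg (pbL (mfderiv (𝓡 6) (𝓡 6) (ch x) x)) (dE_congr ?_)
  have h2 : Filter.Tendsto (fun y : E => (w, y)) (𝓝 (ch x x)) (𝓝 (w, ch x x)) :=
    (Continuous.prodMk_right _).tendsto _
  filter_upwards [h2.eventually hev] with y hy'
  exact (chartRep_kap hF hy'.1 hy'.2 α e).symm

/-! ### The chain homotopy attached to a path of maps. -/

section Deformation

open MeasureTheory

variable {P : Type*} [NormedAddCommGroup P] [NormedSpace ℝ P] {H : P × ℝ → M → M}

/-- A cut-off function on the line which is `1` on the unit interval. -/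
noncomputable def lineBump : ContDiffBump (0 : ℝ) := ⟨1, 2, one_pos, one_lt_two⟩

theorem lineBump_eq_one {t : ℝ} (ht : t ∈ Icc (0 : ℝ) 1) : lineBump t = 1 :=
  lineBump.one_of_mem_closedBall (by
    rw [Metric.mem_closedBall, Real.dist_0_eq_abs, abs_of_nonneg ht.1]; exact ht.2)

theorem lineBump_eq_zero {t : ℝ} (ht : t ∉ Metric.closedBall (0 : ℝ) 2) : lineBump t = 0 := by
  have : t ∉ tsupport lineBump := by rwa [lineBump.tsupport_eq]
  exact image_eq_zero_of_notMem_tsupport this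

/-- The primitive of `H₁^* α - H₀^* α` for a closed form `α`. -/
noncomputable def hmt (H : P × ℝ → M → M) (α : MForm M) (p : P) : MForm M :=
  -- The indicator restricts the integral to the unit interval. The bump function equals `1` there
  -- and only serves to make the integrated family compactly supported while keeping it smooth.
  formInt volume ((Icc (0 : ℝ) 1).indicator 1)
    fun t => lineBump t • kap H α ((0 : P), (1 : ℝ)) (p, t)

theorem locallyIntegrable_indicator : LocallyIntegrable ((Icc (0 : ℝ) 1).indicator (1 : ℝ → ℝ)) :=
  ((integrable_indicator_iff measurableSet_Icc).2
    (integrableOn_const (by simp) (by simp))).locallyIntegrable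

theorem Fam.hmt_aux (hH : ContMDiff (𝓘(ℝ, P × ℝ).prod (𝓡 6)) (𝓡 6) ∞
    (fun q : (P × ℝ) × M => H q.1 q.2)) {α : MForm M} (hα : IsSmooth α) :
    Fam (univ ×ˢ univ) (fun q : P × ℝ => lineBump q.2 • GenCY.kap H α ((0 : P), (1 : ℝ)) (q.1, q.2)) := by
  rw [univ_prod_univ]
  exact (Fam.kap hH hα _).param_smul isOpen_univ
    (lineBump.contDiff.comp contDiff_snd).contDiffOn

theorem Fam.hmt (hH : ContMDiff (𝓘(ℝ, P × ℝ).prod (𝓡 6)) (𝓡 6) ∞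
    (fun q : (P × ℝ) × M => H q.1 q.2)) {α : MForm M} (hα : IsSmooth α) :
    Fam univ (GenCY.hmt H α) :=
  Fam.formInt isOpen_univ locallyIntegrable_indicator (isCompact_closedBall (0 : ℝ) 2)
    (Fam.hmt_aux hH hα) fun w _ s hs => by rw [lineBump_eq_zero hs, zero_smul]

/-- By Cartan's formula the exterior derivative of the integrand is the time derivative of the
pull-back of `α`. The fundamental theorem of calculus then leaves the two endpoints. -/
theorem extD_hmt (hH : ContMDiff (𝓘(ℝ, P × ℝ).prod (𝓡 6)) (𝓡 6) ∞
    (fun q : (P × ℝ) × M => H q.1 q.2)) {α : MForm M} (hα : IsSmooth α) (hd : extD α = 0) (p : P) :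
    extD (hmt H α p) = pullback (H (p, 1)) α - pullback (H (p, 0)) α := by
  have hfam := Fam.left (V := univ) (θ := fun p t => lineBump t • kap H α ((0 : P), (1 : ℝ)) (p, t))
    (Fam.hmt_aux hH hα) (mem_univ p)
  have hkap := Fam.kap hH hα ((0 : P), (1 : ℝ))
  rw [hmt, extD_formInt locallyIntegrable_indicator (isCompact_closedBall (0 : ℝ) 2) hfam
    fun s hs => by rw [lineBump_eq_zero hs, zero_smul]]
  funext x
  have hpb : Fam univ (fun q : P × ℝ => pullback (H q) α) := fun q _ x =>
    SmAt.pullback hH (hα.smAt q _)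
  have hder : ∀ t, HasDerivAt (fun t => pullback (H (p, t)) α x)
      (extD (kap H α ((0 : P), (1 : ℝ)) (p, t)) x) t := by
    intro t
    have h1 := ((hpb.contDiffAt_apply (mem_univ (p, t)) x).differentiableAt (by simp)).hasFDerivAt
    have h2 : HasDerivAt (fun t : ℝ => (p, t)) ((0 : P), (1 : ℝ)) t :=
      (hasDerivAt_const t p).prodMk (hasDerivAt_id t)
    have h3 := h1.comp_hasDerivAt t h2
    rwa [fderiv_pullback hH hα hd] at h3
  have hcont : Continuous fun t => extD (kap H α ((0 : P), (1 : ℝ)) (p, t)) x := by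
    have h1 : Fam univ (fun q => extD (kap H α ((0 : P), (1 : ℝ)) q)) := fun q hq x =>
      SmAt.extD_of_open isOpen_univ hkap hq x
    exact (h1.continuous_apply x).comp (Continuous.prodMk_right p)
  have h4 := intervalIntegral.integral_eq_sub_of_hasDerivAt (fun t _ => hder t)
    (hcont.intervalIntegrable 0 1)
  rw [Pi.sub_apply, ← h4, intervalIntegral.integral_of_le zero_le_one,
    ← integral_Icc_eq_integral_Ioc, ← integral_indicator measurableSet_Icc, formInt]
  congr 1
  funext t
  by_cases ht : t ∈ Icc (0 : ℝ) 1
  · rw [indicator_of_mem ht, indicator_of_mem ht, extD_smul _ (hkap.isSmooth (mem_univ _)),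
      lineBump_eq_one ht]
    simp
  · rw [indicator_of_notMem ht, indicator_of_notMem ht, zero_smul]

theorem HasParity.formInt {G : Type*} [NormedAddCommGroup G] [NormedSpace ℝ G] [MeasurableSpace G]
    [BorelSpace G] {μ : Measure G} {c : G → ℝ} {k : Set G} (hc : LocallyIntegrable c μ)
    (hk : IsCompact k) {θ : G → MForm M} (h : Fam univ θ) (hz : ∀ s ∉ k, θ s = 0) {p : ZMod 2}
    (hp : ∀ s, HasParity p (θ s)) : HasParity p (GenCY.formInt μ c θ) := by
  rw [hasParity_iff]
  intro x
  have hint := integrable_smul_of_zero hc hk (h.continuous_apply x) (fun s hs => by rw [hz s hs]; rfl)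
  have h1 := invL.integral_comp_comm hint
  refine h1.symm.trans ?_
  rw [GenCY.formInt, ← MeasureTheory.integral_smul]
  congr 1
  funext s
  rw [map_smul, smul_comm]
  exact congrArg _ (hasParity_iff.1 (hp s) x)

theorem HasParity.hmt (hH : ContMDiff (𝓘(ℝ, P × ℝ).prod (𝓡 6)) (𝓡 6) ∞
    (fun q : (P × ℝ) × M => H q.1 q.2)) {α : MForm M} (hα : IsSmooth α) {r : ZMod 2}
    (hr : HasParity r α) (p : P) : HasParity (r + 1) (GenCY.hmt H α p) :=
  HasParity.formInt locallyIntegrable_indicator (isCompact_closedBall (0 : ℝ) 2)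
    (Fam.left (V := univ)
      (θ := fun p t => lineBump t • GenCY.kap H α ((0 : P), (1 : ℝ)) (p, t))
      (Fam.hmt_aux hH hα) (mem_univ p))
    (fun s hs => by rw [lineBump_eq_zero hs, zero_smul])
    fun s x => Submodule.smul_mem _ _ (HasParity.kap hr _ _ x)

end Deformation

end Homotopy

end GenCY

namespace GenCY
set_option linter.unusedSectionVars false

/-! ## Averaging operators -/

/-- The projection to the component of top degree. -/
noncomputable def topProj : Lam →L[ℝ] Lam := topL.smulRight (ExteriorAlgebra.ιMulti ℝ 6 dualBasis)

theorem topProj_apply (a : Lam) :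
    topProj a = topCoeff a • ExteriorAlgebra.ιMulti ℝ 6 dualBasis := rfl

theorem topProj_pb (A : E →L[ℝ] E) (a : Lam) : topProj (pb A a) = pb A (topProj a) := by
  have h : pb A (ExteriorAlgebra.ιMulti ℝ 6 dualBasis) =
      A.det • ExteriorAlgebra.ιMulti ℝ 6 dualBasis := by
    have h1 : pb A (ExteriorAlgebra.ιMulti ℝ 6 dualBasis) ∈ ⋀[ℝ]^6 (Module.Dual ℝ E) := by
      rw [pb_ιMulti, ← ExteriorAlgebra.ιMulti_span_fixedDegree]
      exact Submodule.subset_span ⟨_, rfl⟩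
    rw [exteriorPower_six_eq h1, topCoeff_pb, topCoeff_ιMulti_six, Module.Basis.det_self, mul_one]
  rw [topProj_apply, topProj_apply, topCoeff_pb, map_smul, h, smul_smul, mul_comm]

theorem topCoeff_topProj (a : Lam) : topCoeff (topProj a) = topCoeff a := by
  rw [topProj_apply, map_smul, topCoeff_ιMulti_six, Module.Basis.det_self, smul_eq_mul, mul_one]

theorem ι_mul_volume (i : Fin 6) :
    ExteriorAlgebra.ι ℝ (dualBasis i) * ExteriorAlgebra.ιMulti ℝ 6 dualBasis = 0 := by
  have h : ExteriorAlgebra.ι ℝ (dualBasis i) * ExteriorAlgebra.ιMulti ℝ 6 dualBasis =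
      ExteriorAlgebra.ιMulti ℝ 7 (Fin.cons (dualBasis i) dualBasis) := by
    rw [ExteriorAlgebra.ιMulti_succ_apply]
    simp [Matrix.vecTail, Function.comp_def]
  rw [h]
  exact AlternatingMap.map_eq_zero_of_eq _ _ (i := 0) (j := i.succ) (by simp) (Fin.succ_ne_zero i).symm

theorem wedge_topProj (L : E →L[ℝ] Lam) : wedge (topProj ∘L L) = 0 := by
  rw [wedge_apply]
  refine Finset.sum_eq_zero fun i _ => ?_
  rw [ContinuousLinearMap.comp_apply, topProj_apply, mul_smul_comm, ι_mul_volume, smul_zero]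

section Averaging

open MeasureTheory

variable {M : Type*} [TopologicalSpace M] [ChartedSpace E M] [IsManifold (𝓡 6) ∞ M]

/-- The chart at `x₀`. -/
local notation "ch" => extChartAt (𝓡 6) (M := M) (H := E)

theorem extD_topProj {θ : MForm M} (hθ : IsSmooth θ) : extD (fun x => topProj (θ x)) = 0 := by
  apply form_ext_chart
  intro x₀ y hy
  rw [(hθ.map topProj_pb).chartRep_extD hy, chartRep_comp topProj_pb, chartRep_zero, dE_eq_wedge]
  have h := (topProj.hasFDerivAt.comp y
    ((hθ.contDiffAt hy).differentiableAt (by simp)).hasFDerivAt).fderiv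
  exact (congrArg wedge h).trans (wedge_topProj _)

theorem pullback_pullback {f g : M → M} (hf : ContMDiff (𝓡 6) (𝓡 6) ∞ f)
    (hg : ContMDiff (𝓡 6) (𝓡 6) ∞ g) (θ : MForm M) :
    pullback f (pullback g θ) = pullback (g ∘ f) θ := by
  funext x
  exact pullAt_comp rfl (hg.contMDiffAt.mdifferentiableAt (by simp))
    (hf.contMDiffAt.mdifferentiableAt (by simp)) _

/-- A smooth family of diffeomorphisms, parametrized by a vector space, with the identity at the
origin. -/
structure DiffFam {G : Type*} [NormedAddCommGroup G] [NormedSpace ℝ G] (F F' : G → M → M) : Prop where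
  smooth : ContMDiff (𝓘(ℝ, G).prod (𝓡 6)) (𝓡 6) ∞ (fun q : G × M => F q.1 q.2)
  smooth' : ContMDiff (𝓘(ℝ, G).prod (𝓡 6)) (𝓡 6) ∞ (fun q : G × M => F' q.1 q.2)
  left_inv : ∀ z x, F' z (F z x) = x
  right_inv : ∀ z x, F z (F' z x) = x
  zero : ∀ x, F 0 x = x

variable {G : Type*} [NormedAddCommGroup G] [NormedSpace ℝ G] {F F' : G → M → M}

theorem DiffFam.symm (h : DiffFam F F') : DiffFam F' F :=
  ⟨h.smooth', h.smooth, h.right_inv, h.left_inv, fun x => by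
    have := h.left_inv 0 x
    rwa [h.zero] at this⟩

/-- The contraction of the family to the identity. -/
def DiffFam.path (F : G → M → M) : G × ℝ → M → M := fun q => F (q.2 • q.1)

theorem DiffFam.path_smooth (h : DiffFam F F') :
    ContMDiff (𝓘(ℝ, G × ℝ).prod (𝓡 6)) (𝓡 6) ∞ (fun q : (G × ℝ) × M => DiffFam.path F q.1 q.2) := by
  have h1 : ContMDiff (𝓘(ℝ, G × ℝ).prod (𝓡 6)) 𝓘(ℝ, G) ∞ (fun q : (G × ℝ) × M => q.1.2 • q.1.1) := by
    have : ContDiff ℝ ∞ (fun q : G × ℝ => q.2 • q.1) := contDiff_snd.smul contDiff_fst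
    exact this.contMDiff.comp contMDiff_fst
  exact h.smooth.comp (h1.prodMk contMDiff_snd)

theorem DiffFam.extD_hmt (h : DiffFam F F') {α : MForm M} (hα : IsSmooth α) (hd : extD α = 0) (z : G) :
    extD (hmt (DiffFam.path F) α z) = pullback (F z) α - α := by
  rw [GenCY.extD_hmt h.path_smooth hα hd]
  have h0 : DiffFam.path F (z, 0) = id := by
    funext x; simp [DiffFam.path, h.zero]
  have h1 : DiffFam.path F (z, 1) = F z := by
    funext x; simp [DiffFam.path]
  rw [h0, h1, pullback_id]

theorem DiffFam.slice (h : DiffFam F F') (z : G) : ContMDiff (𝓡 6) (𝓡 6) ∞ (F z) :=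
  GenCY.ContMDiff.slice h.smooth z

variable [CompactSpace M] [T2Space M] {ν : MForm M}

/-- Only the top-degree component is integrated, and this component is closed. Contracting the
family to the identity makes the difference between its pull-back and itself exact, and Stokes
applies. -/
theorem DiffFam.integral_pullback (h : DiffFam F F') (hν : IsVolumeForm ν) {θ : MForm M}
    (hθ : IsSmooth θ) (z : G) : integral ν (pullback (F z) θ) = integral ν θ := by
  have hs : IsSmooth (fun x => topProj (θ x)) := hθ.map topProj_pb
  have h1 := h.extD_hmt hs (extD_topProj hθ) z
  have h2 := integral_extD hν ((Fam.hmt h.path_smooth hs).isSmooth (mem_univ z))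
  rw [h1, integral_sub hν (hs.pullback (h.slice z)) hs, sub_eq_zero] at h2
  rw [integral_congr_top (η := fun x => topProj (θ x)) fun x => (topCoeff_topProj _).symm, ← h2]
  refine integral_congr_top fun x => ?_
  have : pullback (F z) (fun x => topProj (θ x)) x = topProj (pullback (F z) θ x) :=
    (topProj_pb _ _).symm
  rw [this, topCoeff_topProj]

/-- Invariance of the integral, applied to the integrand of the right-hand side pulled back by `F
z`; there the inverse map `F' z` cancels. -/
theorem DiffFam.ip_pullback (h : DiffFam F F') (hν : IsVolumeForm ν) {β η : MForm M}
    (hβ : IsSmooth β) (hη : IsSmooth η) (z : G) :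
    ip ν β (pullback (F z) η) = ip ν (pullback (F' z) β) η := by
  have hβ' : IsSmooth (pullback (F' z) β) := hβ.pullback (h.symm.slice z)
  rw [ip, ip, ← h.integral_pullback hν (hβ'.sigmaWedge hη) z]
  congr 1
  have h1 : pullback (F z) (pullback (F' z) β) = β := by
    rw [pullback_pullback (h.slice z) (h.symm.slice z)]
    have : F' z ∘ F z = id := funext (h.left_inv z)
    rw [this, pullback_id]
  funext x
  have h2 := congrFun h1 x
  have h3 : pullback (F z) (sigmaWedge (pullback (F' z) β) η) x =
      CliffordAlgebra.reverse (pullback (F z) (pullback (F' z) β) x) * pullback (F z) η x := by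
    have hr : ∀ a, CliffordAlgebra.reverse (pullAt (F z) x a) =
      pullAt (F z) x (CliffordAlgebra.reverse a) := reverse_pb _
    simp only [pullback, sigmaWedge, map_mul, hr]
  rw [h3, h2]
  rfl

/-- Operators on forms which commute with `d`, are chain homotopic to the identity and have a
transpose. -/
structure Adm (ν : MForm M) (R Rt : MForm M → MForm M) : Prop where
  fam : ∀ {θ : E → MForm M}, Fam univ θ → Fam univ (fun s => R (θ s))
  famt : ∀ {θ : E → MForm M}, Fam univ θ → Fam univ (fun s => Rt (θ s))
  add : ∀ {η η' : MForm M}, IsSmooth η → IsSmooth η' → R (η + η') = R η + R η'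
  smul : ∀ (c : ℝ) {η : MForm M}, IsSmooth η → R (c • η) = c • R η
  extD : ∀ {η : MForm M}, IsSmooth η → extD (R η) = R (extD η)
  parity : ∀ {p : ZMod 2} {η : MForm M}, IsSmooth η → HasParity p η → HasParity p (R η)
  homotopic : ∀ {p : ZMod 2} {α : MForm M}, α ∈ closedForms M p → R α - α ∈ exactForms M p
  transpose : ∀ {β η : MForm M}, IsSmooth β → IsSmooth η → ip ν β (R η) = ip ν (Rt β) η
  -- This lets an operator be moved inside the integral over rank-one kernels in
  -- `Smoothing.adm_comp`.
  int : ∀ {k : Set E} {θ : E → MForm M}, IsCompact k → Fam univ θ → (∀ s ∉ k, θ s = 0) →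
    R (formInt volume (fun _ => 1) θ) = formInt volume (fun _ => 1) (fun s => R (θ s))

variable {R Rt S St : MForm M → MForm M}

theorem Adm.isSmooth (h : Adm ν R Rt) {η : MForm M} (hη : IsSmooth η) : IsSmooth (R η) :=
  (h.fam (hη.fam (univ : Set E))).isSmooth (mem_univ 0)

theorem Adm.isSmooth_t (h : Adm ν R Rt) {η : MForm M} (hη : IsSmooth η) : IsSmooth (Rt η) :=
  (h.famt (hη.fam (univ : Set E))).isSmooth (mem_univ 0)

theorem Adm.map_zero (h : Adm ν R Rt) : R 0 = 0 := by
  simpa using h.smul 0 isSmooth_zero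

theorem Adm.mem_closedForms (h : Adm ν R Rt) {p : ZMod 2} {α : MForm M}
    (hα : α ∈ closedForms M p) : R α ∈ closedForms M p :=
  ⟨h.isSmooth hα.1, h.parity hα.1 hα.2.1, by rw [h.extD hα.1, hα.2.2, h.map_zero]⟩

theorem adm_id : Adm ν (fun η => η) (fun η => η) where
  fam h := h
  famt h := h
  add _ _ := rfl
  smul _ _ _ := rfl
  extD _ := rfl
  parity _ h := h
  homotopic _ := by rw [sub_self]; exact Submodule.zero_mem _
  transpose _ _ := rfl
  int _ _ _ := rfl

theorem Adm.comp (h : Adm ν R Rt) (h' : Adm ν S St) :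
    Adm ν (fun η => R (S η)) (fun η => St (Rt η)) where
  fam hθ := h.fam (h'.fam hθ)
  famt hθ := h'.famt (h.famt hθ)
  add h1 h2 := by rw [h'.add h1 h2, h.add (h'.isSmooth h1) (h'.isSmooth h2)]
  smul c η hη := by rw [h'.smul c hη, h.smul c (h'.isSmooth hη)]
  extD hη := by rw [h.extD (h'.isSmooth hη), h'.extD hη]
  parity hη hp := h.parity (h'.isSmooth hη) (h'.parity hη hp)
  homotopic hα := by
    have := Submodule.add_mem _ (h.homotopic (h'.mem_closedForms hα)) (h'.homotopic hα)
    simpa using this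
  transpose hβ hη := by rw [h.transpose hβ (h'.isSmooth hη), h'.transpose (h.isSmooth_t hβ) hη]
  int hk hθ hz := by
    rw [h'.int hk hθ hz, h.int hk (h'.fam hθ) fun s hs => by rw [hz s hs, h'.map_zero]]

variable [MeasurableSpace G] [BorelSpace G] {μ : Measure G} [IsLocallyFiniteMeasure μ]
  {b : G → ℝ} {k : Set G}

/-- The average of the pull-backs of a form by a family of diffeomorphisms. -/
noncomputable def avg (μ : Measure G) (b : G → ℝ) (F : G → M → M) (η : MForm M) : MForm M :=
  formInt μ (fun _ => 1) (fun z => b z • pullback (F z) η)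

theorem DiffFam.fam_pullback {W : Type*} [NormedAddCommGroup W] [NormedSpace ℝ W]
    (h : DiffFam F F') (hb : ContDiff ℝ ∞ b) {V : Set W} {θ : W → MForm M} (hV : IsOpen V)
    (hθ : Fam V θ) :
    Fam (V ×ˢ univ) (fun q : W × G => b q.2 • pullback (F q.2) (θ q.1)) := by
  refine Fam.param_smul (f := fun q : W × G => b q.2) ?_ (hV.prod isOpen_univ)
    (hb.comp contDiff_snd).contDiffOn
  intro q hq x
  refine SmAt.pullback (F := fun q : W × G => F q.2) (θ := fun q : W × G => θ q.1) ?_ ?_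
  · exact h.smooth.comp (ContMDiff.prodMk
      ((contDiff_snd (𝕜 := ℝ) (E := W) (F := G)).contMDiff.comp contMDiff_fst) contMDiff_snd)
  · exact SmAt.param (g := fun q : W × G => q.1) (hθ q.1 hq.1 _) contDiffAt_fst

theorem DiffFam.fam_pullback_const (h : DiffFam F F') (hb : ContDiff ℝ ∞ b) {η : MForm M}
    (hη : IsSmooth η) : Fam univ (fun z => b z • pullback (F z) η) :=
  Fam.left (V := (univ : Set ℝ)) (θ := fun _ z => b z • pullback (F z) η)
    (h.fam_pullback hb isOpen_univ (hη.fam _)) (mem_univ 0)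

/-- Each property holds for a single pull-back and survives averaging. The homotopy to the identity
is the average of the homotopies `hmt`, where the total mass `1` of `b` is needed; the transpose
averages the inverse maps; `int` is Fubini. -/
theorem DiffFam.adm (h : DiffFam F F') (hν : IsVolumeForm ν) (hb : ContDiff ℝ ∞ b)
    (hk : IsCompact k) (hbz : ∀ z ∉ k, b z = 0) (h1 : ∫ z, b z ∂μ = 1) :
    Adm ν (avg μ b F) (avg μ b F') := by
  have hc : LocallyIntegrable (fun _ : G => (1 : ℝ)) μ := locallyIntegrable_const 1
  have hz : ∀ (F : G → M → M) (η : MForm M), ∀ z ∉ k, b z • pullback (F z) η = 0 := fun F η z hz => by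
    rw [hbz z hz, zero_smul]
  have hfam : ∀ {F F' : G → M → M}, DiffFam F F' → ∀ {θ : E → MForm M}, Fam univ θ →
      Fam univ (fun s => avg μ b F (θ s)) := fun h θ hθ =>
    Fam.formInt isOpen_univ hc hk (h.fam_pullback hb isOpen_univ hθ) fun s _ => hz _ (θ s)
  have hint : ∀ {F F' : G → M → M}, DiffFam F F' → ∀ {η : MForm M}, IsSmooth η → ∀ x,
      Integrable (fun z => (1 : ℝ) • (b z • pullback (F z) η) x) μ := fun h η hη x =>
    integrable_smul_of_zero hc hk ((h.fam_pullback_const hb hη).continuous_apply x)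
      fun s hs => by rw [hz _ _ s hs]; rfl
  refine ⟨hfam h, hfam h.symm, ?_, ?_, ?_, ?_, ?_, ?_, ?_⟩
  · intro η η' hη hη'
    funext x
    rw [Pi.add_apply, avg, avg, avg, formInt, formInt, formInt,
      ← MeasureTheory.integral_add (hint h hη x) (hint h hη' x)]
    congr 1
    funext z
    simp [pullback]
  · intro c η hη
    funext x
    rw [Pi.smul_apply, avg, avg, formInt, formInt, ← MeasureTheory.integral_smul]
    congr 1
    funext z
    simp [pullback, smul_comm c]
  · intro η hη
    rw [avg, extD_formInt hc hk (h.fam_pullback_const hb hη) (hz F η), avg]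
    congr 1
    funext z
    rw [extD_smul _ (hη.pullback (h.slice z)), extD_pullback (h.slice z) hη]
  · intro p η hη hp
    refine HasParity.formInt hc hk (h.fam_pullback_const hb hη) (hz F η) fun z => ?_
    rw [hasParity_iff] at hp ⊢
    intro x
    have hr : ∀ a, inv (pullAt (F z) x a) = pullAt (F z) x (inv a) := inv_pb _
    simp only [Pi.smul_apply, pullback, map_smul, hr, hp]
    rw [smul_comm]
  · intro p α hα
    have hfm := (Fam.hmt h.path_smooth hα.1).param_smul isOpen_univ hb.contDiffOn
    have hz' : ∀ z ∉ k, b z • hmt (DiffFam.path F) α z = 0 := fun z hz => by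
      rw [hbz z hz, zero_smul]
    refine ⟨formInt μ (fun _ => 1) (fun z => b z • hmt (DiffFam.path F) α z),
      isSmooth_formInt hc hk hfm hz', HasParity.formInt hc hk hfm hz' fun z x =>
        Submodule.smul_mem _ _ (HasParity.hmt h.path_smooth hα.1 hα.2.1 z x), ?_⟩
    rw [extD_formInt hc hk hfm hz']
    have e1 : ∀ z, extD (b z • hmt (DiffFam.path F) α z) = b z • (pullback (F z) α - α) := by
      intro z
      rw [extD_smul _ ((Fam.hmt h.path_smooth hα.1).isSmooth (mem_univ z)),
        h.extD_hmt hα.1 hα.2.2]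
    simp only [e1]
    funext x
    have hbi : Integrable (fun z => b z) μ := by
      simpa using integrable_smul_of_zero hc hk hb.continuous hbz
    have e2 : α x = ∫ z, (1 : ℝ) • (b z • α x) ∂μ := by
      simp only [one_smul]
      rw [integral_smul_const, h1, one_smul]
    rw [Pi.sub_apply, avg, formInt, formInt, e2, ← MeasureTheory.integral_sub (hint h hα.1 x)
      (by simpa using hbi.smul_const (α x))]
    congr 1
    funext z
    simp [smul_sub]
  · intro β η hβ hη
    rw [avg, avg, ip_formInt hν hβ continuous_const hk (h.fam_pullback_const hb hη) (hz F η),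
      ip_formInt_left hν hη continuous_const hk (h.symm.fam_pullback_const hb hβ) (hz F' β)]
    congr 1
    funext z
    rw [ip_smul_right, ip_smul_left, h.ip_pullback hν hβ hη]
  · intro k' θ hk' hθ hzθ
    have hcE : LocallyIntegrable (fun _ : E => (1 : ℝ)) volume := locallyIntegrable_const 1
    have hfam2 := h.fam_pullback hb isOpen_univ hθ
    rw [univ_prod_univ] at hfam2
    funext x
    have e1 : ∀ z, (1 : ℝ) • (b z • pullback (F z) (formInt volume (fun _ => 1) θ)) x =
        ∫ s, b z • pullback (F z) (θ s) x := by
      intro z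
      have hi := integrable_smul_of_zero hcE hk' (hθ.continuous_apply (F z x))
        fun s hs => by rw [hzθ s hs]; rfl
      have h3 := (pbL (mfderiv (𝓡 6) (𝓡 6) (F z) x)).integral_comp_comm hi
      rw [one_smul, MeasureTheory.integral_smul]
      refine congrArg (b z • ·) (h3.symm.trans ?_)
      simp only [one_smul]
      rfl
    have e2 : ∀ s, (1 : ℝ) • avg μ b F (θ s) x = ∫ z, b z • pullback (F z) (θ s) x ∂μ := by
      intro s
      rw [one_smul, avg, formInt]
      simp only [one_smul]
      rfl
    rw [avg, formInt, formInt]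
    simp only [e1, e2]
    refine integral_integral_swap_of_hasCompactSupport
      (f := fun z s => b z • pullback (F z) (θ s) x) ?_ ?_
    · exact (hfam2.continuous_apply x).comp (continuous_snd.prodMk continuous_fst)
    · refine hasCompactSupport_of_zero (hk.prod hk') ?_
      rintro ⟨z, s⟩ hzs
      by_cases hs : s ∈ k'
      · have : z ∉ k := fun hz' => hzs ⟨hz', hs⟩
        simp only [Function.uncurry, hbz z this, zero_smul]
      · have : pullback (F z) (0 : MForm M) x = 0 := map_zero (pullAt (F z) x)
        simp only [Function.uncurry, hzθ s hs, this, smul_zero]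

end Averaging

end GenCY

namespace GenCY
set_option linter.unusedSectionVars false

/-! ## Local diffeomorphisms -/

-- A perturbation of the identity by a contraction is a global homeomorphism. Its derivative `1 +
-- Dg` is invertible by the Neumann series, so the inverse is smooth.
open scoped NNReal in
theorem exists_smooth_inverse {X : Type*} [NormedAddCommGroup X] [NormedSpace ℝ X]
    [FiniteDimensional ℝ X] [Nontrivial X] {g : X → X} {c : ℝ≥0} (hg : ContDiff ℝ ∞ g) (hL : LipschitzWith c g)
    (hc : c < 1) : ∃ Ψ : X → X, ContDiff ℝ ∞ Ψ ∧ (∀ x, Ψ (x + g x) = x) ∧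
      ∀ y, Ψ y + g (Ψ y) = y := by
  have := FiniteDimensional.complete ℝ X
  set f : X → X := fun x => x + g x with hf
  have happ : ApproximatesLinearOn f ((ContinuousLinearEquiv.refl ℝ X : X ≃L[ℝ] X) : X →L[ℝ] X)
      univ c := by
    intro x _ y _
    have : f x - f y - (x - y) = g x - g y := by simp only [hf]; abel
    have h2 := hL.dist_le_mul x y
    rw [dist_eq_norm, dist_eq_norm] at h2
    simpa [this] using h2
  have hN : c < ‖((ContinuousLinearEquiv.refl ℝ X).symm : X →L[ℝ] X)‖₊⁻¹ := by
    have : ‖((ContinuousLinearEquiv.refl ℝ X).symm : X →L[ℝ] X)‖₊ = 1 := by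
      ext
      exact ContinuousLinearMap.norm_id
    rw [this, inv_one]; exact hc
  let h := happ.toHomeomorph f (Or.inr hN)
  have hcoe : ∀ x, h x = f x := fun x => rfl
  have hnorm : ∀ a, ‖-fderiv ℝ g a‖ < 1 := fun a => by
    rw [norm_neg]
    exact (norm_fderiv_le_of_lipschitz ℝ hL).trans_lt (by exact_mod_cast hc)
  have hder : ∀ a, HasFDerivAt h ((ContinuousLinearEquiv.unitsEquiv ℝ X
      (Units.oneSub (-fderiv ℝ g a) (hnorm a)) : X ≃L[ℝ] X) : X →L[ℝ] X) a := by
    intro a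
    have h1 := (hasFDerivAt_id a).add (hg.differentiable (by simp) a).hasFDerivAt
    refine h1.congr_fderiv ?_
    ext v
    simp [ContinuousLinearEquiv.unitsEquiv_apply, Units.oneSub]
  refine ⟨h.symm, h.contDiff_symm hder ?_, fun x => h.symm_apply_apply x, fun y =>
    h.apply_symm_apply y⟩
  exact contDiff_id.add hg

/-! ### Families of diffeomorphisms that are translations near a point in a chart. -/

section Glue

variable {M : Type*} [TopologicalSpace M] [ChartedSpace E M] [IsManifold (𝓡 6) ∞ M] [T2Space M]

/-- The chart at `x₀`. -/
local notation "ch" => extChartAt (𝓡 6) (M := M) (H := E)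

open Classical in
/-- The family of maps of `M` given in a chart by `φ`, and by the identity outside the chart. -/
noncomputable def glue (i : M) (φ : E → E → E) (z : E) (x : M) : M :=
  if x ∈ (ch i).source then (ch i).symm (φ z (ch i x)) else x

theorem glue_of_mem {i x : M} (hx : x ∈ (ch i).source) (φ : E → E → E) (z : E) :
    glue i φ z x = (ch i).symm (φ z (ch i x)) := if_pos hx

theorem glue_of_notMem {i x : M} (hx : x ∉ (ch i).source) (φ : E → E → E) (z : E) :
    glue i φ z x = x := if_neg hx

variable {i : M} {C : Set E} {φ ψ : E → E → E}

theorem mapsTo_target (hCt : C ⊆ (ch i).target) (h1 : ∀ z, ∀ y ∉ C, φ z y = y)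
    (h2 : ∀ z, ∀ y ∈ C, φ z y ∈ C) (z : E) {y : E} (hy : y ∈ (ch i).target) :
    φ z y ∈ (ch i).target := by
  by_cases h : y ∈ C
  · exact hCt (h2 z y h)
  · rwa [h1 z y h]

/-- Inside the chart the map is `φ` conjugated by the chart. Points outside the chart domain have
neighbourhoods avoiding the compact image of `C`, where the map is the identity. -/
theorem glue_smooth (hC : IsCompact C) (hCt : C ⊆ (ch i).target)
    (hφ : ContDiff ℝ ∞ (fun q : E × E => φ q.1 q.2)) (h1 : ∀ z, ∀ y ∉ C, φ z y = y)
    (h2 : ∀ z, ∀ y ∈ C, φ z y ∈ C) :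
    ContMDiff (𝓘(ℝ, E).prod (𝓡 6)) (𝓡 6) ∞ (fun q : E × M => glue i φ q.1 q.2) := by
  rintro ⟨z, x⟩
  by_cases hx : x ∈ (ch i).source
  · have hy := (ch i).map_source hx
    have e : ContMDiffAt (𝓘(ℝ, E).prod (𝓡 6)) (𝓡 6) ∞
        (fun q : E × M => (ch i).symm (φ q.1 (ch i q.2))) (z, x) := by
      have a1 : ContMDiffAt (𝓘(ℝ, E).prod (𝓡 6)) 𝓘(ℝ, E × E) ∞
          (fun q : E × M => (q.1, ch i q.2)) (z, x) := by
        have hx' := hx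
        rw [extChartAt_source] at hx'
        exact contMDiffAt_fst.prodMk_space
          ((contMDiffAt_extChartAt' (n := ∞) hx').comp (z, x) contMDiffAt_snd)
      have a2 := (hφ.contMDiff.contMDiffAt (x := (z, ch i x))).comp (z, x) a1
      exact ContMDiffAt.comp (z, x) (contMDiffAt_chart_symm (mapsTo_target hCt h1 h2 z hy)) a2
    refine e.congr_of_eventuallyEq ?_
    filter_upwards [(continuousAt_snd (p := (z, x))).eventually
      ((isOpen_extChartAt_source i).mem_nhds hx)] with q hq
    exact glue_of_mem hq φ q.1
  · have hK : IsCompact ((ch i).symm '' C) :=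
      hC.image_of_continuousOn ((continuousOn_extChartAt_symm i).mono hCt)
    have hxK : x ∉ (ch i).symm '' C := by
      rintro ⟨y, hy, rfl⟩
      exact hx ((ch i).map_target (hCt hy))
    have e : ContMDiffAt (𝓘(ℝ, E).prod (𝓡 6)) (𝓡 6) ∞ (fun q : E × M => q.2) (z, x) :=
      contMDiffAt_snd
    refine e.congr_of_eventuallyEq ?_
    filter_upwards [(continuousAt_snd (p := (z, x))).eventually
      (hK.isClosed.isOpen_compl.mem_nhds hxK)] with q hq
    by_cases hqs : q.2 ∈ (ch i).source
    · rw [glue_of_mem hqs, h1, (ch i).left_inv hqs]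
      exact fun h => hq ⟨_, h, (ch i).left_inv hqs⟩
    · exact glue_of_notMem hqs φ q.1

theorem glue_glue (hCt : C ⊆ (ch i).target) (h1 : ∀ z, ∀ y ∉ C, φ z y = y)
    (h2 : ∀ z, ∀ y ∈ C, φ z y ∈ C) (h : ∀ z y, ψ z (φ z y) = y) (z : E) (x : M) :
    glue i ψ z (glue i φ z x) = x := by
  by_cases hx : x ∈ (ch i).source
  · have ht := mapsTo_target hCt h1 h2 z ((ch i).map_source hx)
    rw [glue_of_mem hx, glue_of_mem ((ch i).map_target ht), (ch i).right_inv ht, h,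
      (ch i).left_inv hx]
  · rw [glue_of_notMem hx, glue_of_notMem hx]

/-- A family of diffeomorphisms which acts by the translations by `δ z` near `i` in a chart. -/
structure LocalTranslations (i : M) (δ r : ℝ) (Φ : E → E → E) (F F' : E → M → M) : Prop where
  δ_pos : 0 < δ
  r_pos : 0 < r
  fam : DiffFam F F'
  ball : Metric.closedBall (ch i i) r ⊆ (ch i).target
  off : ∀ z, ∀ x ∉ (ch i).source, F z x = x
  chart : ∀ z, ∀ y ∈ (ch i).target, Φ z y ∈ (ch i).target ∧ F z ((ch i).symm y) = (ch i).symm (Φ z y)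
  transl : ∀ z, ∀ y ∈ Metric.ball (ch i i) r, ‖z‖ ≤ 2 → Φ z y = y + δ • z
  near : ∀ z y, ‖Φ z y - y‖ ≤ δ * ‖z‖

/-- Take `Φ z y = y + δ χ(y) b(z) z` with cut-offs `χ` and `b`. The perturbation is compactly
supported in `(z, y)`, hence Lipschitz, so for small `δ` the map `(z, y) ↦ (z, Φ z y)` is
invertible, smoothly in both variables together. -/
theorem exists_localTranslations (i : M) :
    ∃ δ r Φ F F', LocalTranslations (M := M) i δ r Φ F F' := by
  set p := ch i i
  obtain ⟨r₀, hr₀, hr₀t⟩ := Metric.isOpen_iff.1 (isOpen_extChartAt_target i) p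
    (mem_extChartAt_target i)
  let χ : ContDiffBump p := ⟨r₀ / 4, r₀ / 2, by positivity, by linarith⟩
  -- The value `1` is kept up to norm `2` so that sums of two vectors of norm at most `1` still act
  -- as translations.
  let b : ContDiffBump (0 : E) := ⟨2, 3, by norm_num, by norm_num⟩
  set C := Metric.closedBall p (r₀ / 2) with hCdef
  have hC : IsCompact C := isCompact_closedBall _ _
  have hCt : C ⊆ (ch i).target :=
    (Metric.closedBall_subset_ball (by linarith)).trans hr₀t
  have hχ0 : ∀ y ∉ C, χ y = 0 := fun y hy => by
    have : y ∉ tsupport χ := by rwa [χ.tsupport_eq]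
    exact image_eq_zero_of_notMem_tsupport this
  have hb0 : ∀ z ∉ Metric.closedBall (0 : E) 3, b z = 0 := fun y hy => by
    have : y ∉ tsupport b := by rwa [b.tsupport_eq]
    exact image_eq_zero_of_notMem_tsupport this
  set g₀ : E × E → E × E := fun q => (0, χ q.2 • b q.1 • q.1) with hg₀
  have hg₀s : ContDiff ℝ ∞ g₀ := contDiff_const.prodMk
    ((χ.contDiff.comp contDiff_snd).smul ((b.contDiff.comp contDiff_fst).smul contDiff_fst))
  have hg₀c : HasCompactSupport g₀ := by
    refine hasCompactSupport_of_zero ((isCompact_closedBall (0 : E) 3).prod hC) ?_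
    rintro ⟨z, y⟩ h
    by_cases hz : z ∈ Metric.closedBall (0 : E) 3
    · have : y ∉ C := fun hy => h ⟨hz, hy⟩
      simp [hg₀, hχ0 y this]
    · simp [hg₀, hb0 z hz]
  obtain ⟨c, hc⟩ := hg₀s.lipschitzWith_of_hasCompactSupport hg₀c (by simp)
  -- Chosen so that `δ c < 1` for the Lipschitz constant `c` of the unscaled perturbation.
  set δ : ℝ := (2 * (c + 1))⁻¹ with hδ
  have hδpos : 0 < δ := by positivity
  set Φ : E → E → E := fun z y => y + δ • χ y • b z • z with hΦ
  have hgs : ContDiff ℝ ∞ (fun q => δ • g₀ q) := hg₀s.const_smul δ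
  have hgL : LipschitzWith (‖δ‖₊ * c) (fun q => δ • g₀ q) :=
    LipschitzWith.of_dist_le_mul fun q q' => by
      rw [dist_smul₀, NNReal.coe_mul, mul_assoc]
      exact mul_le_mul_of_nonneg_left (hc.dist_le_mul q q') (norm_nonneg _)
  have hlt : ‖δ‖₊ * c < 1 := by
    rw [← NNReal.coe_lt_coe, NNReal.coe_mul, coe_nnnorm, Real.norm_of_nonneg hδpos.le,
      NNReal.coe_one, hδ, inv_mul_lt_iff₀ (by positivity)]
    linarith [c.coe_nonneg]
  obtain ⟨Ψ, hΨs, hΨ1, hΨ2⟩ := exists_smooth_inverse hgs hgL hlt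
  have hsum : ∀ z y, (z, y) + δ • g₀ (z, y) = (z, Φ z y) := by
    intro z y; simp [hg₀, hΦ]
  have hΨfst : ∀ q, (Ψ q).1 = q.1 := by
    intro q
    have := congrArg Prod.fst (hΨ2 q)
    simpa [hg₀] using this
  set Φ' : E → E → E := fun z y => (Ψ (z, y)).2 with hΦ'
  have hl : ∀ z y, Φ' z (Φ z y) = y := by
    intro z y
    have := hΨ1 (z, y)
    rw [hsum] at this
    simp only [hΦ', this]
  have hr : ∀ z y, Φ z (Φ' z y) = y := by
    intro z y
    have h1 := hΨ2 (z, y)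
    have h2 : Ψ (z, y) = (z, Φ' z y) := Prod.ext (hΨfst _) rfl
    rw [h2, hsum] at h1
    exact congrArg Prod.snd h1
  have hΦs : ContDiff ℝ ∞ (fun q : E × E => Φ q.1 q.2) := by
    have := contDiff_snd.comp (contDiff_id.add hgs)
    exact (funext fun q => (congrArg Prod.snd (hsum q.1 q.2)).symm :
      (fun q : E × E => Φ q.1 q.2) = _) ▸ this
  have hΦ's : ContDiff ℝ ∞ (fun q : E × E => Φ' q.1 q.2) := contDiff_snd.comp hΨs
  have hf1 : ∀ z, ∀ y ∉ C, Φ z y = y := fun z y hy => by simp [hΦ, hχ0 y hy]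
  have hf1' : ∀ z, ∀ y ∉ C, Φ' z y = y := fun z y hy => by
    have := hl z y
    rwa [hf1 z y hy] at this
  -- A point of `C` sent outside `C` would be fixed by the inverse map, and so would not have come
  -- from `C`.
  have hf2 : ∀ z, ∀ y ∈ C, Φ z y ∈ C := by
    intro z y hy
    by_contra h
    have h1 := hf1' z _ h
    rw [hl] at h1
    exact h (h1 ▸ hy)
  have hf2' : ∀ z, ∀ y ∈ C, Φ' z y ∈ C := by
    intro z y hy
    by_contra h
    have h1 := hf1 z _ h
    rw [hr] at h1
    exact h (h1 ▸ hy)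
  refine ⟨δ, r₀ / 4, Φ, glue i Φ, glue i Φ', hδpos, by positivity, ⟨?_, ?_, ?_, ?_, ?_⟩, ?_, ?_, ?_,
    ?_, ?_⟩
  · exact glue_smooth hC hCt hΦs hf1 hf2
  · exact glue_smooth hC hCt hΦ's hf1' hf2'
  · exact glue_glue hCt hf1 hf2 hl
  · exact glue_glue hCt hf1' hf2' hr
  · intro x
    by_cases hx : x ∈ (ch i).source
    · rw [glue_of_mem hx]
      have h0 : Φ 0 (ch i x) = ch i x := by simp [hΦ]
      rw [h0, (ch i).left_inv hx]
    · exact glue_of_notMem hx _ _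
  · exact (Metric.closedBall_subset_closedBall (by linarith)).trans hCt
  · exact fun z x hx => glue_of_notMem hx _ _
  · intro z y hy
    refine ⟨mapsTo_target hCt hf1 hf2 z hy, ?_⟩
    rw [glue_of_mem ((ch i).map_target hy), (ch i).right_inv hy]
  · intro z y hy hz
    have h1 : χ y = 1 := χ.one_of_mem_closedBall (Metric.ball_subset_closedBall hy)
    have h2 : b z = 1 := b.one_of_mem_closedBall (by simpa using hz)
    simp [hΦ, h1, h2]
  · intro z y
    have : Φ z y - y = δ • χ y • b z • z := by simp [hΦ]
    rw [this, norm_smul, norm_smul, norm_smul, Real.norm_of_nonneg hδpos.le,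
      Real.norm_of_nonneg χ.nonneg, Real.norm_of_nonneg b.nonneg]
    have h1 : χ y * (b z * ‖z‖) ≤ 1 * (1 * ‖z‖) :=
      mul_le_mul χ.le_one (mul_le_mul_of_nonneg_right b.le_one (norm_nonneg _))
        (mul_nonneg b.nonneg (norm_nonneg _)) zero_le_one
    rw [one_mul, one_mul] at h1
    exact mul_le_mul_of_nonneg_left h1 hδpos.le

theorem DiffFam.comp_linear {G : Type*} [NormedAddCommGroup G] [NormedSpace ℝ G]
    {F F' : E → M → M} (h : DiffFam F F') (L : G →L[ℝ] E) :
    DiffFam (fun z => F (L z)) (fun z => F' (L z)) where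
  smooth := h.smooth.comp ((L.contDiff.contMDiff.comp contMDiff_fst).prodMk contMDiff_snd)
  smooth' := h.smooth'.comp ((L.contDiff.contMDiff.comp contMDiff_fst).prodMk contMDiff_snd)
  left_inv z := h.left_inv _
  right_inv z := h.right_inv _
  zero x := by rw [map_zero]; exact h.zero x

end Glue

end GenCY

namespace GenCY
set_option linter.unusedSectionVars false

/-! ## Smoothing operators -/

section SmoothingOps

open MeasureTheory

variable {M : Type*} [TopologicalSpace M] [ChartedSpace E M] [IsManifold (𝓡 6) ∞ M]
  [CompactSpace M] [T2Space M] {ν : MForm M}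

/-- The chart at `x₀`. -/
local notation "ch" => extChartAt (𝓡 6) (M := M) (H := E)

/-- Operators which are integrals of smooth families of operators of rank one. -/
def Smoothing (ν : MForm M) (S : MForm M → MForm M) : Prop :=
  ∃ (ι : Type) (_ : Fintype ι) (k β : ι → E → MForm M) (K : Set E), IsCompact K ∧
    (∀ a, Fam univ (k a)) ∧ (∀ a, Fam univ (β a)) ∧ (∀ a, ∀ s ∉ K, k a s = 0) ∧
    ∀ η, IsSmooth η → S η = ∑ a, formInt volume (fun _ => 1) (fun s => ip ν (β a s) η • k a s)

theorem Fam.ip_smul (hν : IsVolumeForm ν) {k β : E → MForm M} (hk : Fam univ k) (hβ : Fam univ β)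
    {η : MForm M} (hη : IsSmooth η) : Fam univ (fun s => ip ν (β s) η • k s) :=
  hk.param_smul isOpen_univ (contDiffOn_ip hν isOpen_univ hβ (hη.fam _))

variable {R Rt S S' T Tt : MForm M → MForm M}

theorem Smoothing.congr (h : Smoothing ν S) (he : ∀ η, IsSmooth η → S' η = S η) :
    Smoothing ν S' := by
  obtain ⟨ι, i1, k, β, K, h1, h2, h3, h4, h5⟩ := h
  exact ⟨ι, i1, k, β, K, h1, h2, h3, h4, fun η hη => (he η hη).trans (h5 η hη)⟩

theorem smoothing_zero : Smoothing ν (fun _ => 0) :=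
  ⟨Empty, inferInstance, fun a => a.elim, fun a => a.elim, ∅, isCompact_empty, fun a => a.elim,
    fun a => a.elim, fun a => a.elim, fun _ _ => by simp⟩

theorem Smoothing.add (h : Smoothing ν S) (h' : Smoothing ν S') :
    Smoothing ν (fun η => S η + S' η) := by
  obtain ⟨ι, i1, k, β, K, h1, h2, h3, h4, h5⟩ := h
  obtain ⟨ι', i1', k', β', K', h1', h2', h3', h4', h5'⟩ := h'
  refine ⟨ι ⊕ ι', inferInstance, Sum.elim k k', Sum.elim β β', K ∪ K', h1.union h1', ?_, ?_, ?_, ?_⟩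
  · rintro (a | a)
    exacts [h2 a, h2' a]
  · rintro (a | a)
    exacts [h3 a, h3' a]
  · rintro (a | a) s hs
    exacts [h4 a s fun h => hs (.inl h), h4' a s fun h => hs (.inr h)]
  · intro η hη
    dsimp only
    rw [Fintype.sum_sum_type, h5 η hη, h5' η hη]
    rfl

theorem Adm.map_sum (h : Adm ν R Rt) {ι : Type*} (s : Finset ι) {θ : ι → MForm M}
    (hθ : ∀ a, IsSmooth (θ a)) : R (∑ a ∈ s, θ a) = ∑ a ∈ s, R (θ a) := by
  classical
  induction s using Finset.induction_on with
  | empty => simpa using h.map_zero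
  | insert a s ha ih =>
    rw [Finset.sum_insert ha, Finset.sum_insert ha, h.add (hθ a) (IsSmooth.sum s fun a _ => hθ a), ih]

theorem Smoothing.adm_comp (hν : IsVolumeForm ν) (h : Adm ν R Rt) (hS : Smoothing ν S) :
    Smoothing ν (fun η => R (S η)) := by
  obtain ⟨ι, i1, k, β, K, h1, h2, h3, h4, h5⟩ := hS
  refine ⟨ι, i1, fun a s => R (k a s), β, K, h1, fun a => h.fam (h2 a), h3, fun a s hs => by
    simp only [h4 a s hs, h.map_zero], fun η hη => ?_⟩
  have hf : ∀ a, Fam univ (fun s => ip ν (β a s) η • k a s) := fun a => (h2 a).ip_smul hν (h3 a) hη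
  have hz : ∀ a, ∀ s ∉ K, ip ν (β a s) η • k a s = 0 := fun a s hs => by
    rw [h4 a s hs, smul_zero]
  dsimp only
  rw [h5 η hη, h.map_sum _ fun a => isSmooth_formInt (locallyIntegrable_const 1) h1 (hf a) (hz a)]
  refine Finset.sum_congr rfl fun a _ => ?_
  rw [h.int h1 (hf a) (hz a)]
  congr 1
  funext s
  exact h.smul _ ((h2 a).isSmooth (mem_univ s))

/-- Precomposition only alters the covectors `β`, through the transpose of `T`, and the transpose
preserves smooth families. -/
theorem Smoothing.comp (hS : Smoothing ν S) (hT : ∀ η, IsSmooth η → IsSmooth (T η))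
    (hTt : ∀ θ : E → MForm M, Fam univ θ → Fam univ (fun s => Tt (θ s)))
    (ht : ∀ β η, IsSmooth β → IsSmooth η → ip ν β (T η) = ip ν (Tt β) η) :
    Smoothing ν (fun η => S (T η)) := by
  obtain ⟨ι, i1, k, β, K, h1, h2, h3, h4, h5⟩ := hS
  refine ⟨ι, i1, k, fun a s => Tt (β a s), K, h1, h2, fun a => hTt _ (h3 a), h4, fun η hη => ?_⟩
  dsimp only
  rw [h5 _ (hT η hη)]
  refine Finset.sum_congr rfl fun a _ => ?_
  congr 1
  funext s
  rw [ht _ _ ((h3 a).isSmooth (mem_univ s)) hη]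

theorem Smoothing.comp_adm (hS : Smoothing ν S) (h : Adm ν R Rt) :
    Smoothing ν (fun η => S (R η)) :=
  hS.comp (fun _ => h.isSmooth) (fun _ => h.famt) fun _ _ => h.transpose

theorem Fam.fun_smul {W : Type*} [NormedAddCommGroup W] [NormedSpace ℝ W] {V : Set W}
    {θ : W → MForm M} (hθ : Fam V θ) {ψ : M → ℝ} (hψ : ContMDiff (𝓡 6) 𝓘(ℝ, ℝ) ∞ ψ) :
    Fam V (fun s x => ψ x • θ s x) := fun s hs x =>
  SmAt.fun_smul (f := fun _ x => ψ x) ((hψ x).comp (s, x) contMDiffAt_snd) (hθ s hs x)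

theorem IsSmooth.fun_smul {η : MForm M} (hη : IsSmooth η) {ψ : M → ℝ}
    (hψ : ContMDiff (𝓡 6) 𝓘(ℝ, ℝ) ∞ ψ) : IsSmooth (fun x => ψ x • η x) :=
  (Fam.fun_smul (hη.fam (univ : Set ℝ)) hψ).isSmooth (mem_univ 0)

theorem Smoothing.comp_fun_smul (hS : Smoothing ν S) {ψ : M → ℝ}
    (hψ : ContMDiff (𝓡 6) 𝓘(ℝ, ℝ) ∞ ψ) : Smoothing ν (fun η => S (fun x => ψ x • η x)) :=
  hS.comp (T := fun η x => ψ x • η x) (Tt := fun η x => ψ x • η x) (fun _ h => h.fun_smul hψ)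
    (fun _ h => h.fun_smul hψ) fun β η _ _ => ip_fun_smul ψ β η

/-! ## Convolution in a chart -/

/-- The kernel of the average of the translations by `δ t`, with density `b` in `t`. -/
noncomputable def ker (δ : ℝ) (b : E → ℝ) (u : E) : ℝ := (δ ^ 6)⁻¹ * b (δ⁻¹ • u)

/-- Substitute `s = y + δ t`; the Jacobian `δ⁶` accounts for the factor in `ker`. -/
theorem integral_translate {F : Type*} [NormedAddCommGroup F] [NormedSpace ℝ F] {δ : ℝ} (hδ : 0 < δ)
    (b : E → ℝ) (f : E → F) (y : E) :
    ∫ t, b t • f (y + δ • t) = ∫ s, ker δ b (s - y) • f s := by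
  have h1 := Measure.integral_comp_smul (volume : Measure E)
    (fun u => ker δ b u • f (y + u)) δ
  have h2 : ∫ s, ker δ b (s - y) • f s = ∫ u, ker δ b u • f (y + u) := by
    rw [← integral_sub_right_eq_self (fun u => ker δ b u • f (y + u)) y]
    congr 1
    funext s
    rw [add_sub_cancel]
  have hd : Module.finrank ℝ E = 6 := by simp
  rw [h2]
  have h3 : ∀ t : E, b t • f (y + δ • t) = δ ^ 6 • (ker δ b (δ • t) • f (y + δ • t)) := by
    intro t
    rw [smul_smul, ker, ← mul_assoc, mul_inv_cancel₀ (by positivity), one_mul, smul_smul,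
      inv_mul_cancel₀ hδ.ne', one_smul]
  simp only [h3]
  rw [MeasureTheory.integral_smul, h1, hd, abs_of_pos (by positivity), smul_smul,
    mul_inv_cancel₀ (by positivity), one_smul]

theorem ker_eq_zero {δ ρ : ℝ} (hδ : 0 < δ) {b : E → ℝ} (hb : ∀ z, ρ < ‖z‖ → b z = 0) {u : E}
    (hu : δ * ρ < ‖u‖) : ker δ b u = 0 := by
  rw [ker, hb, mul_zero]
  rwa [norm_smul, Real.norm_of_nonneg (by positivity), lt_inv_mul_iff₀ hδ]

theorem contDiff_ker (δ : ℝ) {b : E → ℝ} (hb : ContDiff ℝ ∞ b) : ContDiff ℝ ∞ (ker δ b) :=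
  contDiff_const.mul (hb.comp (contDiff_const_smul δ⁻¹))

/-- A non-degenerate pairing on a finite-dimensional space represents every functional. It is used
to write the coordinates of a form as pairings. -/
theorem exists_pairing_eq (l : Lam →ₗ[ℝ] ℝ) : ∃ b : Lam, ∀ a, pairing b a = l a := by
  let P : Lam →ₗ[ℝ] Module.Dual ℝ Lam := LinearMap.mk₂ ℝ pairing
    (fun a b c => by simp [pairing, add_mul]) (fun r a b => by simp [pairing])
    (fun a b c => by simp [pairing, mul_add]) (fun r a b => by simp [pairing])
  have hinj : Function.Injective P := by
    rw [injective_iff_map_eq_zero]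
    intro a ha
    exact pairing_nondeg a fun b => LinearMap.congr_fun ha b
  have := (LinearMap.injective_iff_surjective_of_finrank_eq_finrank
    (Subspace.dual_finrank_eq (K := ℝ) (V := Lam)).symm).1 hinj l
  obtain ⟨b, hb⟩ := this
  exact ⟨b, fun a => LinearMap.congr_fun hb a⟩

end SmoothingOps

end GenCY

namespace GenCY
set_option linter.unusedSectionVars false
-- Averages of local translations are smoothing operators.
section SmoothingOps
open MeasureTheory
variable {M : Type*} [TopologicalSpace M] [ChartedSpace E M] [IsManifold (𝓡 6) ∞ M]
  [CompactSpace M] [T2Space M] {ν : MForm M}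
/-- The chart at `x₀`. -/
local notation "ch" => extChartAt (𝓡 6) (M := M) (H := E)

variable {i : M} {δ r : ℝ} {Φ : E → E → E} {F F' : E → M → M} {A : Set M} {ε : ℝ}

theorem contDiff_of_target {G : Type*} [NormedAddCommGroup G] [NormedSpace ℝ G] {C : Set E}
    (hC : IsCompact C) (hCt : C ⊆ (ch i).target) {g : E → G} (hg : ∀ y ∉ C, g y = 0)
    (hs : ∀ y ∈ (ch i).target, ContDiffAt ℝ ∞ g y) : ContDiff ℝ ∞ g := by
  rw [contDiff_iff_contDiffAt]
  intro y
  by_cases hy : y ∈ (ch i).target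
  · exact hs y hy
  · refine (contDiffAt_const (c := (0 : G))).congr_of_eventuallyEq ?_
    filter_upwards [hC.isClosed.isOpen_compl.mem_nhds fun h => hy (hCt h)] with y' hy'
    exact hg y' hy'

/-- For `y` in the ball the map is a translation around `y`, so its derivative is the identity.
Otherwise both sides vanish: a point of the image of `A` within distance `ε` of `y` would put `y` in
the `ε`-thickening, which lies in the ball. -/
theorem LocalTranslations.chartRep_pullback (h : LocalTranslations i δ r Φ F F')
    (hε : Metric.cthickening ε (ch i '' A) ⊆ Metric.ball (ch i i) r)
    {θ : MForm M} (hz : ∀ x ∉ A, θ x = 0) {z : E} (hz2 : ‖z‖ ≤ 2) (hzε : δ * ‖z‖ ≤ ε) {y : E}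
    (hy : y ∈ (ch i).target) :
    chartRep i (pullback (F z) θ) y = (ch i).target.indicator (chartRep i θ) (y + δ • z) := by
  have hbt : Metric.ball (ch i i) r ⊆ (ch i).target := Metric.ball_subset_closedBall.trans h.ball
  have hFy : F z ((ch i).symm y) ∈ (ch i).source := by
    rw [(h.chart z y hy).2]
    exact (ch i).map_target (h.chart z y hy).1
  by_cases hyb : y ∈ Metric.ball (ch i i) r
  · have hev : inCharts i i (F z) =ᶠ[𝓝 y] fun y' => y' + δ • z := by
      filter_upwards [Metric.isOpen_ball.mem_nhds hyb] with y' hy'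
      have h1 := h.chart z y' (hbt hy')
      rw [← h.transl z y' hy' hz2]
      change ch i (F z ((ch i).symm y')) = _
      rw [h1.2, (ch i).right_inv h1.1]
    have hfd : fderiv ℝ (inCharts i i (F z)) y = ContinuousLinearMap.id ℝ E := by
      rw [hev.fderiv_eq, fderiv_add_const]
      exact fderiv_id
    have ht : y + δ • z ∈ (ch i).target := by
      rw [← h.transl z y hyb hz2]; exact (h.chart z y hy).1
    rw [GenCY.chartRep_pullback hy (h.fam.slice z).contMDiffAt hFy, hfd, pb_id, hev.eq_of_nhds,
      indicator_of_mem ht]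
    rfl
  · have key : ∀ y', ‖y' - y‖ ≤ δ * ‖z‖ → y' ∉ ch i '' A := fun y' hy' hA =>
      hyb (hε (Metric.mem_cthickening_of_dist_le y y' ε _ hA (by
        rw [dist_comm, dist_eq_norm]; exact hy'.trans hzε)))
    have h1 : θ (F z ((ch i).symm y)) = 0 := by
      refine hz _ fun hA => key _ (h.near z y) ⟨_, hA, ?_⟩
      rw [(h.chart z y hy).2, (ch i).right_inv (h.chart z y hy).1]
    have h2 : (ch i).target.indicator (chartRep i θ) (y + δ • z) = 0 := by
      by_cases ht : y + δ • z ∈ (ch i).target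
      · rw [indicator_of_mem ht, chartRep, pullback, hz, map_zero]
        intro hA
        refine key (y + δ • z) ?_ ⟨_, hA, (ch i).right_inv ht⟩
        rw [add_sub_cancel_left, norm_smul, Real.norm_of_nonneg h.δ_pos.le]
      · exact indicator_of_notMem ht _
    rw [h2, chartRep, pullback, pullback, h1, map_zero, map_zero]

theorem isCompact_image_chart (hA : IsCompact A) (hAs : A ⊆ (ch i).source) :
    IsCompact (ch i '' A) := hA.image_of_continuousOn ((continuousOn_extChartAt i).mono hAs)

theorem contDiff_indicator_chartRep (hA : IsCompact A) (hAs : A ⊆ (ch i).source) {θ : MForm M}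
    (hθ : IsSmooth θ) (hz : ∀ x ∉ A, θ x = 0) :
    (∀ y ∉ ch i '' A, (ch i).target.indicator (chartRep i θ) y = 0) ∧
    ContDiff ℝ ∞ ((ch i).target.indicator (chartRep i θ)) := by
  have hAt : ch i '' A ⊆ (ch i).target := by
    rintro _ ⟨x, hx, rfl⟩
    exact (ch i).map_source (hAs hx)
  have h0 : ∀ y ∉ ch i '' A, (ch i).target.indicator (chartRep i θ) y = 0 := by
    intro y hy
    by_cases ht : y ∈ (ch i).target
    · rw [indicator_of_mem ht, chartRep, pullback, hz, map_zero]
      exact fun h => hy ⟨_, h, (ch i).right_inv ht⟩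
    · exact indicator_of_notMem ht _
  refine ⟨h0, contDiff_of_target (isCompact_image_chart hA hAs) hAt h0 fun y hy => ?_⟩
  refine (hθ.contDiffAt hy).congr_of_eventuallyEq ?_
  filter_upwards [(isOpen_extChartAt_target i).mem_nhds hy] with y' hy'
  exact indicator_of_mem hy' _

theorem LocalTranslations.fam_two (h : LocalTranslations i δ r Φ F F') :
    DiffFam (fun q : E × E => F (q.1 + q.2)) (fun q : E × E => F' (q.1 + q.2)) :=
  h.fam.comp_linear (ContinuousLinearMap.fst ℝ E E + ContinuousLinearMap.snd ℝ E E)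

/-- Two independent translations give two successive convolutions. One kernel links `s` to the
output point `y`, the other links `s` to the integration variable `w`. For fixed `s` the operator
therefore has finite rank, which is the shape required by `Smoothing`. -/
theorem LocalTranslations.chartRep_avg (h : LocalTranslations i δ r Φ F F')
    (hA : IsCompact A) (hAs : A ⊆ (ch i).source)
    (hε : Metric.cthickening ε (ch i '' A) ⊆ Metric.ball (ch i i) r) {ρ : ℝ} (hρ : ρ ≤ 1)
    (hρε : 2 * (δ * ρ) ≤ ε) {b : E → ℝ} (hb : ContDiff ℝ ∞ b) (hbz : ∀ z, ρ < ‖z‖ → b z = 0)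
    {θ : MForm M} (hθ : IsSmooth θ) (hz : ∀ x ∉ A, θ x = 0) {y : E} (hy : y ∈ (ch i).target) :
    chartRep i (avg volume (fun q : E × E => b q.1 * b q.2) (fun q => F (q.1 + q.2)) θ) y =
      ∫ s, ker δ b (s - y) • ∫ w, ker δ b (w - s) • (ch i).target.indicator (chartRep i θ) w := by
  set ζ := (ch i).target.indicator (chartRep i θ) with hζ
  have hζs : ContDiff ℝ ∞ ζ := (contDiff_indicator_chartRep hA hAs hθ hz).2
  have hbb : ContDiff ℝ ∞ (fun q : E × E => b q.1 * b q.2) :=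
    (hb.comp contDiff_fst).mul (hb.comp contDiff_snd)
  have hk : IsCompact (Metric.closedBall (0 : E) ρ ×ˢ Metric.closedBall (0 : E) ρ) :=
    (isCompact_closedBall _ _).prod (isCompact_closedBall _ _)
  have hbk : ∀ q ∉ Metric.closedBall (0 : E) ρ ×ˢ Metric.closedBall (0 : E) ρ,
      b q.1 * b q.2 = 0 := by
    intro q hq
    rw [mem_prod, not_and_or, mem_closedBall_zero_iff, mem_closedBall_zero_iff, not_le, not_le] at hq
    rcases hq with hq | hq
    · rw [hbz _ hq, zero_mul]
    · rw [hbz _ hq, mul_zero]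
  rw [avg, chartRep_formInt (locallyIntegrable_const 1) hk (h.fam_two.fam_pullback_const hbb hθ)
    fun q hq => by rw [hbk q hq, zero_smul]]
  have e1 : ∀ q : E × E, (1 : ℝ) • chartRep i ((b q.1 * b q.2) • pullback (F (q.1 + q.2)) θ) y =
      b q.1 • b q.2 • ζ (y + δ • q.1 + δ • q.2) := by
    intro q
    rw [one_smul, chartRep_smul, Pi.smul_apply, mul_smul]
    by_cases hq : q ∈ Metric.closedBall (0 : E) ρ ×ˢ Metric.closedBall (0 : E) ρ
    · rw [mem_prod, mem_closedBall_zero_iff, mem_closedBall_zero_iff] at hq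
      have hn : ‖q.1 + q.2‖ ≤ 2 * ρ := (norm_add_le _ _).trans (by linarith [hq.1, hq.2])
      rw [h.chartRep_pullback hε hz (by linarith) (by nlinarith [h.δ_pos]) hy, smul_add, add_assoc]
    · rw [← mul_smul, ← mul_smul, hbk q hq, zero_smul, zero_smul]
  simp only [e1]
  have hcont : Continuous fun q : E × E => b q.1 • b q.2 • ζ (y + δ • q.1 + δ • q.2) := by
    have := hb.continuous
    have := hζs.continuous
    fun_prop
  rw [Measure.volume_eq_prod, integral_prod _ (hcont.integrable_of_hasCompactSupport
    (hasCompactSupport_of_zero hk fun q hq => by rw [← mul_smul, hbk q hq, zero_smul]))]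
  simp only [MeasureTheory.integral_smul, integral_translate h.δ_pos]
  exact integral_translate h.δ_pos b (fun s => ∫ w, ker δ b (w - s) • ζ w) y



theorem fam_push_eps (hν : IsVolumeForm ν) {C : Set E} (hC : IsCompact C)
    (hCt : C ⊆ (ch i).target) {g : E → E → Lam} (hg : ∀ s, ∀ y ∉ C, g s y = 0)
    (hs : ∀ s, ∀ y ∈ (ch i).target, ContDiffAt ℝ ∞ (fun q : E × E => g q.1 q.2) (s, y)) :
    Fam univ (fun s => push i (fun y => eps ν i y • g s y)) := by
  intro s _ x
  refine SmAt.push hC hCt (.of_forall fun s y hy => by rw [hg s y hy, smul_zero]) (fun y hy => ?_) x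
  have h1 : ContDiffAt ℝ ∞ (fun q : E × E => eps ν i y • g q.1 q.2) (s, y) :=
    ContDiffAt.smul (f := fun _ => eps ν i y) contDiffAt_const (hs s y hy)
  refine h1.congr_of_eventuallyEq ?_
  filter_upwards [(continuousAt_snd (p := (s, y))).eventually (eps_eventually hν hy)] with q hq
  rw [hq]

/-- In the double convolution the inner integral at `s` is a vector of `Lam`. Its coordinates in a
basis are pairings of `η` with forms `β` supported in the chart, and the outer kernel times the
basis vectors gives the forms `k`. -/
theorem LocalTranslations.smoothing (hν : IsVolumeForm ν) (h : LocalTranslations i δ r Φ F F')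
    (hA : IsCompact A) (hAs : A ⊆ (ch i).source) (hAb : ch i '' A ⊆ Metric.ball (ch i i) r) :
    ∃ ρ : ℝ, 0 < ρ ∧ ∀ b : E → ℝ, ContDiff ℝ ∞ b → (∀ z, ρ < ‖z‖ → b z = 0) →
      ∀ ψ : M → ℝ, ContMDiff (𝓡 6) 𝓘(ℝ, ℝ) ∞ ψ → (∀ x ∉ A, ψ x = 0) →
      Smoothing ν (fun η => avg volume (fun q : E × E => b q.1 * b q.2) (fun q => F (q.1 + q.2))
        (fun x => ψ x • η x)) := by
  have hAc := isCompact_image_chart hA hAs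
  obtain ⟨ε, hε0, hε⟩ := hAc.exists_cthickening_subset_open Metric.isOpen_ball hAb
  have hδ := h.δ_pos
  -- The variable `s` ranges within `2δρ` of the image of `A` and the output point within `δρ` of
  -- `s`. So `4δρ ≤ ε` leaves the supports of the kernels inside the `ε`-thickening.
  set ρ := min 1 (ε / (4 * δ)) with hρdef
  have hρ0 : 0 < ρ := lt_min one_pos (by positivity)
  have hρε : 4 * (δ * ρ) ≤ ε := by
    have := min_le_right 1 (ε / (4 * δ))
    rw [← hρdef, le_div_iff₀ (by positivity)] at this
    linarith
  have hδρ : 0 < δ * ρ := by positivity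
  refine ⟨ρ, hρ0, fun b hb hbz ψ hψ hψz => ?_⟩
  set Ac := ch i '' A with hAcdef
  have hbt : Metric.ball (ch i i) r ⊆ (ch i).target := Metric.ball_subset_closedBall.trans h.ball
  have hAt : Ac ⊆ (ch i).target := hAb.trans hbt
  -- The cut-off `κ` is `1` wherever the inner integral can be nonzero, so inserting it changes
  -- nothing, and it makes the kernels compactly supported in `s`.
  obtain ⟨κ, hκ0, hκ1, -⟩ := exists_contMDiffMap_zero_one_of_isClosed (n := ⊤) 𝓘(ℝ, E)
    (s := (Metric.thickening (2 * (δ * ρ)) Ac)ᶜ) (t := Metric.cthickening (δ * ρ) Ac)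
    Metric.isOpen_thickening.isClosed_compl Metric.isClosed_cthickening
    (disjoint_left.2 fun x hx hx' => hx (Metric.cthickening_subset_thickening' (by positivity)
      (by linarith) _ hx'))
  have hκs : ContDiff ℝ ∞ κ := κ.contMDiff.contDiff
  have hks : ContDiff ℝ ∞ (ker δ b) := contDiff_ker δ hb
  have hkz : ∀ u, δ * ρ < ‖u‖ → ker δ b u = 0 := fun u => ker_eq_zero hδ hbz
  let B := Module.finBasis ℝ Lam
  choose bb hbb using fun I => exists_pairing_eq (B.coord I)
  set C := Metric.cthickening ε Ac with hCdef
  have hC : IsCompact C := hAc.cthickening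
  have hCt : C ⊆ (ch i).target := hε.trans hbt
  set ψc := (ch i).target.indicator (fun y => ψ ((ch i).symm y)) with hψc
  have hψc0 : ∀ y ∉ Ac, ψc y = 0 := by
    intro y hy
    by_cases ht : y ∈ (ch i).target
    · rw [hψc, indicator_of_mem ht, hψz]
      exact fun h => hy ⟨_, h, (ch i).right_inv ht⟩
    · exact indicator_of_notMem ht _
  have hψcs : ContDiff ℝ ∞ ψc := by
    refine contDiff_of_target hAc hAt hψc0 fun y hy => ?_
    have h1 : ContDiffAt ℝ ∞ (fun y => ψ ((ch i).symm y)) y :=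
      (((hψ _).comp y (contMDiffAt_chart_symm hy)).contDiffAt)
    refine h1.congr_of_eventuallyEq ?_
    filter_upwards [(isOpen_extChartAt_target i).mem_nhds hy] with y' hy'
    exact indicator_of_mem hy' _
  set k : Fin (Module.finrank ℝ Lam) → E → MForm M := fun I s =>
    push i (fun y => (κ s * ker δ b (s - y)) • B I) with hkdef
  set β : Fin (Module.finrank ℝ Lam) → E → MForm M := fun I s =>
    push i (fun w => eps ν i w • (ker δ b (w - s) * ψc w) • bb I) with hβdef
  have hkC : ∀ s, ∀ y ∉ C, κ s * ker δ b (s - y) = 0 := by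
    intro s y hy
    by_cases hs : s ∈ Metric.thickening (2 * (δ * ρ)) Ac
    · rw [hkz, mul_zero]
      by_contra! hsy
      obtain ⟨a, ha, hsa⟩ := Metric.mem_thickening_iff.1 hs
      refine hy (Metric.mem_cthickening_of_dist_le y a ε _ ha ?_)
      have : dist y s ≤ δ * ρ := by rwa [dist_comm, dist_eq_norm]
      linarith [dist_triangle y s a]
    · rw [show κ s = 0 from hκ0 hs, zero_mul]
  have hkF : ∀ I, Fam univ (k I) := fun I s _ x => by
    refine SmAt.push hC hCt (.of_forall fun s y hy => by rw [hkC s y hy, zero_smul])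
      (fun y _ => ContDiff.contDiffAt ?_) x
    exact ((hκs.comp contDiff_fst).mul (hks.comp (contDiff_fst.sub contDiff_snd))).smul
      contDiff_const
  have hgz : ∀ I s, ∀ y ∉ Ac, (ker δ b (y - s) * ψc y) • bb I = 0 := fun I s y hy => by
    rw [hψc0 y hy, mul_zero, zero_smul]
  have hgs : ∀ I, ContDiff ℝ ∞ (fun q : E × E => (ker δ b (q.2 - q.1) * ψc q.2) • bb I) := fun I =>
    ((hks.comp (contDiff_snd.sub contDiff_fst)).mul (hψcs.comp contDiff_snd)).smul contDiff_const
  have hβF : ∀ I, Fam univ (β I) := fun I =>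
    fam_push_eps hν hAc hAt (hgz I) fun s y _ => (hgs I).contDiffAt
  have hκz : ∀ s ∉ Metric.cthickening (2 * (δ * ρ)) Ac, κ s = 0 := fun s hs =>
    hκ0 fun h' => hs (Metric.thickening_subset_cthickening _ _ h')
  have hkz' : ∀ I, ∀ s ∉ Metric.cthickening (2 * (δ * ρ)) Ac, k I s = 0 := by
    intro I s hs
    funext x
    simp only [hkdef, hκz s hs, zero_mul, zero_smul]
    by_cases hx : x ∈ (ch i).source
    · rw [push_of_mem hx, map_zero]; rfl
    · exact push_of_notMem hx _
  refine ⟨_, inferInstance, k, β, Metric.cthickening (2 * (δ * ρ)) Ac, hAc.cthickening, hkF, hβF,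
    hkz', fun η hη => ?_⟩
  have hθ := hη.fun_smul hψ
  have hθz : ∀ x ∉ A, ψ x • η x = 0 := fun x hx => by rw [hψz x hx, zero_smul]
  set ζ := (ch i).target.indicator (chartRep i fun x => ψ x • η x) with hζ
  obtain ⟨hζ0, hζs⟩ : (∀ y ∉ Ac, ζ y = 0) ∧ ContDiff ℝ ∞ ζ :=
    contDiff_indicator_chartRep hA hAs hθ hθz
  set m : E → Lam := fun s => ∫ w, ker δ b (w - s) • ζ w with hm
  have hint : ∀ s, MeasureTheory.Integrable (fun w => ker δ b (w - s) • ζ w) := fun s =>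
    Continuous.integrable_of_hasCompactSupport
      ((hks.continuous.comp (continuous_id.sub continuous_const)).smul hζs.continuous)
      (hasCompactSupport_of_zero hAc fun w hw => by rw [hζ0 w hw, smul_zero])
  have hip : ∀ I s, ip ν (β I s) η = B.coord I (m s) := by
    intro I s
    have h1 := ip_push hν hAc hAt (hgz I s) (fun y _ => ((hgs I).comp
      ((contDiff_const (c := s)).prodMk contDiff_id)).contDiffAt) hη
    rw [hβdef, h1]
    have h2 := (LinearMap.toContinuousLinearMap (B.coord I)).integral_comp_comm (hint s)
    refine Eq.trans ?_ h2
    congr 1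
    funext w
    have h3 : ∀ (c : ℝ) (a a' : Lam), pairing (c • a) a' = c * pairing a a' := by
      intro c a a'; simp [pairing]
    rw [h3, hbb]
    change _ = B.coord I (ker δ b (w - s) • ζ w)
    by_cases ht : w ∈ (ch i).target
    · have h4 : ζ w = ψc w • chartRep i η w := by
        rw [hζ, hψc, indicator_of_mem ht, indicator_of_mem ht]
        exact map_smul (pullAt (ch i).symm w) _ _
      rw [h4, map_smul, map_smul, smul_eq_mul, smul_eq_mul, mul_assoc]
    · rw [hζ0 w fun h' => ht (hAt h'), hψc0 w fun h' => ht (hAt h')]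
      simp
  have hm0 : ∀ s ∉ Metric.cthickening (δ * ρ) Ac, m s = 0 := by
    intro s hs
    refine (integral_congr_ae (.of_forall fun w => ?_)).trans (MeasureTheory.integral_zero E Lam)
    by_cases hw : w ∈ Ac
    · have : δ * ρ < ‖w - s‖ := by
        by_contra! hle
        refine hs (Metric.mem_cthickening_of_dist_le s w _ _ hw ?_)
        rwa [dist_comm, dist_eq_norm]
      change ker δ b (w - s) • ζ w = 0
      rw [hkz _ this, zero_smul]
    · change ker δ b (w - s) • ζ w = 0
      rw [hζ0 w hw, smul_zero]
  funext x
  dsimp only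
  rw [Finset.sum_apply]
  by_cases hx : x ∈ (ch i).source
  · have hy := (ch i).map_source hx
    rw [form_eq_pullAt_chartRep hx (avg _ _ _ _), h.chartRep_avg hA hAs hε (min_le_left _ _)
      (by linarith) hb hbz hθ hθz hy]
    have hfi : ∀ I, Fam univ (fun s => ip ν (β I s) η • k I s) := fun I =>
      (hkF I).ip_smul hν (hβF I) hη
    have hfz : ∀ I, ∀ s ∉ Metric.cthickening (2 * (δ * ρ)) Ac, ip ν (β I s) η • k I s = 0 :=
      fun I s hs => by rw [hkz' I s hs, smul_zero]
    have e1 : ∀ I, formInt volume (fun _ => 1) (fun s => ip ν (β I s) η • k I s) x =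
        pullAt (ch i) x (∫ s, B.coord I (m s) • (κ s * ker δ b (s - ch i x)) • B I) := by
      intro I
      rw [form_eq_pullAt_chartRep hx (formInt _ _ _), chartRep_formInt (locallyIntegrable_const 1)
        hAc.cthickening (hfi I) (hfz I)]
      congr 2
      funext s
      rw [one_smul, chartRep_smul, Pi.smul_apply, hip, chartRep_push _ hy]
    have e2 : ∀ I, MeasureTheory.Integrable (fun s =>
        B.coord I (m s) • (κ s * ker δ b (s - ch i x)) • B I) := by
      intro I
      simp only [← hip]
      refine Continuous.integrable_of_hasCompactSupport ?_ (hasCompactSupport_of_zero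
        hAc.cthickening fun s hs => by rw [hκz s hs, zero_mul, zero_smul, smul_zero])
      have h1 := contDiffOn_ip hν isOpen_univ (hβF I) (hη.fam univ)
      rw [contDiffOn_univ] at h1
      exact h1.continuous.smul ((hκs.continuous.mul (hks.continuous.comp
        (continuous_id.sub continuous_const))).smul continuous_const)
    simp only [e1]
    rw [← map_sum, ← integral_finsetSum _ fun I _ => e2 I]
    congr 2
    funext s
    have e3 : ∑ I, B.coord I (m s) • (κ s * ker δ b (s - ch i x)) • B I =
        (κ s * ker δ b (s - ch i x)) • m s := by
      simp only [smul_comm (B.coord _ (m s))]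
      rw [← Finset.smul_sum]
      congr 1
      exact B.sum_repr (m s)
    rw [e3]
    by_cases hs : s ∈ Metric.cthickening (δ * ρ) Ac
    · rw [show κ s = 1 from hκ1 hs, one_mul]
    · change ker δ b (s - ch i x) • m s = _
      rw [hm0 s hs, smul_zero, smul_zero]
  · have hxA : x ∉ A := fun h' => hx (hAs h')
    have e1 : ∀ q : E × E, pullback (F (q.1 + q.2)) (fun x => ψ x • η x) x = 0 := fun q => by
      rw [pullback, h.off _ x hx, hθz x hxA, map_zero]
    have e2 : ∀ I s, k I s x = 0 := fun I s => push_of_notMem hx _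
    simp [avg, formInt, e1, e2]

end SmoothingOps

end GenCY

namespace GenCY
set_option linter.unusedSectionVars false

/-! ## A smoothing operator homotopic to the identity -/

section Regularization

open MeasureTheory

variable {M : Type*} [TopologicalSpace M] [ChartedSpace E M] [IsManifold (𝓡 6) ∞ M]
  [CompactSpace M] [T2Space M] {ν : MForm M}

/-- The chart at `x₀`. -/
local notation "ch" => extChartAt (𝓡 6) (M := M) (H := E)

theorem exists_density {ρ : ℝ} (hρ : 0 < ρ) : ∃ b : E → ℝ, ContDiff ℝ ∞ b ∧
    (∀ z, ρ < ‖z‖ → b z = 0) ∧ ∫ z, b z = 1 := by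
  let f : ContDiffBump (0 : E) := ⟨ρ / 2, ρ, by positivity, by linarith⟩
  refine ⟨f.normed volume, f.contDiff_normed, fun z hz => ?_, f.integral_normed⟩
  have : z ∉ tsupport (f.normed volume) := by
    rw [f.tsupport_normed_eq, mem_closedBall_zero_iff]
    exact not_le.2 hz
  exact image_eq_zero_of_notMem_tsupport this

theorem exists_cutoff {K A : Set M} (hK : IsCompact K) (hKA : K ⊆ interior A) :
    ∃ g : M → ℝ, ContMDiff (𝓡 6) 𝓘(ℝ, ℝ) ∞ g ∧ (∀ x ∈ K, g x = 1) ∧ ∀ x ∉ A, g x = 0 := by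
  obtain ⟨g, h1, h0, -⟩ := exists_contMDiffMap_one_nhds_of_subset_interior (n := ⊤) (𝓡 6)
    hK.isClosed hKA
  exact ⟨g, g.contMDiff, fun x hx => h1.self_of_nhdsSet x hx, h0⟩

/-- At the origin the map is the identity and moves no point from outside `B` into `K`. The tube
lemma over the compact complement of the interior of `B` gives a uniform radius. -/
theorem DiffFam.eventually_mapsTo {F F' : E → M → M} (h : DiffFam F F') {K B : Set M}
    (hK : IsCompact K) (hKB : K ⊆ interior B) :
    ∃ ρ : ℝ, 0 < ρ ∧ ∀ z, ‖z‖ < ρ → ∀ x ∉ B, F z x ∉ K := by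
  have ho : IsOpen {q : E × M | F q.1 q.2 ∉ K} :=
    hK.isClosed.isOpen_compl.preimage h.smooth.continuous
  have hB : IsCompact (interior B)ᶜ := isOpen_interior.isClosed_compl.isCompact
  obtain ⟨u, v, hu, hv, hu0, hvB, huv⟩ := generalized_tube_lemma (isCompact_singleton (x := (0 : E)))
    hB ho (by
      rintro ⟨z, x⟩ ⟨rfl, hx⟩
      simp only [mem_ofPred_eq, h.zero]
      exact fun hxK => hx (hKB hxK))
  obtain ⟨ρ, hρ, hρu⟩ := Metric.isOpen_iff.1 hu 0 (hu0 rfl)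
  refine ⟨ρ, hρ, fun z hz x hx => ?_⟩
  exact @huv (z, x) ⟨hρu (by simpa using hz), hvB fun h => hx (interior_subset h)⟩

/-- The domain of the translations near `i`. -/
def tdom (i : M) (r : ℝ) : Set M := (ch i).source ∩ ch i ⁻¹' Metric.ball (ch i i) r

theorem isOpen_tdom (i : M) (r : ℝ) : IsOpen (tdom i r) :=
  (continuousOn_extChartAt i).isOpen_inter_preimage (isOpen_extChartAt_source i) Metric.isOpen_ball

/-- Induction on the charts. Split `A` into `K₁` in the new domain and `K₂` in the old ones, and
compose the inductive operator `R` with a new average `L`. On forms supported near `K₁`, `L` is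
already smoothing. Forms supported in `K₂` are moved by `L` so little that they stay where `R` is
smoothing. -/
theorem exists_adm_on (hν : IsVolumeForm ν) {δ r : M → ℝ} {Φ : M → E → E → E}
    {F F' : M → E → M → M} (h : ∀ i, LocalTranslations i (δ i) (r i) (Φ i) (F i) (F' i))
    (l : Finset M) : ∀ A : Set M, IsCompact A → A ⊆ ⋃ i ∈ l, tdom i (r i) →
      ∃ R Rt, Adm ν R Rt ∧ ∀ ψ : M → ℝ, ContMDiff (𝓡 6) 𝓘(ℝ, ℝ) ∞ ψ → (∀ x ∉ A, ψ x = 0) →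
        Smoothing ν (fun η => R (fun x => ψ x • η x)) := by
  classical
  have : LocallyCompactSpace M := ChartedSpace.locallyCompactSpace E M
  induction l using Finset.induction_on with
  | empty =>
    intro A _ hA
    refine ⟨_, _, adm_id, fun ψ _ hψ => smoothing_zero.congr fun η _ => ?_⟩
    funext x
    rw [hψ x fun hx => by simpa using hA hx, zero_smul]
    rfl
  | insert i l hi ih =>
    intro A hA hAl
    rw [Finset.set_biUnion_insert] at hAl
    have hUo : IsOpen (⋃ j ∈ l, tdom j (r j)) := isOpen_biUnion fun j _ => isOpen_tdom j (r j)
    obtain ⟨K₁, K₂, hK₁, hK₂, hK₁i, hK₂l, rfl⟩ := hA.binary_compact_cover (isOpen_tdom i (r i)) hUo hAl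
    obtain ⟨A₁, hA₁, hKA₁, hA₁i⟩ := exists_compact_between hK₁ (isOpen_tdom i (r i)) hK₁i
    obtain ⟨B, hB, hKB, hBl⟩ := exists_compact_between hK₂ hUo hK₂l
    obtain ⟨A₂, hA₂, hBA₂, hA₂l⟩ := exists_compact_between hB hUo hBl
    obtain ⟨R, Rt, hR, hRs⟩ := ih A₂ hA₂ hA₂l
    obtain ⟨g, hg, hg1, hg0⟩ := exists_cutoff hK₁ hKA₁
    obtain ⟨χ, hχ, hχ1, hχ0⟩ := exists_cutoff hB hBA₂
    obtain ⟨ρ₁, hρ₁, hker⟩ := (h i).smoothing hν hA₁ (fun x hx => (hA₁i hx).1) (by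
      rintro _ ⟨x, hx, rfl⟩; exact (hA₁i hx).2)
    obtain ⟨ρ₂, hρ₂, hmap⟩ := (h i).fam.eventually_mapsTo hK₂ hKB
    -- The third of `ρ₂` makes the sum of two translation vectors shorter than `ρ₂`.
    obtain ⟨b, hb, hbz, hb1⟩ := exists_density (ρ := min ρ₁ (ρ₂ / 3)) (by positivity)
    have hsm := hker b hb fun z hz => hbz z ((min_le_left _ _).trans_lt hz)
    set ρ := min ρ₁ (ρ₂ / 3) with hρ
    have hk : IsCompact (Metric.closedBall (0 : E) ρ ×ˢ Metric.closedBall (0 : E) ρ) :=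
      (isCompact_closedBall _ _).prod (isCompact_closedBall _ _)
    have hbk : ∀ q ∉ Metric.closedBall (0 : E) ρ ×ˢ Metric.closedBall (0 : E) ρ,
        b q.1 * b q.2 = 0 := by
      intro q hq
      rw [mem_prod, not_and_or, mem_closedBall_zero_iff, mem_closedBall_zero_iff, not_le,
        not_le] at hq
      rcases hq with hq | hq
      · rw [hbz _ hq, zero_mul]
      · rw [hbz _ hq, mul_zero]
    have hbb1 : ∫ q : E × E, b q.1 * b q.2 = 1 := by
      rw [Measure.volume_eq_prod, integral_prod_mul, hb1, one_mul]
    have hL : Adm ν (avg volume (fun q : E × E => b q.1 * b q.2) (fun q => F i (q.1 + q.2)))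
        (avg volume (fun q : E × E => b q.1 * b q.2) (fun q => F' i (q.1 + q.2))) :=
      (h i).fam_two.adm hν (μ := volume) ((hb.comp contDiff_fst).mul (hb.comp contDiff_snd))
      hk hbk hbb1
    set L : MForm M → MForm M :=
      avg volume (fun q : E × E => b q.1 * b q.2) (fun q => F i (q.1 + q.2)) with hLdef
    refine ⟨_, _, hR.comp hL, fun ψ hψ hψz => ?_⟩
    have h1 : Smoothing ν (fun η => R (L (fun x => (g x * ψ x) • η x))) :=
      (hsm (fun x => g x * ψ x) (hg.mul hψ) fun x hx => by rw [hg0 x hx, zero_mul]).adm_comp hν hR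
    have hψ₂ : ContMDiff (𝓡 6) 𝓘(ℝ, ℝ) ∞ (fun x => (1 - g x) * ψ x) :=
      (contMDiff_const.sub hg).mul hψ
    have hψ₂z : ∀ x ∉ K₂, (1 - g x) * ψ x = 0 := by
      intro x hx
      by_cases hx1 : x ∈ K₁
      · rw [hg1 x hx1, sub_self, zero_mul]
      · rw [hψz x fun h => h.elim hx1 hx, mul_zero]
    -- The cut form is supported in `K₂`, hence after `L` in `B`, where `χ = 1`. So `χ` may be
    -- inserted between `R` and `L`, and the inductive hypothesis applies to `R` after
    -- multiplication by `χ`.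
    have h2 : Smoothing ν (fun η => R (L (fun x => ((1 - g x) * ψ x) • η x))) := by
      refine (((hRs χ hχ hχ0).comp_adm hL).comp_fun_smul hψ₂).congr fun η _ => ?_
      congr 1
      funext x
      by_cases hx : x ∈ B
      · rw [hχ1 x hx, one_smul]
      · have : L (fun x => ((1 - g x) * ψ x) • η x) x = 0 := by
          have e : ∀ q : E × E, ((b q.1 * b q.2) • pullback (F i (q.1 + q.2))
              (fun x => ((1 - g x) * ψ x) • η x)) x = 0 := by
            intro q
            by_cases hq : q ∈ Metric.closedBall (0 : E) ρ ×ˢ Metric.closedBall (0 : E) ρ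
            · rw [mem_prod, mem_closedBall_zero_iff, mem_closedBall_zero_iff] at hq
              have hn : ‖q.1 + q.2‖ < ρ₂ := (norm_add_le _ _).trans_lt (by
                linarith [hq.1, hq.2, min_le_right ρ₁ (ρ₂ / 3)])
              rw [Pi.smul_apply, pullback, hψ₂z _ (hmap _ hn x hx), zero_smul, map_zero, smul_zero]
            · rw [hbk q hq, zero_smul]; rfl
          simp only [hLdef, avg, formInt, e, smul_zero, MeasureTheory.integral_zero]
        rw [this, smul_zero]
    refine (h1.add h2).congr fun η hη => ?_
    have hgψ : ContMDiff (𝓡 6) 𝓘(ℝ, ℝ) ∞ (fun x => g x * ψ x) := hg.mul hψ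
    rw [← hR.add (hL.isSmooth (hη.fun_smul hgψ)) (hL.isSmooth (hη.fun_smul hψ₂)),
      ← hL.add (hη.fun_smul hgψ) (hη.fun_smul hψ₂)]
    congr 2
    funext x
    rw [Pi.add_apply, ← add_smul]
    congr 1
    ring

/-- There is a smoothing operator which commutes with `d` and is homotopic to the identity. -/
theorem exists_adm_smoothing (hν : IsVolumeForm ν) : ∃ R Rt, Adm ν R Rt ∧ Smoothing ν R := by
  choose δ r Φ F F' h using fun i : M => exists_localTranslations i
  obtain ⟨l, hl⟩ := isCompact_univ.elim_finite_subcover (fun i : M => tdom i (r i))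
    (fun i => isOpen_tdom i (r i)) fun i _ => mem_iUnion.2 ⟨i, mem_extChartAt_source i, by
      simpa using (h i).r_pos⟩
  obtain ⟨R, Rt, hR, hs⟩ := exists_adm_on hν h l univ isCompact_univ hl
  refine ⟨R, Rt, hR, (hs (fun _ => 1) contMDiff_const fun x hx => (hx (mem_univ x)).elim).congr
    fun η _ => ?_⟩
  simp only [one_smul]

end Regularization

end GenCY

namespace GenCY
set_option linter.unusedSectionVars false

/-! ## Compact perturbations of the identity -/

section Riesz

open Filter

variable {X : Type*} [NormedAddCommGroup X] [NormedSpace ℝ X] [CompleteSpace X] {K : X →L[ℝ] X}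

/-- On this kernel `K` is the identity, and a space whose identity is compact is finite-dimensional.
-/
theorem finiteDimensional_ker_one_sub (hK : IsCompactOperator K) :
    FiniteDimensional ℝ (LinearMap.ker ((1 - K : X →L[ℝ] X) : X →ₗ[ℝ] X)) := by
  set N := LinearMap.ker ((1 - K : X →L[ℝ] X) : X →ₗ[ℝ] X) with hN
  have hmem : ∀ x ∈ N, K x = x := fun x hx => by
    have : x - K x = 0 := hx
    exact (sub_eq_zero.1 this).symm
  have hNc : IsClosed (N : Set X) := (1 - K).isClosed_ker
  have : CompleteSpace N := hNc.completeSpace_coe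
  apply FiniteDimensional.of_isCompactOperator_id (𝕜 := ℝ)
  have h2 := (hK.comp_clm N.subtypeL).codRestrict (V := N)
    (fun x => by
      change K x ∈ N
      rw [hmem x x.2]
      exact x.2) hNc
  refine (congrArg IsCompactOperator (funext fun x => ?_)).mp h2
  exact Subtype.ext (hmem x x.2)

/-- On a closed complement `C` of the kernel `1 - K` is bounded below. Otherwise there are unit
vectors of `C` with images tending to `0`; by compactness a subsequence converges, and its limit is
a unit vector lying both in the kernel and in `C`. -/
theorem isClosed_range_one_sub (hK : IsCompactOperator K) :
    IsClosed (LinearMap.range ((1 - K : X →L[ℝ] X) : X →ₗ[ℝ] X) : Set X) := by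
  set N := LinearMap.ker ((1 - K : X →L[ℝ] X) : X →ₗ[ℝ] X) with hN
  have := finiteDimensional_ker_one_sub hK
  obtain ⟨C, hCc, hC⟩ :=
    (Submodule.ClosedComplemented.of_finiteDimensional (𝕜 := ℝ) N).exists_isClosed_isCompl
  have : CompleteSpace C := hCc.completeSpace_coe
  set S : C →L[ℝ] X := (1 - K) ∘L C.subtypeL with hS
  have hSx : ∀ x : C, S x = (x : X) - K x := fun x => rfl
  have hrange : (LinearMap.range ((1 - K : X →L[ℝ] X) : X →ₗ[ℝ] X) : Set X) = range S := by
    ext y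
    constructor
    · rintro ⟨x, rfl⟩
      obtain ⟨n, hn, c, hc, rfl⟩ := Submodule.mem_sup.1 (hC.sup_eq_top ▸ Submodule.mem_top (x := x))
      refine ⟨⟨c, hc⟩, ?_⟩
      have : (1 - K) n = 0 := hn
      change (1 - K) c = (1 - K) (n + c)
      rw [map_add, this, zero_add]
    · rintro ⟨x, rfl⟩
      exact ⟨x, rfl⟩
  suffices h : ∃ k, AntilipschitzWith k S by
    obtain ⟨k, hk⟩ := h
    rw [hrange]
    exact hk.isClosed_range S.uniformContinuous
  rw [antilipschitzWith_iff_exists_mul_le_norm]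
  by_contra! h
  have h1 : ∀ n : ℕ, ∃ x : C, ‖x‖ = 1 ∧ ‖S x‖ < 1 / ((n : ℝ) + 1) := by
    intro n
    obtain ⟨x, hx⟩ := h (1 / ((n : ℝ) + 1)) (by positivity)
    have hx0 : 0 < ‖x‖ := by
      by_contra h0
      have : ‖x‖ = 0 := le_antisymm (not_lt.1 h0) (norm_nonneg _)
      rw [this, mul_zero] at hx
      exact absurd hx (not_lt.2 (norm_nonneg _))
    refine ⟨‖x‖⁻¹ • x, by rw [norm_smul, norm_inv, norm_norm, inv_mul_cancel₀ hx0.ne'], ?_⟩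
    rw [map_smul, norm_smul, norm_inv, norm_norm, inv_mul_lt_iff₀ hx0, mul_comm]
    exact hx
  choose x hx1 hxS using h1
  have hS0 : Tendsto (fun n => S (x n)) atTop (𝓝 0) :=
    squeeze_zero_norm (fun n => (hxS n).le) tendsto_one_div_add_atTop_nhds_zero_nat
  obtain ⟨Q, hQ, hQ'⟩ := hK.image_closedBall_subset_compact 1
  obtain ⟨y, -, φ, hφ, hy⟩ := hQ.tendsto_subseq (x := fun n => K (x n)) fun n =>
    hQ' ⟨x n, by simpa using (hx1 n).le, rfl⟩
  have hxy : Tendsto (fun n => (x (φ n) : X)) atTop (𝓝 y) := by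
    have := (hS0.comp hφ.tendsto_atTop).add hy
    rw [zero_add] at this
    refine this.congr fun n => ?_
    simp [hSx]
  have hyC : y ∈ C := hCc.mem_of_tendsto hxy (.of_forall fun n => (x (φ n)).2)
  have hyN : y ∈ N := by
    have h2 : Tendsto (fun n => S (x (φ n))) atTop (𝓝 (y - K y)) :=
      hxy.sub ((K.continuous.tendsto y).comp hxy)
    exact tendsto_nhds_unique h2 (hS0.comp hφ.tendsto_atTop)
  have hy0 : y = 0 := Submodule.disjoint_def.1 hC.disjoint y hyN hyC
  have hy1 : ‖y‖ = 1 := tendsto_nhds_unique hxy.norm (by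
    refine tendsto_const_nhds.congr fun n => ?_
    exact (hx1 (φ n)).symm)
  rw [hy0, norm_zero] at hy1
  exact zero_ne_one hy1

/-- Modulo the range `K` and the identity agree, so compactness of `K` together with openness of the
quotient map makes the identity of the quotient compact. -/
theorem finiteDimensional_quotient_range_one_sub (hK : IsCompactOperator K) :
    FiniteDimensional ℝ (X ⧸ LinearMap.range ((1 - K : X →L[ℝ] X) : X →ₗ[ℝ] X)) := by
  set W := LinearMap.range ((1 - K : X →L[ℝ] X) : X →ₗ[ℝ] X) with hW
  have : IsClosed (W : Set X) := isClosed_range_one_sub hK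
  apply FiniteDimensional.of_isCompactOperator_id (𝕜 := ℝ)
  obtain ⟨Q, hQ, hQ0⟩ := hK.continuous_comp (g := W.mkQL) W.mkQL.continuous
  refine ⟨Q, hQ, ?_⟩
  have h1 : W.mkQL ∘ K = W.mkQL := by
    funext x
    refine ((Submodule.Quotient.eq W).2 ?_).symm
    exact ⟨x, rfl⟩
  rw [h1] at hQ0
  have h2 : W.mkQL '' (W.mkQL ⁻¹' Q) ∈ 𝓝 (W.mkQL 0) :=
    (QuotientAddGroup.isOpenMap_coe (N := W.toAddSubgroup)).image_mem_nhds hQ0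
  rw [map_zero] at h2
  exact Filter.mem_of_superset h2 (image_preimage_subset _ _)

/-- A linear map which vanishes on the range of a compact perturbation of the identity is
continuous, and its range is finite-dimensional. -/
theorem continuous_of_comp_one_sub {F : Type*} [AddCommGroup F] [Module ℝ F] (hK : IsCompactOperator K)
    (q : X →ₗ[ℝ] F) (hq : ∀ x, q (K x) = q x) :
    FiniteDimensional ℝ (LinearMap.range q) ∧ ∀ f : F →ₗ[ℝ] ℝ, Continuous fun x => f (q x) := by
  set W := LinearMap.range ((1 - K : X →L[ℝ] X) : X →ₗ[ℝ] X) with hW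
  have hfin : FiniteDimensional ℝ (X ⧸ W) := finiteDimensional_quotient_range_one_sub hK
  have : IsClosed (W : Set X) := isClosed_range_one_sub hK
  have hle : W ≤ LinearMap.ker q := by
    rintro _ ⟨x, rfl⟩
    change q (x - K x) = 0
    rw [map_sub, hq, sub_self]
  refine ⟨?_, fun f => ?_⟩
  · rw [← Submodule.range_liftQ W q hle]
    infer_instance
  · have h1 : Continuous (f ∘ₗ W.liftQ q hle) := LinearMap.continuous_of_finiteDimensional _
    exact h1.comp W.mkQL.continuous

/-- Compact operators form a closed subspace. A functional separating the integral from it would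
vanish on the subspace, yet it commutes with the integral. -/
theorem isCompactOperator_integral {P Y : Type*} [TopologicalSpace P] [MeasurableSpace P]
    [NormedAddCommGroup Y] [NormedSpace ℝ Y] [CompleteSpace Y] (μ : MeasureTheory.Measure P)
    (f : P → Y →L[ℝ] Y) (hf : MeasureTheory.Integrable f μ) (h : ∀ s, IsCompactOperator (f s)) :
    IsCompactOperator (∫ s, f s ∂μ : Y →L[ℝ] Y) := by
  set C := compactOperator (RingHom.id ℝ) Y Y
  have hC : IsClosed (C : Set (Y →L[ℝ] Y)) := isClosed_setOfPred_isCompactOperator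
  by_cases h0 : μ = 0
  · rw [h0, MeasureTheory.integral_zero_measure]
    exact isCompactOperator_zero
  by_contra hne
  obtain ⟨g, u, hg, hu⟩ := geometric_hahn_banach_closed_point C.convex hC hne
  have hz : ∀ a ∈ C, g a = 0 := by
    intro a ha
    by_contra ha0
    have h1 := hg ((u / g a) • a) (C.smul_mem _ ha)
    rw [map_smul, smul_eq_mul, div_mul_cancel₀ _ ha0] at h1
    exact lt_irrefl _ h1
  have h2 : g (∫ s, f s ∂μ) = 0 := by
    rw [← g.integral_comp_comm hf]
    simp only [hz _ (h _), MeasureTheory.integral_zero]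
  have h3 := hg 0 C.zero_mem
  rw [map_zero] at h3
  rw [h2] at hu
  exact lt_asymm hu h3

end Riesz

end GenCY

namespace GenCY
set_option linter.unusedSectionVars false

/-! ## The Banach space of continuous forms -/

section PairC

open MeasureTheory

/-- The pairing as a continuous bilinear map. -/
noncomputable def pairL : Lam →L[ℝ] Lam →L[ℝ] ℝ :=
  (ContinuousLinearMap.compL ℝ Lam Lam ℝ topL) ∘L lmul ∘L revL

variable {K : Type*} [TopologicalSpace K] [CompactSpace K] [MeasurableSpace K] [BorelSpace K]

theorem integrable_pairL (μ : Measure K) [IsFiniteMeasure μ] (w : C(K, ℝ)) (g h : C(K, Lam)) :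
    Integrable (fun y => w y * pairL (g y) (h y)) μ := by
  refine Continuous.integrable_of_hasCompactSupport ?_ (HasCompactSupport.of_compactSpace _)
  exact w.continuous.mul ((pairL.continuous.comp g.continuous).clm_apply h.continuous)

/-- The integrated pairing of continuous functions on a compact space, with weight `w`. -/
noncomputable def pairC (μ : Measure K) [IsFiniteMeasure μ] (w : C(K, ℝ)) :
    C(K, Lam) →L[ℝ] C(K, Lam) →L[ℝ] ℝ :=
  LinearMap.mkContinuous₂
    (LinearMap.mk₂ ℝ (fun g h : C(K, Lam) => ∫ y, w y * pairL (g y) (h y) ∂μ)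
      (fun g g' h => by
        rw [← MeasureTheory.integral_add (integrable_pairL μ w g h) (integrable_pairL μ w g' h)]
        simp [mul_add])
      (fun c g h => by
        rw [← MeasureTheory.integral_smul]
        simp [mul_left_comm])
      (fun g h h' => by
        rw [← MeasureTheory.integral_add (integrable_pairL μ w g h) (integrable_pairL μ w g h')]
        simp [mul_add])
      (fun c g h => by
        rw [← MeasureTheory.integral_smul]
        simp [mul_left_comm]))
    (‖w‖ * ‖pairL‖ * μ.real univ) (fun g h => by
      have h1 : ∀ y, ‖w y * pairL (g y) (h y)‖ ≤ ‖w‖ * (‖pairL‖ * ‖g‖ * ‖h‖) := fun y => by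
        rw [norm_mul]
        exact mul_le_mul (w.norm_coe_le_norm y) ((pairL.le_opNorm₂ _ _).trans (mul_le_mul
          (mul_le_mul_of_nonneg_left (g.norm_coe_le_norm y) pairL.opNorm_nonneg) (h.norm_coe_le_norm y)
          (norm_nonneg _) (by positivity))) (norm_nonneg _) (norm_nonneg _)
      have h2 := norm_integral_le_of_norm_le_const (μ := μ) (.of_forall h1)
      refine h2.trans (le_of_eq ?_)
      ring)

theorem pairC_apply (μ : Measure K) [IsFiniteMeasure μ] (w : C(K, ℝ)) (g h : C(K, Lam)) :
    pairC μ w g h = ∫ y, w y * pairing (g y) (h y) ∂μ := rfl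

end PairC

/-! ### Smooth forms inside a Banach space of continuous chart expressions. -/

section BanachForms

open MeasureTheory

variable {M : Type*} [TopologicalSpace M] [ChartedSpace E M] [IsManifold (𝓡 6) ∞ M]
  [CompactSpace M] [T2Space M] {ν : MForm M}

/-- The chart at `x₀`. -/
local notation "ch" => extChartAt (𝓡 6) (M := M) (H := E)

/-- The image in the chart at `i` of the support of the partition function. -/
def chartSet (i : M) : Set E := ch i '' tsupport (chartPartition M i)

theorem isCompact_chartSet (i : M) : IsCompact (chartSet i) :=
  isCompact_image_chart (isCompact_tsupport_chartPartition i) (tsupport_chartPartition i)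

theorem chartSet_subset (i : M) : chartSet i ⊆ (ch i).target := by
  rintro _ ⟨x, hx, rfl⟩
  exact (ch i).map_source (tsupport_chartPartition i hx)

instance (i : M) : CompactSpace (chartSet i) := isCompact_iff_compactSpace.1 (isCompact_chartSet i)

/-- The Lebesgue measure on `chartSet i`. -/
noncomputable def chartVol (i : M) : Measure (chartSet i) := Measure.comap Subtype.val volume

instance (i : M) : IsFiniteMeasure (chartVol i) :=
  ⟨by
    rw [chartVol, comap_subtype_coe_apply (isCompact_chartSet i).measurableSet, image_univ,
      Subtype.range_coe]
    exact (isCompact_chartSet i).measure_lt_top⟩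

/-- Continuous expressions of forms in the charts of the partition of unity. -/
abbrev ChartForms (M : Type*) [TopologicalSpace M] [ChartedSpace E M] [IsManifold (𝓡 6) ∞ M]
    [CompactSpace M] [T2Space M] : Type _ := (i : cidx M) → C(chartSet (i : M), Lam)

/-- The expressions of a smooth form in the charts. -/
noncomputable def emb (θ : MForm M) (h : IsSmooth θ) : ChartForms M := fun i =>
  ⟨fun y => chartRep (i : M) θ y, ((h i).continuousOn.mono (chartSet_subset (i : M))).domRestrict⟩

theorem emb_apply {θ : MForm M} (h : IsSmooth θ) (i : cidx M) (y : chartSet (i : M)) :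
    emb θ h i y = chartRep (i : M) θ y := rfl

theorem emb_add {θ η : MForm M} (h : IsSmooth θ) (h' : IsSmooth η) :
    emb (θ + η) (h.add h') = emb θ h + emb η h' := by
  funext i; ext y; simp [emb_apply, chartRep_add]

theorem emb_smul (c : ℝ) {θ : MForm M} (h : IsSmooth θ) :
    emb (c • θ) (h.smul c) = c • emb θ h := by
  funext i; ext y; simp [emb_apply, chartRep_smul]

theorem emb_zero (h : IsSmooth (0 : MForm M)) : emb 0 h = 0 := by
  funext i; ext y; simp [emb_apply, chartRep_zero]

/-- Some partition function is positive at each point, so every point lies in one of the compact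
sets on which the chart expressions are recorded. -/
theorem emb_injective {θ η : MForm M} {h : IsSmooth θ} {h' : IsSmooth η} (he : emb θ h = emb η h') :
    θ = η := by
  funext x
  obtain ⟨i, hi⟩ := (chartPartition M).exists_pos_of_mem (mem_univ x)
  have hit : x ∈ tsupport (chartPartition M i) := subset_tsupport _ hi.ne'
  have hic : i ∈ cidx M := (finite_chartPartition (M := M)).mem_toFinset.2 ⟨x, hi.ne'⟩
  have h1 := DFunLike.congr_fun (congrFun he ⟨i, hic⟩) ⟨ch i x, ⟨x, hit, rfl⟩⟩
  have hx := tsupport_chartPartition i hit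
  rw [form_eq_pullAt_chartRep hx θ, form_eq_pullAt_chartRep hx η]
  exact congrArg _ h1

/-- Joint continuity on a product with a compact space is continuity into the space of continuous
functions with the supremum norm. -/
theorem continuous_emb {k : E → MForm M} (hk : Fam univ k) :
    Continuous fun s => emb (k s) (hk.isSmooth (mem_univ s)) := by
  refine continuous_pi fun i => ?_
  have h1 : Continuous fun q : E × chartSet (i : M) => chartRep (i : M) (k q.1) q.2 := by
    have h2 := (hk.contDiffOn (i : M)).continuousOn
    have h3 : Continuous fun q : E × chartSet (i : M) => (q.1, (q.2 : E)) :=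
      continuous_fst.prodMk (continuous_subtype_val.comp continuous_snd)
    exact ContinuousOn.comp_continuous (f := fun q : E × chartSet (i : M) => (q.1, (q.2 : E)))
      h2 h3 fun q => ⟨mem_univ _, chartSet_subset _ q.2.2⟩
  exact (ContinuousMap.curry ⟨_, h1⟩).continuous

/-- The density of the integral in the chart at `i`. -/
noncomputable def weight (hν : IsVolumeForm ν) (i : M) : C(chartSet i, ℝ) where
  toFun y := eps ν i y * chartPartition M i ((ch i).symm y)
  continuous_toFun := by
    refine Continuous.mul ?_ ?_
    · refine continuous_iff_continuousAt.2 fun y => ?_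
      have h1 := eps_eventually hν (chartSet_subset i y.2)
      refine ContinuousAt.comp (f := Subtype.val) (g := eps ν i) ?_ continuous_subtype_val.continuousAt
      exact (continuousAt_const (y := eps ν i y)).congr (h1.mono fun _ h => h.symm)
    · exact (contMDiff_chartPartition i).continuous.comp
        (((continuousOn_extChartAt_symm i).mono (chartSet_subset i)).domRestrict)

/-- The extension of the pairing of forms to continuous forms. -/
noncomputable def pairY (hν : IsVolumeForm ν) : ChartForms M →L[ℝ] ChartForms M →L[ℝ] ℝ :=
  ∑ i : cidx M, (pairC (chartVol (i : M)) (weight hν (i : M))).bilinearComp (ContinuousLinearMap.proj i)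
    (ContinuousLinearMap.proj i)

theorem pairY_emb (hν : IsVolumeForm ν) {β η : MForm M} (hβ : IsSmooth β) (hη : IsSmooth η) :
    pairY hν (emb β hβ) (emb η hη) = ip ν β η := by
  rw [ip, integral_eq_sum, ← Finset.sum_coe_sort, pairY]
  simp only [_root_.sum_apply, ContinuousLinearMap.bilinearComp_apply,
    ContinuousLinearMap.proj_apply, pairC_apply]
  refine Finset.sum_congr rfl fun i _ => ?_
  refine (integral_subtype_comap (μ := volume) (isCompact_chartSet (i : M)).measurableSet
    (fun y : E => eps ν (i : M) y * chartPartition M (i : M) ((ch (i : M)).symm y) *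
      pairing (chartRep (i : M) β y) (chartRep (i : M) η y))).trans ?_
  rw [intChart, ← integral_indicator (isCompact_chartSet (i : M)).measurableSet]
  congr 1
  funext y
  by_cases hy : y ∈ chartSet (i : M)
  · rw [indicator_of_mem hy, loc_of_mem (chartSet_subset _ hy), map_smul, smul_eq_mul, mul_assoc]
    have h1 : chartRep (i : M) (cut (i : M) (sigmaWedge β η)) y =
        chartPartition M (i : M) ((ch (i : M)).symm y) • chartRep (i : M) (sigmaWedge β η) y :=
      chartRep_fun_smul _ _ _ y
    have h2 : chartRep (i : M) (sigmaWedge β η) y =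
        CliffordAlgebra.reverse (chartRep (i : M) β y) * chartRep (i : M) η y := by
      have hr : ∀ a, CliffordAlgebra.reverse (pullAt (ch (i : M)).symm y a) =
        pullAt (ch (i : M)).symm y (CliffordAlgebra.reverse a) := reverse_pb _
      simp only [chartRep, pullback, sigmaWedge, map_mul, hr]
    rw [h1, h2, map_smul, smul_eq_mul]
    rfl
  · rw [indicator_of_notMem hy, loc_eq_zero (cut_eq_zero (i : M) _), map_zero]
    rintro ⟨x, ⟨hx, -⟩, rfl⟩
    exact hy ⟨x, hx, rfl⟩

end BanachForms

end GenCY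

namespace GenCY
set_option linter.unusedSectionVars false

/-! ## Finite-dimensionality and Poincaré duality -/

section Duality

open MeasureTheory

variable {M : Type*} [TopologicalSpace M] [ChartedSpace E M] [IsManifold (𝓡 6) ∞ M]
  [CompactSpace M] [T2Space M] {ν : MForm M}

/-- The chart at `x₀`. -/
local notation "ch" => extChartAt (𝓡 6) (M := M) (H := E)

/-- A smooth compactly supported family of operators of rank one whose integral is `S`. -/
structure SmoothKernel (ν : MForm M) (S : MForm M → MForm M) where
  ι : Type
  fin : Fintype ι
  k : ι → E → MForm M
  β : ι → E → MForm M
  K : Set E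
  compact : IsCompact K
  famk : ∀ a, Fam univ (k a)
  famβ : ∀ a, Fam univ (β a)
  zk : ∀ a, ∀ s ∉ K, k a s = 0
  zβ : ∀ a, ∀ s ∉ K, β a s = 0
  eq : ∀ η, IsSmooth η →
    S η = ∑ a, formInt volume (fun _ => 1) (fun s => ip ν (β a s) η • k a s)

/-- Cutting off `β` by a bump function equal to `1` on `K` does not change the operator, because `k`
vanishes off `K`. The compact support of `β` matters for duality, where `k` and `β` exchange roles.
-/
theorem Smoothing.nonempty_smoothKernel {S : MForm M → MForm M} (h : Smoothing ν S) :
    Nonempty (SmoothKernel ν S) := by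
  obtain ⟨ι, i1, k, β, K, h1, h2, h3, h4, h5⟩ := h
  obtain ⟨r, hr0, hr⟩ := h1.isBounded.subset_closedBall_lt 0 (0 : E)
  let χ : ContDiffBump (0 : E) := ⟨r, r + 1, hr0, by linarith⟩
  have hχ0 : ∀ s ∉ Metric.closedBall (0 : E) (r + 1), χ s = 0 := fun s hs => by
    have : s ∉ tsupport χ := by rwa [χ.tsupport_eq]
    exact image_eq_zero_of_notMem_tsupport this
  refine ⟨⟨ι, i1, k, fun a s => χ s • β a s, Metric.closedBall 0 (r + 1), isCompact_closedBall _ _, h2,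
    fun a => (h3 a).param_smul isOpen_univ χ.contDiff.contDiffOn, fun a s hs => h4 a s fun h =>
      hs (Metric.closedBall_subset_closedBall (by linarith) (hr h)),
    fun a s hs => by simp only [hχ0 s hs, zero_smul], fun η hη => ?_⟩⟩
  rw [h5 η hη]
  refine Finset.sum_congr rfl fun a _ => ?_
  congr 1
  funext s
  by_cases hs : s ∈ K
  · rw [χ.one_of_mem_closedBall (hr hs), one_smul]
  · rw [h4 a s hs, smul_zero, smul_zero]

theorem IsSmooth.inv {θ : MForm M} (h : IsSmooth θ) : IsSmooth (fun x => GenCY.inv (θ x)) :=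
  h.map (T := invL) invL_pb

/-- A smooth form is closed of parity `p` if it is orthogonal to all forms that are orthogonal to
the closed forms of parity `p`. -/
theorem mem_closedForms_of_ip (hν : IsVolumeForm ν) {p : ZMod 2} {θ : MForm M} (hθ : IsSmooth θ)
    (h : ∀ τ, IsSmooth τ → (∀ α ∈ closedForms M p, ip ν τ α = 0) → ip ν τ θ = 0) :
    θ ∈ closedForms M p := by
  -- Two kinds of test form suffice: `inv β - sgn p • β`, orthogonal to all forms of parity `p`,
  -- detects the parity, and `extD β`, orthogonal to all closed forms, detects closedness.
  have hip : ∀ β η : MForm M, IsSmooth β → IsSmooth η →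
      ip ν ((fun x => inv (β x)) + (-sgn p) • β) η =
        ip ν β ((fun x => inv (η x)) + (-sgn p) • η) := fun β η hβ hη => by
    rw [ip_add_left hν hβ.inv (hβ.smul _) hη, ip_add_right hν hβ hη.inv (hη.smul _), ip_inv,
      ip_smul_left, ip_smul_right]
  refine ⟨hθ, ?_, ?_⟩
  · have h0 : (fun x => inv (θ x)) + (-sgn p) • θ = 0 := by
      refine ip_nondegenerate hν (hθ.inv.add (hθ.smul _)) fun β hβ => ?_
      rw [← hip β θ hβ hθ]
      refine h _ (hβ.inv.add (hβ.smul _)) fun α hα => ?_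
      rw [hip β α hβ hα.1]
      have : (fun x => inv (α x)) + (-sgn p) • α = 0 := by
        funext x
        have := hasParity_iff.1 hα.2.1 x
        simp [this]
      rw [this]
      simpa using ip_smul_right (ν := ν) 0 β 0
    rw [hasParity_iff]
    intro x
    have := congrFun h0 x
    simp only [Pi.add_apply, Pi.zero_apply, neg_smul] at this
    exact add_neg_eq_zero.1 this
  · refine ip_nondegenerate hν hθ.extD fun β hβ => ?_
    rw [ip_extD_right hν hθ hβ, neg_eq_zero]
    refine h _ hβ.extD fun α hα => ?_
    rw [ip_extD_left hν hβ hα.1, hα.2.2, neg_eq_zero]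
    simpa using ip_smul_right (ν := ν) 0 β 0

attribute [instance] SmoothKernel.fin

variable {S : MForm M → MForm M} (D : SmoothKernel ν S)

theorem SmoothKernel.smoothk (a : D.ι) (s : E) : IsSmooth (D.k a s) := (D.famk a).isSmooth (mem_univ s)

theorem SmoothKernel.smoothβ (a : D.ι) (s : E) : IsSmooth (D.β a s) := (D.famβ a).isSmooth (mem_univ s)

/-- The coefficient of the operator of rank one. -/
noncomputable def SmoothKernel.coef (hν : IsVolumeForm ν) (a : D.ι) (s : E) : ChartForms M →L[ℝ] ℝ :=
  pairY hν (emb (D.β a s) (D.smoothβ a s))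

theorem SmoothKernel.continuous_coef (hν : IsVolumeForm ν) (a : D.ι) :
    Continuous (D.coef hν a) := (pairY hν).continuous.comp (continuous_emb (D.famβ a))

theorem SmoothKernel.locallyIntegrable (hν : IsVolumeForm ν) (a : D.ι) (y : ChartForms M) :
    LocallyIntegrable (fun s => D.coef hν a s y) :=
  ((D.continuous_coef hν a).clm_apply continuous_const).locallyIntegrable

/-- The extension of the smoothing operator to continuous forms. -/
noncomputable def SmoothKernel.ext (hν : IsVolumeForm ν) (y : ChartForms M) : MForm M :=
  ∑ a, formInt volume (fun s => D.coef hν a s y) (D.k a)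

theorem SmoothKernel.isSmooth_ext (hν : IsVolumeForm ν) (y : ChartForms M) :
    IsSmooth (D.ext hν y) :=
  IsSmooth.sum _ fun a _ => isSmooth_formInt (D.locallyIntegrable hν a y) D.compact (D.famk a) (D.zk a)

theorem SmoothKernel.ext_emb (hν : IsVolumeForm ν) {η : MForm M} (hη : IsSmooth η) :
    D.ext hν (emb η hη) = S η := by
  rw [D.eq η hη, SmoothKernel.ext]
  refine Finset.sum_congr rfl fun a _ => ?_
  funext x
  simp only [formInt, SmoothKernel.coef, pairY_emb, Pi.smul_apply, one_smul]

/-- The smoothing operator on continuous forms. -/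
noncomputable def SmoothKernel.op (hν : IsVolumeForm ν) : ChartForms M →L[ℝ] ChartForms M :=
  ∑ a, ∫ s, (D.coef hν a s).smulRight (emb (D.k a s) (D.smoothk a s))

theorem SmoothKernel.integrable (hν : IsVolumeForm ν) (a : D.ι) :
    Integrable fun s => (D.coef hν a s).smulRight (emb (D.k a s) (D.smoothk a s)) := by
  refine Continuous.integrable_of_hasCompactSupport ?_ (hasCompactSupport_of_zero D.compact ?_)
  · exact ((ContinuousLinearMap.smulRightL ℝ (ChartForms M) (ChartForms M)).continuous.comp
      (D.continuous_coef hν a)).clm_apply (continuous_emb (D.famk a))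
  · intro s hs
    have : emb (D.k a s) (D.smoothk a s) = 0 := by
      have h0 := emb_zero (M := M) isSmooth_zero
      rw [← h0]
      congr 1
      exact D.zk a s hs
    rw [this]
    ext y
    simp

/-- Operators of rank one are compact, and an operator-valued integral of compact operators is
compact. -/
theorem SmoothKernel.isCompactOperator_op (hν : IsVolumeForm ν) : IsCompactOperator (D.op hν) := by
  have h : D.op hν ∈ compactOperator (RingHom.id ℝ) (ChartForms M) (ChartForms M) := by
    refine Submodule.sum_mem _ fun a _ => ?_
    refine isCompactOperator_integral volume _ (D.integrable hν a) fun s => ?_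
    have h1 : IsCompactOperator (D.coef hν a s) :=
      isCompactOperator_of_locallyCompactSpace_dom (D.coef hν a s)
    exact h1.clm_comp ((1 : ℝ →L[ℝ] ℝ).smulRight (emb (D.k a s) (D.smoothk a s)))
  exact h

/-- Evaluation at a point of a chart is continuous and linear, so it commutes with the
operator-valued integral. In particular the extended operator takes values in smooth forms. -/
theorem SmoothKernel.emb_ext (hν : IsVolumeForm ν) (y : ChartForms M) :
    emb (D.ext hν y) (D.isSmooth_ext hν y) = D.op hν y := by
  funext i
  ext z
  let ev : ChartForms M →L[ℝ] Lam :=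
    (ContinuousMap.evalCLM ℝ z) ∘L (ContinuousLinearMap.proj i)
  have h1 : D.op hν y i z = ∑ a, ∫ s, D.coef hν a s y • chartRep (i : M) (D.k a s) z := by
    change ev (D.op hν y) = _
    rw [SmoothKernel.op, _root_.sum_apply, map_sum]
    refine Finset.sum_congr rfl fun a _ => ?_
    rw [ContinuousLinearMap.integral_apply (D.integrable hν a),
      ← ev.integral_comp_comm ((D.integrable hν a).apply_continuousLinearMap y)]
    congr 1
  have h2 : ∀ a, chartRep (i : M) (formInt volume (fun s => D.coef hν a s y) (D.k a)) z =
      ∫ s, D.coef hν a s y • chartRep (i : M) (D.k a s) z := fun a =>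
    chartRep_formInt (D.locallyIntegrable hν a y) D.compact (D.famk a) (D.zk a) _ _
  rw [h1, emb_apply, SmoothKernel.ext]
  simp only [← h2]
  simp [chartRep, pullback, Finset.sum_apply]

theorem SmoothKernel.ip_ext (hν : IsVolumeForm ν) {τ : MForm M} (hτ : IsSmooth τ) (y : ChartForms M) :
    ip ν τ (D.ext hν y) = pairY hν (emb τ hτ) (D.op hν y) := by
  rw [← D.emb_ext hν y, pairY_emb]

end Duality

end GenCY

namespace GenCY
set_option linter.unusedSectionVars false

/-! ### Classes of limits of closed forms, and representation of functionals by closed forms. -/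

section PoincareDuality

open MeasureTheory

variable {M : Type*} [TopologicalSpace M] [ChartedSpace E M] [IsManifold (𝓡 6) ∞ M]
  [CompactSpace M] [T2Space M] {ν : MForm M} {R Rt : MForm M → MForm M} {p : ZMod 2}

/-- The expressions in charts of closed forms. -/
noncomputable def embZ (M : Type*) [TopologicalSpace M] [ChartedSpace E M] [IsManifold (𝓡 6) ∞ M]
    [CompactSpace M] [T2Space M] (p : ZMod 2) : closedForms M p →ₗ[ℝ] ChartForms M where
  toFun α := emb (α : MForm M) α.2.1
  map_add' α β := emb_add α.2.1 β.2.1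
  map_smul' c α := emb_smul c α.2.1

/-- The closure of the closed forms in the space of continuous forms. -/
noncomputable def closedClosure (M : Type*) [TopologicalSpace M] [ChartedSpace E M]
    [IsManifold (𝓡 6) ∞ M] [CompactSpace M] [T2Space M] (p : ZMod 2) : Submodule ℝ (ChartForms M) :=
  (LinearMap.range (embZ M p)).topologicalClosure

/-- By `mem_closedForms_of_ip` membership is a family of linear equations on pairings. These
pairings with the regularized form depend continuously on `y`, so the equations pass from closed
forms to their limits. -/
theorem SmoothKernel.ext_mem (D : SmoothKernel ν R) (hν : IsVolumeForm ν) (hR : Adm ν R Rt)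
    {y : ChartForms M} (hy : y ∈ closedClosure M p) : D.ext hν y ∈ closedForms M p := by
  refine mem_closedForms_of_ip hν (D.isSmooth_ext hν y) fun τ hτ h => ?_
  have hc : IsClosed {y : ChartForms M | pairY hν (emb τ hτ) (D.op hν y) = 0} :=
    isClosed_eq (((pairY hν (emb τ hτ)).continuous).comp (D.op hν).continuous) continuous_const
  rw [D.ip_ext hν hτ]
  refine (hc.closure_subset_iff.2 ?_) hy
  rintro _ ⟨α, rfl⟩
  change pairY hν (emb τ hτ) (D.op hν (emb (α : MForm M) α.2.1)) = 0
  rw [← D.ip_ext hν hτ, D.ext_emb]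
  exact h _ (hR.mem_closedForms α.2)

theorem SmoothKernel.ext_add (D : SmoothKernel ν R) (hν : IsVolumeForm ν) (y z : ChartForms M) :
    D.ext hν (y + z) = D.ext hν y + D.ext hν z := by
  refine emb_injective (h := D.isSmooth_ext hν _)
    (h' := (D.isSmooth_ext hν y).add (D.isSmooth_ext hν z)) ?_
  rw [emb_add (D.isSmooth_ext hν y) (D.isSmooth_ext hν z), D.emb_ext, D.emb_ext, D.emb_ext, map_add]

theorem SmoothKernel.ext_smul (D : SmoothKernel ν R) (hν : IsVolumeForm ν) (c : ℝ)
    (y : ChartForms M) : D.ext hν (c • y) = c • D.ext hν y := by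
  refine emb_injective (h := D.isSmooth_ext hν _) (h' := (D.isSmooth_ext hν y).smul c) ?_
  rw [emb_smul c (D.isSmooth_ext hν y), D.emb_ext, D.emb_ext, map_smul]

theorem Coh.mk_eq_iff {α β : closedForms M p} :
    Coh.mk α = Coh.mk β ↔ (α : MForm M) - β ∈ exactForms M p :=
  Submodule.Quotient.eq _

theorem Coh.mk_surjective (u : Coh M p) : ∃ α : closedForms M p, Coh.mk α = u :=
  Submodule.Quotient.mk_surjective _ u

/-- The class of the regularization of a limit of closed forms. -/
noncomputable def SmoothKernel.cls (D : SmoothKernel ν R) (hν : IsVolumeForm ν) (hR : Adm ν R Rt)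
    (p : ZMod 2) : closedClosure M p →ₗ[ℝ] Coh M p where
  toFun y := Coh.mk ⟨D.ext hν y, D.ext_mem hν hR y.2⟩
  map_add' y z := by
    refine Eq.trans ?_ (Submodule.Quotient.mk_add _).symm
    exact congrArg Coh.mk (Subtype.ext (D.ext_add hν y z))
  map_smul' c y := by
    refine Eq.trans ?_ (Submodule.Quotient.mk_smul _ _ _).symm
    exact congrArg Coh.mk (Subtype.ext (D.ext_smul hν c y))

theorem embZ_mem (α : closedForms M p) : embZ M p α ∈ closedClosure M p :=
  Submodule.le_topologicalClosure _ ⟨α, rfl⟩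

theorem SmoothKernel.op_mem (D : SmoothKernel ν R) (hν : IsVolumeForm ν) (hR : Adm ν R Rt)
    {y : ChartForms M} (hy : y ∈ closedClosure M p) : D.op hν y ∈ closedClosure M p := by
  rw [← D.emb_ext hν y]
  exact embZ_mem ⟨_, D.ext_mem hν hR hy⟩

theorem SmoothKernel.cls_embZ (D : SmoothKernel ν R) (hν : IsVolumeForm ν) (hR : Adm ν R Rt)
    (α : closedForms M p) : D.cls hν hR p ⟨embZ M p α, embZ_mem α⟩ = Coh.mk α := by
  refine Coh.mk_eq_iff.2 ?_
  change D.ext hν (emb (α : MForm M) α.2.1) - α ∈ _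
  rw [D.ext_emb]
  exact hR.homotopic α.2

/-- The regularization of `y` is already a closed smooth form. Regularizing it once more does not
change its class, since the operator is homotopic to the identity. -/
theorem SmoothKernel.cls_op (D : SmoothKernel ν R) (hν : IsVolumeForm ν) (hR : Adm ν R Rt)
    (y : closedClosure M p) :
    D.cls hν hR p ⟨D.op hν y, D.op_mem hν hR y.2⟩ = D.cls hν hR p y := by
  have h := D.cls_embZ hν hR ⟨D.ext hν y, D.ext_mem hν hR y.2⟩
  refine Eq.trans ?_ h
  congr 2
  exact (D.emb_ext hν y).symm

/-- The regularization restricts to a compact operator on the Banach space of limits of closed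
forms, and the class map is invariant under it, so the Riesz theory applies. -/
theorem cls_properties (D : SmoothKernel ν R) (hν : IsVolumeForm ν) (hR : Adm ν R Rt) (p : ZMod 2) :
    FiniteDimensional ℝ (LinearMap.range (D.cls hν hR p)) ∧
      ∀ f : Coh M p →ₗ[ℝ] ℝ, Continuous fun y => f (D.cls hν hR p y) := by
  have : CompleteSpace (closedClosure M p) :=
    (Submodule.isClosed_topologicalClosure _).completeSpace_coe
  set K : closedClosure M p →L[ℝ] closedClosure M p :=
    ((D.op hν) ∘L (closedClosure M p).subtypeL).codRestrict _
      fun y => D.op_mem hν hR y.2 with hK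
  have hKc : IsCompactOperator K :=
    ((D.isCompactOperator_op hν).comp_clm (closedClosure M p).subtypeL).codRestrict
      (fun y => D.op_mem hν hR y.2) (Submodule.isClosed_topologicalClosure _)
  exact continuous_of_comp_one_sub hKc (D.cls hν hR p) fun y => D.cls_op hν hR y

/-- Every class is represented by a closed form and is therefore in the range of the class map. -/
theorem finiteDimensional_coh (hν : IsVolumeForm ν) (p : ZMod 2) :
    FiniteDimensional ℝ (Coh M p) := by
  obtain ⟨R, Rt, hR, hS⟩ := exists_adm_smoothing hν
  obtain ⟨D⟩ := hS.nonempty_smoothKernel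
  have h1 := (cls_properties D hν hR p).1
  have h2 : LinearMap.range (D.cls hν hR p) = ⊤ := by
    rw [LinearMap.range_eq_top]
    intro u
    obtain ⟨α, rfl⟩ := Coh.mk_surjective u
    exact ⟨_, D.cls_embZ hν hR α⟩
  rw [h2] at h1
  exact LinearEquiv.finiteDimensional (Submodule.topEquiv (R := ℝ) (M := Coh M p))

theorem mk_eq_zero_of_mem_exactForms {α : closedForms M p} (h : (α : MForm M) ∈ exactForms M p) :
    Coh.mk α = 0 := (Submodule.Quotient.mk_eq_zero _).2 h

theorem ip_zero_right (β : MForm M) : ip ν β 0 = 0 := by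
  simpa using ip_smul_right (ν := ν) 0 β 0

/-- The projection of forms to the forms of parity `p`. -/
noncomputable def parityPart (p : ZMod 2) (θ : MForm M) : MForm M :=
  (2⁻¹ : ℝ) • (θ + sgn p • fun x => inv (θ x))

theorem IsSmooth.parityPart {θ : MForm M} (h : IsSmooth θ) (p : ZMod 2) :
    IsSmooth (parityPart p θ) := (h.add (h.inv.smul _)).smul _

theorem hasParity_parityPart (p : ZMod 2) (θ : MForm M) : HasParity p (parityPart p θ) := by
  rw [hasParity_iff]
  intro x
  have hi : inv (inv (θ x)) = θ x := inv_inv (θ x)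
  simp only [parityPart, Pi.smul_apply, Pi.add_apply, map_smul, map_add, hi, smul_add, smul_smul]
  rw [add_comm, mul_left_comm (sgn p), sgn_mul_self, mul_one, mul_comm (sgn p)]

theorem ip_parityPart (hν : IsVolumeForm ν) {β η : MForm M} (hβ : IsSmooth β) (hη : IsSmooth η) :
    ip ν (parityPart p β) η = ip ν β (parityPart p η) := by
  rw [parityPart, parityPart, ip_smul_left, ip_smul_right, ip_add_left hν hβ (hβ.inv.smul _) hη,
    ip_add_right hν hβ hη (hη.inv.smul _), ip_smul_left, ip_smul_right, ip_inv]

theorem parityPart_of_hasParity {θ : MForm M} (h : HasParity p θ) : parityPart p θ = θ := by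
  funext x
  have := hasParity_iff.1 h x
  simp only [parityPart, Pi.smul_apply, Pi.add_apply, this, smul_smul, sgn_mul_self, one_smul]
  rw [← two_smul ℝ (θ x), smul_smul]
  norm_num

theorem extD_parityPart {τ : MForm M} (h : IsSmooth τ) :
    extD (parityPart (p + 1) τ) = parityPart p (extD τ) := by
  rw [parityPart, extD_smul _ (h.add (h.inv.smul _)), extD_add h (h.inv.smul _),
    extD_smul _ h.inv, extD_inv h, parityPart, sgn_add_one]
  congr 2
  funext x
  simp

/-- Poincaré duality: each linear functional on the cohomology is the pairing with a closed form. -/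
theorem exists_dual_form (hν : IsVolumeForm ν) (f : Coh M p →ₗ[ℝ] ℝ) :
    ∃ β : closedForms M p, ∀ α : closedForms M p, f (Coh.mk α) = ip ν (β : MForm M) α := by
  obtain ⟨R, Rt, hR, hS⟩ := exists_adm_smoothing hν
  obtain ⟨D⟩ := hS.nonempty_smoothKernel
  let g : closedClosure M p →L[ℝ] ℝ :=
    ⟨f ∘ₗ D.cls hν hR p, (cls_properties D hν hR p).2 f⟩
  -- Hahn–Banach: the functional on limits of closed forms, continuous by the Riesz theory, extends
  -- to all continuous forms.
  obtain ⟨T, hT, -⟩ := exists_extension_norm_eq (closedClosure M p) g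
  have hTc : ∀ a, Continuous fun s => T (emb (D.k a s) (D.smoothk a s)) := fun a =>
    T.continuous.comp (continuous_emb (D.famk a))
  -- This is the transposed kernel applied to `T`. It is smooth although `T` is only a continuous
  -- functional, and pairing with it is `T` composed with the regularization.
  set β₀ : MForm M := ∑ a, formInt volume (fun s => T (emb (D.k a s) (D.smoothk a s))) (D.β a)
    with hβ₀
  have hβi : ∀ a, IsSmooth (formInt volume (fun s => T (emb (D.k a s) (D.smoothk a s))) (D.β a)) :=
    fun a => isSmooth_formInt (hTc a).locallyIntegrable D.compact (D.famβ a) (D.zβ a)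
  have hβs : IsSmooth β₀ := IsSmooth.sum _ fun a _ => hβi a
  have key : ∀ α : closedForms M p, ip ν β₀ α = f (Coh.mk α) := by
    intro α
    have h1 : T (D.op hν (embZ M p α)) = f (Coh.mk α) := by
      have h2 := hT ⟨D.op hν (embZ M p α), D.op_mem hν hR (embZ_mem α)⟩
      refine h2.trans ?_
      change f (D.cls hν hR p _) = _
      rw [D.cls_op hν hR ⟨embZ M p α, embZ_mem α⟩, D.cls_embZ]
    rw [← h1, SmoothKernel.op, _root_.sum_apply, map_sum]
    have h3 : ip ν β₀ (α : MForm M) = ∑ a, ip ν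
        (formInt volume (fun s => T (emb (D.k a s) (D.smoothk a s))) (D.β a)) α := by
      rw [hβ₀]
      have h4 : ∀ s : Finset D.ι, ip ν (∑ a ∈ s,
          formInt volume (fun s => T (emb (D.k a s) (D.smoothk a s))) (D.β a)) (α : MForm M) =
          ∑ a ∈ s, ip ν (formInt volume (fun s => T (emb (D.k a s) (D.smoothk a s))) (D.β a)) α := by
        classical
        intro s
        induction s using Finset.induction_on with
        | empty => simpa using ip_smul_left (ν := ν) 0 0 (α : MForm M)
        | insert a s ha ih =>
          rw [Finset.sum_insert ha, Finset.sum_insert ha,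
            ip_add_left hν (hβi a) (IsSmooth.sum _ fun a _ => hβi a) α.2.1, ih]
      exact h4 _
    rw [h3]
    refine Finset.sum_congr rfl fun a _ => ?_
    rw [ip_formInt_left hν α.2.1 (hTc a) D.compact (D.famβ a) (D.zβ a),
      ContinuousLinearMap.integral_apply (D.integrable hν a),
      ← T.integral_comp_comm ((D.integrable hν a).apply_continuousLinearMap _)]
    congr 1
    funext s
    rw [ContinuousLinearMap.smulRight_apply, map_smul, smul_eq_mul, mul_comm]
    congr 1
    exact (pairY_emb hν (D.smoothβ a s) α.2.1).symm
  -- Closedness holds because `f` vanishes on exact forms. The parity part is taken since `β₀` is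
  -- only controlled through its pairings with forms of parity `p`.
  have hclosed : parityPart p β₀ ∈ closedForms M p := by
    refine ⟨hβs.parityPart p, hasParity_parityPart p β₀, ?_⟩
    refine ip_nondegenerate hν (hβs.parityPart p).extD fun τ hτ => ?_
    rw [ip_extD_right hν (hβs.parityPart p) hτ, ip_skew, neg_neg,
      ip_parityPart hν hβs hτ.extD, ← extD_parityPart hτ]
    have hex : extD (parityPart (p + 1) τ) ∈ exactForms M p :=
      ⟨_, hτ.parityPart _, hasParity_parityPart _ _, rfl⟩
    have h5 := key ⟨_, exactForms_le_closedForms p hex⟩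
    rw [mk_eq_zero_of_mem_exactForms hex, map_zero] at h5
    exact h5
  refine ⟨⟨_, hclosed⟩, fun α => ?_⟩
  rw [← key α]
  change _ = ip ν (parityPart p β₀) α
  rw [ip_parityPart hν hβs α.2.1, parityPart_of_hasParity α.2.2.1]

end PoincareDuality

end GenCY

namespace GenCY
set_option linter.unusedSectionVars false

/-! ## Equivalent structures have the same classes -/

section Gauge

variable {M : Type*} [TopologicalSpace M] [ChartedSpace E M] [IsManifold (𝓡 6) ∞ M]
  {p : ZMod 2}

/-- The homotopy formula along the isotopy; the additional real parameter is a dummy. -/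
theorem pullback_sub_mem_exactForms {F : ℝ → M → M}
    (hF : ContMDiff (𝓘(ℝ, ℝ).prod (𝓡 6)) (𝓡 6) ∞ (fun q : ℝ × M => F q.1 q.2))
    (h0 : ∀ x, F 0 x = x) {θ : MForm M} (hθ : θ ∈ closedForms M p) :
    pullback (F 1) θ - θ ∈ exactForms M p := by
  have hH : ContMDiff (𝓘(ℝ, ℝ × ℝ).prod (𝓡 6)) (𝓡 6) ∞
      (fun q : (ℝ × ℝ) × M => (fun r : ℝ × ℝ => F r.2) q.1 q.2) := by
    have h1 : ContMDiff 𝓘(ℝ, ℝ × ℝ) 𝓘(ℝ, ℝ) ∞ (fun q : ℝ × ℝ => q.2) := contDiff_snd.contMDiff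
    exact hF.comp ((h1.comp contMDiff_fst).prodMk contMDiff_snd)
  have h2 := extD_hmt (H := fun r : ℝ × ℝ => F r.2) hH hθ.1 hθ.2.2 (0 : ℝ)
  have h3 : F 0 = id := funext h0
  simp only [h3, pullback_id] at h2
  exact ⟨_, (Fam.hmt (H := fun r : ℝ × ℝ => F r.2) hH hθ.1).isSmooth (mem_univ 0), HasParity.hmt (H := fun r : ℝ × ℝ => F r.2) hH hθ.1 hθ.2.1 0, h2⟩

theorem mul_mem_exactForms {ξ θ : MForm M} (hξ : IsSmooth ξ) (hp : HasParity 1 ξ)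
    (hθ : θ ∈ closedForms M p) : extD ξ * θ ∈ exactForms M p := by
  refine ⟨ξ * θ, hξ.mul hθ.1, ?_, ?_⟩
  · rw [add_comm]; exact hp.mul hθ.2.1
  · rw [extD_mul hξ hθ.1, hθ.2.2, mul_zero, add_zero]

/-- For closed `θ` one has `dξ ∧ θ = d(ξ ∧ θ)`. The result is again closed, so the same applies to
the higher powers of `dξ` in the exponential. -/
theorem expForm_sub_mem_exactForms {ξ θ : MForm M} (hξ : IsSmooth ξ)
    (h1 : ∀ x, ξ x ∈ ⋀[ℝ]^1 (Module.Dual ℝ E)) (hθ : θ ∈ closedForms M p) :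
    expForm (extD ξ) * θ - θ ∈ exactForms M p := by
  have hp : HasParity 1 ξ := fun x => by
    have h := h1 x
    change ξ x ∈ LinearMap.range (ExteriorAlgebra.ι ℝ) ^ 1 at h
    rw [pow_one] at h
    obtain ⟨v, hv⟩ := h
    rw [← hv]
    exact CliffordAlgebra.ι_mem_evenOdd_one _ v
  have e1 := mul_mem_exactForms hξ hp hθ
  have e2 := mul_mem_exactForms hξ hp (exactForms_le_closedForms p e1)
  have e3 := mul_mem_exactForms hξ hp (exactForms_le_closedForms p e2)
  have e : expForm (extD ξ) * θ - θ = extD ξ * θ + (2⁻¹ : ℝ) • (extD ξ * (extD ξ * θ)) +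
      (6⁻¹ : ℝ) • (extD ξ * (extD ξ * (extD ξ * θ))) := by
    funext x
    simp only [expForm, Pi.sub_apply, Pi.mul_apply, Pi.add_apply, Pi.smul_apply,
      Finset.sum_range_succ, Finset.sum_range_zero, zero_add, Nat.factorial, pow_zero,
      add_mul, smul_mul_assoc, pow_succ, mul_assoc, one_mul]
    norm_num
    abel
  rw [e]
  exact Submodule.add_mem _ (Submodule.add_mem _ e1 (Submodule.smul_mem _ _ e2))
    (Submodule.smul_mem _ _ e3)

theorem gauge_sub_mem_exactForms {F : ℝ → M → M}
    (hF : ContMDiff (𝓘(ℝ, ℝ).prod (𝓡 6)) (𝓡 6) ∞ (fun q : ℝ × M => F q.1 q.2))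
    (h0 : ∀ x, F 0 x = x) {ξ θ : MForm M} (hξ : IsSmooth ξ)
    (h1 : ∀ x, ξ x ∈ ⋀[ℝ]^1 (Module.Dual ℝ E)) (hθ : θ ∈ closedForms M p) :
    expForm (extD ξ) * pullback (F 1) θ - θ ∈ exactForms M p := by
  have e1 := pullback_sub_mem_exactForms hF h0 hθ
  have hc : pullback (F 1) θ ∈ closedForms M p := by
    have := Submodule.add_mem _ (exactForms_le_closedForms p e1) hθ
    rwa [sub_add_cancel] at this
  have := Submodule.add_mem _ (expForm_sub_mem_exactForms hξ h1 hc) e1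
  rwa [sub_add_sub_cancel] at this

end Gauge

end GenCY

namespace GenCY
set_option linter.unusedSectionVars false

/-! ## The Clifford action and the pairing -/

theorem topCoeff_of_mem {n : ℕ} (hn : n ≠ 6) {a : Lam} (ha : a ∈ ⋀[ℝ]^n (Module.Dual ℝ E)) :
    topCoeff a = 0 := by
  rw [← ExteriorAlgebra.ιMulti_span_fixedDegree] at ha
  induction ha using Submodule.span_induction with
  | mem x hx =>
    obtain ⟨f, rfl⟩ := hx
    rw [topCoeff, ExteriorAlgebra.liftAlternating_apply_ιMulti, Pi.single_eq_of_ne hn]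
    rfl
  | zero => exact map_zero _
  | add x y _ _ hx hy => rw [map_add, hx, hy, add_zero]
  | smul c x _ hx => rw [map_smul, hx, smul_zero]

theorem contr_mem (v : E) (n : ℕ) : ∀ a ∈ ⋀[ℝ]^(n + 1) (Module.Dual ℝ E),
    contr v a ∈ ⋀[ℝ]^n (Module.Dual ℝ E) := by
  induction n with
  | zero =>
    intro a ha
    change a ∈ LinearMap.range (ExteriorAlgebra.ι ℝ) ^ (0 + 1) at ha
    rw [zero_add, pow_one] at ha
    obtain ⟨ξ, rfl⟩ := ha
    have h := contr_ι_mul v ξ 1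
    have h1 : contr v 1 = 0 := by
      have := contr_algebraMap v 1
      rwa [map_one] at this
    rw [mul_one, h1, mul_zero, sub_zero] at h
    rw [h]
    refine Submodule.smul_mem _ _ ?_
    change (1 : Lam) ∈ LinearMap.range (ExteriorAlgebra.ι ℝ) ^ 0
    rw [pow_zero]
    exact Submodule.one_le.1 le_rfl
  | succ n ih =>
    intro a ha
    change a ∈ LinearMap.range (ExteriorAlgebra.ι ℝ) ^ (n + 1 + 1) at ha
    rw [pow_succ'] at ha
    induction ha using Submodule.mul_induction_on' with
    | mem_mul_mem m hm a ha =>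
      obtain ⟨ξ, rfl⟩ := hm
      rw [contr_ι_mul]
      refine Submodule.sub_mem _ (Submodule.smul_mem _ _ ha) ?_
      change _ ∈ LinearMap.range (ExteriorAlgebra.ι ℝ) ^ (n + 1)
      rw [pow_succ']
      exact Submodule.mul_mem_mul ⟨ξ, rfl⟩ (ih a ha)
    | add x _ y _ hx hy => rw [map_add]; exact Submodule.add_mem _ hx hy

/-- Contraction lowers the degree by one, so a degree 6 component could only come from degree 7,
where forms vanish. -/
theorem topCoeff_contr (v : E) (a : Lam) : topCoeff (contr v a) = 0 := by
  have ha : a ∈ Submodule.span ℝ (range fun x : Σ n, Fin n → Module.Dual ℝ E =>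
      ExteriorAlgebra.ιMulti ℝ x.1 x.2) := by
    rw [ExteriorAlgebra.ιMulti_span]; trivial
  induction ha using Submodule.span_induction with
  | mem x hx =>
    obtain ⟨⟨n, f⟩, rfl⟩ := hx
    have hm : ExteriorAlgebra.ιMulti ℝ n f ∈ ⋀[ℝ]^n (Module.Dual ℝ E) :=
      ExteriorAlgebra.ιMulti_range ℝ n ⟨f, rfl⟩
    dsimp only
    rcases n with _ | n
    · rw [ExteriorAlgebra.ιMulti_zero_apply]
      have := contr_algebraMap v 1
      rw [map_one] at this
      rw [this, map_zero]
    · by_cases hn : n = 6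
      · subst hn
        have : ExteriorAlgebra.ιMulti ℝ 7 f = 0 := by
          refine AlternatingMap.map_linearDependent _ f fun h => ?_
          have := h.fintype_card_le_finrank
          simp at this
        rw [this, map_zero, map_zero]
      · exact topCoeff_of_mem hn (contr_mem v n _ hm)
  | zero => simp
  | add x y _ _ hx hy => rw [map_add, map_add, hx, hy, add_zero]
  | smul c x _ hx => rw [map_smul, map_smul, hx, smul_zero]

theorem pairing_ι_mul (ξ : Module.Dual ℝ E) (a b : Lam) :
    pairing (ExteriorAlgebra.ι ℝ ξ * a) b = pairing a (ExteriorAlgebra.ι ℝ ξ * b) := by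
  have : CliffordAlgebra.reverse (ExteriorAlgebra.ι ℝ ξ) = ExteriorAlgebra.ι ℝ ξ :=
    CliffordAlgebra.reverse_ι _
  rw [pairing, CliffordAlgebra.reverse.map_mul, this, mul_assoc, pairing]

/-- Peel one-forms off `a`, using that wedging with a one-form is self-adjoint and that contraction
is an antiderivation. The base case is the vanishing of the top coefficient of a contraction. -/
theorem pairing_contr (v : E) (a b : Lam) : pairing (contr v a) b = pairing a (contr v b) := by
  induction a using CliffordAlgebra.left_induction generalizing b with
  | algebraMap r =>
    have h : pairing (algebraMap ℝ Lam r) (contr v b) = 0 := by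
      rw [pairing, CliffordAlgebra.reverse.commutes, ← Algebra.smul_def, map_smul, topCoeff_contr,
        smul_zero]
    rw [contr_algebraMap]
    refine Eq.trans ?_ h.symm
    simp [pairing]
  | add x y hx hy =>
    have h : ∀ x y z, pairing (x + y) z = pairing x z + pairing y z := by
      intro x y z; simp [pairing, add_mul]
    rw [map_add, h, h, hx, hy]
  | ι_mul x ξ hx =>
    change pairing (contr v (ExteriorAlgebra.ι ℝ ξ * x)) b = pairing (ExteriorAlgebra.ι ℝ ξ * x) _
    have h1 : ∀ x y z, pairing (x - y) z = pairing x z - pairing y z := by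
      intro x y z; simp [pairing, sub_mul]
    have h2 : ∀ x y z, pairing x (y - z) = pairing x y - pairing x z := by
      intro x y z; simp [pairing, mul_sub]
    have h3 : ∀ (c : ℝ) x z, pairing (c • x) z = pairing x (c • z) := by
      intro c x z; simp [pairing]
    rw [contr_ι_mul, h1, pairing_ι_mul, pairing_ι_mul, hx, contr_ι_mul, h2, h3]
    ring

theorem cl_apply (w : E × Module.Dual ℝ E) (a : Lam) :
    cl w a = contr w.1 a + ExteriorAlgebra.ι ℝ w.2 * a := rfl

theorem pairing_cl (w : E × Module.Dual ℝ E) (a b : Lam) : pairing (cl w a) b = pairing a (cl w b) := by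
  have h : ∀ x y z, pairing (x + y) z = pairing x z + pairing y z := by
    intro x y z; simp [pairing, add_mul]
  have h' : ∀ x y z, pairing x (y + z) = pairing x y + pairing x z := by
    intro x y z; simp [pairing, mul_add]
  rw [cl_apply, cl_apply, h, h', pairing_contr, pairing_ι_mul]

/-- The natural inner product on `V ⊕ V*` (twice the usual one). -/
noncomputable def natInner (w w' : E × Module.Dual ℝ E) : ℝ := w.2 w'.1 + w'.2 w.1

theorem cl_cl (w w' : E × Module.Dual ℝ E) (a : Lam) :
    cl w (cl w' a) + cl w' (cl w a) = natInner w w' • a := by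
  have h1 : contr w.1 (contr w'.1 a) = -contr w'.1 (contr w.1 a) :=
    CliffordAlgebra.contractLeft_comm (Q := (0 : QuadraticForm ℝ (Module.Dual ℝ E)))
      (Module.Dual.eval ℝ E w.1) (Module.Dual.eval ℝ E w'.1) a
  have h2 : ExteriorAlgebra.ι ℝ w.2 * (ExteriorAlgebra.ι ℝ w'.2 * a) =
      -(ExteriorAlgebra.ι ℝ w'.2 * (ExteriorAlgebra.ι ℝ w.2 * a)) := by
    rw [← mul_assoc, ← mul_assoc, ← neg_mul]
    congr 1
    exact eq_neg_of_add_eq_zero_left (ExteriorAlgebra.ι_add_mul_swap _ _)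
  simp only [cl_apply, map_add, contr_ι_mul, h1, h2, natInner, add_smul]
  abel

end GenCY

namespace GenCY
set_option linter.unusedSectionVars false

/-! ## Derivatives of families of linear maps of constant rank -/

/-- The derivative of a family of linear maps of maximal rank at `0` sends the kernel into the
range. -/
theorem mem_range_of_hasDerivAt {X Y : Type*} [AddCommGroup X] [Module ℝ X]
    [NormedAddCommGroup Y] [NormedSpace ℝ Y] [FiniteDimensional ℝ Y]
    (A : ℝ → X →ₗ[ℝ] Y) (hc : ∀ x, ContinuousAt (fun t => A t x) 0)
    (hr : ∀ᶠ t in 𝓝 (0 : ℝ), Module.finrank ℝ (LinearMap.range (A t)) ≤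
      Module.finrank ℝ (LinearMap.range (A 0)))
    {e : X} {v : Y} (he : A 0 e = 0) (hd : HasDerivAt (fun t => A t e) v 0) :
    v ∈ LinearMap.range (A 0) := by
  by_contra hv
  set r := Module.finrank ℝ (LinearMap.range (A 0))
  let b := Module.finBasis ℝ (LinearMap.range (A 0))
  choose x hx using fun i => (b i).2
  have hli : LinearIndependent ℝ (fun i => A 0 (x i)) := by
    simp only [hx]
    exact b.linearIndependent.map' (LinearMap.range (A 0)).subtype (Submodule.ker_subtype _)
  -- If `v` were outside the range it would be independent of the `r` vectors `A 0 (x i)`.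
  -- Independence is an open condition, so for small `t ≠ 0` the difference quotient of `A t e` and
  -- the `A t (x i)` would be `r + 1` independent vectors in the range of `A t`.
  have hli' : LinearIndependent ℝ (fun o : Option (Fin r) => o.elim v fun i => A 0 (x i)) := by
    rw [linearIndependent_option]
    refine ⟨hli, fun h => hv ?_⟩
    refine Submodule.span_le.2 ?_ h
    rintro _ ⟨i, rfl⟩
    exact ⟨x i, rfl⟩
  have ht : Filter.Tendsto (fun t : ℝ => fun o : Option (Fin r) =>
      o.elim (t⁻¹ • A t e) fun i => A t (x i)) (𝓝[≠] 0)
      (𝓝 fun o : Option (Fin r) => o.elim v fun i => A 0 (x i)) := by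
    rw [tendsto_pi_nhds]
    rintro (_ | i)
    · have := hasDerivAt_iff_tendsto_slope_zero.1 hd
      simpa [he] using this
    · exact (hc (x i)).tendsto.mono_left nhdsWithin_le_nhds
  have h1 := ht.eventually hli'.eventually
  obtain ⟨t, h1, h2⟩ := (h1.and (hr.filter_mono nhdsWithin_le_nhds)).exists
  have h3 : ∀ o : Option (Fin r), o.elim (t⁻¹ • A t e) (fun i => A t (x i)) ∈
      LinearMap.range (A t) := by
    rintro (_ | i)
    · exact Submodule.smul_mem _ _ ⟨e, rfl⟩
    · exact ⟨x i, rfl⟩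
  have h4 : LinearIndependent ℝ (fun o => (⟨_, h3 o⟩ : LinearMap.range (A t))) :=
    LinearIndependent.of_comp (LinearMap.range (A t)).subtype h1
  have h5 := h4.fintype_card_le_finrank
  rw [Fintype.card_option, Fintype.card_fin] at h5
  omega

/-! ## The complexified Clifford action -/

/-- The space `V ⊕ V*`. -/
abbrev GenTangent : Type := E × Module.Dual ℝ E

/-- The action of `(V ⊕ V*) ⊗ ℂ` on complex forms. -/
noncomputable def ccl (w : GenTangent × GenTangent) : CLam →ₗ[ℝ] CLam where
  toFun φ := (cl w.1 φ.1 - cl w.2 φ.2, cl w.1 φ.2 + cl w.2 φ.1)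
  map_add' φ ψ := by
    ext <;> simp only [Prod.fst_add, Prod.snd_add, map_add] <;> abel
  map_smul' c φ := by
    ext <;> simp [smul_sub, smul_add]

theorem ccl_apply (w : GenTangent × GenTangent) (φ : CLam) :
    ccl w φ = (cl w.1 φ.1 - cl w.2 φ.2, cl w.1 φ.2 + cl w.2 φ.1) := rfl

theorem ccl_add (w w' : GenTangent × GenTangent) (φ : CLam) :
    ccl (w + w') φ = ccl w φ + ccl w' φ := by
  ext <;> simp only [ccl_apply, Prod.fst_add, Prod.snd_add, cl_add] <;> abel

theorem ccl_smul (c : ℝ) (w : GenTangent × GenTangent) (φ : CLam) :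
    ccl (c • w) φ = c • ccl w φ := by
  ext <;> simp only [ccl_apply, Prod.smul_fst, Prod.smul_snd, cl_smul, smul_sub, smul_add]

/-- The Clifford action on a fixed complex form. -/
noncomputable def cclOn (φ : CLam) : GenTangent × GenTangent →ₗ[ℝ] CLam where
  toFun w := ccl w φ
  map_add' w w' := ccl_add w w' φ
  map_smul' c w := ccl_smul c w φ

theorem mem_annihilator_iff (φ : CLam) (w : GenTangent × GenTangent) :
    w ∈ annihilator φ ↔ ccl w φ = 0 := by
  rw [ccl_apply, Prod.mk_eq_zero]
  rfl

theorem ker_cclOn (φ : CLam) : LinearMap.ker (cclOn φ) = annihilator φ := by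
  ext w
  rw [mem_annihilator_iff]
  rfl

/-- Multiplication of a complex form by `s + it`. -/
def cmul (s t : ℝ) (φ : CLam) : CLam := (s • φ.1 - t • φ.2, s • φ.2 + t • φ.1)

theorem ccl_cmul (s t : ℝ) (w : GenTangent × GenTangent) (φ : CLam) :
    ccl w (cmul s t φ) = cmul s t (ccl w φ) := by
  ext <;> simp only [ccl_apply, cmul, map_add, map_sub, map_smul, smul_sub, smul_add] <;> abel

theorem cmul_zero (s t : ℝ) : cmul s t 0 = 0 := by simp [cmul]

/-- The real part of the complex bilinear extension of the natural inner product. -/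
noncomputable def natRe (w w' : GenTangent × GenTangent) : ℝ :=
  natInner w.1 w'.1 - natInner w.2 w'.2

/-- The imaginary part of the complex bilinear extension of the natural inner product. -/
noncomputable def natIm (w w' : GenTangent × GenTangent) : ℝ :=
  natInner w.1 w'.2 + natInner w.2 w'.1

theorem ccl_ccl (w w' : GenTangent × GenTangent) (φ : CLam) :
    ccl w (ccl w' φ) + ccl w' (ccl w φ) = cmul (natRe w w') (natIm w w') φ := by
  ext
  · have e1 := cl_cl w.1 w'.1 φ.1
    have e2 := cl_cl w.2 w'.2 φ.1
    have e3 := cl_cl w.1 w'.2 φ.2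
    have e4 := cl_cl w.2 w'.1 φ.2
    simp only [ccl_apply, cmul, map_add, map_sub, natRe, natIm, Prod.mk_add_mk, sub_smul, add_smul,
      ← e1, ← e2, ← e3, ← e4]
    abel
  · have e1 := cl_cl w.1 w'.1 φ.2
    have e2 := cl_cl w.2 w'.2 φ.2
    have e3 := cl_cl w.1 w'.2 φ.1
    have e4 := cl_cl w.2 w'.1 φ.1
    simp only [ccl_apply, cmul, map_add, map_sub, natRe, natIm, Prod.mk_add_mk, sub_smul, add_smul,
      ← e1, ← e2, ← e3, ← e4]
    abel

theorem pairing_add_left (a b c : Lam) : pairing (a + b) c = pairing a c + pairing b c := by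
  simp [pairing, add_mul]

theorem pairing_add_right (a b c : Lam) : pairing a (b + c) = pairing a b + pairing a c := by
  simp [pairing, mul_add]

theorem pairing_sub_left (a b c : Lam) : pairing (a - b) c = pairing a c - pairing b c := by
  simp [pairing, sub_mul]

theorem pairing_sub_right (a b c : Lam) : pairing a (b - c) = pairing a b - pairing a c := by
  simp [pairing, mul_sub]

theorem cpairing_ccl (w : GenTangent × GenTangent) (φ ψ : CLam) :
    cpairing (ccl w φ) ψ = cpairing φ (ccl w ψ) := by
  simp only [cpairing, ccl_apply, pairing_add_left, pairing_add_right, pairing_sub_left,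
    pairing_sub_right, pairing_cl, Complex.mk.injEq]
  constructor <;> ring

theorem cpairing_add_left (φ φ' ψ : CLam) :
    cpairing (φ + φ') ψ = cpairing φ ψ + cpairing φ' ψ := by
  apply Complex.ext <;> simp only [cpairing, Prod.fst_add, Prod.snd_add, pairing_add_left,
    Complex.add_re, Complex.add_im] <;> ring

theorem cpairing_zero_left (ψ : CLam) : cpairing 0 ψ = 0 := by
  apply Complex.ext <;> simp [cpairing, pairing]

theorem cpairing_zero_right (ψ : CLam) : cpairing ψ 0 = 0 := by
  apply Complex.ext <;> simp [cpairing, pairing]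

/-- The product of any `n` elements of `F` kills `ψ`. -/
def Kills (F : Submodule ℝ (GenTangent × GenTangent)) : ℕ → CLam → Prop
  | 0, ψ => ψ = 0
  | n + 1, ψ => ∀ e ∈ F, Kills F n (ccl e ψ)

variable {F G : Submodule ℝ (GenTangent × GenTangent)}

theorem Kills.mono (h : G ≤ F) {n : ℕ} {ψ : CLam} (hψ : Kills F n ψ) : Kills G n ψ := by
  induction n generalizing ψ with
  | zero => exact hψ
  | succ n ih => exact fun e he => ih (hψ e (h he))

theorem Kills.ccl_of_anticomm {b : GenTangent × GenTangent}
    (hb : ∀ e ∈ F, ∀ ψ, ccl e (ccl b ψ) = -ccl b (ccl e ψ)) {n : ℕ} {ψ : CLam}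
    (hψ : Kills F n ψ) : Kills F n (ccl b ψ) := by
  -- Each exchange with `b` introduces a sign, so both signs are carried through the induction.
  have h : ∀ n (ψ : CLam), Kills F n ψ → Kills F n (ccl b ψ) ∧ Kills F n (-ccl b ψ) := by
    intro n
    induction n with
    | zero =>
      intro ψ hψ
      have : ψ = 0 := hψ
      subst this
      simp [Kills]
    | succ n ih =>
      intro ψ hψ
      refine ⟨fun e he => ?_, fun e he => ?_⟩
      · rw [hb e he]
        exact (ih _ (hψ e he)).2
      · rw [map_neg, hb e he, neg_neg]
        exact (ih _ (hψ e he)).1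
  exact (h n ψ hψ).1

theorem exists_natInner_ne_zero {w : GenTangent} (hw : w ≠ 0) : ∃ w', natInner w w' ≠ 0 := by
  by_contra! h
  apply hw
  have h2 : w.2 = 0 := LinearMap.ext fun v => by simpa [natInner] using h (v, 0)
  have h1 : w.1 = 0 := by
    rw [← Module.forall_dual_apply_eq_zero_iff ℝ]
    intro f
    simpa [natInner] using h (0, f)
  exact Prod.ext h1 h2

theorem natInner_smul_right (c : ℝ) (w w' : GenTangent) :
    natInner w (c • w') = c * natInner w w' := by
  simp [natInner, mul_add]

theorem natInner_add_left (w w' w'' : GenTangent) :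
    natInner (w + w') w'' = natInner w w'' + natInner w' w'' := by
  simp [natInner]; ring

theorem natInner_smul_left (c : ℝ) (w w' : GenTangent) :
    natInner (c • w) w' = c * natInner w w' := by
  simp [natInner, mul_add]

/-- The functional `natRe · b`. -/
noncomputable def natReLeft (b : GenTangent × GenTangent) : GenTangent × GenTangent →ₗ[ℝ] ℝ where
  toFun w := natRe w b
  map_add' w w' := by simp only [natRe, Prod.fst_add, Prod.snd_add, natInner_add_left]; ring
  map_smul' c w := by
    simp only [natRe, Prod.smul_fst, Prod.smul_snd, natInner_smul_left, RingHom.id_apply,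
      smul_eq_mul]
    ring

/-- The functional `natIm · b`. -/
noncomputable def natImLeft (b : GenTangent × GenTangent) : GenTangent × GenTangent →ₗ[ℝ] ℝ where
  toFun w := natIm w b
  map_add' w w' := by simp only [natIm, Prod.fst_add, Prod.snd_add, natInner_add_left]; ring
  map_smul' c w := by
    simp only [natIm, Prod.smul_fst, Prod.smul_snd, natInner_smul_left, RingHom.id_apply,
      smul_eq_mul]
    ring

theorem exists_nat_eq_one {a : GenTangent × GenTangent} (ha : a ≠ 0) :
    ∃ b, natRe a b = 1 ∧ natIm a b = 0 := by
  obtain ⟨w, hw⟩ : ∃ w, natInner a.1 w ≠ 0 ∨ natInner a.2 w ≠ 0 := by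
    by_cases h : a.1 = 0
    · obtain ⟨w, hw⟩ := exists_natInner_ne_zero (w := a.2) fun h' => ha (Prod.ext h h')
      exact ⟨w, Or.inr hw⟩
    · obtain ⟨w, hw⟩ := exists_natInner_ne_zero h
      exact ⟨w, Or.inl hw⟩
  set s := natInner a.1 w with hs
  set t := natInner a.2 w with ht
  have h : s ^ 2 + t ^ 2 ≠ 0 := by
    rcases hw with h | h <;> positivity
  -- The vector `b` is `w / (s + it)`, where `s + it` is the inner product of `a` with the real
  -- vector `w`.
  refine ⟨((s / (s ^ 2 + t ^ 2)) • w, (-t / (s ^ 2 + t ^ 2)) • w), ?_, ?_⟩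
  · simp only [natRe, natInner_smul_right, ← hs, ← ht]
    field_simp
    ring
  · simp only [natIm, natInner_smul_right, ← hs, ← ht]
    field_simp
    ring

theorem finrank_inf_ker (F : Submodule ℝ (GenTangent × GenTangent))
    (f : GenTangent × GenTangent →ₗ[ℝ] ℝ) :
    Module.finrank ℝ F ≤ Module.finrank ℝ (F ⊓ LinearMap.ker f : Submodule ℝ _) + 1 := by
  have h1 := Submodule.finrank_sup_add_finrank_inf_eq F (LinearMap.ker f)
  have h2 := f.finrank_range_add_finrank_ker
  have h3 : Module.finrank ℝ (LinearMap.range f) ≤ 1 := by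
    simpa using (LinearMap.range f).finrank_le
  have h4 := (F ⊔ LinearMap.ker f).finrank_le
  omega

/-- If `ψ` is killed by products of `p`, and `ψ'` by products of `q` elements of `F`, and `F` is not
too small, then `ψ` and `ψ'` are orthogonal. -/
theorem cpairing_eq_zero_of_kills (n : ℕ) : ∀ (p q : ℕ), p + q = n →
    ∀ (F : Submodule ℝ (GenTangent × GenTangent)), 2 * n ≤ Module.finrank ℝ F →
    ∀ ψ ψ' : CLam, Kills F p ψ → Kills F q ψ' → cpairing ψ ψ' = 0 := by
  induction n with
  | zero =>
    intro p q h F _ ψ ψ' hψ _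
    obtain rfl : p = 0 := by omega
    have : ψ = 0 := hψ
    rw [this, cpairing_zero_left]
  | succ n ih =>
    intro p q h F hF ψ ψ' hψ hψ'
    rcases p with _ | p
    · have : ψ = 0 := hψ
      rw [this, cpairing_zero_left]
    rcases q with _ | q
    · have : ψ' = 0 := hψ'
      rw [this, cpairing_zero_right]
    have hF0 : F ≠ ⊥ := by
      rintro rfl
      simp at hF
    obtain ⟨a, haF, ha⟩ := Submodule.exists_mem_ne_zero_of_ne_bot hF0
    obtain ⟨b, h1, h2⟩ := exists_nat_eq_one ha
    -- The complex orthogonal complement of `b` in `F`. It costs at most two real dimensions, which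
    -- pays for lowering `n` by one, and its elements anticommute with `b`.
    set G := F ⊓ LinearMap.ker (natReLeft b) ⊓ LinearMap.ker (natImLeft b) with hG
    have hGF : G ≤ F := inf_le_left.trans inf_le_left
    have hGn : 2 * n ≤ Module.finrank ℝ G := by
      have e1 := finrank_inf_ker F (natReLeft b)
      have e2 := finrank_inf_ker (F ⊓ LinearMap.ker (natReLeft b)) (natImLeft b)
      rw [← hG] at e2
      omega
    have hb : ∀ e ∈ G, ∀ ψ, ccl e (ccl b ψ) = -ccl b (ccl e ψ) := by
      intro e he ψ
      have e1 : natRe e b = 0 := he.1.2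
      have e2 : natIm e b = 0 := he.2
      have := ccl_ccl e b ψ
      rw [e1, e2] at this
      rw [eq_neg_iff_add_eq_zero, this]
      simp [cmul]
    -- Clifford relation for vectors of inner product `1`. After moving the outer factor across the
    -- pairing, one term pairs `bψ` with `aψ'` and the other `aψ` with `bψ'`. Acting by `a` shortens
    -- the killing length of its argument by one, while `b` preserves it over `G`.
    have key : ψ = ccl a (ccl b ψ) + ccl b (ccl a ψ) := by
      rw [ccl_ccl, h1, h2]
      simp [cmul]
    rw [key, cpairing_add_left, cpairing_ccl a, cpairing_ccl b (ccl a ψ),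
      ih (p + 1) q (by omega) G hGn _ _ (Kills.ccl_of_anticomm hb (hψ.mono hGF))
        ((hψ' a haF).mono hGF),
      ih p (q + 1) (by omega) G hGn _ _ ((hψ a haF).mono hGF)
        (Kills.ccl_of_anticomm hb (hψ'.mono hGF)), add_zero]

/-- The derivative of a family of pure spinors. -/
theorem kills_deriv {φ : ℝ → CLam} {ψ : CLam} (hφ : ∀ᶠ t in 𝓝 (0 : ℝ), IsPure (φ t))
    (hd : HasDerivAt φ ψ 0) : Kills (annihilator (φ 0)) 3 ψ := by
  have hlin : ∀ e, HasDerivAt (fun t => cclOn (φ t) e) (ccl e ψ) 0 := fun e =>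
    ((LinearMap.toContinuousLinearMap (ccl e)).hasFDerivAt).comp_hasDerivAt (0 : ℝ) hd
  have hrank : ∀ t, IsPure (φ t) → Module.finrank ℝ (LinearMap.range (cclOn (φ t))) + 12 =
      Module.finrank ℝ (GenTangent × GenTangent) := by
    intro t ht
    have := (cclOn (φ t)).finrank_range_add_finrank_ker
    rw [ker_cclOn] at this
    rw [← this, ht]
  have hr : ∀ᶠ t in 𝓝 (0 : ℝ), Module.finrank ℝ (LinearMap.range (cclOn (φ t))) ≤
      Module.finrank ℝ (LinearMap.range (cclOn (φ 0))) := by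
    have h0 := hrank 0 hφ.self_of_nhds
    filter_upwards [hφ] with t ht
    have := hrank t ht
    omega
  intro e he e₂ he₂ e₃ he₃
  -- Purity fixes the dimension of the annihilator, so the rank is constant near `0`, and
  -- differentiating the Clifford action on a fixed `e` gives `e · ψ = w · φ 0`.
  obtain ⟨w, hw⟩ := mem_range_of_hasDerivAt (fun t => cclOn (φ t))
    (fun x => (hlin x).continuousAt) hr ((mem_annihilator_iff _ _).1 he) (hlin e)
  rw [mem_annihilator_iff] at he₂ he₃
  have hw' : ccl e ψ = ccl w (φ 0) := hw.symm
  -- As `e₂` kills `φ 0`, the product `e₂ · w · φ 0` is a complex multiple of `φ 0`, and `e₃` kills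
  -- that.
  have h := ccl_ccl e₂ w (φ 0)
  rw [he₂, map_zero, add_zero] at h
  change ccl e₃ (ccl e₂ (ccl e ψ)) = 0
  rw [hw', h, ccl_cmul, he₃, cmul_zero]

/-- Two tangent vectors at the same point to the cone of pure spinors are orthogonal. -/
theorem cpairing_deriv_eq_zero {φ φ' : ℝ → CLam} {ψ ψ' : CLam} (h0 : φ 0 = φ' 0)
    (hφ : ∀ᶠ t in 𝓝 (0 : ℝ), IsPure (φ t)) (hφ' : ∀ᶠ t in 𝓝 (0 : ℝ), IsPure (φ' t))
    (hd : HasDerivAt φ ψ 0) (hd' : HasDerivAt φ' ψ' 0) : cpairing ψ ψ' = 0 :=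
  cpairing_eq_zero_of_kills 6 3 3 rfl (annihilator (φ 0)) (le_of_eq hφ.self_of_nhds.symm) _ _
    (kills_deriv hφ hd) (h0 ▸ kills_deriv hφ' hd')

end GenCY

namespace GenCY
set_option linter.unusedSectionVars false

/-! ## Special pseudo-Kähler structures from a vector field -/

section FromField

variable {W : Type*} [NormedAddCommGroup W] [NormedSpace ℝ W] [FiniteDimensional ℝ W]

/-- `J` makes `W` a finite-dimensional complex vector space; the map is given by coordinates in a
complex basis. -/
theorem exists_complexEquiv (J : W →L[ℝ] W) (hJ : ∀ a, J (J a) = -a) :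
    ∃ (m : ℕ) (e : W ≃L[ℝ] (Fin m → ℂ)), ∀ a, e (J a) = Complex.I • e a := by
  let f : ℂ →ₐ[ℝ] Module.End ℝ W := Complex.lift ⟨J.toLinearMap, by
    ext a
    simp [Module.End.mul_apply, hJ]⟩
  let : Module ℂ W := Module.compHom W f.toRingHom
  have hs : ∀ (z : ℂ) (a : W), z • a = f z a := fun _ _ => rfl
  have : IsScalarTower ℝ ℂ W := ⟨fun c z a => by
    rw [hs, hs, map_smul, LinearMap.smul_apply]⟩
  have : FiniteDimensional ℂ W := Module.Finite.of_restrictScalars_finite ℝ ℂ W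
  let e := (Module.finBasis ℂ W).equivFun
  refine ⟨_, (e.restrictScalars ℝ).toContinuousLinearEquiv, fun a => ?_⟩
  have h : J a = Complex.I • a := by
    rw [hs]
    simp [f]
  change e (J a) = Complex.I • e a
  rw [h, map_smul]

/-- Let `J₀` be the value of `J = DX` at `u₀`. The map `(u - J₀ X(u)) / 2` has derivative `(1 - J₀
J) / 2`, which intertwines `J` with `J₀` because both square to `-1`. At `u₀` it is the identity, so
by the inverse function theorem it gives coordinates nearby. -/
theorem isIntegrable_fderiv {U : Set W} (hU : IsOpen U) {X : W → W} (hX : ContDiffOn ℝ ∞ X U)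
    (hJ : ∀ u ∈ U, ∀ a, fderiv ℝ X u (fderiv ℝ X u a) = -a) :
    IsIntegrable U (fderiv ℝ X) := by
  intro u₀ hu₀
  obtain ⟨m, e, he⟩ := exists_complexEquiv (fderiv ℝ X u₀) (hJ u₀ hu₀)
  set J₀ := fderiv ℝ X u₀
  let z : W → Fin m → ℂ := fun u => e ((2⁻¹ : ℝ) • (u - J₀ (X u)))
  have hXd : ∀ u ∈ U, HasFDerivAt X (fderiv ℝ X u) u := fun u hu =>
    ((hX.contDiffAt (hU.mem_nhds hu)).differentiableAt (by simp)).hasFDerivAt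
  have hz : ∀ u ∈ U, HasFDerivAt z (e.toContinuousLinearMap ∘L
      ((2⁻¹ : ℝ) • (ContinuousLinearMap.id ℝ W - J₀ ∘L fderiv ℝ X u))) u := fun u hu =>
    e.hasFDerivAt.comp u (((hasFDerivAt_id u).sub (J₀.hasFDerivAt.comp u (hXd u hu))).const_smul _)
  have hzs : ContDiffOn ℝ ∞ z U :=
    e.contDiff.comp_contDiffOn ((contDiffOn_id.sub (J₀.contDiff.comp_contDiffOn hX)).const_smul _)
  have hza : ∀ u ∈ U, ∀ a, fderiv ℝ z u a = e ((2⁻¹ : ℝ) • (a - J₀ (fderiv ℝ X u a))) := by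
    intro u hu a
    rw [(hz u hu).fderiv]
    rfl
  have hz₀ : fderiv ℝ z u₀ = e.toContinuousLinearMap := by
    ext1 a
    rw [hza u₀ hu₀, hJ u₀ hu₀, sub_neg_eq_add, ← two_smul ℝ a, smul_smul]
    norm_num
  have hc : ContDiffAt ℝ ∞ z u₀ := hzs.contDiffAt (hU.mem_nhds hu₀)
  have hd : HasFDerivAt z (e : W →L[ℝ] Fin m → ℂ) u₀ := hz₀ ▸ (hc.differentiableAt (by simp)).hasFDerivAt
  let P := hc.toOpenPartialHomeomorph z hd (by simp)
  have h1 : ∀ᶠ u in 𝓝 u₀, u ∈ P.source := P.open_source.mem_nhds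
    (hc.mem_toOpenPartialHomeomorph_source hd (by simp))
  have h2 : ∀ᶠ u in 𝓝 u₀, fderiv ℝ z u ∈ range ((↑) : (W ≃L[ℝ] Fin m → ℂ) → W →L[ℝ] Fin m → ℂ) := by
    have : ContinuousAt (fderiv ℝ z) u₀ := (hc.fderiv_right (m := 0) (by simp)).continuousAt
    refine this.eventually ?_
    rw [hz₀]
    exact ContinuousLinearEquiv.nhds e
  obtain ⟨V, hV, hVo, hVu⟩ := mem_nhds_iff.1 ((h1.and h2).and (hU.mem_nhds hu₀))
  refine ⟨V, fun u hu => (hV hu).2, hVo, hVu, m, z, hzs.mono fun u hu => (hV hu).2, ?_, ?_⟩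
  · exact P.injOn.mono fun u hu => (hV hu).1.1
  · intro u hu
    obtain ⟨⟨_, e', he'⟩, huU⟩ := hV hu
    refine ⟨he' ▸ e'.bijective, fun a => ?_⟩
    rw [hza u huU, hza u huU, hJ u huU, ← he, map_smul J₀, map_sub J₀, hJ u₀ hu₀]
    congr 2
    rw [map_neg, sub_neg_eq_add, sub_neg_eq_add, add_comm]

/-- Skewness and invariance of `J` give `Ω(J²a, b) = -Ω(Ja, Jb) = -Ω(a, b)`, so `J² = -1` by
non-degeneracy. The connection and the form are constant. -/
theorem isSpecialPseudoKahler_of_field {U : Set W} (hU : IsOpen U) (Ω : W →L[ℝ] W →L[ℝ] ℝ)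
    (halt : ∀ a, Ω a a = 0) (hnd : ∀ a, (∀ b, Ω a b = 0) → a = 0) {X : W → W}
    (hX : ContDiffOn ℝ ∞ X U)
    (h1 : ∀ u ∈ U, ∀ a b, Ω (fderiv ℝ X u a) (fderiv ℝ X u b) = Ω a b)
    (h2 : ∀ u ∈ U, ∀ a b, Ω (fderiv ℝ X u a) b = -Ω a (fderiv ℝ X u b)) :
    IsSpecialPseudoKahler U (fun _ => 0) (fun _ => Ω) (fderiv ℝ X) := by
  have hsq : ∀ u ∈ U, ∀ a, fderiv ℝ X u (fderiv ℝ X u a) = -a := by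
    intro u hu a
    rw [← sub_eq_zero, sub_neg_eq_add]
    refine hnd _ fun b => ?_
    rw [map_add, add_apply, h2 u hu, h1 u hu, neg_add_cancel]
  refine ⟨hU, contDiffOn_const, contDiffOn_const, hX.fderiv_of_isOpen hU (by simp), ?_, ?_,
    fun _ _ => halt, fun _ _ => hnd, ?_, ?_, hsq, isIntegrable_fderiv hU hX hsq, h1, ?_⟩
  · intros; rfl
  · intros; simp
  · intros; simp
  · intros; simp
  · exact fun u₀ hu₀ => ⟨U, subset_rfl, hU, hu₀, X, hX, fun u _ a => by simp⟩

end FromField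

end GenCY

namespace GenCY
set_option linter.unusedSectionVars false

/-! ## Families of closed forms and their classes -/

section Classes

variable {M : Type*} [TopologicalSpace M] [ChartedSpace E M] [IsManifold (𝓡 6) ∞ M]
  [CompactSpace M] [T2Space M] {p : ZMod 2} {ν : MForm M}

theorem ip_eq_of_mk_eq (hν : IsVolumeForm ν) {α β β' : closedForms M p}
    (h : Coh.mk β = Coh.mk β') : ip ν (α : MForm M) β = ip ν (α : MForm M) β' := by
  obtain ⟨τ, hτ, _, h⟩ := Coh.mk_eq_iff.1 h
  rw [← sub_eq_zero, ← ip_sub_right hν α.2.1 β.2.1 β'.2.1, ← h, ip_extD_right hν hτ α.2.1, α.2.2.2,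
    ip_skew, ip_zero_right, neg_zero, neg_zero]

/-- The intersection form on cohomology. -/
theorem exists_intersectionForm (hν : IsVolumeForm ν) (p : ZMod 2) :
    ∃ Ω : Coh M p →L[ℝ] Coh M p →L[ℝ] ℝ,
      (∀ α β : closedForms M p, Ω (Coh.mk α) (Coh.mk β) = ip ν (α : MForm M) β) ∧
      (∀ a, Ω a a = 0) ∧ ∀ a, (∀ b, Ω a b = 0) → a = 0 := by
  have := finiteDimensional_coh hν p
  choose s hs using Coh.mk_surjective (M := M) (p := p)
  have hadd : ∀ α β : closedForms M p, Coh.mk (α + β) = Coh.mk α + Coh.mk β := fun _ _ => rfl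
  have hsmul : ∀ (c : ℝ) (α : closedForms M p), Coh.mk (c • α) = c • Coh.mk α := fun _ _ => rfl
  have hr : ∀ (α : closedForms M p) {β β' : closedForms M p}, Coh.mk β = Coh.mk β' →
      ip ν (α : MForm M) β = ip ν (α : MForm M) β' := fun _ => ip_eq_of_mk_eq hν
  have hl : ∀ (α : closedForms M p) {β β' : closedForms M p}, Coh.mk β = Coh.mk β' →
      ip ν (β : MForm M) α = ip ν (β' : MForm M) α := by
    intro α β β' h
    rw [ip_skew, hr α h, ← ip_skew]
  let B : Coh M p →ₗ[ℝ] Coh M p →ₗ[ℝ] ℝ := LinearMap.mk₂ ℝ (fun u v => ip ν (s u : MForm M) (s v))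
    (fun u u' v => by
      rw [hl (s v) (show Coh.mk (s (u + u')) = Coh.mk (s u + s u') by rw [hadd, hs, hs, hs])]
      exact ip_add_left hν (s u).2.1 (s u').2.1 (s v).2.1)
    (fun c u v => by
      rw [hl (s v) (show Coh.mk (s (c • u)) = Coh.mk (c • s u) by rw [hsmul, hs, hs])]
      exact ip_smul_left c _ _)
    (fun u v v' => by
      rw [hr (s u) (show Coh.mk (s (v + v')) = Coh.mk (s v + s v') by rw [hadd, hs, hs, hs])]
      exact ip_add_right hν (s u).2.1 (s v).2.1 (s v').2.1)
    (fun c u v => by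
      rw [hr (s u) (show Coh.mk (s (c • v)) = Coh.mk (c • s v) by rw [hsmul, hs, hs])]
      exact ip_smul_right c _ _)
  have hB : ∀ α β : closedForms M p, B (Coh.mk α) (Coh.mk β) = ip ν (α : MForm M) β := by
    intro α β
    change ip ν (s _ : MForm M) (s _) = _
    rw [hl _ (hs (Coh.mk α)), hr _ (hs (Coh.mk β))]
  refine ⟨LinearMap.toContinuousLinearMap ((LinearMap.toContinuousLinearMap :
    (Coh M p →ₗ[ℝ] ℝ) ≃ₗ[ℝ] Coh M p →L[ℝ] ℝ).toLinearMap ∘ₗ B), hB, ?_, ?_⟩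
  · intro a
    change B a a = 0
    obtain ⟨α, rfl⟩ := Coh.mk_surjective a
    have := ip_skew (ν := ν) (α : MForm M) α
    rw [hB]
    linarith
  · intro a ha
    -- Non-degeneracy is Poincaré duality: every functional on cohomology is the pairing with a
    -- class.
    rw [← Module.forall_dual_apply_eq_zero_iff ℝ]
    intro f
    obtain ⟨β, hβ⟩ := exists_dual_form hν f
    obtain ⟨α, rfl⟩ := Coh.mk_surjective a
    rw [hβ, ip_skew, ← hB]
    exact neg_eq_zero.2 (ha _)

variable {W : Type*} [NormedAddCommGroup W] [NormedSpace ℝ W] [FiniteDimensional ℝ W] {V : Set W}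

theorem dFam_mem_closedForms (hV : IsOpen V) {θ : W → MForm M} (hθ : Fam V θ)
    (hc : ∀ w ∈ V, θ w ∈ closedForms M p) {w : W} (hw : w ∈ V) (a : W) :
    dFam θ a w ∈ closedForms M p := by
  refine ⟨(hθ.dFam hV a).isSmooth hw, ?_, ?_⟩
  · rw [hasParity_iff]
    intro x
    have hd := ((hθ.contDiffAt_apply hw x).differentiableAt (by simp)).hasFDerivAt
    have h1 : HasFDerivAt (fun w => invL (θ w x)) (invL ∘L fderiv ℝ (fun w => θ w x) w) w :=
      invL.hasFDerivAt.comp w hd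
    have h2 := h1.congr_of_eventuallyEq (f₁ := fun w => sgn p • θ w x) (by
      filter_upwards [hV.mem_nhds hw] with w' hw'
      exact ((hasParity_iff.1 (hc w' hw').2.1) x).symm)
    exact DFunLike.congr_fun (h2.unique (hd.const_smul (sgn p))) a
  · rw [extD_dFam hV hθ a hw]
    funext x
    have : (fun w => extD (θ w) x) =ᶠ[𝓝 w] fun _ => 0 := by
      filter_upwards [hV.mem_nhds hw] with w' hw'
      rw [(hc w' hw').2.2]
      rfl
    change fderiv ℝ (fun w => extD (θ w) x) w a = 0
    rw [this.fderiv_eq]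
    simp

theorem dual_comp_eq {f : Coh M p →ₗ[ℝ] ℝ} {β : closedForms M p}
    (hβ : ∀ α : closedForms M p, f (Coh.mk α) = ip ν (β : MForm M) α) {θ : MForm M} {u : Coh M p}
    (h : Represents θ u) : f u = ip ν (β : MForm M) θ := by
  obtain ⟨h, rfl⟩ := h
  exact hβ _

/-- By duality the coordinates of the class are pairings with fixed closed forms, and these are
integrals depending smoothly on the parameter. -/
theorem contDiffOn_class (hν : IsVolumeForm ν) (hV : IsOpen V) {θ : W → MForm M} (hθ : Fam V θ)
    {c : W → Coh M p} (hc : ∀ w ∈ V, Represents (θ w) (c w)) : ContDiffOn ℝ ∞ c V := by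
  have := finiteDimensional_coh hν p
  let e := (Module.finBasis ℝ (Coh M p)).equivFun.toContinuousLinearEquiv
  rw [← e.comp_contDiffOn_iff, contDiffOn_pi]
  intro i
  obtain ⟨β, hβ⟩ := exists_dual_form hν ((Module.finBasis ℝ (Coh M p)).coord i)
  refine (contDiffOn_ip hν hV (β.2.1.fam V) hθ).congr fun w hw => ?_
  exact dual_comp_eq hβ (hc w hw)

/-- Functionals separate classes, and each functional is a pairing with a fixed closed form, which
can be differentiated under the integral. -/
theorem represents_dFam (hν : IsVolumeForm ν) (hV : IsOpen V) {θ : W → MForm M} (hθ : Fam V θ)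
    {c : W → Coh M p} (hc : ∀ w ∈ V, Represents (θ w) (c w)) {w : W} (hw : w ∈ V) (a : W) :
    Represents (dFam θ a w) (fderiv ℝ c w a) := by
  have := finiteDimensional_coh hν p
  have hm := dFam_mem_closedForms hV hθ (fun w hw => (hc w hw).1) hw a
  refine ⟨hm, ?_⟩
  rw [← sub_eq_zero, ← Module.forall_dual_apply_eq_zero_iff ℝ]
  intro f
  obtain ⟨β, hβ⟩ := exists_dual_form hν f
  have hcd := ((contDiffOn_class hν hV hθ hc).contDiffAt (hV.mem_nhds hw)).differentiableAt (by simp)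
  have h1 := ((LinearMap.toContinuousLinearMap f).hasFDerivAt.comp w hcd.hasFDerivAt).fderiv
  have h2 : (⇑(LinearMap.toContinuousLinearMap f) ∘ c) =ᶠ[𝓝 w] fun w => ip ν (β : MForm M) (θ w) := by
    filter_upwards [hV.mem_nhds hw] with w' hw'
    exact dual_comp_eq hβ (hc w' hw')
  have h3 := DFunLike.congr_fun (h2.fderiv_eq.symm.trans h1) a
  rw [fderiv_ip hν hV (β.2.1.fam V) hθ hw] at h3
  have h4 : dFam (fun _ : W => (β : MForm M)) a w = 0 := by
    funext x
    simp [dFam]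
  rw [h4, ip_skew, ip_zero_right, neg_zero, zero_add] at h3
  rw [map_sub, hβ, sub_eq_zero]
  exact h3

/-! ## Families of generalized Calabi–Yau structures -/

/-- Restricting the family to the lines `w + t a` and `w + t b` gives two curves of pure spinors
through the same point. -/
theorem cpairing_dFam (hV : IsOpen V) {φ : W → CForm M} (h1 : Fam V fun w => (φ w).1)
    (h2 : Fam V fun w => (φ w).2) (hp : ∀ w ∈ V, ∀ x, IsPure ((φ w).at x)) {w : W} (hw : w ∈ V)
    (a b : W) (x : M) :
    cpairing (dFam (fun w => (φ w).1) a w x, dFam (fun w => (φ w).2) a w x)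
      (dFam (fun w => (φ w).1) b w x, dFam (fun w => (φ w).2) b w x) = 0 := by
  have hl : ∀ a : W, HasDerivAt (fun t : ℝ => w + t • a) a 0 := fun a => by
    simpa using ((hasDerivAt_id (0 : ℝ)).smul_const a).const_add w
  have hcurve : ∀ a : W, HasDerivAt (fun t : ℝ => (φ (w + t • a)).at x)
      (dFam (fun w => (φ w).1) a w x, dFam (fun w => (φ w).2) a w x) 0 := by
    intro a
    have e1 := ((h1.contDiffAt_apply hw x).differentiableAt (by simp)).hasFDerivAt
    have e2 := ((h2.contDiffAt_apply hw x).differentiableAt (by simp)).hasFDerivAt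
    have hw0 : w = w + (0 : ℝ) • a := by simp
    rw [hw0] at e1 e2
    have e3 := (e1.comp_hasDerivAt (0 : ℝ) (hl a)).prodMk (e2.comp_hasDerivAt (0 : ℝ) (hl a))
    rw [← hw0] at e3
    exact e3
  have hpure : ∀ a : W, ∀ᶠ t in 𝓝 (0 : ℝ), IsPure ((φ (w + t • a)).at x) := by
    intro a
    have : ∀ᶠ t in 𝓝 (0 : ℝ), w + t • a ∈ V :=
      (hl a).continuousAt.eventually_mem (hV.mem_nhds (by simpa using hw))
    exact this.mono fun t ht => hp _ ht x
  exact cpairing_deriv_eq_zero (by simp) (hpure a) (hpure b) (hcurve a) (hcurve b)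

theorem GaugeEquiv.class_rhoHat_eq {φ φ' : CForm M} (h : GaugeEquiv φ φ') {v v' : Coh M p}
    (hφ : φ.2 ∈ closedForms M p) (hv : Represents (rhoHat φ) v) (hv' : Represents (rhoHat φ') v') :
    v = v' := by
  obtain ⟨F, ξ, hF, h0, hξ, h1, _, e⟩ := h
  obtain ⟨_, rfl⟩ := hv
  obtain ⟨_, rfl⟩ := hv'
  refine (Coh.mk_eq_iff.2 ?_).symm
  have := gauge_sub_mem_exactForms (F := fun t x => F t x) hF h0 hξ h1 hφ
  change (2 : ℝ) • φ'.2 - (2 : ℝ) • φ.2 ∈ _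
  rw [← smul_sub, e]
  exact Submodule.smul_mem _ _ this

theorem IsGCY.represents_rhoHat {φ : CForm M} (h : IsGCY p φ) :
    ∃ v : Coh M p, Represents (rhoHat φ) v :=
  ⟨_, Submodule.smul_mem _ _ h.closed_im, rfl⟩

variable {U : Set (Coh M p)} {S : Set (CForm M)}

/-- The vector field `[ρ] ↦ [ρ̂]`. -/
theorem IsModuliSpace.exists_field (hU : IsModuliSpace p U S) : ∃ X : Coh M p → Coh M p,
    ∀ φ ∈ S, ∀ u v : Coh M p, Represents (rho φ) u → Represents (rhoHat φ) v → X u = v := by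
  classical
  have h : ∀ u : Coh M p, ∃ w, ∀ φ ∈ S, ∀ v : Coh M p,
      Represents (rho φ) u → Represents (rhoHat φ) v → w = v := by
    intro u
    by_cases hu : ∃ φ ∈ S, Represents (rho φ) u
    · obtain ⟨φ, hφ, hr⟩ := hu
      obtain ⟨w, hw⟩ := (hU.isGCY φ hφ).represents_rhoHat
      exact ⟨w, fun φ' hφ' v hr' hv => (hU.equiv φ hφ φ' hφ' u hr hr').class_rhoHat_eq
        (hU.isGCY φ hφ).closed_im hw hv⟩
    · exact ⟨0, fun φ hφ v hr _ => (hu ⟨φ, hφ, hr⟩).elim⟩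
  choose X hX using h
  exact ⟨X, fun φ hφ u v hr hv => hX u φ hφ v hr hv⟩

/-- Near each point the field is smooth, its derivative preserves the intersection form and is
skew for it. -/
theorem IsModuliSpace.field_properties (hν : IsVolumeForm ν) (hU : IsModuliSpace p U S)
    {Ω : Coh M p →L[ℝ] Coh M p →L[ℝ] ℝ}
    (hΩ : ∀ α β : closedForms M p, Ω (Coh.mk α) (Coh.mk β) = ip ν (α : MForm M) β)
    {X : Coh M p → Coh M p} (hX : ∀ φ ∈ S, ∀ u v : Coh M p,
      Represents (rho φ) u → Represents (rhoHat φ) v → X u = v) {u : Coh M p} (hu : u ∈ U) :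
    ContDiffAt ℝ ∞ X u ∧
      (∀ a b, Ω (fderiv ℝ X u a) (fderiv ℝ X u b) = Ω a b) ∧
      ∀ a b, Ω (fderiv ℝ X u a) b = -Ω a (fderiv ℝ X u b) := by
  have := finiteDimensional_coh hν p
  obtain ⟨V, hVU, hV, huV, φ, h1, h2, hS⟩ := hU.family u hu
  rw [isSmoothFamily_iff hV] at h1 h2
  change Fam V _ at h1 h2
  have hρ : Fam V fun w => rho (φ w) := h1.const_smul 2
  have hρ' : Fam V fun w => rhoHat (φ w) := h2.const_smul 2
  have hXr : ∀ w ∈ V, Represents (rhoHat (φ w)) (X w) := by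
    intro w hw
    obtain ⟨v, hv⟩ := (hU.isGCY _ (hS w hw).1).represents_rhoHat
    rwa [hX _ (hS w hw).1 w v (hS w hw).2 hv]
  -- The family is parametrized by its own classes, so the class map is the identity and its
  -- derivative in the direction `a` is `a`.
  have e1 : ∀ a, Represents (dFam (fun w => rho (φ w)) a u) a := by
    intro a
    have := represents_dFam hν hV hρ (c := id) (fun w hw => (hS w hw).2) huV a
    rwa [fderiv_id] at this
  have e2 := fun a => represents_dFam hν hV hρ' hXr huV a
  have hΩr : ∀ {θ η : MForm M} {a b : Coh M p}, Represents θ a → Represents η b →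
      Ω a b = ip ν θ η := by
    rintro θ η _ _ ⟨h, rfl⟩ ⟨h', rfl⟩
    exact hΩ _ _
  have hd : ∀ {θ : Coh M p → MForm M}, Fam V θ → ∀ a, dFam (fun w => (2 : ℝ) • θ w) a u =
      (2 : ℝ) • dFam θ a u := by
    intro θ hθ a
    funext x
    have := ((hθ.contDiffAt_apply huV x).differentiableAt (by simp)).hasFDerivAt.const_smul (2 : ℝ)
    exact DFunLike.congr_fun this.fderiv a
  have hd1 : ∀ a, dFam (fun w => rho (φ w)) a u = (2 : ℝ) • dFam (fun w => (φ w).1) a u := hd h1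
  have hd2 : ∀ a, dFam (fun w => rhoHat (φ w)) a u = (2 : ℝ) • dFam (fun w => (φ w).2) a u := hd h2
  -- The derivatives of `ρ + i ρ̂ = 2φ` in two directions are orthogonal at each point. The real
  -- part of this identity gives the invariance of `Ω` under `DX`, the imaginary part the skewness.
  have hc := cpairing_dFam hV h1 h2 (fun w hw => (hU.isGCY _ (hS w hw).1).pure) huV
  refine ⟨(contDiffOn_class hν hV hρ' hXr).contDiffAt (hV.mem_nhds huV), fun a b => ?_,
    fun a b => ?_⟩
  · rw [hΩr (e2 a) (e2 b), hΩr (e1 a) (e1 b), hd1, hd1, hd2, hd2, ip_smul_left, ip_smul_left,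
      ip_smul_right, ip_smul_right]
    congr 2
    refine integral_congr_top fun x => ?_
    have := congrArg Complex.re (hc a b x)
    rw [sigmaWedge_apply, sigmaWedge_apply]
    exact (sub_eq_zero.1 this).symm
  · rw [hΩr (e2 a) (e1 b), hΩr (e1 a) (e2 b), hd1, hd1, hd2, hd2, ip_smul_left, ip_smul_left,
      ip_smul_right, ip_smul_right, ← mul_neg, ← mul_neg]
    congr 2
    rw [ip, ip, ← integral_neg]
    refine integral_congr_top fun x => ?_
    have := congrArg Complex.im (hc a b x)
    rw [Pi.neg_apply, map_neg, sigmaWedge_apply, sigmaWedge_apply]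
    exact eq_neg_of_add_eq_zero_right this

end Classes

end GenCY

/-! ### The special pseudo-Kähler structure on the moduli space. -/

open GenCY in
theorem mainTheorem6 {M : Type*} [TopologicalSpace M] [ChartedSpace E M] [IsManifold (𝓡 6) ∞ M]
    [CompactSpace M] [T2Space M]
    (ν : MForm M) (hν : IsVolumeForm ν)
    (p : ZMod 2) (U : Set (Coh M p)) (S : Set (CForm M)) (hU : IsModuliSpace p U S) :
    FiniteDimensional ℝ (Coh M p) ∧
    ∃ (Ω : Coh M p →L[ℝ] Coh M p →L[ℝ] ℝ) (X : Coh M p → Coh M p)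
      (J : Coh M p → Coh M p →L[ℝ] Coh M p),
      (∀ α β : closedForms M p,
        Ω (Coh.mk α) (Coh.mk β) = integral ν (sigmaWedge (α : MForm M) (β : MForm M))) ∧
      (∀ φ ∈ S, ∀ u v : Coh M p,
        Represents (rho φ) u → Represents (rhoHat φ) v → X u = v) ∧
      ContDiffOn ℝ ∞ X U ∧
      (∀ u ∈ U, HasFDerivAt X (J u) u) ∧
      IsSpecialPseudoKahler U (fun _ => 0) (fun _ => Ω) J := by
  have := finiteDimensional_coh hν p
  obtain ⟨Ω, hΩ, halt, hnd⟩ := exists_intersectionForm hν p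
  obtain ⟨X, hX⟩ := hU.exists_field
  have h := fun u hu => hU.field_properties hν hΩ hX (u := u) hu
  have hXs : ContDiffOn ℝ ∞ X U := fun u hu => (h u hu).1.contDiffWithinAt
  exact ⟨inferInstance, Ω, X, fderiv ℝ X, hΩ, hX, hXs,
    fun u hu => ((h u hu).1.differentiableAt (by simp)).hasFDerivAt,
    isSpecialPseudoKahler_of_field hU.isOpen Ω halt hnd hXs (fun u hu => (h u hu).2.1)
      fun u hu => (h u hu).2.2⟩
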